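/- **Theorem.** Let $\omega$ be such that two real $m\times m$ matrices can be multiplied in $O(m^{\omega})$ operations. Time is the number of unit-cost operations of a randomized real RAM (exact $+,-,\times,/,\sqrt{\cdot}$ and comparisons of reals, index arithmetic, random access to arrays, drawing a uniform real of $[0,1]$). Fix a polynomial $p$ and $c\in\mathbb R$. Input: $A\in\mathbb{R}^{n\times d}$ of full column rank ($d\ge 1$), a number of rounds $r\ge 1$, and $d^{(0)}\in\mathbb{R}_{>0}^n$; in each round $k=1,\dots,r$ a vector $d^{(k)}\in\mathbb{R}_{>0}^n$ is revealed (the sequence does not depend on the random choices of the algorithm). Write $D^{(k)}=\mathrm{diag}(d^{(k)})$ and $M_k=A^{\top}D^{(k)}A$, and suppose that $\ell^2$ stability holds with $\beta=p(n)$: $$\|\log d^{(k)}-\log d^{(k-1)}\|_2\le 0.1\quad\text{and}\quad \beta^{-1}M_0\preceq M_k\preceq\beta M_0\qquad(1\le k\le r).$$ Consider the following algorithm. Set $d^{(\mathrm{apr})}:=d^{(0)}$; in each round $k\ge1$ set $d^{(\mathrm{apr})}_i:=d^{(k)}_i$ for every $i$ for which $0.9\,d^{(\mathrm{apr})}_i\le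 d^{(k)}_i\le 1.1\,d^{(\mathrm{apr})}_i$ is false. At the start ($k=0$) and in each round, take (implicitly) a symmetric matrix $K^{(k)}$ with $e^{-\kappa}Q^{-1}\preceq K^{(k)}\preceq e^{\kappa}Q^{-1}$, where $Q=A^{\top}\mathrm{diag}(d^{(\mathrm{apr})})A$, and provide the linear solver for $M_k$ that answers a query $(b,\epsilon)$ with $b\in\mathbb R^d$, $\epsilon\in(0,1/2]$ by $Q_\epsilon b$, where $$Q_\epsilon=\tfrac1L K^{(k)}\sum_{j=0}^{z_\epsilon}\bigl(I-\tfrac1L M_kK^{(k)}\bigr)^j .$$ There are constants $\kappa$, $L>0$, $C$, $q$ and a single program for this machine (all depending only on $\omega,p,c$) that implements this algorithm, without knowing future vectors $d^{(k)}$, so that for all inputs as above: 1. the total time of the initialization and of all $r$ rounds is at most $$C(1+\log n)^q\Bigl(s\,d^{\omega-1}+r\,(n\,d^{\omega-1})^{\frac{2\omega}{2\omega+1}}\Bigr),\qquad s=\max\Bigl\{\max_{1\le k\le r}\mathrm{nnz}(d^{(k)}),\,d\Bigr\};$$ 2. for every $0\le k\le r$ the solver of round $k$ answers each query $(b,\epsilon)$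 in time at most $C(1+\log n)^q(\mathrm{nnz}(A)+d^2)\log(1/\epsilon)$; 3. with probability at least $1-n^{-c}$, for all $0\le k\le r$ there is a $K^{(k)}$ as above such that for every $\epsilon\in(0,1/2]$ there is a number of steps $z_\epsilon$ for which every answer is $x=Q_\epsilon b$ and satisfies $\|x-M_k^{-1}b\|_{M_k}^2\le\epsilon\,\|M_k^{-1}b\|_{M_k}^2$. -/

import Mathlib

open MeasureTheory

namespace InverseMaintenance

/-! ### Machine model: a randomized real RAM with unit cost -/

/-- Memory of the machine: arrays of naturals and arrays of reals (array name, then two indices),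
and the number of random reals that have been drawn so far. -/
structure State where
  nat : ℕ → ℕ → ℕ → ℕ
  real : ℕ → ℕ → ℕ → ℝ
  pos : ℕ

/-- Integer (index) expressions: constants, array access, addition, truncated subtraction. -/
inductive NatExp where
  | lit (c : ℕ)
  | get (a : ℕ) (i j : NatExp)
  | add (e f : NatExp)
  | sub (e f : NatExp)

/-- Real expressions: constants, conversion from integers, array access and exact arithmetic.
There is no conversion from reals to integers. -/
inductive RealExp where
  | lit (c : ℝ)
  | ofNat (e : NatExp)
  | get (a : ℕ) (i j : NatExp)
  | add (e f : RealExp)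
  | sub (e f : RealExp)
  | mul (e f : RealExp)
  | div (e f : RealExp)
  | sqrt (e : RealExp)

/-- Tests: comparison of two integers or of two reals. -/
inductive Test where
  | natLt (e f : NatExp)
  | realLt (e f : RealExp)

/-- Value of an integer expression. -/
def NatExp.eval (s : State) : NatExp → ℕ
  | .lit c => c
  | .get a i j => s.nat a (i.eval s) (j.eval s)
  | .add e f => e.eval s + f.eval s
  | .sub e f => e.eval s - f.eval s

/-- Cost of evaluating an integer expression: one unit per node. -/
def NatExp.cost : NatExp → ℕ
  | .lit _ => 1
  | .get _ i j => 1 + i.cost + j.cost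
  | .add e f => 1 + e.cost + f.cost
  | .sub e f => 1 + e.cost + f.cost

/-- Value of a real expression. -/
noncomputable def RealExp.eval (s : State) : RealExp → ℝ
  | .lit c => c
  | .ofNat e => (e.eval s : ℝ)
  | .get a i j => s.real a (i.eval s) (j.eval s)
  | .add e f => e.eval s + f.eval s
  | .sub e f => e.eval s - f.eval s
  | .mul e f => e.eval s * f.eval s
  | .div e f => e.eval s / f.eval s
  | .sqrt e => Real.sqrt (e.eval s)

/-- Cost of evaluating a real expression: one unit per node. -/
def RealExp.cost : RealExp → ℕ
  | .lit _ => 1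
  | .ofNat e => 1 + e.cost
  | .get _ i j => 1 + i.cost + j.cost
  | .add e f => 1 + e.cost + f.cost
  | .sub e f => 1 + e.cost + f.cost
  | .mul e f => 1 + e.cost + f.cost
  | .div e f => 1 + e.cost + f.cost
  | .sqrt e => 1 + e.cost

/-- Truth of a test. -/
def Test.Holds (s : State) : Test → Prop
  | .natLt e f => e.eval s < f.eval s
  | .realLt e f => e.eval s < f.eval s

/-- Cost of a test. -/
def Test.cost : Test → ℕ
  | .natLt e f => 1 + e.cost + f.cost
  | .realLt e f => 1 + e.cost + f.cost

/-- Programs. `rand a i j` draws a fresh uniform real of `[0,1]` and stores it in the cell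
`(i, j)` of the real array `a`. -/
inductive Prog where
  | skip
  | setNat (a : ℕ) (i j e : NatExp)
  | setReal (a : ℕ) (i j : NatExp) (e : RealExp)
  | rand (a : ℕ) (i j : NatExp)
  | seq (P Q : Prog)
  | branch (b : Test) (P Q : Prog)
  | loop (b : Test) (P : Prog)

/-- Overwrite one integer cell. -/
def State.putNat (s : State) (a i j v : ℕ) : State :=
  { s with nat := fun a' i' j' => if a' = a ∧ i' = i ∧ j' = j then v else s.nat a' i' j' }

/-- Overwrite one real cell. -/
noncomputable def State.putReal (s : State) (a i j : ℕ) (v : ℝ) : State :=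
  { s with real := fun a' i' j' => if a' = a ∧ i' = i ∧ j' = j then v else s.real a' i' j' }

/-- The sequence of random reals that the machine may draw. -/
abbrev Tape : Type := ℕ → unitInterval

/-- Independent uniform random reals of `[0,1]`. -/
noncomputable def tapeMeasure : Measure Tape :=
  Measure.infinitePi fun _ : ℕ => (volume : Measure unitInterval)

/-- `Exec ρ P s s' t`: on the tape `ρ`, the program `P` started in memory `s` halts in memory `s'`
after `t` elementary operations. -/
inductive Exec (ρ : Tape) : Prog → State → State → ℕ → Prop where
  | skip (s : State) : Exec ρ .skip s s 1
  | setNat (s : State) (a : ℕ) (i j e : NatExp) :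
      Exec ρ (.setNat a i j e) s (s.putNat a (i.eval s) (j.eval s) (e.eval s))
        (1 + i.cost + j.cost + e.cost)
  | setReal (s : State) (a : ℕ) (i j : NatExp) (e : RealExp) :
      Exec ρ (.setReal a i j e) s (s.putReal a (i.eval s) (j.eval s) (e.eval s))
        (1 + i.cost + j.cost + e.cost)
  | rand (s : State) (a : ℕ) (i j : NatExp) :
      Exec ρ (.rand a i j) s
        { s.putReal a (i.eval s) (j.eval s) (ρ s.pos : ℝ) with pos := s.pos + 1 }
        (1 + i.cost + j.cost)
  | seq {P Q : Prog} {s s₁ s₂ : State} {t₁ t₂ : ℕ} :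
      Exec ρ P s s₁ t₁ → Exec ρ Q s₁ s₂ t₂ → Exec ρ (.seq P Q) s s₂ (t₁ + t₂)
  | branch_true {b : Test} {P Q : Prog} {s s₁ : State} {t : ℕ} :
      b.Holds s → Exec ρ P s s₁ t → Exec ρ (.branch b P Q) s s₁ (b.cost + t)
  | branch_false {b : Test} {P Q : Prog} {s s₁ : State} {t : ℕ} :
      ¬ b.Holds s → Exec ρ Q s s₁ t → Exec ρ (.branch b P Q) s s₁ (b.cost + t)
  | loop_true {b : Test} {P : Prog} {s s₁ s₂ : State} {t₁ t₂ : ℕ} :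
      b.Holds s → Exec ρ P s s₁ t₁ → Exec ρ (.loop b P) s₁ s₂ t₂ →
        Exec ρ (.loop b P) s s₂ (b.cost + t₁ + t₂)
  | loop_false {b : Test} {P : Prog} {s : State} :
      ¬ b.Holds s → Exec ρ (.loop b P) s s b.cost

/-- `ω` is a matrix multiplication exponent: one program multiplies any two real `m × m` matrices
in `O(m ^ ω)` operations. The number `m` is read from integer cell `(0; 0, 0)`, the factors from
the real arrays `0` and `1`, the product is left in the real array `2`; the rest of the memory may
hold anything at the start. -/
def IsMatMulExponent (ω : ℝ) : Prop :=
  ∃ (P : Prog) (C : ℝ), ∀ (m : ℕ), 1 ≤ m → ∀ (X Y : Matrix (Fin m) (Fin m) ℝ) (ρ : Tape)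
    (s : State), s.nat 0 0 0 = m →
    (∀ i j : Fin m, s.real 0 i j = X i j) → (∀ i j : Fin m, s.real 1 i j = Y i j) →
    ∃ (s' : State) (t : ℕ), Exec ρ P s s' t ∧ (t : ℝ) ≤ C * (m : ℝ) ^ ω ∧
      ∀ i j : Fin m, s'.real 2 i j = (X * Y) i j

/-! ### Matrices -/

/-- `N ⪯ M` -/
def SpecLE {d : ℕ} (N M : Matrix (Fin d) (Fin d) ℝ) : Prop :=
  ∀ x : Fin d → ℝ, x ⬝ᵥ N.mulVec x ≤ x ⬝ᵥ M.mulVec x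

/-- `M ≈_κ N`, that is `exp (-κ) N ⪯ M ⪯ exp κ N` -/
def SpecApprox {d : ℕ} (κ : ℝ) (M N : Matrix (Fin d) (Fin d) ℝ) : Prop :=
  SpecLE (Real.exp (-κ) • N) M ∧ SpecLE M (Real.exp κ • N)

/-- `‖x‖_M ^ 2` -/
def normSq {d : ℕ} (M : Matrix (Fin d) (Fin d) ℝ) (x : Fin d → ℝ) : ℝ := x ⬝ᵥ M.mulVec x

/-- The matrix `Aᵀ diag(w) A`. -/
def gram {n d : ℕ} (A : Matrix (Fin n) (Fin d) ℝ) (w : Fin n → ℝ) : Matrix (Fin d) (Fin d) ℝ :=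
  A.transpose * Matrix.diagonal w * A

/-- Number of nonzero entries of a matrix. -/
noncomputable def nnz {n d : ℕ} (A : Matrix (Fin n) (Fin d) ℝ) : ℕ :=
  Set.ncard {e : Fin n × Fin d | A e.1 e.2 ≠ 0}

/-- Number of nonzero entries of a vector. -/
noncomputable def nnzVec {n : ℕ} (v : Fin n → ℝ) : ℕ := Set.ncard {i : Fin n | v i ≠ 0}

/-! ### The inverse maintenance problem -/

/-- Input of the inverse maintenance problem with `r` rounds: a matrix of full column rank and
positive weight vectors `D 0, …, D r`, where `D k` is revealed in round `k`. -/
structure IsInput {n d : ℕ} (r : ℕ) (A : Matrix (Fin n) (Fin d) ℝ) (D : ℕ → Fin n → ℝ) :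
    Prop where
  d_pos : 0 < d
  r_pos : 0 < r
  full_rank : A.rank = d
  weights_pos : ∀ k ≤ r, ∀ i, 0 < D k i

/-- The `ℓ²` stability assumption with parameter `β`. -/
structure L2Stable {n d : ℕ} (r : ℕ) (A : Matrix (Fin n) (Fin d) ℝ) (D : ℕ → Fin n → ℝ)
    (β : ℝ) : Prop where
  step : ∀ k < r,
    ‖WithLp.toLp 2 (fun i => Real.log (D (k + 1) i) - Real.log (D k i))‖ ≤ 0.1
  lower : ∀ k ≤ r, SpecLE (β⁻¹ • gram A (D 0)) (gram A (D k))
  upper : ∀ k ≤ r, SpecLE (gram A (D k)) (β • gram A (D 0))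

open Classical in
/-- The approximate weights kept by the algorithm: a coordinate is refreshed in a round exactly
when `0.9 d_apr ≤ d ≤ 1.1 d_apr` fails for it. -/
noncomputable def aprWeights {n : ℕ} (D : ℕ → Fin n → ℝ) : ℕ → Fin n → ℝ
  | 0 => D 0
  | k + 1 => fun i =>
      if 0.9 * aprWeights D k i ≤ D (k + 1) i ∧ D (k + 1) i ≤ 1.1 * aprWeights D k i
      then aprWeights D k i else D (k + 1) i

/-- The linear operator of `z + 1` steps of preconditioned gradient descent for `M x = b` with
preconditioner `K` and step size `1 / L`, started at `0`. -/
noncomputable def descentOperator {d : ℕ} (M K : Matrix (Fin d) (Fin d) ℝ) (L : ℝ) (z : ℕ) :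
    Matrix (Fin d) (Fin d) ℝ :=
  L⁻¹ • (K * ∑ j ∈ Finset.range (z + 1), (1 - L⁻¹ • (M * K)) ^ j)

/-- The requirements on the answers of a linear solver for `M` that is obtained from an approximate
inverse `K` by preconditioned gradient descent; `S b ε x` says that the solver answers `x` to the
query `(b, ε)`. -/
def IsSolverFrom {d : ℕ} (M K : Matrix (Fin d) (Fin d) ℝ) (L : ℝ)
    (S : (Fin d → ℝ) → ℝ → (Fin d → ℝ) → Prop) : Prop :=
  ∀ ε : ℝ, 0 < ε → ε ≤ 1 / 2 → ∃ z : ℕ, ∀ b x : Fin d → ℝ, S b ε x →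
    x = (descentOperator M K L z).mulVec b ∧
    normSq M (x - M⁻¹.mulVec b) ≤ ε * normSq M (M⁻¹.mulVec b)

/-! ### Implementations -/

/-- An implementation: a program for the start, one for each round, and one for solver queries.
They share the memory. -/
structure Maintainer where
  init : Prog
  round : Prog
  solve : Prog

open Classical in
/-- The environment writes the vector `v` to the cells `(0, 0), …, (m - 1, 0)` of the real
array `a`. -/
noncomputable def State.putVec (s : State) (a : ℕ) {m : ℕ} (v : Fin m → ℝ) : State :=
  { s with real := fun a' i j =>
      if h : a' = a ∧ j = 0 ∧ i < m then v ⟨i, h.2.2⟩ else s.real a' i j }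

open Classical in
/-- Memory at the start: `n`, `d`, `r` in the integer array `0`, the matrix in the real array `0`,
the initial weights in the real array `1`, and zeros elsewhere. -/
noncomputable def startState {n d : ℕ} (r : ℕ) (A : Matrix (Fin n) (Fin d) ℝ)
    (w : Fin n → ℝ) : State :=
  State.putVec
    { nat := fun a i j => if a = 0 ∧ i = 0 then
        (if j = 0 then n else if j = 1 then d else if j = 2 then r else 0) else 0
      real := fun a i j => if h : a = 0 ∧ i < n ∧ j < d then A ⟨i, h.2.1⟩ ⟨j, h.2.2⟩ else 0
      pos := 0 }
    1 w

/-- `σ k` is the memory after round `k` and `t k` the time spent in round `k`, where round `0` is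
the initialization. In each later round the new weights are written to the real array `1`. -/
def Maintainer.IsRun (𝒜 : Maintainer) {n d : ℕ} (r : ℕ) (A : Matrix (Fin n) (Fin d) ℝ)
    (D : ℕ → Fin n → ℝ) (ρ : Tape) (σ : ℕ → State) (t : ℕ → ℕ) : Prop :=
  Exec ρ 𝒜.init (startState r A (D 0)) (σ 0) (t 0) ∧
  ∀ k < r, Exec ρ 𝒜.round ((σ k).putVec 1 (D (k + 1))) (σ (k + 1)) (t (k + 1))

/-- In memory `s`, the solver answers the query `(b, ε)` by `x` after `τ` operations. The query is
written to the real arrays `2` and `3`, and the answer is read from the real array `4`. -/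
def Maintainer.Answers (𝒜 : Maintainer) {d : ℕ} (ρ : Tape) (s : State) (b : Fin d → ℝ) (ε : ℝ)
    (x : Fin d → ℝ) (τ : ℕ) : Prop :=
  ∃ s' : State, Exec ρ 𝒜.solve ((s.putVec 2 b).putReal 3 0 0 ε) s' τ ∧
    ∀ j : Fin d, s'.real 4 j 0 = x j

end InverseMaintenance

/-! The program draws no random numbers and succeeds on every tape. It uses `L = 1` and `κ = 1`. In
each round it suffices to be able to apply P⁻¹, where P = Aᵀ diag(v) A for some weights v with 0.9 v
≤ d^(k) ≤ 1.1 v. Then 0.9 P ⪯ M_k ⪯ 1.1 P, so one step of preconditioned descent at least halves the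
squared error (`contraction`, `normSq_iter`), and about log₂(1/ε) steps answer a query. The weights
d^(apr) satisfy the same two inequalities, so v and d^(apr) differ by a factor of at most 11/9 < e.
Hence P⁻¹ is an admissible K (`ratio_bounds`, `specApprox_inv`), and v may be chosen for
convenience.

Let D = 2^a be d rounded up to a power of two. Rounds are grouped into blocks of T = 2^τ rounds,
with T^(2ω+1) equal to n D^(ω-1) up to a constant factor. Inside a block, v equals the weights w at
its start, except on a growing list of rows where v is the current weight. A row of A joins the list
once its weight leaves the 10% window around w. By Cauchy–Schwarz over time such a row has squared
movement at least a constant over T, while all rows together move by at most 0.01 T. So the list has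
at most 2T² rows (`card_changed_le`).

A restart costs n D^(ω-1) up to a logarithm, which is T^(2ω) per round of the block. This is the
order of (n d^(ω-1))^(2ω/(2ω+1)), the permitted cost of a round. If T² < D (`Conf.LowRank`), the
restart provides V = (Aᵀ diag(w) A)⁻¹ and A V. With U the listed rows, δ the diagonal of weight
changes and G = U V Uᵀ, Woodbury's formula (`low_rank_inv`) gives P⁻¹ = V − V Uᵀ (1 + δG)⁻¹ δ U V,
and inverting 1 + δG costs T^(2ω) up to a logarithm. If D ≤ T², the matrix P itself can be inverted
within this bound.

It remains to maintain G. It is computed in batches of θ rows, each of cost T² D θ^(ω-2). A full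
batch is computed once per block and charged to its rows through a potential (`exec_roundProg`). The
last, incomplete batch is recomputed at every update. The choice of θ balances the two: the full
batches of a block cost O(T^(2ω+1)) by `Conf.batches_le`, and a single batch costs O(T^(2ω) + D²) by
`Conf.batch_le`. If nnz(A) + d² ≤ T^(2ω), the round pays for the single batch. Otherwise
(`Conf.Lazy`) the update is postponed to the queries, whose budget nnz(A) + d² then dominates
T^(2ω).

Fast inversion is the Schur complement recursion on positive definite matrices, run with an explicit
stack (`runs_invLoop`). A general invertible M is reduced to MᵀM. That ω ≥ 2 follows because a
multiplication program must write m² cells (`IsMatMulExponent.two_le`), and this absorbs all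
quadratic overheads. Finally, positive weights have full support, so s ≥ n and the first term of the
time bound covers the setup and the first restart. -/

namespace InverseMaintenance

/-! ### Frames, determinism and time-bounded triples -/

/-- The program may write to the integer array `a`. -/
def Prog.WritesNat : Prog → ℕ → Prop
  | .skip, _ => False
  | .setNat b _ _ _, a => a = b
  | .setReal _ _ _ _, _ => False
  | .rand _ _ _, _ => False
  | .seq P Q, a => P.WritesNat a ∨ Q.WritesNat a
  | .branch _ P Q, a => P.WritesNat a ∨ Q.WritesNat a
  | .loop _ P, a => P.WritesNat a

/-- The program may write to the real array `a`. -/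
def Prog.WritesReal : Prog → ℕ → Prop
  | .skip, _ => False
  | .setNat _ _ _ _, _ => False
  | .setReal b _ _ _, a => a = b
  | .rand b _ _, a => a = b
  | .seq P Q, a => P.WritesReal a ∨ Q.WritesReal a
  | .branch _ P Q, a => P.WritesReal a ∨ Q.WritesReal a
  | .loop _ P, a => P.WritesReal a

/-- Arrays that `P` does not write to agree in the two memories. -/
structure Frame (P : Prog) (s s' : State) : Prop where
  nat : ∀ a, ¬ P.WritesNat a → s'.nat a = s.nat a
  real : ∀ a, ¬ P.WritesReal a → s'.real a = s.real a

theorem State.putNat_nat_of_ne {s : State} {a b i j v : ℕ} (h : b ≠ a) :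
    (s.putNat a i j v).nat b = s.nat b := by
  funext x y; simp [State.putNat, h]

theorem State.putReal_real_of_ne {s : State} {a b i j : ℕ} {v : ℝ} (h : b ≠ a) :
    (s.putReal a i j v).real b = s.real b := by
  funext x y; simp [State.putReal, h]

@[simp] theorem State.putNat_real {s : State} {a i j v : ℕ} : (s.putNat a i j v).real = s.real :=
  rfl

@[simp] theorem State.putReal_nat {s : State} {a i j : ℕ} {v : ℝ} :
    (s.putReal a i j v).nat = s.nat := rfl

theorem State.putNat_nat (s : State) (a i j v b x y : ℕ) :
    (s.putNat a i j v).nat b x y = if b = a ∧ x = i ∧ y = j then v else s.nat b x y := rfl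

theorem State.putReal_real (s : State) (a i j : ℕ) (v : ℝ) (b x y : ℕ) :
    (s.putReal a i j v).real b x y = if b = a ∧ x = i ∧ y = j then v else s.real b x y := rfl

/-- Which arrays a program may write is read off its syntax. All later invariants are carried across
program calls in this way. -/
theorem Exec.frame {ρ : Tape} {P : Prog} {s s' : State} {t : ℕ} (h : Exec ρ P s s' t) :
    Frame P s s' := by
  induction h with
  | skip s => exact ⟨fun _ _ => rfl, fun _ _ => rfl⟩
  | setNat s a i j e =>
    exact ⟨fun b hb => State.putNat_nat_of_ne hb, fun _ _ => rfl⟩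
  | setReal s a i j e =>
    exact ⟨fun _ _ => rfl, fun b hb => State.putReal_real_of_ne hb⟩
  | rand s a i j =>
    exact ⟨fun _ _ => rfl, fun b hb => State.putReal_real_of_ne hb⟩
  | seq _ _ h1 h2 =>
    refine ⟨fun b hb => ?_, fun b hb => ?_⟩ <;>
      simp only [Prog.WritesNat, Prog.WritesReal, not_or] at hb
    · rw [h2.nat b hb.2, h1.nat b hb.1]
    · rw [h2.real b hb.2, h1.real b hb.1]
  | branch_true _ _ h1 =>
    refine ⟨fun b hb => ?_, fun b hb => ?_⟩ <;>
      simp only [Prog.WritesNat, Prog.WritesReal, not_or] at hb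
    · exact h1.nat b hb.1
    · exact h1.real b hb.1
  | branch_false _ _ h1 =>
    refine ⟨fun b hb => ?_, fun b hb => ?_⟩ <;>
      simp only [Prog.WritesNat, Prog.WritesReal, not_or] at hb
    · exact h1.nat b hb.2
    · exact h1.real b hb.2
  | loop_true _ _ _ h1 h2 =>
    refine ⟨fun b hb => ?_, fun b hb => ?_⟩
    · rw [h2.nat b hb, h1.nat b hb]
    · rw [h2.real b hb, h1.real b hb]
  | loop_false _ => exact ⟨fun _ _ => rfl, fun _ _ => rfl⟩

/-- `IsSolverFrom` speaks about every answer of the solver. Determinism reduces it to the one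
execution that is exhibited. -/
theorem Exec.deterministic {ρ : Tape} {P : Prog} {s s₁ : State} {t₁ : ℕ} (h : Exec ρ P s s₁ t₁) :
    ∀ {s₂ : State} {t₂ : ℕ}, Exec ρ P s s₂ t₂ → s₁ = s₂ ∧ t₁ = t₂ := by
  induction h with
  | skip s => intro _ _ h; cases h; exact ⟨rfl, rfl⟩
  | setNat s a i j e => intro _ _ h; cases h; exact ⟨rfl, rfl⟩
  | setReal s a i j e => intro _ _ h; cases h; exact ⟨rfl, rfl⟩
  | rand s a i j => intro _ _ h; cases h; exact ⟨rfl, rfl⟩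
  | seq _ _ h1 h2 =>
    intro _ _ h
    cases h with
    | seq g1 g2 =>
      obtain ⟨rfl, rfl⟩ := h1 g1
      obtain ⟨rfl, rfl⟩ := h2 g2
      exact ⟨rfl, rfl⟩
  | branch_true hb _ h1 =>
    intro _ _ h
    cases h with
    | branch_true _ g => obtain ⟨rfl, rfl⟩ := h1 g; exact ⟨rfl, rfl⟩
    | branch_false hn _ => exact absurd hb hn
  | branch_false hb _ h1 =>
    intro _ _ h
    cases h with
    | branch_true hn _ => exact absurd hn hb
    | branch_false _ g => obtain ⟨rfl, rfl⟩ := h1 g; exact ⟨rfl, rfl⟩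
  | loop_true hb _ _ h1 h2 =>
    intro _ _ h
    cases h with
    | loop_true _ g1 g2 =>
      obtain ⟨rfl, rfl⟩ := h1 g1
      obtain ⟨rfl, rfl⟩ := h2 g2
      exact ⟨rfl, rfl⟩
    | loop_false hn => exact absurd hb hn
  | loop_false hb =>
    intro _ _ h
    cases h with
    | loop_true hn _ _ => exact absurd hn hb
    | loop_false _ => exact ⟨rfl, rfl⟩

/-- Started in `s`, the program halts within `B` operations in a memory that satisfies `Q`. -/
def Runs (ρ : Tape) (P : Prog) (s : State) (B : ℝ) (Q : State → Prop) : Prop :=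
  ∃ (s' : State) (t : ℕ), Exec ρ P s s' t ∧ (t : ℝ) ≤ B ∧ Q s'

namespace Runs

variable {ρ : Tape} {P R : Prog} {s : State} {B B' B₁ B₂ : ℝ} {Q Q' : State → Prop}

theorem mono (h : Runs ρ P s B Q) (hB : B ≤ B') (hQ : ∀ s', Q s' → Q' s') :
    Runs ρ P s B' Q' := by
  obtain ⟨s', t, h1, h2, h3⟩ := h
  exact ⟨s', t, h1, h2.trans hB, hQ s' h3⟩

theorem frame (h : Runs ρ P s B Q) : Runs ρ P s B (fun s' => Q s' ∧ Frame P s s') := by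
  obtain ⟨s', t, h1, h2, h3⟩ := h
  exact ⟨s', t, h1, h2, h3, h1.frame⟩

theorem skip (h : Q s) : Runs ρ .skip s 1 Q := ⟨s, 1, .skip s, by simp, h⟩

theorem seq (h1 : Runs ρ P s B₁ Q') (h2 : ∀ s₁, Q' s₁ → Runs ρ R s₁ B₂ Q) :
    Runs ρ (P.seq R) s (B₁ + B₂) Q := by
  obtain ⟨s₁, t₁, e₁, c₁, q₁⟩ := h1
  obtain ⟨s₂, t₂, e₂, c₂, q₂⟩ := h2 s₁ q₁
  exact ⟨s₂, t₁ + t₂, .seq e₁ e₂, by push_cast; linarith, q₂⟩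

/-- Sequential composition with a given total budget. -/
theorem step (h1 : Runs ρ P s B₁ Q') (h2 : ∀ s₁, Q' s₁ → Runs ρ R s₁ (B - B₁) Q) :
    Runs ρ (P.seq R) s B Q :=
  (seq h1 h2).mono (by linarith) (fun _ h => h)

theorem setNat {a : ℕ} {i j e : NatExp}
    (h : Q (s.putNat a (i.eval s) (j.eval s) (e.eval s))) :
    Runs ρ (.setNat a i j e) s ((1 + i.cost + j.cost + e.cost : ℕ) : ℝ) Q :=
  ⟨_, _, .setNat s a i j e, le_rfl, h⟩

theorem setReal {a : ℕ} {i j : NatExp} {e : RealExp}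
    (h : Q (s.putReal a (i.eval s) (j.eval s) (e.eval s))) :
    Runs ρ (.setReal a i j e) s ((1 + i.cost + j.cost + e.cost : ℕ) : ℝ) Q :=
  ⟨_, _, .setReal s a i j e, le_rfl, h⟩

theorem setNat_step {a : ℕ} {i j e : NatExp}
    (h : Runs ρ R (s.putNat a (i.eval s) (j.eval s) (e.eval s))
      (B - ((1 + i.cost + j.cost + e.cost : ℕ) : ℝ)) Q) :
    Runs ρ (.seq (.setNat a i j e) R) s B Q :=
  step (setNat (Q := fun s' => s' = s.putNat a (i.eval s) (j.eval s) (e.eval s)) rfl)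
    (fun _ h' => h' ▸ h)

theorem setReal_step {a : ℕ} {i j : NatExp} {e : RealExp}
    (h : Runs ρ R (s.putReal a (i.eval s) (j.eval s) (e.eval s))
      (B - ((1 + i.cost + j.cost + e.cost : ℕ) : ℝ)) Q) :
    Runs ρ (.seq (.setReal a i j e) R) s B Q :=
  step (setReal (Q := fun s' => s' = s.putReal a (i.eval s) (j.eval s) (e.eval s)) rfl)
    (fun _ h' => h' ▸ h)

theorem setNat_last {a : ℕ} {i j e : NatExp}
    (h : Q (s.putNat a (i.eval s) (j.eval s) (e.eval s)))
    (hB : ((1 + i.cost + j.cost + e.cost : ℕ) : ℝ) ≤ B) : Runs ρ (.setNat a i j e) s B Q :=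
  (setNat h).mono hB (fun _ h => h)

theorem setReal_last {a : ℕ} {i j : NatExp} {e : RealExp}
    (h : Q (s.putReal a (i.eval s) (j.eval s) (e.eval s)))
    (hB : ((1 + i.cost + j.cost + e.cost : ℕ) : ℝ) ≤ B) : Runs ρ (.setReal a i j e) s B Q :=
  (setReal h).mono hB (fun _ h => h)

theorem branch_last {b : Test} (h1 : b.Holds s → Runs ρ P s (B - b.cost) Q)
    (h2 : ¬ b.Holds s → Runs ρ R s (B - b.cost) Q) : Runs ρ (.branch b P R) s B Q := by
  by_cases hb : b.Holds s
  · obtain ⟨s', t, e, c, q⟩ := h1 hb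
    exact ⟨s', _, .branch_true hb e, by push_cast; linarith, q⟩
  · obtain ⟨s', t, e, c, q⟩ := h2 hb
    exact ⟨s', _, .branch_false hb e, by push_cast; linarith, q⟩

theorem loop_true {b : Test} (hb : b.Holds s) (h1 : Runs ρ P s B₁ Q')
    (h2 : ∀ s₁, Q' s₁ → Runs ρ (.loop b P) s₁ B₂ Q) :
    Runs ρ (.loop b P) s (b.cost + B₁ + B₂) Q := by
  obtain ⟨s₁, t₁, e₁, c₁, q₁⟩ := h1
  obtain ⟨s₂, t₂, e₂, c₂, q₂⟩ := h2 s₁ q₁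
  exact ⟨s₂, _, .loop_true hb e₁ e₂, by push_cast; linarith, q₂⟩

theorem loop_false {b : Test} (hb : ¬ b.Holds s) (h : Q s) :
    Runs ρ (.loop b P) s b.cost Q := ⟨s, _, .loop_false hb, le_rfl, h⟩

/-- Rule for loops: `I k` holds after `k` rounds of the loop, and there are at most `N` rounds. -/
theorem while_le {b : Test} (I : ℕ → State → Prop) (N : ℕ) (hB : 0 ≤ B)
    (hb : ∀ k s, I k s → b.Holds s → k < N ∧ Runs ρ P s B (I (k + 1))) {k : ℕ} (h0 : I k s)
    (hk : k ≤ N) :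
    Runs ρ (.loop b P) s ((N - k) * (B + b.cost) + b.cost)
      (fun s' => ∃ k' ≤ N, k ≤ k' ∧ I k' s' ∧ ¬ b.Holds s') := by
  obtain ⟨m, hm⟩ := Nat.exists_eq_add_of_le hk
  have hc : (0 : ℝ) ≤ B + b.cost := by positivity
  induction m generalizing k s with
  | zero =>
    have : ¬ b.Holds s := fun h => by have := (hb k s h0 h).1; omega
    refine (loop_false this ⟨k, hk, le_rfl, h0, this⟩).mono ?_ (fun _ h => h)
    subst hm; simp
  | succ m ih =>
    by_cases h : b.Holds s
    · obtain ⟨h1, h2⟩ := hb k s h0 h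
      refine (loop_true h h2 (fun s₁ hs₁ => ih hs₁ (by omega) (by omega))).mono ?_ ?_
      · push_cast; linarith
      · rintro s' ⟨k', h3, h4, h5⟩
        exact ⟨k', h3, by omega, h5⟩
    · refine (loop_false h ⟨k, hk, le_rfl, h0, h⟩).mono ?_ (fun _ h => h)
      have : (0 : ℝ) ≤ N - k := by rw [hm]; push_cast; linarith [Nat.cast_nonneg (α := ℝ) m]
      nlinarith [mul_nonneg this hc]

end Runs

/-! ### Programs built from loops over index ranges -/

/-- A scalar variable, kept in cell `(0, 0)` of its own integer array. -/
abbrev V (v : ℕ) : NatExp := .get v (.lit 0) (.lit 0)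

/-- A scalar real variable. -/
abbrev RV (v : ℕ) : RealExp := .get v (.lit 0) (.lit 0)

/-- Assignment to a scalar integer variable. -/
abbrev setV (v : ℕ) (e : NatExp) : Prog := .setNat v (.lit 0) (.lit 0) e

/-- Assignment to a scalar real variable. -/
abbrev setRV (v : ℕ) (e : RealExp) : Prog := .setReal v (.lit 0) (.lit 0) e

/-- `for v := 0, …, n - 1`. -/
def forP (v : ℕ) (n : NatExp) (body : Prog) : Prog :=
  .seq (setV v (.lit 0)) (.loop (.natLt (V v) n) (.seq body (setV v (.add (V v) (.lit 1)))))

/-- The body has to leave the counter at `k`, and the next invariant is required only after the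
increment, so `I` may mention the counter. The constant 12 pays for the test and the increment. -/
theorem Runs.forP {ρ : Tape} {v : ℕ} {n : NatExp} {body : Prog} {s : State} {N : ℕ} {B : ℝ}
    (I : ℕ → State → Prop) (hB : 0 ≤ B) (h0 : I 0 (s.putNat v 0 0 0))
    (hn : ∀ k s, I k s → s.nat v 0 0 = k ∧ n.eval s = N)
    (hb : ∀ k < N, ∀ s, I k s →
      Runs ρ body s B (fun s' => s'.nat v 0 0 = k ∧ I (k + 1) (s'.putNat v 0 0 (k + 1)))) :
    Runs ρ (forP v n body) s (N * (B + n.cost + 12) + n.cost + 8) (I N) := by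
  have key := Runs.while_le (ρ := ρ) (b := .natLt (V v) n)
    (P := .seq body (setV v (.add (V v) (.lit 1)))) (B := B + 8)
    (s := s.putNat v 0 0 0) (fun k s => I k s ∧ k ≤ N) N (by linarith) ?_ (k := 0)
    ⟨h0, Nat.zero_le _⟩ (Nat.zero_le _)
  · refine (Runs.seq (Q' := fun s' => s' = s.putNat v 0 0 0) (Runs.setNat rfl)
      (fun s₁ h => h ▸ key)).mono ?_ ?_
    · simp [NatExp.cost, Test.cost]; ring_nf; rfl
    · rintro s' ⟨k, hk, _, ⟨h1, _⟩, h2⟩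
      obtain ⟨e1, e2⟩ := hn k s' h1
      simp only [Test.Holds, NatExp.eval, e1, e2, not_lt] at h2
      obtain rfl : k = N := le_antisymm hk h2
      exact h1
  · rintro k s ⟨hI, hk⟩ hh
    obtain ⟨e1, e2⟩ := hn k s hI
    simp only [Test.Holds, NatExp.eval, e1, e2] at hh
    refine ⟨hh, (Runs.seq (hb k hh s hI) (fun s₁ h => Runs.setNat (Q := fun s => I (k+1) s ∧ k + 1 ≤ N)
      ?_)).mono ?_ (fun _ h => h)⟩
    · simp only [NatExp.eval, h.1]
      exact ⟨h.2, hh⟩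
    · simp [NatExp.cost]

/-- The memories agree except for the loop counters `80`, `81` and the real array `a`. -/
structure Agr (a : ℕ) (s s₁ : State) : Prop where
  nat : ∀ b, b ≠ 80 → b ≠ 81 → s₁.nat b = s.nat b
  real : ∀ b, b ≠ a → s₁.real b = s.real b

theorem Agr.put80 {a : ℕ} {s s₁ : State} (h : Agr a s s₁) (x y v : ℕ) :
    Agr a s (s₁.putNat 80 x y v) :=
  ⟨fun b h1 h2 => by rw [State.putNat_nat_of_ne h1, h.nat b h1 h2], h.real⟩

theorem Agr.put81 {a : ℕ} {s s₁ : State} (h : Agr a s s₁) (x y v : ℕ) :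
    Agr a s (s₁.putNat 81 x y v) :=
  ⟨fun b h1 h2 => by rw [State.putNat_nat_of_ne h2, h.nat b h1 h2], h.real⟩

theorem Agr.putReal {a : ℕ} {s s₁ : State} (h : Agr a s s₁) (x y : ℕ) (v : ℝ) :
    Agr a s (s₁.putReal a x y v) :=
  ⟨h.nat, fun b h1 => by rw [State.putReal_real_of_ne h1, h.real b h1]⟩

theorem Agr.refl (a : ℕ) (s : State) : Agr a s s := ⟨fun _ _ _ => rfl, fun _ _ => rfl⟩

/-- Assign to the cells `(ri, ci)` of the real array `a` the values of `e`, where the counters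
`80 < m₁` and `81 < m₂` run. -/
def assign2 (a : ℕ) (ri ci m₁ m₂ : NatExp) (e : RealExp) : Prog :=
  forP 80 m₁ (forP 81 m₂ (.setReal a ri ci e))

/-- Add to the cells `(ri, ci)` of the real array `a` the values of `e`, where the counters
`80 < m₁` and `81 < m₂` run. -/
def scatter2 (a : ℕ) (ri ci m₁ m₂ : NatExp) (e : RealExp) : Prog :=
  assign2 a ri ci m₁ m₂ (.add (.get a ri ci) e)

/-- Double loops whose body writes one cell of `a`: `C D` is an invariant of the array `a` indexed by
the set `D` of pairs of counter values that have been treated. -/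
theorem Runs.double {ρ : Tape} {a : ℕ} {ri ci m₁ m₂ : NatExp} {e : RealExp} {s : State}
    {N₁ N₂ w : ℕ} (gi gj : ℕ → ℕ → ℕ) (C : (ℕ → ℕ → Prop) → (ℕ → ℕ → ℝ) → Prop)
    (h0 : C (fun _ _ => False) (s.real a))
    (hm : ∀ s₁, Agr a s s₁ → m₁.eval s₁ = N₁ ∧ m₂.eval s₁ = N₂)
    (hw : ri.cost + ci.cost + e.cost + m₁.cost + m₂.cost + 30 ≤ w)
    (hs : ∀ i < N₁, ∀ j < N₂, ∀ s₁, Agr a s s₁ →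
      C (fun i' j' => (i' < i ∧ j' < N₂) ∨ (i' = i ∧ j' < j)) (s₁.real a) →
      s₁.nat 80 0 0 = i → s₁.nat 81 0 0 = j →
      ri.eval s₁ = gi i j ∧ ci.eval s₁ = gj i j ∧
      C (fun i' j' => (i' < i ∧ j' < N₂) ∨ (i' = i ∧ j' < j + 1))
        (fun x y => if x = gi i j ∧ y = gj i j then e.eval s₁ else s₁.real a x y)) :
    Runs ρ (assign2 a ri ci m₁ m₂ e) s (N₁ * (N₂ * w + w) + w)
      (fun s' => Agr a s s' ∧ C (fun i j => i < N₁ ∧ j < N₂) (s'.real a)) := by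
  have hw' : (ri.cost + ci.cost + e.cost + m₁.cost + m₂.cost + 30 : ℝ) ≤ w := by exact_mod_cast hw
  have p1 := Nat.cast_nonneg (α := ℝ) ri.cost
  have p2 := Nat.cast_nonneg (α := ℝ) ci.cost
  have p3 := Nat.cast_nonneg (α := ℝ) e.cost
  have p4 := Nat.cast_nonneg (α := ℝ) m₁.cost
  have p5 := Nat.cast_nonneg (α := ℝ) m₂.cost
  have n1 := Nat.cast_nonneg (α := ℝ) N₁
  have n2 := Nat.cast_nonneg (α := ℝ) N₂
  have hC : ∀ D D' r, (∀ i j, D i j ↔ D' i j) → C D r → C D' r := by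
    intro D D' r hD h
    have : D = D' := by funext i j; exact propext (hD i j)
    exact this ▸ h
  have inner : ∀ i < N₁, ∀ s₁, Agr a s s₁ → C (fun i' j' => i' < i ∧ j' < N₂) (s₁.real a) →
      s₁.nat 80 0 0 = i →
      Runs ρ (InverseMaintenance.forP 81 m₂ (.setReal a ri ci e)) s₁
        (N₂ * ((1 + ri.cost + ci.cost + e.cost : ℕ) + m₂.cost + 12) + m₂.cost + 8)
        (fun s' => s'.nat 80 0 0 = i ∧ Agr a s s' ∧
          C (fun i' j' => i' < i + 1 ∧ j' < N₂) (s'.real a)) := by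
    intro i hi s₁ h0 h1 h2
    refine (Runs.forP (I := fun k s' => s'.nat 80 0 0 = i ∧ s'.nat 81 0 0 = k ∧ Agr a s s' ∧
      C (fun i' j' => (i' < i ∧ j' < N₂) ∨ (i' = i ∧ j' < k)) (s'.real a)) (by positivity)
      ⟨by simpa [State.putNat_nat] using h2, by simp [State.putNat_nat],
        h0.put81 _ _ _, hC _ _ _ (by simp) h1⟩ ?_ ?_).mono le_rfl ?_
    · rintro k s' ⟨_, h4, h5, h6⟩
      exact ⟨h4, (hm _ h5).2⟩
    · rintro k hk s' ⟨h3, h4, h5, h6⟩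
      obtain ⟨q1, q2, q3⟩ := hs i hi k hk s' h5 h6 h3 h4
      refine Runs.setReal ⟨by simpa using h4, by simpa [State.putNat_nat] using h3,
        by simp [State.putNat_nat], (h5.putReal _ _ _).put81 _ _ _, ?_⟩
      convert q3 using 1
      funext x y
      simp [State.putReal_real, q1, q2]
    · rintro s' ⟨h3, h4, h5, h6⟩
      refine ⟨h3, h5, hC _ _ _ (fun i' j' => ?_) h6⟩
      constructor
      · rintro (h | h) <;> omega
      · intro h; omega
  refine (Runs.forP (I := fun k s' => s'.nat 80 0 0 = k ∧ Agr a s s' ∧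
      C (fun i' j' => i' < k ∧ j' < N₂) (s'.real a)) (N := N₁)
      (B := N₂ * ((1 + ri.cost + ci.cost + e.cost : ℕ) + m₂.cost + 12) + m₂.cost + 8)
      (by positivity)
      ⟨by simp [State.putNat_nat], (Agr.refl a s).put80 _ _ _, hC _ _ _ (by simp) h0⟩ ?_ ?_).mono
      ?_ (fun s' h => h.2)
  · rintro k s' ⟨h3, h4, _⟩
    exact ⟨h3, (hm _ h4).1⟩
  · rintro k hk s' ⟨h3, h4, h5⟩
    refine (inner k hk s' h4 h5 h3).mono le_rfl ?_
    rintro s'' ⟨h5, h6, h7⟩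
    exact ⟨h5, by simp [State.putNat_nat], h6.put80 _ _ _, h7⟩
  · push_cast
    have : (N₂ : ℝ) * (1 + ri.cost + ci.cost + e.cost + m₂.cost + 12) ≤ N₂ * w :=
      mul_le_mul_of_nonneg_left (by linarith) n2
    have h2 : (N₁ : ℝ) * (N₂ * (1 + ri.cost + ci.cost + e.cost + m₂.cost + 12) + m₂.cost + 8
      + m₁.cost + 12) ≤ N₁ * (N₂ * w + w) := mul_le_mul_of_nonneg_left (by linarith) n1
    linarith

/-- Two pairs may address the same cell if they store the same value there (`hg`). When `e` is
evaluated, only cells addressed by other pairs may have changed, so `e` may read the old value of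
its own target and updates in place are covered. -/
theorem Runs.assign2 {ρ : Tape} {a : ℕ} {ri ci m₁ m₂ : NatExp} {e : RealExp} {s : State}
    (N₁ N₂ w : ℕ) (gi gj : ℕ → ℕ → ℕ) (f : ℕ → ℕ → ℝ)
    (hm : ∀ s₁, Agr a s s₁ → m₁.eval s₁ = N₁ ∧ m₂.eval s₁ = N₂)
    (hw : ri.cost + ci.cost + e.cost + m₁.cost + m₂.cost + 30 ≤ w)
    (hg : ∀ i < N₁, ∀ j < N₂, ∀ i' < N₁, ∀ j' < N₂, gi i' j' = gi i j → gj i' j' = gj i j →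
      f i' j' = f i j)
    (hs : ∀ i < N₁, ∀ j < N₂, ∀ s₁, Agr a s s₁ → s₁.nat 80 0 0 = i → s₁.nat 81 0 0 = j →
      (∀ x y, (∀ i' < N₁, ∀ j' < N₂, (i' ≠ i ∨ j' ≠ j) → ¬ (x = gi i' j' ∧ y = gj i' j')) →
        s₁.real a x y = s.real a x y) →
      ri.eval s₁ = gi i j ∧ ci.eval s₁ = gj i j ∧ e.eval s₁ = f i j) :
    Runs ρ (assign2 a ri ci m₁ m₂ e) s (N₁ * (N₂ * w + w) + w)
      (fun s' => Agr a s s' ∧ (∀ i < N₁, ∀ j < N₂, s'.real a (gi i j) (gj i j) = f i j) ∧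
        ∀ x y, (∀ i < N₁, ∀ j < N₂, ¬ (x = gi i j ∧ y = gj i j)) →
          s'.real a x y = s.real a x y) := by
  refine (Runs.double gi gj (N₁ := N₁) (N₂ := N₂) (w := w)
    (C := fun D r => (∀ i j, D i j → i < N₁ → j < N₂ → r (gi i j) (gj i j) = f i j) ∧
      ∀ x y, (∀ i j, D i j → i < N₁ → j < N₂ → ¬ (x = gi i j ∧ y = gj i j)) →
        r x y = s.real a x y) (by simp) hm hw ?_).mono le_rfl ?_
  · rintro i hi j hj s₁ h1 ⟨h2, h3⟩ h4 h5
    obtain ⟨q1, q2, q3⟩ := hs i hi j hj s₁ h1 h4 h5 (fun x y hxy => h3 x y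
      (fun i' j' hd hi' hj' => hxy i' hi' j' hj' (by omega)))
    refine ⟨q1, q2, ?_, ?_⟩
    · intro i' j' hD hi' hj'
      dsimp only
      split_ifs with hh
      · rw [q3, hg i hi j hj i' hi' j' hj' hh.1 hh.2]
      · rcases hD with hD | ⟨rfl, hD⟩
        · exact h2 i' j' (Or.inl hD) hi' hj'
        · have : j' ≠ j := by rintro rfl; exact hh ⟨rfl, rfl⟩
          exact h2 i' j' (Or.inr ⟨rfl, by omega⟩) hi' hj'
    · intro x y hxy
      dsimp only
      rw [if_neg (hxy i j (Or.inr ⟨rfl, by omega⟩) hi hj)]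
      exact h3 x y (fun i' j' hd => hxy i' j' (by omega))
  · rintro s' ⟨h1, h2, h3⟩
    exact ⟨h1, fun i hi j hj => h2 i j ⟨hi, hj⟩ hi hj,
      fun x y hxy => h3 x y (fun i j _ hi hj => hxy i hi j hj)⟩

/-- Here several pairs may address one cell with different values and their contributions add up,
which is what a sparse matrix–vector product needs. -/
theorem Runs.scatter2 {ρ : Tape} {a : ℕ} {ri ci m₁ m₂ : NatExp} {e : RealExp} {s : State}
    (N₁ N₂ w : ℕ) (gi gj : ℕ → ℕ → ℕ) (f : ℕ → ℕ → ℝ)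
    (hm : ∀ s₁, Agr a s s₁ → m₁.eval s₁ = N₁ ∧ m₂.eval s₁ = N₂)
    (hw : 2 * ri.cost + 2 * ci.cost + e.cost + m₁.cost + m₂.cost + 32 ≤ w)
    (hs : ∀ i < N₁, ∀ j < N₂, ∀ s₁, Agr a s s₁ → s₁.nat 80 0 0 = i → s₁.nat 81 0 0 = j →
      ri.eval s₁ = gi i j ∧ ci.eval s₁ = gj i j ∧ e.eval s₁ = f i j) :
    Runs ρ (scatter2 a ri ci m₁ m₂ e) s (N₁ * (N₂ * w + w) + w)
      (fun s' => Agr a s s' ∧ ∀ x y, s'.real a x y = s.real a x y +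
        ∑ i ∈ Finset.range N₁, ∑ j ∈ Finset.range N₂,
          if x = gi i j ∧ y = gj i j then f i j else 0) := by
  classical
  refine (Runs.double gi gj (N₁ := N₁) (N₂ := N₂) (w := w)
    (C := fun D r => ∀ x y, r x y = s.real a x y +
        ∑ i ∈ Finset.range N₁, ∑ j ∈ Finset.range N₂,
          if D i j then (if x = gi i j ∧ y = gj i j then f i j else 0) else 0)
    (by simp) hm (by simp only [RealExp.cost]; omega) ?_).mono le_rfl ?_
  · intro i hi j hj s₁ h1 h2 h3 h4
    obtain ⟨q1, q2, q3⟩ := hs i hi j hj s₁ h1 h3 h4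
    refine ⟨q1, q2, fun x y => ?_⟩
    -- Treating one more pair adds exactly one term to the double sum.
    have key : ∀ F : ℕ → ℕ → ℝ, (∑ i' ∈ Finset.range N₁, ∑ j' ∈ Finset.range N₂,
        @ite ℝ ((i' < i ∧ j' < N₂) ∨ (i' = i ∧ j' < j + 1)) (Classical.propDecidable _)
          (F i' j') 0) =
        (∑ i' ∈ Finset.range N₁, ∑ j' ∈ Finset.range N₂,
        @ite ℝ ((i' < i ∧ j' < N₂) ∨ (i' = i ∧ j' < j)) (Classical.propDecidable _)
          (F i' j') 0) + F i j := by
      intro F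
      have : F i j = ∑ i' ∈ Finset.range N₁, ∑ j' ∈ Finset.range N₂,
          if i' = i ∧ j' = j then F i' j' else 0 := by
        rw [Finset.sum_eq_single_of_mem i (Finset.mem_range.2 hi),
          Finset.sum_eq_single_of_mem j (Finset.mem_range.2 hj)]
        · simp
        · intro b _ hb; simp [hb]
        · intro b _ hb; simp [hb]
      rw [this, ← Finset.sum_add_distrib]
      refine Finset.sum_congr rfl fun i' _ => ?_
      rw [← Finset.sum_add_distrib]
      refine Finset.sum_congr rfl fun j' hj' => ?_
      have hj'' := Finset.mem_range.1 hj'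
      by_cases c1 : (i' < i ∧ j' < N₂) ∨ (i' = i ∧ j' < j)
      · rw [if_pos c1, if_pos (by omega), if_neg (by omega), add_zero]
      · by_cases c2 : i' = i ∧ j' = j
        · rw [if_neg c1, if_pos c2, if_pos (by omega), zero_add]
        · rw [if_neg c1, if_neg c2, if_neg (by omega), zero_add]
    dsimp only at h2 ⊢
    rw [key, ← add_assoc, ← h2 x y]
    split_ifs with hh
    · simp only [RealExp.eval, q1, q2, q3, hh.1, hh.2]
    · simp
  · rintro s' ⟨h1, h2⟩
    refine ⟨h1, fun x y => ?_⟩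
    rw [h2 x y]
    congr 1
    refine Finset.sum_congr rfl fun i hi => Finset.sum_congr rfl fun j hj => ?_
    rw [if_pos ⟨Finset.mem_range.1 hi, Finset.mem_range.1 hj⟩]

/-! ### Renaming the arrays of a program -/

/-- Rename the arrays of an expression. -/
def NatExp.shift : NatExp → NatExp
  | .lit c => .lit c
  | .get a i j => .get (a + 100) i.shift j.shift
  | .add e f => .add e.shift f.shift
  | .sub e f => .sub e.shift f.shift

/-- Rename the arrays of an expression. -/
def RealExp.shift : RealExp → RealExp
  | .lit c => .lit c
  | .ofNat e => .ofNat e.shift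
  | .get a i j => .get (a + 100) i.shift j.shift
  | .add e f => .add e.shift f.shift
  | .sub e f => .sub e.shift f.shift
  | .mul e f => .mul e.shift f.shift
  | .div e f => .div e.shift f.shift
  | .sqrt e => .sqrt e.shift

/-- Rename the arrays of a test. -/
def Test.shift : Test → Test
  | .natLt e f => .natLt e.shift f.shift
  | .realLt e f => .realLt e.shift f.shift

/-- Rename the arrays of a program: the array `a` becomes `a + 100`. -/
def Prog.shift : Prog → Prog
  | .skip => .skip
  | .setNat a i j e => .setNat (a + 100) i.shift j.shift e.shift
  | .setReal a i j e => .setReal (a + 100) i.shift j.shift e.shift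
  | .rand a i j => .rand (a + 100) i.shift j.shift
  | .seq P Q => .seq P.shift Q.shift
  | .branch b P Q => .branch b.shift P.shift Q.shift
  | .loop b P => .loop b.shift P.shift

/-- The memory seen by a renamed program. -/
def State.view (s : State) : State := ⟨fun a => s.nat (a + 100), fun a => s.real (a + 100), s.pos⟩

theorem NatExp.eval_shift (s : State) (e : NatExp) : e.shift.eval s = e.eval s.view := by
  induction e with
  | lit c => rfl
  | get a i j hi hj => simp only [NatExp.shift, NatExp.eval, hi, hj]; rfl
  | add e f he hf => simp only [NatExp.shift, NatExp.eval, he, hf]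
  | sub e f he hf => simp only [NatExp.shift, NatExp.eval, he, hf]

theorem NatExp.cost_shift (e : NatExp) : e.shift.cost = e.cost := by
  induction e <;> simp_all [NatExp.shift, NatExp.cost]

theorem RealExp.eval_shift (s : State) (e : RealExp) : e.shift.eval s = e.eval s.view := by
  induction e <;> simp_all [RealExp.shift, RealExp.eval, NatExp.eval_shift, State.view]

theorem RealExp.cost_shift (e : RealExp) : e.shift.cost = e.cost := by
  induction e <;> simp_all [RealExp.shift, RealExp.cost, NatExp.cost_shift]

theorem Test.holds_shift (s : State) (b : Test) : b.shift.Holds s ↔ b.Holds s.view := by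
  cases b <;> simp [Test.shift, Test.Holds, NatExp.eval_shift, RealExp.eval_shift]

theorem Test.cost_shift (b : Test) : b.shift.cost = b.cost := by
  cases b <;> simp [Test.shift, Test.cost, NatExp.cost_shift, RealExp.cost_shift]

theorem Prog.le_of_writes_shift (P : Prog) (a : ℕ) :
    (P.shift.WritesNat a → 100 ≤ a) ∧ (P.shift.WritesReal a → 100 ≤ a) := by
  induction P <;> simp_all [Prog.shift, Prog.WritesNat, Prog.WritesReal] <;> grind

theorem State.view_putNat (s : State) (a i j v : ℕ) :
    (s.putNat (a + 100) i j v).view = s.view.putNat a i j v := by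
  simp [State.view, State.putNat]

theorem State.view_putReal (s : State) (a i j : ℕ) (v : ℝ) :
    (s.putReal (a + 100) i j v).view = s.view.putReal a i j v := by
  simp [State.view, State.putReal]

/-- The given multiplication program may use any arrays. After the renaming it stays in the arrays
from 100 on, so it can be called without destroying the data structure. -/
theorem Exec.shift {ρ : Tape} {P : Prog} {s₀ s₁ : State} {t : ℕ} (h : Exec ρ P s₀ s₁ t) :
    ∀ s, s.view = s₀ → ∃ s', s'.view = s₁ ∧ Exec ρ P.shift s s' t := by
  induction h with
  | skip s => intro s h; exact ⟨s, h, .skip s⟩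
  | setNat s a i j e =>
    rintro s rfl
    refine ⟨_, State.view_putNat s a _ _ _, ?_⟩
    have := Exec.setNat (ρ := ρ) s (a + 100) i.shift j.shift e.shift
    simp only [NatExp.eval_shift, NatExp.cost_shift] at this
    exact this
  | setReal s a i j e =>
    rintro s rfl
    refine ⟨_, State.view_putReal s a _ _ _, ?_⟩
    have := Exec.setReal (ρ := ρ) s (a + 100) i.shift j.shift e.shift
    simp only [NatExp.eval_shift, NatExp.cost_shift, RealExp.eval_shift, RealExp.cost_shift]
      at this
    exact this
  | rand s a i j =>
    rintro s rfl
    have := Exec.rand (ρ := ρ) s (a + 100) i.shift j.shift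
    simp only [NatExp.eval_shift, NatExp.cost_shift] at this
    refine ⟨_, ?_, this⟩
    simp [State.view, State.putReal]
    rfl
  | seq _ _ h1 h2 =>
    intro s h
    obtain ⟨u, hu, e1⟩ := h1 s h
    obtain ⟨v, hv, e2⟩ := h2 u hu
    exact ⟨v, hv, .seq e1 e2⟩
  | branch_true hb _ h1 =>
    rintro s rfl
    obtain ⟨u, hu, e1⟩ := h1 s rfl
    refine ⟨u, hu, ?_⟩
    rw [← Test.cost_shift]
    exact .branch_true ((Test.holds_shift _ _).2 hb) e1
  | branch_false hb _ h1 =>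
    rintro s rfl
    obtain ⟨u, hu, e1⟩ := h1 s rfl
    refine ⟨u, hu, ?_⟩
    rw [← Test.cost_shift]
    exact .branch_false (fun h => hb ((Test.holds_shift _ _).1 h)) e1
  | loop_true hb _ _ h1 h2 =>
    rintro s rfl
    obtain ⟨u, hu, e1⟩ := h1 s rfl
    obtain ⟨v, hv, e2⟩ := h2 u hu
    refine ⟨v, hv, ?_⟩
    rw [← Test.cost_shift]
    exact .loop_true ((Test.holds_shift _ _).2 hb) e1 e2
  | loop_false hb =>
    rintro s rfl
    refine ⟨s, rfl, ?_⟩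
    rw [← Test.cost_shift]
    exact .loop_false (fun h => hb ((Test.holds_shift _ _).1 h))

/-! ### Matrix multiplication exponents are at least two -/

/-- Every operation overwrites at most one cell, so the running time bounds the number of changed
cells. -/
theorem Exec.changed_card {ρ : Tape} {P : Prog} {s s' : State} {t : ℕ} (h : Exec ρ P s s' t)
    (a : ℕ) : ∃ F : Finset (ℕ × ℕ), F.card ≤ t ∧ ∀ x, x ∉ F → s'.real a x.1 x.2 = s.real a x.1 x.2 := by
  classical
  induction h with
  | skip s => exact ⟨∅, by simp, fun _ _ => rfl⟩
  | setNat s b i j e => exact ⟨∅, by simp, fun _ _ => rfl⟩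
  | setReal s b i j e =>
    refine ⟨{(i.eval s, j.eval s)}, by simp; omega, fun x hx => ?_⟩
    rw [State.putReal_real, if_neg]
    rintro ⟨_, h1, h2⟩
    exact hx (by simp [← h1, ← h2])
  | rand s b i j =>
    refine ⟨{(i.eval s, j.eval s)}, by simp; omega, fun x hx => ?_⟩
    show (s.putReal b _ _ _).real a _ _ = _
    rw [State.putReal_real, if_neg]
    rintro ⟨_, h1, h2⟩
    exact hx (by simp [← h1, ← h2])
  | seq _ _ h1 h2 =>
    obtain ⟨F, hF, h3⟩ := h1
    obtain ⟨G, hG, h4⟩ := h2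
    refine ⟨F ∪ G, (Finset.card_union_le _ _).trans (by omega), fun x hx => ?_⟩
    rw [Finset.notMem_union] at hx
    rw [h4 x hx.2, h3 x hx.1]
  | branch_true _ _ h1 =>
    obtain ⟨F, hF, h3⟩ := h1
    exact ⟨F, by omega, h3⟩
  | branch_false _ _ h1 =>
    obtain ⟨F, hF, h3⟩ := h1
    exact ⟨F, by omega, h3⟩
  | loop_true _ _ _ h1 h2 =>
    obtain ⟨F, hF, h3⟩ := h1
    obtain ⟨G, hG, h4⟩ := h2
    refine ⟨F ∪ G, (Finset.card_union_le _ _).trans (by omega), fun x hx => ?_⟩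
    rw [Finset.notMem_union] at hx
    rw [h4 x hx.2, h3 x hx.1]
  | loop_false _ => exact ⟨∅, by simp, fun _ _ => rfl⟩

/-- The output array may be full of ones at the start while the product is zero. All m² cells must
then be overwritten, so m² ≤ C m^ω for every m, which fails for large m if ω < 2. -/
theorem IsMatMulExponent.two_le {ω : ℝ} (h : IsMatMulExponent ω) : 2 ≤ ω := by
  obtain ⟨P, C, hP⟩ := h
  have key : ∀ m : ℕ, 1 ≤ m → (m : ℝ) ^ (2 : ℝ) ≤ C * (m : ℝ) ^ ω := by
    intro m hm
    let s : State := ⟨fun _ _ _ => m, fun a _ _ => if a = 2 then 1 else 0, 0⟩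
    obtain ⟨s', t, he, ht, hz⟩ := hP m hm 0 0 (fun _ => 0) s rfl (fun _ _ => by simp [s])
      (fun _ _ => by simp [s])
    obtain ⟨F, hF, h1⟩ := he.changed_card 2
    have hsub : (Finset.range m ×ˢ Finset.range m) ⊆ F := by
      intro x hx
      by_contra hn
      have h2 := h1 x hn
      simp only [Finset.mem_product, Finset.mem_range] at hx
      have h3 := hz ⟨x.1, hx.1⟩ ⟨x.2, hx.2⟩
      simp only [mul_zero, Matrix.zero_apply] at h3
      rw [h3] at h2
      simp [s] at h2
    have h4 := (Finset.card_le_card hsub).trans hF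
    rw [Finset.card_product, Finset.card_range] at h4
    calc (m : ℝ) ^ (2 : ℝ) = ((m * m : ℕ) : ℝ) := by
          rw [Real.rpow_two]; push_cast; ring
      _ ≤ t := by exact_mod_cast h4
      _ ≤ _ := ht
  by_contra hlt
  push Not at hlt
  have h1 : Filter.Tendsto (fun m : ℕ => (m : ℝ) ^ (2 - ω)) Filter.atTop Filter.atTop :=
    (tendsto_rpow_atTop (by linarith)).comp tendsto_natCast_atTop_atTop
  obtain ⟨m, hm, hm1⟩ := ((h1.eventually_gt_atTop C).and (Filter.eventually_ge_atTop 1)).exists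
  have hpos : (0 : ℝ) < m := by exact_mod_cast hm1
  have := key m hm1
  rw [Real.rpow_sub hpos, lt_div_iff₀ (Real.rpow_pos_of_pos hpos _)] at hm
  linarith

/-- A matrix multiplication program on the arrays `100`, `101`, `102` that does not touch the
arrays below `100`. -/
structure Mul where
  P : Prog
  ω : ℝ
  C : ℝ
  two_le : 2 ≤ ω
  one_le : 1 ≤ C
  nat_ge : ∀ a, P.WritesNat a → 100 ≤ a
  real_ge : ∀ a, P.WritesReal a → 100 ≤ a
  run : ∀ (ρ : Tape) (s : State) (m : ℕ), 1 ≤ m → s.nat 100 0 0 = m →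
    Runs ρ P s (C * (m : ℝ) ^ ω) (fun s' => ∀ i < m, ∀ j < m,
      s'.real 102 i j = ∑ l ∈ Finset.range m, s.real 100 i l * s.real 101 l j)

theorem IsMatMulExponent.exists_mul {ω : ℝ} (h : IsMatMulExponent ω) : ∃ μ : Mul, μ.ω = ω := by
  have h2 := h.two_le
  obtain ⟨P, C, hP⟩ := h
  refine ⟨⟨P.shift, ω, max C 1, h2, le_max_right _ _, fun a => (P.le_of_writes_shift a).1,
    fun a => (P.le_of_writes_shift a).2, ?_⟩, rfl⟩
  intro ρ s m hm hs
  obtain ⟨s', t, he, ht, hz⟩ := hP m hm (Matrix.of fun i j => s.real 100 i j)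
    (Matrix.of fun i j => s.real 101 i j) ρ s.view hs (fun _ _ => rfl) (fun _ _ => rfl)
  obtain ⟨u, rfl, e⟩ := he.shift s rfl
  refine ⟨u, t, e, ht.trans (mul_le_mul_of_nonneg_right (le_max_left _ _) (by positivity)), ?_⟩
  intro i hi j hj
  have := hz ⟨i, hi⟩ ⟨j, hj⟩
  rw [Matrix.mul_apply] at this
  rw [Finset.sum_range]
  exact this

/-! ### Products of blocks -/

/-- The memories agree on the arrays below `80`. -/
structure Low (s s₁ : State) : Prop where
  nat : ∀ b, b < 80 → s₁.nat b = s.nat b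
  real : ∀ b, b < 80 → s₁.real b = s.real b

theorem Low.trans {s s₁ s₂ : State} (h : Low s s₁) (h' : Low s₁ s₂) : Low s s₂ :=
  ⟨fun b hb => (h'.nat b hb).trans (h.nat b hb), fun b hb => (h'.real b hb).trans (h.real b hb)⟩

theorem Agr.low {a : ℕ} {s s₁ : State} (h : Agr a s s₁) (ha : 80 ≤ a) : Low s s₁ :=
  ⟨fun b hb => h.nat b (by omega) (by omega), fun b hb => h.real b (by omega)⟩

theorem Low.putNat {s s₁ : State} (h : Low s s₁) {a : ℕ} (ha : 80 ≤ a) (x y v : ℕ) :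
    Low s (s₁.putNat a x y v) :=
  ⟨fun b hb => by rw [State.putNat_nat_of_ne (by omega), h.nat b hb], h.real⟩

/-- A program that only writes to arrays from `80` on. -/
def Prog.High (P : Prog) : Prop := ∀ a, (P.WritesNat a → 80 ≤ a) ∧ (P.WritesReal a → 80 ≤ a)

theorem Frame.low {P : Prog} {s s' : State} (h : Frame P s s') (hP : P.High) : Low s s' :=
  ⟨fun b hb => h.nat b fun hw => absurd ((hP b).1 hw) (by omega),
    fun b hb => h.real b fun hw => absurd ((hP b).2 hw) (by omega)⟩

namespace Mul

variable (μ : Mul)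

theorem high : μ.P.High := fun a =>
  ⟨fun h => by have := μ.nat_ge a h; omega, fun h => by have := μ.real_ge a h; omega⟩

/-- Constant in the cost of block products. -/
noncomputable def K : ℝ := μ.C + 3000

theorem K_ge : 3000 ≤ μ.K := by have := μ.one_le; unfold K; linarith

/-- Copying an M × M block costs M². This bound lets every such copy be absorbed by a block product.
-/
theorem sq_le (M : ℕ) : (M : ℝ) ^ 2 ≤ (M : ℝ) ^ μ.ω := by
  rcases Nat.eq_zero_or_pos M with rfl | h
  · simp [Real.zero_rpow (show μ.ω ≠ 0 by have := μ.two_le; linarith)]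
  · rw [← Real.rpow_two]
    exact Real.rpow_le_rpow_of_exponent_le (by exact_mod_cast h) μ.two_le

/-- Real array `80` becomes the product of the `m × lim` matrix `x` with the `lim × m` matrix
`y`, where `lim` is rounded up to a multiple of `m`. -/
def prod (m lim : NatExp) (x y : NatExp → NatExp → RealExp) : Prog :=
  .seq (assign2 80 (V 80) (V 81) m m (.lit 0)) <| .seq (setV 82 (.lit 0)) <|
    .loop (.natLt (V 82) lim) <|
      .seq (assign2 100 (V 80) (V 81) m m (x (V 80) (.add (V 82) (V 81)))) <|
      .seq (assign2 101 (V 80) (V 81) m m (y (.add (V 82) (V 80)) (V 81))) <|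
      .seq (setV 100 m) <| .seq μ.P <|
      .seq (scatter2 80 (V 80) (V 81) m m (.get 102 (V 80) (V 81))) <|
      setV 82 (.add (V 82) m)

theorem runs_assign_sq {ρ : Tape} {a : ℕ} {m : NatExp} {e : RealExp} {s : State} (M : ℕ)
    (f : ℕ → ℕ → ℝ) (ha : 80 ≤ a)
    (hm : ∀ s₁, Low s s₁ → m.eval s₁ = M) (hmc : m.cost ≤ 10) (hc : e.cost ≤ 110)
    (hs : ∀ i < M, ∀ j < M, ∀ s₁, Agr a s s₁ → s₁.nat 80 0 0 = i → s₁.nat 81 0 0 = j →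
      (s₁.real a i j = s.real a i j) → e.eval s₁ = f i j) (hM : 1 ≤ M) :
    Runs ρ (assign2 a (V 80) (V 81) m m e) s (600 * (M : ℝ) ^ 2)
      (fun s' => Agr a s s' ∧ ∀ i < M, ∀ j < M, s'.real a i j = f i j) := by
  refine (Runs.assign2 M M 200 (fun i _ => i) (fun _ j => j) f ?_ ?_ ?_ ?_).mono ?_ ?_
  · exact fun s₁ h => ⟨hm s₁ (h.low ha), hm s₁ (h.low ha)⟩
  · simp only [NatExp.cost]; omega
  · rintro i _ j _ i' _ j' _ rfl rfl; rfl
  · intro i hi j hj s₁ h h1 h2 h3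
    exact ⟨h1, h2, hs i hi j hj s₁ h h1 h2 (h3 i j (by omega))⟩
  · have : (1 : ℝ) ≤ M := by exact_mod_cast hM
    push_cast
    nlinarith
  · rintro s' ⟨h1, h2, _⟩
    exact ⟨h1, h2⟩

/-- `hnb` says that `nb` is L / M rounded up. The product is cut into `nb` square ones, so the sum
runs up to `nb * M`, possibly beyond L, and callers have to make the excess terms vanish. -/
theorem runs_prod {ρ : Tape} {m lim : NatExp} {x y : NatExp → NatExp → RealExp} {s : State}
    (M L nb : ℕ) (f g : ℕ → ℕ → ℝ) (hM : 1 ≤ M) (hnb : ∀ k, k * M < L ↔ k < nb)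
    (hm : ∀ s₁, Low s s₁ → m.eval s₁ = M ∧ lim.eval s₁ = L)
    (hx : ∀ s₁, Low s s₁ → ∀ e₁ e₂, (x e₁ e₂).eval s₁ = f (e₁.eval s₁) (e₂.eval s₁))
    (hy : ∀ s₁, Low s s₁ → ∀ e₁ e₂, (y e₁ e₂).eval s₁ = g (e₁.eval s₁) (e₂.eval s₁))
    (hmc : m.cost ≤ 10) (hlc : lim.cost ≤ 10)
    (hxc : (x (V 80) (.add (V 82) (V 81))).cost ≤ 110)
    (hyc : (y (.add (V 82) (V 80)) (V 81)).cost ≤ 110) :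
    Runs ρ (μ.prod m lim x y) s (μ.K * (nb + 1) * (M : ℝ) ^ μ.ω)
      (fun s' => Low s s' ∧ ∀ i < M, ∀ j < M,
        s'.real 80 i j = ∑ l ∈ Finset.range (nb * M), f i l * g l j) := by
  have hM1 : (1 : ℝ) ≤ (M : ℝ) ^ 2 := by
    have : (1 : ℝ) ≤ M := by exact_mod_cast hM
    nlinarith
  have hsq := μ.sq_le M
  let I : ℕ → State → Prop := fun k s' => Low s s' ∧ s'.nat 82 0 0 = k * M ∧
    ∀ i < M, ∀ j < M, s'.real 80 i j = ∑ l ∈ Finset.range (k * M), f i l * g l j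
  have c0 := μ.one_le
  have hX : 1 ≤ (M : ℝ) ^ μ.ω := hM1.trans hsq
  have hmc' : (m.cost : ℝ) ≤ 10 := by exact_mod_cast hmc
  have hlc' : (lim.cost : ℝ) ≤ 10 := by exact_mod_cast hlc
  have body : ∀ k s₁, I k s₁ → Runs ρ (
      .seq (assign2 100 (V 80) (V 81) m m (x (V 80) (.add (V 82) (V 81)))) <|
      .seq (assign2 101 (V 80) (V 81) m m (y (.add (V 82) (V 80)) (V 81))) <|
      .seq (setV 100 m) <| .seq μ.P <|
      .seq (scatter2 80 (V 80) (V 81) m m (.get 102 (V 80) (V 81))) <|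
      setV 82 (.add (V 82) m)) s₁ ((μ.C + 2200) * (M : ℝ) ^ μ.ω) (I (k + 1)) := by
    rintro k s₁ ⟨h1, h2, h3⟩
    refine Runs.step (runs_assign_sq (s := s₁) M (fun i j => f i (k * M + j))
      (by norm_num) (fun s₂ h => (hm s₂ (h1.trans h)).1) hmc hxc ?_ hM) ?_
    · intro i hi j hj s₂ h h4 h5 _
      rw [hx s₂ (h1.trans (h.low (by norm_num)))]
      simp only [NatExp.eval, h4, h5, h.nat 82 (by norm_num) (by norm_num), h2]
    rintro s₂ ⟨h4, h5⟩
    have l2 := h1.trans (h4.low (by norm_num))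
    have e2 : s₂.nat 82 0 0 = k * M := by rw [h4.nat 82 (by norm_num) (by norm_num), h2]
    refine Runs.step (runs_assign_sq (s := s₂) M (fun i j => g (k * M + i) j)
      (by norm_num) (fun s₂ h => (hm s₂ (l2.trans h)).1) hmc hyc ?_ hM) ?_
    · intro i hi j hj s₃ h h4 h5 _
      rw [hy s₃ (l2.trans (h.low (by norm_num)))]
      simp only [NatExp.eval, h4, h5, h.nat 82 (by norm_num) (by norm_num), e2]
    rintro s₃ ⟨h6, h7⟩
    have l3 := l2.trans (h6.low (by norm_num))
    have e3 : s₃.nat 82 0 0 = k * M := by rw [h6.nat 82 (by norm_num) (by norm_num), e2]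
    refine Runs.setNat_step ?_
    simp only [NatExp.eval, (hm s₃ l3).1]
    refine Runs.step (μ.run ρ _ M hM (by simp [State.putNat_nat])).frame ?_
    rintro s₅ ⟨h8, h9⟩
    have l5 : Low s s₅ := (l3.putNat (by norm_num) _ _ _).trans (h9.low μ.high)
    have e5 : s₅.nat 82 0 0 = k * M := by
      rw [h9.nat 82 (fun h => by have := μ.nat_ge 82 h; omega),
        State.putNat_nat_of_ne (by norm_num), e3]
    have t5 : s₅.real 80 = s₁.real 80 := by
      rw [h9.real 80 (fun h => by have := μ.real_ge 80 h; omega), State.putNat_real,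
        h6.real 80 (by norm_num), h4.real 80 (by norm_num)]
    have p5 : ∀ i < M, ∀ j < M, s₅.real 102 i j =
        ∑ l ∈ Finset.range M, f i (k * M + l) * g (k * M + l) j := by
      intro i hi j hj
      rw [h8 i hi j hj]
      refine Finset.sum_congr rfl fun l hl => ?_
      have hl' := Finset.mem_range.1 hl
      rw [State.putNat_real, h7 l hl' j hj, h6.real 100 (by norm_num), h5 i hi l hl']
    refine Runs.step (runs_assign_sq (s := s₅) M
      (fun i j => s₅.real 80 i j + s₅.real 102 i j)
      (by norm_num) (fun s₂ h => (hm s₂ (l5.trans h)).1) hmc (by simp [RealExp.cost,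
        NatExp.cost]) ?_ hM) ?_
    · intro i hi j hj s₆ h h4 h5 h6
      simp only [RealExp.eval, NatExp.eval, h4, h5, h6, h.real 102 (by norm_num)]
    rintro s₆ ⟨h10, h11⟩
    have l6 := l5.trans (h10.low (by norm_num))
    refine Runs.setNat_last ⟨l6.putNat (by norm_num) _ _ _, ?_, ?_⟩ ?_
    · simp only [NatExp.eval, (hm _ l6).1, h10.nat 82 (by norm_num) (by norm_num), e5]
      simp [State.putNat_nat]; ring
    · intro i hi j hj
      rw [State.putNat_real, h11 i hi j hj, t5, h3 i hi j hj, p5 i hi j hj,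
        add_mul, one_mul, Finset.sum_range_add]
    · simp only [NatExp.cost]
      push_cast
      nlinarith
  refine Runs.step (runs_assign_sq (s := s) M (fun i j => 0)
      (by norm_num) (fun s₂ h => (hm s₂ h).1) hmc (by simp [RealExp.cost]) ?_ hM) ?_
  · intros; rfl
  rintro s₁ ⟨h1, h2⟩
  have l1 := h1.low (le_refl 80)
  refine Runs.setNat_step ?_
  simp only [NatExp.eval]
  refine (Runs.while_le (I := fun k s => I k s) nb (B := (μ.C + 2200) * (M : ℝ) ^ μ.ω) (k := 0)
    (by positivity) ?_ ⟨l1.putNat (by norm_num) _ _ _, ?_, ?_⟩ (Nat.zero_le _)).mono ?_ ?_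
  · intro k s₃ h4 hb
    refine ⟨?_, body k s₃ h4⟩
    simp only [Test.Holds, NatExp.eval, (hm s₃ h4.1).2, h4.2.1] at hb
    exact (hnb k).1 hb
  · simp [State.putNat_nat]
  · intro i hi j hj; simp [h2 i hi j hj]
  · simp only [NatExp.cost, Test.cost]
    push_cast
    unfold K
    have hnb0 : (0 : ℝ) ≤ nb := Nat.cast_nonneg _
    have h1 : (nb : ℝ) * lim.cost ≤ nb * 10 := mul_le_mul_of_nonneg_left hlc' hnb0
    have h2 : (nb : ℝ) * 1 ≤ nb * (M : ℝ) ^ μ.ω := mul_le_mul_of_nonneg_left hX hnb0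
    have h3 : 0 ≤ (M : ℝ) ^ μ.ω * μ.C := by positivity
    nlinarith
  · rintro s₃ ⟨k, hk, -, h4, h5⟩
    simp only [Test.Holds, NatExp.eval, (hm s₃ h4.1).2, h4.2.1, hnb k, not_lt] at h5
    obtain rfl := le_antisymm hk h5
    exact ⟨h4.1, h4.2.2⟩

end Mul

/-! ### Inversion of positive definite matrices -/

/-- The `m × m` block at `(a, b)`. -/
def blk (r : ℕ → ℕ → ℝ) (a b m : ℕ) : Matrix (Fin m) (Fin m) ℝ :=
  Matrix.of fun i j => r (a + i) (b + j)

theorem blk_submatrix (r : ℕ → ℕ → ℝ) (a b h : ℕ) :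
    (blk r a b (h + h)).submatrix finSumFinEquiv finSumFinEquiv =
      Matrix.fromBlocks (blk r a b h) (blk r a (b + h) h) (blk r (a + h) b h)
        (blk r (a + h) (b + h) h) := by
  ext i j
  rcases i with i | i <;> rcases j with j | j <;> 
    simp [blk, add_comm, add_left_comm]

open Matrix in
-- A is definite as a principal submatrix. The Schur complement S is semidefinite by Schur's
-- criterion, and invertible because det A · det S ≠ 0, hence definite. This is what lets the
-- recursion run without pivoting. The formula for the inverse is checked by multiplying out.
theorem schur_inv {m : Type*} [Fintype m] [DecidableEq m] {A B D : Matrix m m ℝ}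
    (h : (fromBlocks A B Bᵀ D).PosDef) :
    A.PosDef ∧ (D - Bᵀ * (A⁻¹ * B)).PosDef ∧
    (fromBlocks A B Bᵀ D)⁻¹ =
      fromBlocks (A⁻¹ + A⁻¹ * B * (D - Bᵀ * (A⁻¹ * B))⁻¹ * (A⁻¹ * B)ᵀ)
        (-(A⁻¹ * B * (D - Bᵀ * (A⁻¹ * B))⁻¹)) (-(A⁻¹ * B * (D - Bᵀ * (A⁻¹ * B))⁻¹)ᵀ)
        (D - Bᵀ * (A⁻¹ * B))⁻¹ := by
  have hA : A.PosDef := by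
    have := h.submatrix (e := Sum.inl) Sum.inl_injective
    exact this
  have hAu := hA.isUnit
  have hAdet := (isUnit_iff_isUnit_det A).1 hAu
  have := hAu.invertible
  have hS0 : (D - Bᵀ * (A⁻¹ * B)).PosSemidef := by
    have := (PosDef.fromBlocks₁₁ B D hA).1 (by simpa using h.posSemidef)
    simpa [Matrix.mul_assoc] using this
  have hSdet : IsUnit (D - Bᵀ * (A⁻¹ * B)).det := by
    have h1 := (isUnit_iff_isUnit_det _).1 h.isUnit
    rw [det_fromBlocks₁₁, invOf_eq_nonsing_inv, Matrix.mul_assoc] at h1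
    exact isUnit_of_mul_isUnit_right h1
  have hS : (D - Bᵀ * (A⁻¹ * B)).PosDef :=
    (hS0.posDef_iff_isUnit).2 ((isUnit_iff_isUnit_det _).2 hSdet)
  refine ⟨hA, hS, ?_⟩
  have sA : (A⁻¹)ᵀ = A⁻¹ := by
    have := hA.isHermitian.inv; simpa [IsHermitian] using this
  set S := D - Bᵀ * (A⁻¹ * B) with hSdef
  have sS : (S⁻¹)ᵀ = S⁻¹ := by
    have := hS.isHermitian.inv; simpa [IsHermitian] using this
  have e1 : A * A⁻¹ = 1 := mul_nonsing_inv A hAdet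
  have e2 : S * S⁻¹ = 1 := mul_nonsing_inv S hSdet
  refine inv_eq_right_inv ?_
  rw [fromBlocks_multiply, ← fromBlocks_one]
  have e3 : ∀ X : Matrix m m ℝ, A * (A⁻¹ * X) = X := fun X => by
    rw [← Matrix.mul_assoc, e1, Matrix.one_mul]
  -- S S⁻¹ = 1 with S = D − Bᵀ A⁻¹ B, solved for D S⁻¹, so that D disappears from the products
  -- below.
  have e4 : ∀ X : Matrix m m ℝ, D * (S⁻¹ * X) = X + Bᵀ * (A⁻¹ * (B * (S⁻¹ * X))) := by
    intro X
    have : S * (S⁻¹ * X) = X := by rw [← Matrix.mul_assoc, e2, Matrix.one_mul]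
    rw [hSdef, Matrix.sub_mul, ← hSdef] at this
    simp only [Matrix.mul_assoc] at this
    rw [sub_eq_iff_eq_add] at this
    exact this
  have e5 := e4 1
  simp only [Matrix.mul_one] at e5
  congr 1
  · simp only [Matrix.mul_add, Matrix.mul_neg, Matrix.mul_assoc, transpose_mul, sS, sA, e3, e1]
    abel
  · simp only [Matrix.mul_neg, Matrix.mul_assoc, e3]
    abel
  · simp only [Matrix.mul_add, Matrix.mul_neg, Matrix.mul_assoc, transpose_mul, sS, sA, e4]
    abel
  · simp only [Matrix.mul_neg, Matrix.mul_assoc, e5]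
    abel

/-! ### One level of the block inversion -/

namespace Mul

variable (μ : Mul)

theorem runs_assign_blk {ρ : Tape} {a : ℕ} {ra cb m : NatExp} {e : RealExp} {s : State}
    (x₀ y₀ M : ℕ) (f : ℕ → ℕ → ℝ)
    (hm : ∀ s₁, Agr a s s₁ → ra.eval s₁ = x₀ ∧ cb.eval s₁ = y₀ ∧ m.eval s₁ = M)
    (hac : ra.cost ≤ 10) (hbc : cb.cost ≤ 10) (hmc : m.cost ≤ 10) (hc : e.cost ≤ 110)
    (hM : 1 ≤ M)
    (hs : ∀ i < M, ∀ j < M, ∀ s₁, Agr a s s₁ → s₁.nat 80 0 0 = i → s₁.nat 81 0 0 = j →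
      (∀ x y, (x = x₀ + i ∧ y = y₀ + j) ∨ ¬ ((x₀ ≤ x ∧ x < x₀ + M) ∧ y₀ ≤ y ∧ y < y₀ + M) →
        s₁.real a x y = s.real a x y) → e.eval s₁ = f i j) :
    Runs ρ (assign2 a (.add ra (V 80)) (.add cb (V 81)) m m e) s (600 * (M : ℝ) ^ 2)
      (fun s' => Agr a s s' ∧ (∀ i < M, ∀ j < M, s'.real a (x₀ + i) (y₀ + j) = f i j) ∧
        ∀ x y, ¬ ((x₀ ≤ x ∧ x < x₀ + M) ∧ y₀ ≤ y ∧ y < y₀ + M) →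
          s'.real a x y = s.real a x y) := by
  refine (Runs.assign2 M M 200 (fun i _ => x₀ + i) (fun _ j => y₀ + j) f ?_ ?_ ?_ ?_).mono ?_ ?_
  · exact fun s₁ h => ⟨(hm s₁ h).2.2, (hm s₁ h).2.2⟩
  · simp only [NatExp.cost]; omega
  · intro i _ j _ i' _ j' _ h1 h2
    obtain rfl : i' = i := by omega
    obtain rfl : j' = j := by omega
    rfl
  · intro i hi j hj s₁ h h1 h2 h3
    refine ⟨by simp [NatExp.eval, (hm s₁ h).1, h1], by simp [NatExp.eval, (hm s₁ h).2.1, h2],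
      hs i hi j hj s₁ h h1 h2 fun x y hxy => h3 x y ?_⟩
    intro i' hi' j' hj' _
    omega
  · have : (1 : ℝ) ≤ M := by exact_mod_cast hM
    push_cast
    nlinarith
  · rintro s' ⟨h1, h2, h3⟩
    refine ⟨h1, h2, fun x y hxy => h3 x y fun i hi j hj => ?_⟩
    omega

/-- Entry of the real array `a` at the given offset. -/
abbrev at' (a : ℕ) (e₁ : NatExp) (i : NatExp) (e₂ : NatExp) (j : NatExp) : RealExp :=
  .get a (.add e₁ i) (.add e₂ j)

/-- First half of a step of the block inversion: from `A⁻¹, B, C, D` compute `A⁻¹ B` and the Schur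
complement. -/
def schurProg : Prog :=
  .seq (μ.prod (V 37) (V 37) (at' 14 (V 35) · (V 35) ·) (at' 14 (V 35) · (.add (V 35) (V 37)) ·)) <|
  .seq (assign2 14 (.add (V 35) (V 80)) (.add (.add (V 35) (V 37)) (V 81)) (V 37) (V 37)
    (.get 80 (V 80) (V 81))) <|
  .seq (μ.prod (V 37) (V 37) (at' 14 (.add (V 35) (V 37)) · (V 35) ·)
    (at' 14 (V 35) · (.add (V 35) (V 37)) ·)) <|
  assign2 14 (.add (.add (V 35) (V 37)) (V 80)) (.add (.add (V 35) (V 37)) (V 81)) (V 37) (V 37)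
    (.sub (at' 14 (.add (V 35) (V 37)) (V 80) (.add (V 35) (V 37)) (V 81)) (.get 80 (V 80) (V 81)))

/-- Second half of a step of the block inversion: assemble the inverse. -/
def combineProg : Prog :=
  .seq (μ.prod (V 37) (V 37) (at' 14 (V 35) · (.add (V 35) (V 37)) ·)
    (at' 14 (.add (V 35) (V 37)) · (.add (V 35) (V 37)) ·)) <|
  .seq (assign2 16 (.add (.lit 0) (V 80)) (.add (.lit 0) (V 81)) (V 37) (V 37)
    (.get 80 (V 80) (V 81))) <|
  .seq (μ.prod (V 37) (V 37) (fun i l => .get 16 i l)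
    (fun l j => at' 14 (V 35) j (.add (V 35) (V 37)) l)) <|
  .seq (assign2 14 (.add (V 35) (V 80)) (.add (V 35) (V 81)) (V 37) (V 37)
    (.add (at' 14 (V 35) (V 80) (V 35) (V 81)) (.get 80 (V 80) (V 81)))) <|
  .seq (assign2 14 (.add (V 35) (V 80)) (.add (.add (V 35) (V 37)) (V 81)) (V 37) (V 37)
    (.sub (.lit 0) (.get 16 (V 80) (V 81)))) <|
  assign2 14 (.add (.add (V 35) (V 37)) (V 80)) (.add (V 35) (V 81)) (V 37) (V 37)
    (.sub (.lit 0) (.get 16 (V 81) (V 80)))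

/-- Push an entry on the stack. -/
def push (ph off lev : NatExp) : Prog :=
  .seq (.setNat 31 (V 30) (.lit 0) ph) <| .seq (.setNat 32 (V 30) (.lit 0) off) <|
  .seq (.setNat 33 (V 30) (.lit 0) lev) <| setV 30 (.add (V 30) (.lit 1))

/-- One step of the inversion machine: treat the top entry of the stack. -/
def invBody : Prog :=
  .seq (setV 30 (.sub (V 30) (.lit 1))) <| .seq (setV 34 (.get 31 (V 30) (.lit 0))) <|
  .seq (setV 35 (.get 32 (V 30) (.lit 0))) <| .seq (setV 36 (.get 33 (V 30) (.lit 0))) <|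
  .seq (setV 37 (.get 20 (.sub (V 36) (.lit 1)) (.lit 0))) <|
  .branch (.natLt (V 34) (.lit 1))
    (.branch (.natLt (V 36) (.lit 1))
      (.setReal 14 (V 35) (V 35) (.div (.lit 1) (.get 14 (V 35) (V 35))))
      (.seq (push (.lit 2) (V 35) (V 36)) <|
       .seq (push (.lit 0) (.add (V 35) (V 37)) (.sub (V 36) (.lit 1))) <|
       .seq (push (.lit 1) (V 35) (V 36)) <|
       push (.lit 0) (V 35) (.sub (V 36) (.lit 1))))
    (.branch (.natLt (V 34) (.lit 2)) μ.schurProg μ.combineProg)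

/-- The inversion machine. -/
def invLoop : Prog := .loop (.natLt (.lit 0) (V 30)) μ.invBody

theorem blk_mul_apply {r₁ r₂ : ℕ → ℕ → ℝ} {a b c e h i j : ℕ} (hi : i < h) (hj : j < h) :
    ∑ l ∈ Finset.range (1 * h), r₁ (a + i) (b + l) * r₂ (c + l) (e + j) =
      (blk r₁ a b h * blk r₂ c e h) ⟨i, hi⟩ ⟨j, hj⟩ := by
  rw [one_mul, Finset.sum_range, Matrix.mul_apply]
  rfl

/-- Arrays outside the working memory of the inversion agree. -/
structure InvFrame (s s' : State) : Prop where
  nat : ∀ a < 80, (a < 30 ∨ 37 < a) → s'.nat a = s.nat a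
  real : ∀ a < 80, a ≠ 14 → a ≠ 16 → s'.real a = s.real a

theorem InvFrame.trans {s s₁ s₂ : State} (h : InvFrame s s₁) (h' : InvFrame s₁ s₂) :
    InvFrame s s₂ :=
  ⟨fun a ha hb => (h'.nat a ha hb).trans (h.nat a ha hb),
    fun a ha hb hc => (h'.real a ha hb hc).trans (h.real a ha hb hc)⟩

/-- On entry the first diagonal block already holds A⁻¹. Then Y = A⁻¹ B overwrites B and the Schur
complement D − C Y overwrites D, while A⁻¹ and C stay in place. -/
theorem runs_schur {ρ : Tape} {s : State} (off h : ℕ) (hh : 1 ≤ h) (h35 : s.nat 35 0 0 = off)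
    (h37 : s.nat 37 0 0 = h) :
    Runs ρ μ.schurProg s (5 * μ.K * (h : ℝ) ^ μ.ω) (fun s' =>
      (∀ a < 80, s'.nat a = s.nat a) ∧ (∀ a < 80, a ≠ 14 → s'.real a = s.real a) ∧
      blk (s'.real 14) off (off + h) h = blk (s.real 14) off off h * blk (s.real 14) off (off + h) h ∧
      blk (s'.real 14) (off + h) (off + h) h = blk (s.real 14) (off + h) (off + h) h -
        blk (s.real 14) (off + h) off h *
          (blk (s.real 14) off off h * blk (s.real 14) off (off + h) h) ∧
      ∀ x y, ¬ ((off ≤ x ∧ x < off + h + h) ∧ off + h ≤ y ∧ y < off + h + h) →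
        s'.real 14 x y = s.real 14 x y) := by
  have nb1 : ∀ k, k * h < h ↔ k < 1 := by
    intro k
    constructor
    · intro hk; by_contra hc; push Not at hc; nlinarith
    · intro hk; obtain rfl : k = 0 := by omega
      omega
  refine Runs.step (μ.runs_prod h h 1 (fun i l => s.real 14 (off + i) (off + l))
    (fun l j => s.real 14 (off + l) (off + h + j)) hh nb1 ?_ ?_ ?_ (by simp [NatExp.cost])
    (by simp [NatExp.cost]) (by simp [NatExp.cost, RealExp.cost])
    (by simp [NatExp.cost, RealExp.cost])) ?_
  · intro s₁ l; simp [NatExp.eval, l.nat, h37]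
  · intro s₁ l e₁ e₂; simp [NatExp.eval, RealExp.eval, l.nat, l.real, h35]
  · intro s₁ l e₁ e₂; simp [NatExp.eval, RealExp.eval, l.nat, l.real, h35, h37]
  rintro s₁ ⟨l1, p1⟩
  refine Runs.step (runs_assign_blk off (off + h) h (fun i j => s₁.real 80 i j) ?_
    (by simp [NatExp.cost]) (by simp [NatExp.cost]) (by simp [NatExp.cost])
    (by simp [NatExp.cost, RealExp.cost]) hh ?_) ?_
  · intro s₂ g; simp [NatExp.eval, g.nat, l1.nat, h35, h37]
  · intro i hi j hj s₂ g g1 g2 _; simp [NatExp.eval, RealExp.eval, g.real, g1, g2]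
  rintro s₂ ⟨a2, p2, q2⟩
  have r2 : ∀ x y, ¬ ((off ≤ x ∧ x < off + h) ∧ off + h ≤ y ∧ y < off + h + h) →
      s₂.real 14 x y = s.real 14 x y := by
    intro x y hxy; rw [q2 x y hxy, l1.real 14 (by norm_num)]
  have b2 : blk (s₂.real 14) off (off + h) h =
      blk (s.real 14) off off h * blk (s.real 14) off (off + h) h := by
    ext ⟨i, hi⟩ ⟨j, hj⟩
    rw [← blk_mul_apply hi hj, ← p1 i hi j hj, ← p2 i hi j hj]
    rfl
  have n2 : ∀ a < 80, s₂.nat a = s.nat a := fun a ha => by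
    rw [a2.nat a (by omega) (by omega), l1.nat a ha]
  refine Runs.step (μ.runs_prod h h 1 (fun i l => s₂.real 14 (off + h + i) (off + l))
    (fun l j => s₂.real 14 (off + l) (off + h + j)) hh nb1 ?_ ?_ ?_ (by simp [NatExp.cost])
    (by simp [NatExp.cost]) (by simp [NatExp.cost, RealExp.cost])
    (by simp [NatExp.cost, RealExp.cost])) ?_
  · intro s₁ l; simp [NatExp.eval, l.nat, n2, h37]
  · intro s₁ l e₁ e₂; simp [NatExp.eval, RealExp.eval, l.nat, l.real, n2, h35, h37]
  · intro s₁ l e₁ e₂; simp [NatExp.eval, RealExp.eval, l.nat, l.real, n2, h35, h37]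
  rintro s₃ ⟨l3, p3⟩
  have n3 : ∀ a < 80, s₃.nat a = s.nat a := fun a ha => by rw [l3.nat a ha, n2 a ha]
  have m3 : s₃.real 14 = s₂.real 14 := l3.real 14 (by norm_num)
  refine (runs_assign_blk (off + h) (off + h) h
    (fun i j => s₃.real 14 (off + h + i) (off + h + j) - s₃.real 80 i j) ?_
    (by simp [NatExp.cost]) (by simp [NatExp.cost]) (by simp [NatExp.cost])
    (by simp [NatExp.cost, RealExp.cost]) hh ?_).mono ?_ ?_
  · intro s₂ g; simp [NatExp.eval, g.nat, n3, h35, h37]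
  · intro i hi j hj s₄ g g1 g2 g3
    have := g3 (off + h + i) (off + h + j) (Or.inl ⟨rfl, rfl⟩)
    simp [NatExp.eval, RealExp.eval, g.real, g.nat, g1, g2, n3, h35, h37, this]
  · have h1 := μ.sq_le h
    have h2 := μ.K_ge
    have h3 : (0 : ℝ) ≤ (h : ℝ) ^ μ.ω := by positivity
    push_cast
    nlinarith
  · rintro s₄ ⟨a4, p4, q4⟩
    refine ⟨fun a ha => by rw [a4.nat a (by omega) (by omega), n3 a ha], fun a ha h14 => ?_, ?_, ?_,
      ?_⟩
    · rw [a4.real a h14, l3.real a ha, a2.real a h14, l1.real a ha]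
    · rw [← b2]
      ext ⟨i, hi⟩ ⟨j, hj⟩
      simp only [blk, Matrix.of_apply]
      rw [q4 _ _ (by omega), m3]
    · have b3 : blk (s₂.real 14) (off + h) off h = blk (s.real 14) (off + h) off h := by
        ext ⟨i, hi⟩ ⟨j, hj⟩
        simp only [blk, Matrix.of_apply]
        rw [r2 _ _ (by omega)]
      rw [← b2, ← b3]
      ext ⟨i, hi⟩ ⟨j, hj⟩
      rw [Matrix.sub_apply, ← blk_mul_apply hi hj, ← p3 i hi j hj]
      simp only [blk, Matrix.of_apply]
      rw [p4 i hi j hj, m3, r2 _ _ (by omega)]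
    · intro x y hxy
      rw [q4 x y (by omega), m3, r2 x y (by omega)]

/-- With Y = A⁻¹ B and Z the inverse of the Schur complement, the blocks of the inverse are A⁻¹ + Y
Z Yᵀ, −Y Z, −(Y Z)ᵀ and Z. The product Y Z is kept in array 16, because Y is overwritten before the
last block is formed. -/
theorem runs_combine {ρ : Tape} {s : State} (off h : ℕ) (hh : 1 ≤ h) (h35 : s.nat 35 0 0 = off)
    (h37 : s.nat 37 0 0 = h) :
    Runs ρ μ.combineProg s (5 * μ.K * (h : ℝ) ^ μ.ω) (fun s' =>
      (∀ a < 80, s'.nat a = s.nat a) ∧ (∀ a < 80, a ≠ 14 → a ≠ 16 → s'.real a = s.real a) ∧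
      blk (s'.real 14) off off h = blk (s.real 14) off off h + blk (s.real 14) off (off + h) h *
        blk (s.real 14) (off + h) (off + h) h * (blk (s.real 14) off (off + h) h).transpose ∧
      blk (s'.real 14) off (off + h) h =
        - (blk (s.real 14) off (off + h) h * blk (s.real 14) (off + h) (off + h) h) ∧
      blk (s'.real 14) (off + h) off h =
        - (blk (s.real 14) off (off + h) h * blk (s.real 14) (off + h) (off + h) h).transpose ∧
      blk (s'.real 14) (off + h) (off + h) h = blk (s.real 14) (off + h) (off + h) h ∧
      ∀ x y, ¬ ((off ≤ x ∧ x < off + h + h) ∧ off ≤ y ∧ y < off + h + h) →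
        s'.real 14 x y = s.real 14 x y) := by
  have nb1 : ∀ k, k * h < h ↔ k < 1 := by
    intro k
    constructor
    · intro hk; by_contra hc; push Not at hc; nlinarith
    · intro hk; obtain rfl : k = 0 := by omega
      omega
  set Y := blk (s.real 14) off (off + h) h with hY
  set Z := blk (s.real 14) (off + h) (off + h) h with hZ
  refine Runs.step (μ.runs_prod h h 1 (fun i l => s.real 14 (off + i) (off + h + l))
    (fun l j => s.real 14 (off + h + l) (off + h + j)) hh nb1 ?_ ?_ ?_ (by simp [NatExp.cost])
    (by simp [NatExp.cost]) (by simp [NatExp.cost, RealExp.cost])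
    (by simp [NatExp.cost, RealExp.cost])) ?_
  · intro s₁ l; simp [NatExp.eval, l.nat, h37]
  · intro s₁ l e₁ e₂; simp [NatExp.eval, RealExp.eval, l.nat, l.real, h35, h37]
  · intro s₁ l e₁ e₂; simp [NatExp.eval, RealExp.eval, l.nat, l.real, h35, h37]
  rintro s₁ ⟨l1, p1⟩
  refine Runs.step (runs_assign_blk 0 0 h (fun i j => s₁.real 80 i j) ?_
    (by simp [NatExp.cost]) (by simp [NatExp.cost]) (by simp [NatExp.cost])
    (by simp [NatExp.cost, RealExp.cost]) hh ?_) ?_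
  · intro s₂ g; simp [NatExp.eval, g.nat, l1.nat, h37]
  · intro i hi j hj s₂ g g1 g2 _; simp [NatExp.eval, RealExp.eval, g.real, g1, g2]
  rintro s₂ ⟨a2, p2, -⟩
  have m2 : s₂.real 14 = s.real 14 := by rw [a2.real 14 (by norm_num), l1.real 14 (by norm_num)]
  have b2 : blk (s₂.real 16) 0 0 h = Y * Z := by
    ext ⟨i, hi⟩ ⟨j, hj⟩
    rw [← blk_mul_apply hi hj, ← p1 i hi j hj, ← p2 i hi j hj]
    rfl
  have c2 : ∀ i (hi : i < h) j (hj : j < h), s₂.real 16 i j = (Y * Z) ⟨i, hi⟩ ⟨j, hj⟩ := by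
    intro i hi j hj
    rw [← b2]; simp [blk]
  have n2 : ∀ a < 80, s₂.nat a = s.nat a := fun a ha => by
    rw [a2.nat a (by omega) (by omega), l1.nat a ha]
  refine Runs.step (μ.runs_prod h h 1 (fun i l => s₂.real 16 i l)
    (fun l j => s.real 14 (off + j) (off + h + l)) hh nb1 ?_ ?_ ?_ (by simp [NatExp.cost])
    (by simp [NatExp.cost]) (by simp [NatExp.cost, RealExp.cost])
    (by simp [NatExp.cost, RealExp.cost])) ?_
  · intro s₁ l; simp [NatExp.eval, l.nat, n2, h37]
  · intro s₁ l e₁ e₂; simp [RealExp.eval, l.real]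
  · intro s₁ l e₁ e₂; simp [NatExp.eval, RealExp.eval, l.nat, l.real, n2, h35, h37, m2]
  rintro s₃ ⟨l3, p3⟩
  have n3 : ∀ a < 80, s₃.nat a = s.nat a := fun a ha => by rw [l3.nat a ha, n2 a ha]
  have m3 : s₃.real 14 = s.real 14 := by rw [l3.real 14 (by norm_num), m2]
  have t3 : s₃.real 16 = s₂.real 16 := l3.real 16 (by norm_num)
  refine Runs.step (runs_assign_blk off off h
    (fun i j => s.real 14 (off + i) (off + j) + s₃.real 80 i j) ?_
    (by simp [NatExp.cost]) (by simp [NatExp.cost]) (by simp [NatExp.cost])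
    (by simp [NatExp.cost, RealExp.cost]) hh ?_) ?_
  · intro s₂ g; simp [NatExp.eval, g.nat, n3, h35, h37]
  · intro i hi j hj s₄ g g1 g2 g3
    have := g3 (off + i) (off + j) (Or.inl ⟨rfl, rfl⟩)
    simp [NatExp.eval, RealExp.eval, g.real, g.nat, g1, g2, n3, h35, this, m3]
  rintro s₄ ⟨a4, p4, q4⟩
  have n4 : ∀ a < 80, s₄.nat a = s.nat a := fun a ha => by
    rw [a4.nat a (by omega) (by omega), n3 a ha]
  have t4 : s₄.real 16 = s₂.real 16 := by rw [a4.real 16 (by norm_num), t3]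
  refine Runs.step (runs_assign_blk off (off + h) h (fun i j => - s₂.real 16 i j) ?_
    (by simp [NatExp.cost]) (by simp [NatExp.cost]) (by simp [NatExp.cost])
    (by simp [NatExp.cost, RealExp.cost]) hh ?_) ?_
  · intro s₂ g; simp [NatExp.eval, g.nat, n4, h35, h37]
  · intro i hi j hj s₅ g g1 g2 _
    simp [NatExp.eval, RealExp.eval, g.real, g1, g2, t4]
  rintro s₅ ⟨a5, p5, q5⟩
  have n5 : ∀ a < 80, s₅.nat a = s.nat a := fun a ha => by
    rw [a5.nat a (by omega) (by omega), n4 a ha]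
  have t5 : s₅.real 16 = s₂.real 16 := by rw [a5.real 16 (by norm_num), t4]
  refine (runs_assign_blk (off + h) off h (fun i j => - s₂.real 16 j i) ?_
    (by simp [NatExp.cost]) (by simp [NatExp.cost]) (by simp [NatExp.cost])
    (by simp [NatExp.cost, RealExp.cost]) hh ?_).mono ?_ ?_
  · intro s₂ g; simp [NatExp.eval, g.nat, n5, h35, h37]
  · intro i hi j hj s₆ g g1 g2 _
    simp [NatExp.eval, RealExp.eval, g.real, g1, g2, t5]
  · have h1 := μ.sq_le h
    have h2 := μ.K_ge
    have h3 : (0 : ℝ) ≤ (h : ℝ) ^ μ.ω := by positivity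
    push_cast
    nlinarith
  · rintro s₆ ⟨a6, p6, q6⟩
    refine ⟨fun a ha => by rw [a6.nat a (by omega) (by omega), n5 a ha], fun a ha h14 h16 => ?_,
      ?_, ?_, ?_, ?_, ?_⟩
    · rw [a6.real a h14, a5.real a h14, a4.real a h14, l3.real a ha, a2.real a h16, l1.real a ha]
    · rw [← b2]
      ext ⟨i, hi⟩ ⟨j, hj⟩
      rw [Matrix.add_apply, Matrix.mul_apply]
      have e : (blk (s₆.real 14) off off h) ⟨i, hi⟩ ⟨j, hj⟩ = s₆.real 14 (off + i) (off + j) := rfl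
      rw [e, q6 _ _ (by omega), q5 _ _ (by omega), p4 i hi j hj, p3 i hi j hj, one_mul,
        Finset.sum_range]
      simp [blk, hY]
    · rw [← b2]
      ext ⟨i, hi⟩ ⟨j, hj⟩
      have e : (blk (s₆.real 14) off (off + h) h) ⟨i, hi⟩ ⟨j, hj⟩ =
        s₆.real 14 (off + i) (off + h + j) := rfl
      rw [e, q6 _ _ (by omega), p5 i hi j hj]
      simp [blk]
    · rw [← b2]
      ext ⟨i, hi⟩ ⟨j, hj⟩
      have e : (blk (s₆.real 14) (off + h) off h) ⟨i, hi⟩ ⟨j, hj⟩ =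
        s₆.real 14 (off + h + i) (off + j) := rfl
      rw [e, p6 i hi j hj]
      simp [blk]
    · ext ⟨i, hi⟩ ⟨j, hj⟩
      simp only [hZ, blk, Matrix.of_apply]
      rw [q6 _ _ (by omega), q5 _ _ (by omega), q4 _ _ (by omega), m3]
    · intro x y hxy
      rw [q6 x y (by omega), q5 x y (by omega), q4 x y (by omega), m3]

end Mul

/-! ### The stack that replaces recursion -/

namespace Mul

variable (μ : Mul)

/-- Entry `j` of the stack. -/
def Ent (s : State) (j ph off lev : ℕ) : Prop :=
  s.nat 31 j 0 = ph ∧ s.nat 32 j 0 = off ∧ s.nat 33 j 0 = lev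

/-- The stacks agree below `p`. -/
def Below (s s' : State) (p : ℕ) : Prop :=
  ∀ j < p, ∀ a, (a = 31 ∨ a = 32 ∨ a = 33) → s'.nat a j 0 = s.nat a j 0

theorem Below.ent {s s' : State} {p j ph off lev : ℕ} (h : Below s s' p) (hj : j < p)
    (he : Ent s j ph off lev) : Ent s' j ph off lev :=
  ⟨(h j hj 31 (by simp)).trans he.1, (h j hj 32 (by simp)).trans he.2.1,
    (h j hj 33 (by simp)).trans he.2.2⟩

/-- Register 37 receives 2^(lev − 1), half of the block size, from the table in array 20. At level 0
the truncated index gives a value that the base case does not read. -/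
theorem runs_pop {ρ : Tape} {s : State} {p ph off lev : ℕ} {R : Prog} {B : ℝ}
    {Q : State → Prop} (h30 : s.nat 30 0 0 = p + 1) (he : Ent s p ph off lev)
    (h : ∀ s₁, s₁.nat 30 0 0 = p → s₁.nat 34 0 0 = ph → s₁.nat 35 0 0 = off →
      s₁.nat 36 0 0 = lev → s₁.nat 37 0 0 = s.nat 20 (lev - 1) 0 → Below s s₁ (p + 1) →
      InvFrame s s₁ → s₁.real = s.real →
      Runs ρ R s₁ (B - 50) Q) :
    Runs ρ (.seq (setV 30 (.sub (V 30) (.lit 1))) <| .seq (setV 34 (.get 31 (V 30) (.lit 0))) <|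
      .seq (setV 35 (.get 32 (V 30) (.lit 0))) <| .seq (setV 36 (.get 33 (V 30) (.lit 0))) <|
      .seq (setV 37 (.get 20 (.sub (V 36) (.lit 1)) (.lit 0))) R) s B Q := by
  obtain ⟨e1, e2, e3⟩ := he
  refine Runs.setNat_step <| Runs.setNat_step <| Runs.setNat_step <| Runs.setNat_step <|
    Runs.setNat_step ?_
  refine (h _ ?_ ?_ ?_ ?_ ?_ ?_ ?_ ?_).mono ?_ (fun _ h => h)
  · simp [State.putNat_nat, NatExp.eval, h30]
  · simp [State.putNat_nat, NatExp.eval, h30, e1]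
  · simp [State.putNat_nat, NatExp.eval, h30, e2]
  · simp [State.putNat_nat, NatExp.eval, h30, e3]
  · simp [State.putNat_nat, NatExp.eval, h30, e3]
  · intro j hj a ha
    simp only [State.putNat_nat]
    rcases ha with rfl | rfl | rfl <;> simp
  · refine ⟨fun a ha hb => ?_, fun a _ _ _ => rfl⟩
    simp only [State.putNat_nat_of_ne (show a ≠ 30 by omega), State.putNat_nat_of_ne (show a ≠ 34 by omega), State.putNat_nat_of_ne (show a ≠ 35 by omega), State.putNat_nat_of_ne (show a ≠ 36 by omega), State.putNat_nat_of_ne (show a ≠ 37 by omega)]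
  · rfl
  · simp [NatExp.cost]; linarith

theorem runs_push {ρ : Tape} {s : State} {R : Prog} {B : ℝ} {Q : State → Prop} (p : ℕ)
    {e₁ e₂ e₃ : NatExp} (ph off lev : ℕ) (h30 : s.nat 30 0 0 = p)
    (c : e₁.cost ≤ 10 ∧ e₂.cost ≤ 10 ∧ e₃.cost ≤ 10)
    (he : ∀ s₁, (∀ a, a ≠ 31 → a ≠ 32 → a ≠ 33 → s₁.nat a = s.nat a) →
      e₁.eval s₁ = ph ∧ e₂.eval s₁ = off ∧ e₃.eval s₁ = lev)
    (h : ∀ s₁, s₁.nat 30 0 0 = p + 1 → Ent s₁ p ph off lev → Below s s₁ p →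
      InvFrame s s₁ → s₁.real = s.real → (∀ a, 33 < a → s₁.nat a = s.nat a) →
      Runs ρ R s₁ (B - 60) Q) :
    Runs ρ (.seq (push e₁ e₂ e₃) R) s B Q := by
  have key : Runs ρ (push e₁ e₂ e₃) s 60 (fun s₁ => s₁.nat 30 0 0 = p + 1 ∧ Ent s₁ p ph off lev ∧
      Below s s₁ p ∧ InvFrame s s₁ ∧ s₁.real = s.real ∧ (∀ a, 33 < a → s₁.nat a = s.nat a)) := by
    have r1 := (he s (fun _ _ _ _ => rfl)).1
    have r2 := (he (s.putNat 31 p 0 ph) (fun a h _ _ => State.putNat_nat_of_ne h)).2.1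
    have r3 := (he ((s.putNat 31 p 0 ph).putNat 32 p 0 off) (fun a h h' _ => by
      rw [State.putNat_nat_of_ne h', State.putNat_nat_of_ne h])).2.2
    refine Runs.setNat_step <| Runs.setNat_step <| Runs.setNat_step <| Runs.setNat_last ?_ ?_
    · simp only [NatExp.eval, h30, r1, State.putNat_nat, if_true, and_true, true_and, if_false,
        false_and, Nat.reduceEqDiff, r2, r3]
      refine ⟨?_, ?_, ?_, rfl, ?_⟩
      · simp [Ent, State.putNat_nat]
      · intro j hj a ha
        have : j ≠ p := by omega
        rcases ha with rfl | rfl | rfl <;> simp [State.putNat_nat, this]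
      · refine ⟨fun a ha hb => ?_, fun a _ _ _ => rfl⟩
        simp only [State.putNat_nat_of_ne (show a ≠ 30 by omega),
          State.putNat_nat_of_ne (show a ≠ 31 by omega),
          State.putNat_nat_of_ne (show a ≠ 32 by omega),
          State.putNat_nat_of_ne (show a ≠ 33 by omega)]
      · intro a ha
        simp only [State.putNat_nat_of_ne (show a ≠ 30 by omega),
          State.putNat_nat_of_ne (show a ≠ 31 by omega),
          State.putNat_nat_of_ne (show a ≠ 32 by omega),
          State.putNat_nat_of_ne (show a ≠ 33 by omega)]
    · obtain ⟨c1, c2, c3⟩ := c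
      have c1' : (e₁.cost : ℝ) ≤ 10 := by exact_mod_cast c1
      have c2' : (e₂.cost : ℝ) ≤ 10 := by exact_mod_cast c2
      have c3' : (e₃.cost : ℝ) ≤ 10 := by exact_mod_cast c3
      simp [NatExp.cost]; linarith
  exact Runs.step key fun s₁ ⟨h1, h2, h3, h4, h5, h6⟩ => h s₁ h1 h2 h3 h4 h5 h6

theorem runs_push_last {ρ : Tape} {s : State} {B : ℝ} {Q : State → Prop} (p : ℕ)
    {e₁ e₂ e₃ : NatExp} (ph off lev : ℕ) (h30 : s.nat 30 0 0 = p)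
    (c : e₁.cost ≤ 10 ∧ e₂.cost ≤ 10 ∧ e₃.cost ≤ 10)
    (he : ∀ s₁, (∀ a, a ≠ 31 → a ≠ 32 → a ≠ 33 → s₁.nat a = s.nat a) →
      e₁.eval s₁ = ph ∧ e₂.eval s₁ = off ∧ e₃.eval s₁ = lev)
    (h : ∀ s₁, s₁.nat 30 0 0 = p + 1 → Ent s₁ p ph off lev → Below s s₁ p →
      InvFrame s s₁ → s₁.real = s.real → Q s₁) (hB : 61 ≤ B) :
    Runs ρ (push e₁ e₂ e₃) s B Q := by
  have h1 := runs_push (ρ := ρ) (R := .skip) (B := 61) (Q := Q) p ph off lev h30 c he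
    (fun s₁ g1 g2 g3 g4 g5 _ => (Runs.skip (h s₁ g1 g2 g3 g4 g5)).mono (by norm_num) (fun _ h => h))
  obtain ⟨s', t, h2, h3, h4⟩ := h1
  cases h2 with
  | seq g1 g2 =>
    cases g2 with
    | skip => exact ⟨_, _, g1, by push_cast at h3; linarith, h4⟩

/-- Continuation form: working off the top entry and everything it spawns inverts its block and
leaves the stack below untouched, after which the same loop goes on. This permits an induction on
`k` although the program is not recursive. The two subproblems double the cost, while the bound
grows by a factor of at least four, and the slack pays for the block products. -/
theorem runs_invLoop (k : ℕ) : ∀ (ρ : Tape) (s : State) (off p : ℕ) (B : ℝ) (Q : State → Prop),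
    s.nat 30 0 0 = p + 1 → Ent s p 0 off k → (∀ j < k, s.nat 20 j 0 = 2 ^ j) →
    (blk (s.real 14) off off (2 ^ k)).PosDef →
    (∀ s', s'.nat 30 0 0 = p → Below s s' p → InvFrame s s' →
      blk (s'.real 14) off off (2 ^ k) = (blk (s.real 14) off off (2 ^ k))⁻¹ →
      (∀ x y, ¬ ((off ≤ x ∧ x < off + 2 ^ k) ∧ off ≤ y ∧ y < off + 2 ^ k) →
        s'.real 14 x y = s.real 14 x y) → Runs ρ μ.invLoop s' B Q) →
    Runs ρ μ.invLoop s (B + 20 * μ.K * (k + 1) * ((2 : ℝ) ^ k) ^ μ.ω) Q := by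
  have hK := μ.K_ge
  induction k with
  | zero =>
    intro ρ s off p B Q h30 he hpow hpd cont
    refine (Runs.loop_true (B₁ := 100) (B₂ := B) (Q' := fun s' => s'.nat 30 0 0 = p ∧ Below s s' p ∧
      InvFrame s s' ∧ (∀ x y, s'.real 14 x y = if x = off ∧ y = off then (s.real 14 off off)⁻¹
        else s.real 14 x y)) ?_ ?_ ?_).mono ?_ (fun _ h => h)
    · simp [Test.Holds, NatExp.eval, h30]
    · refine runs_pop h30 he fun s₁ g30 g34 g35 g36 g37 gb gf gr => ?_
      refine Runs.branch_last (fun _ => ?_) (fun hn => ?_)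
      · refine Runs.branch_last (fun _ => ?_) (fun hn => ?_)
        · refine Runs.setReal_last ?_ ?_
          · refine ⟨g30, fun j hj => gb j (by omega), ⟨gf.nat, fun a ha h14 h16 => ?_⟩, ?_⟩
            · rw [State.putReal_real_of_ne h14, gr]
            · intro x y
              simp [State.putReal_real, RealExp.eval, NatExp.eval, g35, gr]
          · simp [NatExp.cost, RealExp.cost, Test.cost]; norm_num
        · simp [Test.Holds, NatExp.eval, g36] at hn
      · simp [Test.Holds, NatExp.eval, g34] at hn
    · rintro s' ⟨h1, h2, h3, h4⟩
      refine cont s' h1 h2 h3 ?_ ?_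
      · have hd : (blk (s.real 14) off off (2 ^ 0)) = Matrix.diagonal fun _ => s.real 14 off off := by
          ext ⟨i, hi⟩ ⟨j, hj⟩
          obtain rfl : i = 0 := by simpa using hi
          obtain rfl : j = 0 := by simpa using hj
          simp [blk]
        have hpos : 0 < s.real 14 off off := by
          have := hpd.diag_pos (i := ⟨0, by norm_num⟩)
          simpa [blk] using this
        symm
        rw [hd]
        apply Matrix.inv_eq_right_inv
        have : blk (s'.real 14) off off (2 ^ 0) = Matrix.diagonal fun _ => (s.real 14 off off)⁻¹ := by
          ext ⟨i, hi⟩ ⟨j, hj⟩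
          obtain rfl : i = 0 := by simpa using hi
          obtain rfl : j = 0 := by simpa using hj
          simp [blk, h4]
        rw [this, Matrix.diagonal_mul_diagonal]
        simp [hpos.ne']
      · intro x y hxy
        rw [h4, if_neg]
        rintro ⟨rfl, rfl⟩
        exact hxy (by simp)
    · simp [Test.cost, NatExp.cost]; linarith
  | succ k ih =>
    intro ρ s off p B Q h30 he hpow hpd cont
    have hpk := hpow k (by omega)
    have hh : 1 ≤ 2 ^ k := Nat.one_le_two_pow
    have hX : (1 : ℝ) ≤ ((2 : ℝ) ^ k) ^ μ.ω :=
      Real.one_le_rpow (one_le_pow₀ (by norm_num)) (by linarith [μ.two_le])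
    set X : ℝ := ((2 : ℝ) ^ k) ^ μ.ω with hXdef
    set T : ℝ := 20 * μ.K * (k + 1) * X with hT
    -- Here ω ≥ 2 enters: doubling the size multiplies the allowance by at least 4.
    have hX4 : 4 * X ≤ ((2 : ℝ) ^ (k + 1)) ^ μ.ω := by
      rw [pow_succ, Real.mul_rpow (by positivity) (by norm_num), hXdef, mul_comm]
      refine mul_le_mul_of_nonneg_left ?_ (by positivity)
      calc (4 : ℝ) = 2 ^ (2 : ℝ) := by norm_num
        _ ≤ 2 ^ μ.ω := Real.rpow_le_rpow_of_exponent_le (by norm_num) μ.two_le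
    rw [pow_succ, mul_two] at hpd
    have hpd2 := hpd.submatrix (e := finSumFinEquiv) finSumFinEquiv.injective
    rw [blk_submatrix] at hpd2
    have hinv : ((blk (s.real 14) off off (2 ^ k + 2 ^ k))⁻¹).submatrix finSumFinEquiv
        finSumFinEquiv = (Matrix.fromBlocks (blk (s.real 14) off off (2 ^ k))
          (blk (s.real 14) off (off + 2 ^ k) (2 ^ k)) (blk (s.real 14) (off + 2 ^ k) off (2 ^ k))
          (blk (s.real 14) (off + 2 ^ k) (off + 2 ^ k) (2 ^ k)))⁻¹ := by
      rw [← blk_submatrix, Matrix.inv_submatrix_equiv]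
    -- By symmetry the lower left block is the transpose of the upper right one, as `schur_inv` and
    -- `combineProg` presuppose.
    have hC : blk (s.real 14) (off + 2 ^ k) off (2 ^ k) =
        (blk (s.real 14) off (off + 2 ^ k) (2 ^ k)).transpose := by
      have := hpd2.isHermitian
      rw [Matrix.isHermitian_fromBlocks_iff] at this
      simpa using this.2.1.symm
    rw [hC] at hpd2 hinv
    obtain ⟨pA, pS, hI⟩ := schur_inv hpd2
    rw [hI] at hinv
    -- the four entries are pushed
    refine (Runs.loop_true (B₁ := 400) (B₂ := B + T + 10 * μ.K * X + 50 + T + 300) (Q' := fun s' =>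
      s'.nat 30 0 0 = p + 4 ∧ Ent s' p 2 off (k + 1) ∧ Ent s' (p + 1) 0 (off + 2 ^ k) k ∧
      Ent s' (p + 2) 1 off (k + 1) ∧ Ent s' (p + 3) 0 off k ∧ Below s s' p ∧ InvFrame s s' ∧
      s'.real = s.real) ?_ ?_ ?_).mono ?_ (fun _ h => h)
    · simp [Test.Holds, NatExp.eval, h30]
    · refine runs_pop h30 he fun s₁ g30 g34 g35 g36 g37 gb gf gr => ?_
      refine Runs.branch_last (fun _ => ?_) (fun hn => ?_)
      swap
      · simp [Test.Holds, NatExp.eval, g34] at hn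
      refine Runs.branch_last (fun hn => ?_) (fun _ => ?_)
      · simp [Test.Holds, NatExp.eval, g36] at hn
      simp only [Nat.add_sub_cancel, hpk] at g37
      refine runs_push p 2 off (k + 1) g30 (by simp [NatExp.cost]) ?_ ?_
      · intro s₂ h; simp [NatExp.eval, h, g35, g36]
      intro s₂ q30 qe qb qf qr qn
      refine runs_push (p + 1) 0 (off + 2 ^ k) k q30 (by simp [NatExp.cost]) ?_ ?_
      · intro s₃ h; simp [NatExp.eval, h, qn, g35, g36, g37]
      intro s₃ q30' qe' qb' qf' qr' qn'
      refine runs_push (p + 2) 1 off (k + 1) q30' (by simp [NatExp.cost]) ?_ ?_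
      · intro s₄ h; simp [NatExp.eval, h, qn, qn', g35, g36]
      intro s₄ q30'' qe'' qb'' qf'' qr'' qn''
      refine runs_push_last (p + 3) 0 off k q30'' (by simp [NatExp.cost]) ?_ ?_ ?_
      · intro s₅ h; simp [NatExp.eval, h, qn, qn', qn'', g35, g36]
      · intro s₅ w30 we wb wf wr
        refine ⟨w30, wb.ent (by omega) (qb''.ent (by omega) (qb'.ent (by omega) qe)),
          wb.ent (by omega) (qb''.ent (by omega) qe'), wb.ent (by omega) qe'', we, ?_, ?_, ?_⟩
        · intro j hj a ha
          rw [wb j (by omega) a ha, qb'' j (by omega) a ha, qb' j (by omega) a ha,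
            qb j (by omega) a ha, gb j (by omega) a ha]
        · exact gf.trans <| qf.trans <| qf'.trans <| qf''.trans wf
        · rw [wr, qr'', qr', qr, gr]
      · simp [Test.cost, NatExp.cost]; norm_num
    · rintro s₁ ⟨h1, e0, e1, e2, e3, b1, f1, r1⟩
      have hpow1 : ∀ j < k + 1, s₁.nat 20 j 0 = 2 ^ j := fun j hj => by
        rw [f1.nat 20 (by norm_num) (by norm_num), hpow j hj]
      refine (ih ρ s₁ off (p + 3) (B + 10 * μ.K * X + 50 + T + 300) Q h1 e3
        (fun j hj => hpow1 j (by omega)) (by rw [r1]; exact pA) ?_).mono (by linarith)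
        (fun _ h => h)
      intro s₂ h2 b2 f2 i2 u2
      rw [r1] at i2 u2
      -- the Schur complement
      refine (Runs.loop_true (B₁ := 100 + 5 * μ.K * X)
        (B₂ := B + 5 * μ.K * X + T + 200) (Q' := fun s' =>
        s'.nat 30 0 0 = p + 2 ∧ Below s₂ s' (p + 2) ∧ InvFrame s₂ s' ∧
        blk (s'.real 14) off (off + 2 ^ k) (2 ^ k) =
          blk (s₂.real 14) off off (2 ^ k) * blk (s₂.real 14) off (off + 2 ^ k) (2 ^ k) ∧
        blk (s'.real 14) (off + 2 ^ k) (off + 2 ^ k) (2 ^ k) =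
          blk (s₂.real 14) (off + 2 ^ k) (off + 2 ^ k) (2 ^ k) -
          blk (s₂.real 14) (off + 2 ^ k) off (2 ^ k) * (blk (s₂.real 14) off off (2 ^ k) *
            blk (s₂.real 14) off (off + 2 ^ k) (2 ^ k)) ∧
        ∀ x y, ¬ ((off ≤ x ∧ x < off + 2 ^ k + 2 ^ k) ∧
          off + 2 ^ k ≤ y ∧ y < off + 2 ^ k + 2 ^ k) → s'.real 14 x y = s₂.real 14 x y)
        ?_ ?_ ?_).mono ?_ (fun _ h => h)
      · simp [Test.Holds, NatExp.eval, h2]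
      · refine runs_pop h2 (b2.ent (by omega) e2) fun s₁ g30 g34 g35 g36 g37 gb gf gr => ?_
        refine Runs.branch_last (fun hn => ?_) (fun _ => ?_)
        · simp [Test.Holds, NatExp.eval, g34] at hn
        refine Runs.branch_last (fun _ => ?_) (fun hn => ?_)
        swap
        · simp [Test.Holds, NatExp.eval, g34] at hn
        rw [Nat.add_sub_cancel, f2.nat 20 (by norm_num) (by norm_num), hpow1 k (by omega)] at g37
        refine (μ.runs_schur off (2 ^ k) hh g35 g37).mono ?_ ?_
        · simp [Test.cost, NatExp.cost]; linarith
        · rintro s' ⟨w1, w2, w3, w4, w5⟩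
          rw [gr] at w3 w4 w5
          refine ⟨by rw [w1 30 (by norm_num), g30], fun j hj a ha => ?_,
            gf.trans ⟨fun a ha _ => w1 a ha, fun a ha h14 _ => w2 a ha h14⟩, w3, w4, w5⟩
          rw [w1 a (by omega), gb j (by omega) a ha]
      · rintro s₃ ⟨h3, b3, f3, y3, d3, u3⟩
        have B2 : blk (s₂.real 14) off (off + 2 ^ k) (2 ^ k) =
            blk (s.real 14) off (off + 2 ^ k) (2 ^ k) := by
          ext ⟨i, hi⟩ ⟨j, hj⟩
          exact u2 _ _ (by omega)
        have C2 : blk (s₂.real 14) (off + 2 ^ k) off (2 ^ k) =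
            blk (s.real 14) (off + 2 ^ k) off (2 ^ k) := by
          ext ⟨i, hi⟩ ⟨j, hj⟩
          exact u2 _ _ (by omega)
        have D2 : blk (s₂.real 14) (off + 2 ^ k) (off + 2 ^ k) (2 ^ k) =
            blk (s.real 14) (off + 2 ^ k) (off + 2 ^ k) (2 ^ k) := by
          ext ⟨i, hi⟩ ⟨j, hj⟩
          exact u2 _ _ (by omega)
        rw [i2, B2] at y3
        rw [i2, B2, C2, D2, hC] at d3
        have A3 : blk (s₃.real 14) off off (2 ^ k) = (blk (s.real 14) off off (2 ^ k))⁻¹ := by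
          rw [← i2]
          ext ⟨i, hi⟩ ⟨j, hj⟩
          exact u3 _ _ (by omega)
        refine (ih ρ s₃ (off + 2 ^ k) (p + 1) (B + 5 * μ.K * X + 200) Q h3
          (b3.ent (by omega) (b2.ent (by omega) e1))
          (fun j hj => ?_) (by rw [d3]; exact pS) ?_).mono (by linarith) (fun _ h => h)
        · rw [f3.nat 20 (by norm_num) (by norm_num), f2.nat 20 (by norm_num) (by norm_num),
            hpow1 j (by omega)]
        intro s₄ h4 b4 f4 i4 u4
        rw [d3] at i4
        have Y4 : blk (s₄.real 14) off (off + 2 ^ k) (2 ^ k) =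
            (blk (s.real 14) off off (2 ^ k))⁻¹ * blk (s.real 14) off (off + 2 ^ k) (2 ^ k) := by
          rw [← y3]
          ext ⟨i, hi⟩ ⟨j, hj⟩
          exact u4 _ _ (by omega)
        have A4 : blk (s₄.real 14) off off (2 ^ k) = (blk (s.real 14) off off (2 ^ k))⁻¹ := by
          rw [← A3]
          ext ⟨i, hi⟩ ⟨j, hj⟩
          exact u4 _ _ (by omega)
        -- assembling the inverse
        refine (Runs.loop_true (B₁ := 100 + 5 * μ.K * X) (B₂ := B) (Q' := fun s' =>
          s'.nat 30 0 0 = p ∧ Below s₄ s' p ∧ InvFrame s₄ s' ∧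
          blk (s'.real 14) off off (2 ^ k + 2 ^ k) =
            (blk (s.real 14) off off (2 ^ k + 2 ^ k))⁻¹ ∧
          ∀ x y, ¬ ((off ≤ x ∧ x < off + 2 ^ k + 2 ^ k) ∧
            off ≤ y ∧ y < off + 2 ^ k + 2 ^ k) → s'.real 14 x y = s₄.real 14 x y)
          ?_ ?_ ?_).mono ?_ (fun _ h => h)
        · simp [Test.Holds, NatExp.eval, h4]
        · refine runs_pop h4 (b4.ent (by omega) (b3.ent (by omega) (b2.ent (by omega) e0)))
            fun s₁ g30 g34 g35 g36 g37 gb gf gr => ?_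
          refine Runs.branch_last (fun hn => ?_) (fun _ => ?_)
          · simp [Test.Holds, NatExp.eval, g34] at hn
          refine Runs.branch_last (fun hn => ?_) (fun _ => ?_)
          · simp [Test.Holds, NatExp.eval, g34] at hn
          rw [Nat.add_sub_cancel, f4.nat 20 (by norm_num) (by norm_num),
            f3.nat 20 (by norm_num) (by norm_num),
            f2.nat 20 (by norm_num) (by norm_num), hpow1 k (by omega)] at g37
          refine (μ.runs_combine off (2 ^ k) hh g35 g37).mono ?_ ?_
          · simp [Test.cost, NatExp.cost]; linarith
          · rintro s' ⟨w1, w2, w3, w4, w5, w6, w7⟩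
            rw [gr] at w3 w4 w5 w6 w7
            refine ⟨by rw [w1 30 (by norm_num), g30], fun j hj a ha => ?_,
              gf.trans ⟨fun a ha _ => w1 a ha, fun a ha h14 h16 => w2 a ha h14 h16⟩, ?_, w7⟩
            · rw [w1 a (by omega), gb j (by omega) a ha]
            -- Both sides are compared after the reindexing that displays them as 2 × 2 block
            -- matrices.
            · have inj : Function.Injective fun M : Matrix (Fin (2 ^ k + 2 ^ k)) (Fin (2 ^ k + 2 ^ k)) ℝ =>
                  M.submatrix finSumFinEquiv finSumFinEquiv :=
                (Matrix.reindex finSumFinEquiv.symm finSumFinEquiv.symm).injective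
              apply inj
              dsimp only
              rw [hinv, blk_submatrix, w3, w4, w5, w6, A4, Y4, i4]
        · rintro s₅ ⟨h5, b5, f5, i5, u5⟩
          refine cont s₅ h5 ?_ (f1.trans <| f2.trans <| f3.trans <| f4.trans f5) ?_ ?_
          · intro j hj a ha
            rw [b5 j hj a ha, b4 j (by omega) a ha, b3 j (by omega) a ha, b2 j (by omega) a ha,
              b1 j hj a ha]
          · rw [pow_succ, mul_two]; exact i5
          · intro x y hxy
            rw [pow_succ, mul_two] at hxy
            rw [u5 x y (by omega), u4 x y (by omega), u3 x y (by omega), u2 x y (by omega)]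
        · simp [Test.cost, NatExp.cost]; linarith
      · simp [Test.cost, NatExp.cost]; linarith
    · have h1 : (0 : ℝ) ≤ k := Nat.cast_nonneg k
      have h2 : 20 * μ.K * (k + 1 + 1) * (4 * X) ≤
          20 * μ.K * (k + 1 + 1) * ((2 : ℝ) ^ (k + 1)) ^ μ.ω :=
        mul_le_mul_of_nonneg_left hX4 (by positivity)
      have h3 : 3000 * 1 ≤ μ.K * X := mul_le_mul hK hX (by norm_num) (by linarith)
      have h4 : 0 ≤ μ.K * X * k := by positivity
      push_cast
      simp [Test.cost, NatExp.cost]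
      nlinarith

end Mul

/-! ### Inversion of arbitrary invertible matrices -/

namespace Mul

variable (μ : Mul)

/-- Real array `15` becomes the inverse of the matrix of size `V 38 = 2 ^ V 39` in array `13`. -/
def invProg : Prog :=
  .seq (μ.prod (V 38) (V 38) (fun i l => .get 13 l i) (fun l j => .get 13 l j)) <|
  .seq (assign2 14 (.add (.lit 0) (V 80)) (.add (.lit 0) (V 81)) (V 38) (V 38)
    (.get 80 (V 80) (V 81))) <|
  .seq (setV 30 (.lit 0)) <|
  .seq (push (.lit 0) (.lit 0) (V 39)) <|
  .seq μ.invLoop <|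
  .seq (μ.prod (V 38) (V 38) (fun i l => .get 14 i l) (fun l j => .get 13 j l)) <|
  assign2 15 (.add (.lit 0) (V 80)) (.add (.lit 0) (V 81)) (V 38) (V 38) (.get 80 (V 80) (V 81))

theorem nb_one {h : ℕ} (hh : 1 ≤ h) (k : ℕ) : k * h < h ↔ k < 1 := by
  constructor
  · intro hk; by_contra hc; push Not at hc; nlinarith
  · intro hk; obtain rfl : k = 0 := by omega
    omega

/-- M⁻¹ = (MᵀM)⁻¹ Mᵀ, and MᵀM is positive definite as soon as M is invertible. The detour is needed
for 1 + ΔG, which is not symmetric in general. -/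
theorem runs_invProg {ρ : Tape} {s : State} (k : ℕ) (h38 : s.nat 38 0 0 = 2 ^ k)
    (h39 : s.nat 39 0 0 = k) (hpow : ∀ j < k, s.nat 20 j 0 = 2 ^ j)
    (hdet : IsUnit (blk (s.real 13) 0 0 (2 ^ k)).det) :
    Runs ρ μ.invProg s (30 * μ.K * (k + 1) * ((2 : ℝ) ^ k) ^ μ.ω) (fun s' =>
      (∀ a < 80, (a < 30 ∨ 37 < a) → s'.nat a = s.nat a) ∧
      (∀ a < 80, a ≠ 14 → a ≠ 15 → a ≠ 16 → s'.real a = s.real a) ∧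
      blk (s'.real 15) 0 0 (2 ^ k) = (blk (s.real 13) 0 0 (2 ^ k))⁻¹) := by
  have hK := μ.K_ge
  have hm : 1 ≤ 2 ^ k := Nat.one_le_two_pow
  set m := 2 ^ k with hmdef
  have hcast : ((2 : ℝ) ^ k) = (m : ℝ) := by rw [hmdef]; push_cast; rfl
  rw [hcast]
  have hX : (1 : ℝ) ≤ (m : ℝ) ^ μ.ω :=
    Real.one_le_rpow (by exact_mod_cast hm) (by linarith [μ.two_le])
  have hsq := μ.sq_le m
  set M := blk (s.real 13) 0 0 m with hM
  refine Runs.step (μ.runs_prod m m 1 (fun i l => s.real 13 l i) (fun l j => s.real 13 l j) hm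
    (nb_one hm) ?_ ?_ ?_ (by simp [NatExp.cost]) (by simp [NatExp.cost])
    (by simp [NatExp.cost, RealExp.cost]) (by simp [NatExp.cost, RealExp.cost])) ?_
  · intro s₁ l; simp [NatExp.eval, l.nat, h38]
  · intro s₁ l e₁ e₂; simp [RealExp.eval, l.real]
  · intro s₁ l e₁ e₂; simp [RealExp.eval, l.real]
  rintro s₁ ⟨l1, p1⟩
  refine Runs.step (runs_assign_blk 0 0 m (fun i j => s₁.real 80 i j) ?_
    (by simp [NatExp.cost]) (by simp [NatExp.cost]) (by simp [NatExp.cost])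
    (by simp [NatExp.cost, RealExp.cost]) hm ?_) ?_
  · intro s₂ g; simp [NatExp.eval, g.nat, l1.nat, h38]
  · intro i hi j hj s₂ g g1 g2 _; simp [NatExp.eval, RealExp.eval, g.real, g1, g2]
  rintro s₂ ⟨a2, p2, -⟩
  have b2 : blk (s₂.real 14) 0 0 m = M.transpose * M := by
    ext ⟨i, hi⟩ ⟨j, hj⟩
    have e : (blk (s₂.real 14) 0 0 m) ⟨i, hi⟩ ⟨j, hj⟩ = s₂.real 14 (0 + i) (0 + j) := rfl
    rw [e, p2 i hi j hj, p1 i hi j hj, one_mul, Finset.sum_range, Matrix.mul_apply]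
    simp [hM, blk]
  have hpd : (blk (s₂.real 14) 0 0 m).PosDef := by
    rw [b2]
    have := Matrix.PosDef.conjTranspose_mul_self M
      (Matrix.mulVec_injective_of_isUnit ((Matrix.isUnit_iff_isUnit_det M).2 hdet))
    simpa using this
  refine Runs.setNat_step ?_
  refine runs_push 0 0 0 k (by simp [State.putNat_nat, NatExp.eval]) (by simp [NatExp.cost]) ?_ ?_
  · intro s₃ h; simp [NatExp.eval, h, State.putNat_nat, a2.nat, l1.nat, h39]
  intro s₃ h30 he hb hf hr hn
  simp only [State.putNat_real] at hr
  have n3 : ∀ a < 80, (a < 30 ∨ 37 < a) → s₃.nat a = s.nat a := fun a ha hb => by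
    rw [hf.nat a ha hb, State.putNat_nat_of_ne (by omega), a2.nat a (by omega) (by omega),
      l1.nat a ha]
  refine Runs.step (B₁ := 5 + 20 * μ.K * (k + 1) * ((2 : ℝ) ^ k) ^ μ.ω) (μ.runs_invLoop k ρ s₃ 0 0 5
    (fun s' => InvFrame s₃ s' ∧ blk (s'.real 14) 0 0 m = (M.transpose * M)⁻¹) h30 he ?_
    (by rw [hr]; exact hpd) ?_) ?_
  · intro j hj
    rw [n3 20 (by norm_num) (by norm_num), hpow j hj]
  · intro s' h1 _ h2 h3 _
    refine (Runs.loop_false ?_ ⟨h2, ?_⟩).mono ?_ (fun _ h => h)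
    · simp [Test.Holds, NatExp.eval, h1]
    · simp [Test.cost, NatExp.cost]
    · rw [← hmdef, hr, b2] at h3
      exact h3
  rintro s₄ ⟨f4, i4⟩
  have n4 : ∀ a < 80, (a < 30 ∨ 37 < a) → s₄.nat a = s.nat a := fun a ha hb => by
    rw [f4.nat a ha hb, n3 a ha hb]
  have r4 : s₄.real 13 = s.real 13 := by
    rw [f4.real 13 (by norm_num) (by norm_num) (by norm_num), hr, a2.real 13 (by norm_num),
      l1.real 13 (by norm_num)]
  refine Runs.step (μ.runs_prod m m 1 (fun i l => s₄.real 14 i l) (fun l j => s.real 13 j l) hm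
    (nb_one hm) ?_ ?_ ?_ (by simp [NatExp.cost]) (by simp [NatExp.cost])
    (by simp [NatExp.cost, RealExp.cost]) (by simp [NatExp.cost, RealExp.cost])) ?_
  · intro s₁ l; simp [NatExp.eval, l.nat, n4, h38]
  · intro s₁ l e₁ e₂; simp [RealExp.eval, l.real]
  · intro s₁ l e₁ e₂; simp [RealExp.eval, l.real, r4]
  rintro s₅ ⟨l5, p5⟩
  refine (runs_assign_blk 0 0 m (fun i j => s₅.real 80 i j) ?_
    (by simp [NatExp.cost]) (by simp [NatExp.cost]) (by simp [NatExp.cost])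
    (by simp [NatExp.cost, RealExp.cost]) hm ?_).mono ?_ ?_
  · intro s₂ g; simp [NatExp.eval, g.nat, l5.nat, n4, h38]
  · intro i hi j hj s₂ g g1 g2 _; simp [NatExp.eval, RealExp.eval, g.real, g1, g2]
  · have h1 : (0 : ℝ) ≤ k := Nat.cast_nonneg k
    have h3 : 3000 * 1 ≤ μ.K * (m : ℝ) ^ μ.ω := mul_le_mul hK hX (by norm_num) (by linarith)
    have h4 : 0 ≤ μ.K * (m : ℝ) ^ μ.ω * k := by positivity
    rw [hcast]
    simp [NatExp.cost]
    nlinarith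
  · rintro s₆ ⟨a6, p6, -⟩
    refine ⟨fun a ha hb => ?_, fun a ha h14 h15 h16 => ?_, ?_⟩
    · rw [a6.nat a (by omega) (by omega), l5.nat a ha, n4 a ha hb]
    · rw [a6.real a h15, l5.real a ha, f4.real a ha h14 h16, hr, a2.real a h14, l1.real a ha]
    · have e1 : blk (s₆.real 15) 0 0 m = (M.transpose * M)⁻¹ * M.transpose := by
        rw [← i4]
        ext ⟨i, hi⟩ ⟨j, hj⟩
        have e : (blk (s₆.real 15) 0 0 m) ⟨i, hi⟩ ⟨j, hj⟩ = s₆.real 15 (0 + i) (0 + j) := rfl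
        rw [e, p6 i hi j hj, p5 i hi j hj, one_mul, Finset.sum_range, Matrix.mul_apply]
        simp [hM, blk]
      rw [e1]
      symm
      apply Matrix.inv_eq_left_inv
      rw [Matrix.mul_assoc]
      apply Matrix.nonsing_inv_mul
      rw [Matrix.det_mul, Matrix.det_transpose]
      exact hdet.mul hdet

end Mul

/-! ### Sparse representation of the matrix -/

open Classical in
/-- A matrix extended by zeros. -/
noncomputable def ext2 {n d : ℕ} (A : Matrix (Fin n) (Fin d) ℝ) (i j : ℕ) : ℝ :=
  if h : i < n ∧ j < d then A ⟨i, h.1⟩ ⟨j, h.2⟩ else 0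

open Classical in
/-- A vector extended by zeros. -/
noncomputable def ext1 {n : ℕ} (w : Fin n → ℝ) (i : ℕ) : ℝ := if h : i < n then w ⟨i, h⟩ else 0

/-- The number of rows. -/
abbrev eN : NatExp := .get 0 (.lit 0) (.lit 0)

/-- The number of columns. -/
abbrev eD : NatExp := .get 0 (.lit 0) (.lit 1)

/-- The first `i` rows and the first `j` entries of row `i`. -/
noncomputable def prefixSum (d : ℕ) (F : ℕ → ℕ → ℝ) (i j : ℕ) : ℝ :=
  ∑ i' ∈ Finset.range i, ∑ j' ∈ Finset.range d, F i' j' + ∑ j' ∈ Finset.range j, F i j'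

theorem prefixSum_succ (d : ℕ) (F : ℕ → ℕ → ℝ) (i j : ℕ) :
    prefixSum d F i (j + 1) = prefixSum d F i j + F i j := by
  simp [prefixSum, Finset.sum_range_succ, add_assoc]

theorem prefixSum_row (d : ℕ) (F : ℕ → ℕ → ℝ) (i : ℕ) :
    prefixSum d F i d = prefixSum d F (i + 1) 0 := by
  simp [prefixSum, Finset.sum_range_succ]

/-- List the nonzero entries: their number in `9`, rows in `10`, columns in `11`, values in the real
array `10`; and the nonzero rows: their number in `12`, the rows in `13`. -/
def nnzProg : Prog :=
  .seq (setV 9 (.lit 0)) <| .seq (setV 12 (.lit 0)) <|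
  forP 40 eN <| .seq (setV 41 (V 9)) <|
    .seq (forP 42 eD <|
      .branch (.realLt (.lit 0) (.mul (.get 0 (V 40) (V 42)) (.get 0 (V 40) (V 42))))
        (.seq (.setNat 10 (V 9) (.lit 0) (V 40)) <| .seq (.setNat 11 (V 9) (.lit 0) (V 42)) <|
         .seq (.setReal 10 (V 9) (.lit 0) (.get 0 (V 40) (V 42))) <|
         setV 9 (.add (V 9) (.lit 1)))
        .skip) <|
    .branch (.natLt (V 41) (V 9))
      (.seq (.setNat 13 (V 12) (.lit 0) (V 40)) <| setV 12 (.add (V 12) (.lit 1))) .skip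

/-- Sparse representation of the part of `A` given by the first `i` rows and the first `j` entries
of row `i`. -/
structure Entries (n d : ℕ) (A : ℕ → ℕ → ℝ) (i j : ℕ) (s : State) : Prop where
  n_eq : s.nat 0 0 0 = n
  d_eq : s.nat 0 0 1 = d
  mat : s.real 0 = A
  sum : ∀ g : ℕ → ℕ → ℝ, ∑ e ∈ Finset.range (s.nat 9 0 0),
    g (s.nat 10 e 0) (s.nat 11 e 0) * s.real 10 e 0 = prefixSum d (fun i j => g i j * A i j) i j
  card : (s.nat 9 0 0 : ℝ) = prefixSum d (fun i j => if A i j = 0 then 0 else 1) i j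

/-- List of the nonzero rows among the first `i` ones. -/
structure Rows (n d : ℕ) (A : ℕ → ℕ → ℝ) (i z : ℕ) (s : State) : Prop where
  le_i : s.nat 12 0 0 ≤ i
  le_z : s.nat 12 0 0 ≤ z
  lt : ∀ p < s.nat 12 0 0, s.nat 13 p 0 < i
  mem : ∀ i' < i, (∃ j < d, A i' j ≠ 0) → ∃ p < s.nat 12 0 0, s.nat 13 p 0 = i'

theorem Entries.congr {n d : ℕ} {A : ℕ → ℕ → ℝ} {i j : ℕ} {s s' : State}
    (h : Entries n d A i j s) (hn : ∀ a, (a = 0 ∨ a = 9 ∨ a = 10 ∨ a = 11) → s'.nat a = s.nat a)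
    (hr : ∀ a, (a = 0 ∨ a = 10) → s'.real a = s.real a) : Entries n d A i j s' := by
  obtain ⟨h1, h2, h3, h4, h5⟩ := h
  constructor
  · rw [hn 0 (by simp), h1]
  · rw [hn 0 (by simp), h2]
  · rw [hr 0 (by simp), h3]
  · intro g
    rw [hn 9 (by simp), hn 10 (by simp), hn 11 (by simp), hr 10 (by simp), h4 g]
  · rw [hn 9 (by simp), h5]

theorem Rows.congr {n d : ℕ} {A : ℕ → ℕ → ℝ} {i z : ℕ} {s s' : State}
    (h : Rows n d A i z s) (h12 : s'.nat 12 = s.nat 12) (h13 : s'.nat 13 = s.nat 13) :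
    Rows n d A i z s' := by
  obtain ⟨h1, h2, h3, h4⟩ := h
  constructor <;> simp only [h12, h13] <;> assumption

/-- The list is described by its sums against all functions `g`. Appending an entry adds one term to
both sides, and no bijection between positions and entries has to be maintained. -/
theorem Entries.put {n d : ℕ} {A : ℕ → ℕ → ℝ} {i j : ℕ} {s s' : State}
    (h : Entries n d A i j s) (hA : A i j ≠ 0) (h0 : s'.nat 0 = s.nat 0)
    (h9 : s'.nat 9 0 0 = s.nat 9 0 0 + 1)
    (h10 : ∀ e, s'.nat 10 e 0 = if e = s.nat 9 0 0 then i else s.nat 10 e 0)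
    (h11 : ∀ e, s'.nat 11 e 0 = if e = s.nat 9 0 0 then j else s.nat 11 e 0)
    (r0 : s'.real 0 = s.real 0)
    (r10 : ∀ e, s'.real 10 e 0 = if e = s.nat 9 0 0 then A i j else s.real 10 e 0) :
    Entries n d A i (j + 1) s' := by
  obtain ⟨g1, g2, g3, g4, g5⟩ := h
  constructor
  · rw [h0, g1]
  · rw [h0, g2]
  · rw [r0, g3]
  · intro g
    rw [h9, Finset.sum_range_succ, prefixSum_succ, ← g4 g]
    congr 1
    · refine Finset.sum_congr rfl fun e he => ?_
      have : e ≠ s.nat 9 0 0 := (Finset.mem_range.1 he).ne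
      rw [h10, h11, r10, if_neg this, if_neg this, if_neg this]
    · rw [h10, h11, r10, if_pos rfl, if_pos rfl, if_pos rfl]
  · rw [h9, prefixSum_succ, ← g5, if_neg hA]
    push_cast; rfl

theorem Entries.skip {n d : ℕ} {A : ℕ → ℕ → ℝ} {i j : ℕ} {s : State}
    (h : Entries n d A i j s) (hA : A i j = 0) : Entries n d A i (j + 1) s := by
  obtain ⟨g1, g2, g3, g4, g5⟩ := h
  refine ⟨g1, g2, g3, fun g => ?_, ?_⟩
  · rw [prefixSum_succ, g4, hA]; ring
  · rw [prefixSum_succ, g5, if_pos hA]; ring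

theorem Entries.row {n d : ℕ} {A : ℕ → ℕ → ℝ} {i : ℕ} {s : State}
    (h : Entries n d A i d s) : Entries n d A (i + 1) 0 s := by
  obtain ⟨g1, g2, g3, g4, g5⟩ := h
  exact ⟨g1, g2, g3, fun g => by rw [← prefixSum_row, g4], by rw [← prefixSum_row, g5]⟩

/-- Register 41 remembers the number of entries before the current row, and the row is listed as
nonzero exactly when this number has grown. So there are at most as many listed rows as entries, by
which a scan can be charged to nnz(A). -/
theorem runs_nnzProg {ρ : Tape} {s : State} {n d : ℕ} {A : ℕ → ℕ → ℝ} (hn : s.nat 0 0 0 = n)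
    (hd : s.nat 0 0 1 = d) (hA : s.real 0 = A) :
    Runs ρ nnzProg s (n * (d * 100 + 100) + 100) (fun s' =>
      Entries n d A n 0 s' ∧ Rows n d A n (s'.nat 9 0 0) s' ∧ s'.real 1 = s.real 1) := by
  refine Runs.setNat_step <| Runs.setNat_step ?_
  refine (Runs.forP (N := n) (B := d * 100 + 80) (I := fun i s' => s'.nat 40 0 0 = i ∧ Entries n d A i 0 s' ∧
    Rows n d A i (s'.nat 9 0 0) s' ∧ s'.real 1 = s.real 1) (by positivity) ?_ ?_ ?_).mono ?_ ?_
  · refine ⟨by simp [State.putNat_nat], ⟨?_, ?_, ?_, ?_, ?_⟩, ⟨?_, ?_, ?_, ?_⟩, ?_⟩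
    · simp [State.putNat_nat, hn]
    · simp [State.putNat_nat, hd]
    · simp [hA]
    · intro g; simp [State.putNat_nat, NatExp.eval, prefixSum]
    · simp [State.putNat_nat, NatExp.eval, prefixSum]
    · simp [State.putNat_nat, NatExp.eval]
    · simp [State.putNat_nat, NatExp.eval]
    · simp [State.putNat_nat, NatExp.eval]
    · simp
    · simp
  · rintro i s₁ ⟨h1, h2, _⟩
    exact ⟨h1, h2.n_eq⟩
  · rintro i hi s₁ ⟨h1, h2, h3, h4⟩
    refine Runs.setNat_step ?_
    refine Runs.step (B₁ := d * 92 + 20) (Q' := fun s₂ => s₂.nat 40 0 0 = i ∧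
      Entries n d A (i + 1) 0 s₂ ∧ Rows n d A i (s₂.nat 41 0 0) s₂ ∧ s₂.real 1 = s.real 1 ∧
      s₂.nat 41 0 0 ≤ s₂.nat 9 0 0 ∧ ((∃ j < d, A i j ≠ 0) → s₂.nat 41 0 0 < s₂.nat 9 0 0)) ?_ ?_
    · refine (Runs.forP (N := d) (B := 75) (I := fun j s₂ => s₂.nat 42 0 0 = j ∧ s₂.nat 40 0 0 = i ∧
        Entries n d A i j s₂ ∧ Rows n d A i (s₂.nat 41 0 0) s₂ ∧ s₂.real 1 = s.real 1 ∧
        s₂.nat 41 0 0 ≤ s₂.nat 9 0 0 ∧ ((∃ j' < j, A i j' ≠ 0) → s₂.nat 41 0 0 < s₂.nat 9 0 0))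
        (by positivity) ?_ ?_ ?_).mono ?_ ?_
      · refine ⟨by simp [State.putNat_nat], by simpa [State.putNat_nat] using h1, ?_, ?_, ?_, ?_, ?_⟩
        · refine h2.congr (fun a ha => ?_) (fun _ _ => rfl)
          rw [State.putNat_nat_of_ne (by omega), State.putNat_nat_of_ne (by omega)]
        · have : (s₁.putNat 41 (NatExp.eval s₁ (NatExp.lit 0)) (NatExp.eval s₁ (NatExp.lit 0))
              (NatExp.eval s₁ (V 9)) |>.putNat 42 0 0 0).nat 41 0 0 = s₁.nat 9 0 0 := by
            simp [State.putNat_nat, NatExp.eval]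
          rw [this]
          exact h3.congr (by rw [State.putNat_nat_of_ne (by omega), State.putNat_nat_of_ne (by omega)])
            (by rw [State.putNat_nat_of_ne (by omega), State.putNat_nat_of_ne (by omega)])
        · exact h4
        · simp [State.putNat_nat, NatExp.eval]
        · simp
      · rintro j s₂ ⟨g1, _, g3, _⟩
        exact ⟨g1, g3.d_eq⟩
      · rintro j hj s₂ ⟨g1, g2, g3, g4, g5, g6, g7⟩
        have hx : (RealExp.get 0 (V 40) (V 42)).eval s₂ = A i j := by
          simp [RealExp.eval, NatExp.eval, g1, g2, g3.mat]
        refine Runs.branch_last (fun hb => ?_) (fun hb => ?_)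
        -- Real tests are strict inequalities, so x ≠ 0 is decided as 0 < x · x.
        · have hne : A i j ≠ 0 := by
            intro h0
            simp only [Test.Holds, RealExp.eval] at hb hx
            rw [hx, h0] at hb
            simp at hb
          refine Runs.setNat_step <| Runs.setNat_step <| Runs.setReal_step <| Runs.setNat_last ?_ ?_
          · refine ⟨by simp [State.putNat_nat, g1], by simp [State.putNat_nat], by simp [State.putNat_nat, g2], ?_, ?_, ?_, ?_, ?_⟩
            · refine g3.put hne ?_ ?_ ?_ ?_ ?_ ?_
              · funext x y; simp [State.putNat_nat]
              · simp [State.putNat_nat, NatExp.eval]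
              · intro e; simp [State.putNat_nat, NatExp.eval, g2]
              · intro e; simp [State.putNat_nat, NatExp.eval, g1]
              · funext x y; simp [State.putReal_real]
              · intro e
                simp [State.putReal_real, State.putNat_nat, NatExp.eval, RealExp.eval, g1, g2, g3.mat]
            · refine Rows.congr (s := s₂) ?_ (by funext x y; simp [State.putNat_nat])
                (by funext x y; simp [State.putNat_nat])
              simpa [State.putNat_nat] using g4
            · funext x y
              simp [State.putReal_real, g5]
            · simp [State.putNat_nat, NatExp.eval]; omega
            · intro _
              simp [State.putNat_nat, NatExp.eval]; omega
          · simp [NatExp.cost, RealExp.cost, Test.cost]; norm_num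
        · have h0 : A i j = 0 := by
            simp only [Test.Holds, RealExp.eval] at hb hx
            rw [hx] at hb
            by_contra h0
            exact hb (mul_self_pos.2 h0)
          refine (Runs.skip ?_).mono (by simp [NatExp.cost, RealExp.cost, Test.cost]; norm_num)
            (fun _ h => h)
          refine ⟨g1, by simp [State.putNat_nat], by simpa [State.putNat_nat] using g2, ?_, ?_, g5, ?_, ?_⟩
          · refine (g3.skip h0).congr (fun a ha => ?_) (fun _ _ => rfl)
            rw [State.putNat_nat_of_ne (by omega)]
          · refine Rows.congr (s := s₂) ?_ (by funext x y; simp [State.putNat_nat])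
                (by funext x y; simp [State.putNat_nat])
            simpa [State.putNat_nat] using g4
          · simpa [State.putNat_nat] using g6
          · rintro ⟨j', hj', hne⟩
            have : j' ≠ j := by rintro rfl; exact hne h0
            simpa [State.putNat_nat] using g7 ⟨j', by omega, hne⟩
      · simp [NatExp.cost]; linarith
      · rintro s₂ ⟨g1, g2, g3, g4, g5, g6, g7⟩
        exact ⟨g2, g3.row, g4, g5, g6, g7⟩
    · rintro s₂ ⟨g1, g2, g3, g4, g5, g6⟩
      refine Runs.branch_last (fun hb => ?_) (fun hb => ?_)
      · simp only [Test.Holds, NatExp.eval] at hb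
        refine Runs.setNat_step <| Runs.setNat_last ?_ ?_
        · obtain ⟨q1, q2, q3, q4⟩ := g3
          refine ⟨by simp [State.putNat_nat, g1], by simp [State.putNat_nat], ?_, ⟨?_, ?_, ?_, ?_⟩, g4⟩
          · refine g2.congr (fun a ha => ?_) (fun _ _ => rfl)
            rw [State.putNat_nat_of_ne (by omega), State.putNat_nat_of_ne (by omega),
              State.putNat_nat_of_ne (by omega)]
          · simp [State.putNat_nat, NatExp.eval]; omega
          · simp [State.putNat_nat, NatExp.eval]; omega
          · intro p hp
            simp only [State.putNat_nat, NatExp.eval] at hp ⊢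
            simp at hp ⊢
            split_ifs with hpe
            · omega
            · have := q3 p (by omega); omega
          · intro i' hi' hex
            simp only [State.putNat_nat, NatExp.eval]
            simp
            by_cases hii : i' = i
            · exact ⟨s₂.nat 12 0 0, by omega, by simp [g1, hii]⟩
            · obtain ⟨p, hp, hp'⟩ := q4 i' (by omega) hex
              exact ⟨p, by omega, by rw [if_neg (by omega), hp']⟩
        · simp [NatExp.cost, Test.cost]; linarith
      · simp only [Test.Holds, NatExp.eval] at hb
        refine (Runs.skip ?_).mono (by simp [NatExp.cost, Test.cost]; linarith) (fun _ h => h)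
        obtain ⟨q1, q2, q3, q4⟩ := g3
        refine ⟨g1, by simp [State.putNat_nat], ?_, Rows.congr (s := s₂) ⟨?_, ?_, ?_, ?_⟩ ?_ ?_, g4⟩
        · refine g2.congr (fun a ha => ?_) (fun _ _ => rfl)
          rw [State.putNat_nat_of_ne (by omega)]
        · omega
        · simp [State.putNat_nat]; omega
        · intro p hp; have := q3 p hp; omega
        · intro i' hi' hex
          by_cases hii : i' = i
          · subst hii; exact absurd (g6 hex) hb
          · exact q4 i' (by omega) hex
        · funext x y; simp [State.putNat_nat]
        · funext x y; simp [State.putNat_nat]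
  · simp [NatExp.cost]
    have : (0 : ℝ) ≤ n := Nat.cast_nonneg n
    nlinarith
  · rintro s' ⟨_, h1, h2, h3⟩
    exact ⟨h1, h2, h3⟩

/-! ### Parameters of the data structure -/

/-- The parameters that are computed at the start: the padded dimension `2 ^ a`, the block length
`T = 2 ^ τ` and the exponent `j` that determines the batch size. -/
structure Conf (ω : ℝ) where
  n : ℕ
  d : ℕ
  a : ℕ
  τ : ℕ
  j : ℕ
  z : ℕ
  A : ℕ → ℕ → ℝ
  d_pos : 1 ≤ d
  d_le_n : d ≤ n
  d_le : d ≤ 2 ^ a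
  le_d : 2 ^ a ≤ 2 * d
  T_le : ((2 : ℝ) ^ τ) ^ (2 * ω + 1) ≤ n * ((2 : ℝ) ^ a) ^ (ω - 1)
  T_ge : n * ((2 : ℝ) ^ a) ^ (ω - 1) ≤ ((2 : ℝ) ^ τ) ^ (2 * ω + 1) * 2 ^ (2 * ω + 1)
  u_ge : (2 : ℝ) ^ a ≤ 2 ^ j * ((2 : ℝ) ^ τ) ^ ω
  u_le : j = 0 ∨ (2 : ℝ) ^ j * ((2 : ℝ) ^ τ) ^ ω < 2 * 2 ^ a
  supp : ∀ i k, ¬ (i < n ∧ k < d) → A i k = 0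

namespace Conf

variable {ω : ℝ} (c : Conf ω)

/-- The number of rounds of a block. -/
def T : ℕ := 2 ^ c.τ

/-- The batch size. -/
def θ : ℕ := min (c.T * 4 ^ c.j) (c.T * c.T)

/-- The number of queries of the solver is not charged for the update of the inverse. -/
def Lazy : Prop := ((2 : ℝ) ^ c.τ) ^ ω * ((2 : ℝ) ^ c.τ) ^ ω < c.z + c.d * c.d

/-- The inverse is represented by a low rank update. -/
def LowRank : Prop := c.T * c.T < 2 ^ c.a

end Conf

open Classical in
/-- The memory holds the parameters and the sparse representation of the matrix. -/
structure Static {ω : ℝ} (c : Conf ω) (s : State) : Prop where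
  dh : s.nat 1 0 0 = 2 ^ c.a
  a : s.nat 2 0 0 = c.a
  T : s.nat 3 0 0 = c.T
  level : s.nat 4 0 0 = 2 * c.τ + 1
  alpha : s.nat 5 0 0 = c.T * c.T + c.T * c.T
  θ : s.nat 6 0 0 = c.θ
  low : s.nat 7 0 0 = if c.LowRank then 1 else 0
  lazy : s.nat 8 0 0 = if c.Lazy then 1 else 0
  z : s.nat 9 0 0 = c.z
  pow : ∀ j ≤ c.a, s.nat 20 j 0 = 2 ^ j
  entries : Entries c.n c.d c.A c.n 0 s
  rows : Rows c.n c.d c.A c.n c.z s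

theorem Static.congr {ω : ℝ} {c : Conf ω} {s s' : State} (h : Static c s)
    (hn : ∀ a, (a < 14 ∨ a = 20) → s'.nat a = s.nat a)
    (hr : ∀ a, (a = 0 ∨ a = 10) → s'.real a = s.real a) : Static c s' := by
  obtain ⟨h1, h2, h3, h4, h5, h6, h7, h8, h9, h10, h11, h12⟩ := h
  constructor
  · rw [hn 1 (by simp), h1]
  · rw [hn 2 (by simp), h2]
  · rw [hn 3 (by simp), h3]
  · rw [hn 4 (by simp), h4]
  · rw [hn 5 (by simp), h5]
  · rw [hn 6 (by simp), h6]
  · rw [hn 7 (by simp), h7]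
  · rw [hn 8 (by simp), h8]
  · rw [hn 9 (by simp), h9]
  · rw [hn 20 (by simp)]; exact h10
  · exact h11.congr (fun a ha => hn a (by omega)) hr
  · exact h12.congr (hn 12 (by simp)) (hn 13 (by simp))

/-- Compute the power of two `V 1 = 2 ^ V 2` and the table of powers. -/
def dimProg : Prog :=
  .seq (setV 1 (.lit 1)) <| .seq (setV 2 (.lit 0)) <| .seq (.setNat 20 (.lit 0) (.lit 0) (.lit 1)) <|
  .loop (.natLt (V 1) eD) <| .seq (setV 1 (.add (V 1) (V 1))) <| .seq (setV 2 (.add (V 2) (.lit 1))) <|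
    .setNat 20 (V 2) (.lit 0) (V 1)

/-- Compute the size `RV 17` of the cost of a restart. -/
noncomputable def sizeProg (ω : ℝ) : Prog :=
  .seq (setRV 17 (.ofNat eN)) <| forP 43 (V 2) <| setRV 17 (.mul (RV 17) (.lit ((2 : ℝ) ^ (ω - 1))))

/-- Compute the block length. -/
noncomputable def lenProg (ω : ℝ) : Prog :=
  .seq (setV 3 (.lit 1)) <| .seq (setV 14 (.lit 1)) <| .seq (setV 4 (.lit 1)) <|
  .seq (setRV 18 (.lit 1)) <| .seq (setRV 19 (.lit 1)) <|
  .loop (.realLt (.mul (RV 18) (.lit ((2 : ℝ) ^ (2 * ω + 1)))) (RV 17)) <|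
    .seq (setV 3 (.add (V 3) (V 3))) <|
    .seq (setV 14 (.add (.add (V 14) (V 14)) (.add (V 14) (V 14)))) <|
    .seq (setV 4 (.add (V 4) (.lit 2))) <|
    .seq (setRV 18 (.mul (RV 18) (.lit ((2 : ℝ) ^ (2 * ω + 1))))) <|
    setRV 19 (.mul (RV 19) (.lit ((2 : ℝ) ^ ω)))

/-- Compute the flags. -/
def flagProg : Prog :=
  .seq (setV 5 (.add (V 14) (V 14))) <| .seq (setV 7 (.lit 0)) <|
  .seq (.branch (.natLt (V 14) (V 1)) (setV 7 (.lit 1)) .skip) <| .seq (setV 8 (.lit 0)) <|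
  .branch (.realLt (.mul (RV 19) (RV 19)) (.add (.ofNat (V 9)) (.mul (.ofNat eD) (.ofNat eD))))
    (setV 8 (.lit 1)) .skip

/-- Compute the batch size. -/
def batchProg : Prog :=
  .seq (setV 6 (V 3)) <| .seq (setRV 21 (RV 19)) <|
  .seq (.loop (.realLt (RV 21) (.ofNat (V 1))) <|
    .seq (setV 6 (.add (.add (V 6) (V 6)) (.add (V 6) (V 6)))) <|
    setRV 21 (.add (RV 21) (RV 21))) <|
  .branch (.natLt (V 14) (V 6)) (setV 6 (V 14)) .skip

/-! ### Correctness and cost of the initial computations -/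

theorem runs_dimProg {ρ : Tape} {s : State} {d : ℕ} (hd : s.nat 0 0 1 = d) (hd1 : 1 ≤ d) :
    Runs ρ dimProg s (100 * d + 100) (fun s' => ∃ a, s'.nat 1 0 0 = 2 ^ a ∧ s'.nat 2 0 0 = a ∧
      (∀ j ≤ a, s'.nat 20 j 0 = 2 ^ j) ∧ d ≤ 2 ^ a ∧ 2 ^ a ≤ 2 * d ∧ a ≤ d) := by
  refine Runs.setNat_step <| Runs.setNat_step <| Runs.setNat_step ?_
  refine (Runs.while_le (I := fun a s' => s'.nat 0 0 1 = d ∧ s'.nat 1 0 0 = 2 ^ a ∧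
    s'.nat 2 0 0 = a ∧ (∀ j ≤ a, s'.nat 20 j 0 = 2 ^ j) ∧ 2 ^ a ≤ 2 * d) d (B := 50) (k := 0)
    (by norm_num) ?_ ?_ (Nat.zero_le _)).mono ?_ ?_
  · rintro a s₁ ⟨h0, h1, h2, h3, h4⟩ hb
    simp only [Test.Holds, NatExp.eval, h0, h1] at hb
    -- a < 2^a < d: at most d doublings, which fits into the budget of the setup.
    refine ⟨a.lt_two_pow_self.trans hb, ?_⟩
    refine Runs.setNat_step <| Runs.setNat_step <| Runs.setNat_last ⟨?_, ?_, ?_, ?_, ?_⟩ ?_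
    · simp [State.putNat_nat, h0]
    · simp [State.putNat_nat, NatExp.eval, h1, pow_succ]; ring
    · simp [State.putNat_nat, NatExp.eval, h2]
    · intro j hj
      simp only [State.putNat_nat, NatExp.eval]
      simp only [h2, h1]
      by_cases hja : j = a + 1
      · subst hja; simp [pow_succ]; ring
      · simp [hja, h3 j (by omega)]
    · rw [pow_succ]; omega
    · simp [NatExp.cost]; norm_num
  · refine ⟨by simp [State.putNat_nat, hd], by simp [State.putNat_nat, NatExp.eval],
      by simp [State.putNat_nat, NatExp.eval], ?_, by omega⟩
    intro j hj
    obtain rfl : j = 0 := by omega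
    simp [State.putNat_nat, NatExp.eval]
  · simp [NatExp.cost, Test.cost]
    linarith [Nat.cast_nonneg (α := ℝ) d]
  · rintro s' ⟨a, ha, -, ⟨h0, h1, h2, h3, h4⟩, hb⟩
    simp only [Test.Holds, NatExp.eval, h0, h1, not_lt] at hb
    exact ⟨a, h1, h2, h3, hb, h4, ha⟩

/-- The machine has no real powers. Since the padded dimension is a power of two, repeated
multiplication by the constant 2^(ω-1) replaces them. -/
theorem runs_sizeProg {ρ : Tape} {s : State} {ω : ℝ} {n a : ℕ} (hn : s.nat 0 0 0 = n)
    (ha : s.nat 2 0 0 = a) :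
    Runs ρ (sizeProg ω) s (100 * a + 100)
      (fun s' => s'.real 17 0 0 = n * ((2 : ℝ) ^ a) ^ (ω - 1)) := by
  refine Runs.setReal_step ?_
  refine (Runs.forP (N := a) (B := 30) (I := fun k s' => s'.nat 43 0 0 = k ∧ s'.nat 2 0 0 = a ∧
    s'.real 17 0 0 = n * ((2 : ℝ) ^ k) ^ (ω - 1)) (by norm_num) ?_ ?_ ?_).mono ?_ ?_
  · simp [State.putNat_nat, State.putReal_real, RealExp.eval, NatExp.eval, hn, ha]
  · rintro k s₁ ⟨h1, h2, _⟩
    exact ⟨h1, h2⟩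
  · rintro k hk s₁ ⟨h1, h2, h3⟩
    refine Runs.setReal_last ⟨h1, ?_, ?_, ?_⟩ ?_
    · simp [State.putNat_nat]
    · simp [State.putNat_nat, h2]
    · simp [State.putReal_real, RealExp.eval, NatExp.eval, h3, pow_succ]
      rw [Real.mul_rpow (by positivity) (by norm_num), mul_assoc]
    · simp [NatExp.cost, RealExp.cost]; norm_num
  · simp [NatExp.cost, RealExp.cost]
    linarith [Nat.cast_nonneg (α := ℝ) a]
  · rintro s' ⟨_, _, h⟩
    exact h

/-- T is doubled as long as (2T)^(2ω+1) stays below n D^(ω-1), so on exit the two quantities agree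
up to the factor 2^(2ω+1). There are at most n + a doublings because n ≤ 2^n. -/
theorem runs_lenProg {ρ : Tape} {s : State} {ω : ℝ} {n a : ℕ} (hω : 2 ≤ ω) (hn : 1 ≤ n)
    (h17 : s.real 17 0 0 = n * ((2 : ℝ) ^ a) ^ (ω - 1)) :
    Runs ρ (lenProg ω) s (200 * (n + a) + 200) (fun s' => ∃ τ, s'.nat 3 0 0 = 2 ^ τ ∧
      s'.nat 14 0 0 = 2 ^ τ * 2 ^ τ ∧ s'.nat 4 0 0 = 2 * τ + 1 ∧
      s'.real 19 0 0 = ((2 : ℝ) ^ τ) ^ ω ∧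
      ((2 : ℝ) ^ τ) ^ (2 * ω + 1) ≤ n * ((2 : ℝ) ^ a) ^ (ω - 1) ∧
      n * ((2 : ℝ) ^ a) ^ (ω - 1) ≤ ((2 : ℝ) ^ τ) ^ (2 * ω + 1) * 2 ^ (2 * ω + 1)) := by
  have hn' : (1 : ℝ) ≤ n := by exact_mod_cast hn
  have h1a : 1 ≤ ((2 : ℝ) ^ a) ^ (ω - 1) :=
    Real.one_le_rpow (one_le_pow₀ (by norm_num)) (by linarith)
  refine Runs.setNat_step <| Runs.setNat_step <| Runs.setNat_step <| Runs.setReal_step <|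
    Runs.setReal_step ?_
  refine (Runs.while_le (I := fun τ s' => s'.real 17 0 0 = n * ((2 : ℝ) ^ a) ^ (ω - 1) ∧
      s'.nat 3 0 0 = 2 ^ τ ∧
      s'.nat 14 0 0 = 2 ^ τ * 2 ^ τ ∧ s'.nat 4 0 0 = 2 * τ + 1 ∧
      s'.real 18 0 0 = ((2 : ℝ) ^ τ) ^ (2 * ω + 1) ∧ s'.real 19 0 0 = ((2 : ℝ) ^ τ) ^ ω ∧
      ((2 : ℝ) ^ τ) ^ (2 * ω + 1) ≤ n * ((2 : ℝ) ^ a) ^ (ω - 1)) (n + a) (B := 120) (k := 0)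
    (by norm_num) ?_ ?_ (Nat.zero_le _)).mono ?_ ?_
  · rintro τ s₁ ⟨h0, h1, h2, h3, h4, h5, h6⟩ hb
    simp only [Test.Holds, RealExp.eval, NatExp.eval, h0, h4] at hb
    have hb' : ((2 : ℝ) ^ (τ + 1)) ^ (2 * ω + 1) < n * ((2 : ℝ) ^ a) ^ (ω - 1) := by
      rwa [pow_succ, Real.mul_rpow (by positivity) (by norm_num)]
    refine ⟨?_, ?_⟩
    · have h2n : (n : ℝ) ≤ 2 ^ (n : ℝ) := by
        rw [Real.rpow_natCast]; exact_mod_cast (Nat.lt_two_pow_self (n := n)).le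
      have : (2 : ℝ) ^ (((τ + 1 : ℕ) : ℝ) * (2 * ω + 1)) < 2 ^ ((n : ℝ) + a * (ω - 1)) := by
        have e : ∀ (k : ℕ) (y : ℝ), (2 : ℝ) ^ ((k : ℝ) * y) = (2 ^ k) ^ y := fun k y => by
          rw [Real.rpow_mul (by norm_num), Real.rpow_natCast]
        rw [Real.rpow_add (by norm_num) (n : ℝ), e, e]
        exact hb'.trans_le (mul_le_mul_of_nonneg_right h2n (by positivity))
      rw [Real.rpow_lt_rpow_left_iff (by norm_num)] at this
      push_cast at this
      have h3 : ((τ : ℝ)) < n + a := by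
        by_contra hc
        push Not at hc
        have : ((n : ℝ) + a) * (2 * ω + 1) ≤ τ * (2 * ω + 1) :=
          mul_le_mul_of_nonneg_right hc (by linarith)
        nlinarith [Nat.cast_nonneg (α := ℝ) a, Nat.cast_nonneg (α := ℝ) n]
      exact_mod_cast h3
    · refine Runs.setNat_step <| Runs.setNat_step <| Runs.setNat_step <| Runs.setReal_step <|
        Runs.setReal_last ⟨?_, ?_, ?_, ?_, ?_, ?_, hb'.le⟩ ?_
      · simp [State.putReal_real, h0]
      · simp [State.putNat_nat, NatExp.eval, h1]; ring
      · simp [State.putNat_nat, NatExp.eval, h2]; ring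
      · simp [State.putNat_nat, NatExp.eval, h3]; ring
      · simp [State.putReal_real, RealExp.eval, NatExp.eval, h4, pow_succ]
        rw [Real.mul_rpow (by positivity) (by norm_num)]
      · simp [State.putReal_real, RealExp.eval, NatExp.eval, h5, pow_succ]
        rw [Real.mul_rpow (by positivity) (by norm_num)]
      · simp [NatExp.cost, RealExp.cost]; norm_num
  · simp [State.putReal_real, State.putNat_nat, NatExp.eval, RealExp.eval, h17]
    nlinarith
  · simp [NatExp.cost, RealExp.cost, Test.cost]
    linarith [Nat.cast_nonneg (α := ℝ) a, Nat.cast_nonneg (α := ℝ) n]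
  · rintro s' ⟨τ, -, -, ⟨h0, h1, h2, h3, h4, h5, h6⟩, hb⟩
    simp only [Test.Holds, RealExp.eval, NatExp.eval, h0, h4, not_lt] at hb
    exact ⟨τ, h1, h2, h3, h5, h6, hb⟩

open Classical in
theorem runs_flagProg {ρ : Tape} {s : State} {S dh z d : ℕ} {t : ℝ} (h14 : s.nat 14 0 0 = S)
    (h1 : s.nat 1 0 0 = dh) (h9 : s.nat 9 0 0 = z) (hd : s.nat 0 0 1 = d)
    (h19 : s.real 19 0 0 = t) :
    Runs ρ flagProg s 100 (fun s' => s'.nat 5 0 0 = S + S ∧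
      s'.nat 7 0 0 = (if S < dh then 1 else 0) ∧
      s'.nat 8 0 0 = (if t * t < z + d * d then 1 else 0)) := by
  refine Runs.setNat_step <| Runs.setNat_step <| Runs.step (B₁ := 20) (Q' := fun s₁ =>
    (∀ a, a ≠ 5 → a ≠ 7 → s₁.nat a = s.nat a) ∧ s₁.nat 5 0 0 = S + S ∧ s₁.real = s.real ∧
    s₁.nat 7 0 0 = (if S < dh then 1 else 0)) ?_ ?_
  · refine Runs.branch_last (fun hb => Runs.setNat_last ?_ ?_) (fun hb => (Runs.skip ?_).mono ?_
      fun _ h => h)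
    · simp [Test.Holds, State.putNat_nat, NatExp.eval, h14, h1] at hb
      refine ⟨fun a h5 h7 => ?_, ?_, rfl, ?_⟩
      · rw [State.putNat_nat_of_ne h7, State.putNat_nat_of_ne h7, State.putNat_nat_of_ne h5]
      · simp [State.putNat_nat, NatExp.eval, h14]
      · simp [State.putNat_nat, NatExp.eval, hb]
    · simp [NatExp.cost, Test.cost]; norm_num
    · simp [Test.Holds, State.putNat_nat, NatExp.eval, h14, h1] at hb
      refine ⟨fun a h5 h7 => ?_, ?_, rfl, ?_⟩
      · rw [State.putNat_nat_of_ne h7, State.putNat_nat_of_ne h5]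
      · simp [State.putNat_nat, NatExp.eval, h14]
      · simp [State.putNat_nat, NatExp.eval, not_lt.2 hb]
    · simp [NatExp.cost, Test.cost]; norm_num
  rintro s₁ ⟨g1, g2, g3, g4⟩
  refine Runs.setNat_step ?_
  have e9 : s₁.nat 9 = s.nat 9 := g1 9 (by norm_num) (by norm_num)
  have e0 : s₁.nat 0 = s.nat 0 := g1 0 (by norm_num) (by norm_num)
  refine Runs.branch_last (fun hb => Runs.setNat_last ⟨?_, ?_, ?_⟩ ?_) (fun hb =>
    (Runs.skip ⟨?_, ?_, ?_⟩).mono ?_ fun _ h => h)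
  · simp [State.putNat_nat, g2]
  · simp [State.putNat_nat, g4]
  · simp [Test.Holds, State.putNat_nat, NatExp.eval, RealExp.eval, g3, h19, e9, e0, h9, hd] at hb
    simp [State.putNat_nat, NatExp.eval, hb]
  · simp [NatExp.cost, RealExp.cost, Test.cost]; norm_num
  · simp [NatExp.cost, RealExp.cost, Test.cost]; norm_num
  · simp [State.putNat_nat, g2]
  · simp [State.putNat_nat, g4]
  · simp [Test.Holds, State.putNat_nat, NatExp.eval, RealExp.eval, g3, h19, e9, e0, h9, hd] at hb
    simp [State.putNat_nat, NatExp.eval, not_lt.2 hb]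

/-- `j` is the least exponent with D ≤ 2^j T^ω, which is what the alternative `j = 0` or 2^j T^ω <
2D expresses. The batch size T · 4^j is capped at T². -/
theorem runs_batchProg {ρ : Tape} {s : State} {T S a : ℕ} {t : ℝ} (h3 : s.nat 3 0 0 = T)
    (h14 : s.nat 14 0 0 = S) (h1 : s.nat 1 0 0 = 2 ^ a) (h19 : s.real 19 0 0 = t) (ht : 1 ≤ t) :
    Runs ρ batchProg s (100 * a + 100) (fun s' => ∃ j, s'.nat 6 0 0 = min (T * 4 ^ j) S ∧
      (2 : ℝ) ^ a ≤ 2 ^ j * t ∧ (j = 0 ∨ (2 : ℝ) ^ j * t < 2 * 2 ^ a)) := by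
  refine Runs.setNat_step <| Runs.setReal_step <| Runs.step (Runs.while_le
    (I := fun j s' => s'.nat 14 0 0 = S ∧ s'.nat 1 0 0 = 2 ^ a ∧ s'.nat 6 0 0 = T * 4 ^ j ∧
      s'.real 21 0 0 = 2 ^ j * t ∧ (j = 0 ∨ (2 : ℝ) ^ j * t < 2 * 2 ^ a)) a (B := 70) (k := 0)
    (by norm_num) ?_ ?_ (Nat.zero_le _)) ?_
  · rintro j s₁ ⟨g1, g2, g3, g4, g5⟩ hb
    simp only [Test.Holds, RealExp.eval, NatExp.eval, g4, g2] at hb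
    push_cast at hb
    refine ⟨?_, Runs.setNat_step <| Runs.setReal_last ⟨?_, ?_, ?_, ?_, ?_⟩ ?_⟩
    · have : (2 : ℝ) ^ j < 2 ^ a := lt_of_le_of_lt (le_mul_of_one_le_right (by positivity) ht) hb
      exact (pow_lt_pow_iff_right₀ (by norm_num)).1 this
    · simp [State.putNat_nat, g1]
    · simp [State.putNat_nat, g2]
    · simp [State.putNat_nat, NatExp.eval, g3]; ring
    · simp [State.putReal_real, RealExp.eval, NatExp.eval, g4]; ring
    · right; rw [pow_succ]; linarith
    · simp [NatExp.cost, RealExp.cost]; norm_num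
  · simp [State.putReal_real, State.putNat_nat, RealExp.eval, NatExp.eval, h14, h1, h3, h19]
  rintro s₁ ⟨j, -, -, ⟨g1, g2, g3, g4, g5⟩, hb⟩
  simp only [Test.Holds, RealExp.eval, NatExp.eval, g4, g2, not_lt] at hb
  push_cast at hb
  refine Runs.branch_last (fun hc => Runs.setNat_last ⟨j, ?_, hb, g5⟩ ?_) (fun hc =>
    (Runs.skip ⟨j, ?_, hb, g5⟩).mono ?_ fun _ h => h)
  · simp only [Test.Holds, NatExp.eval, g1, g3] at hc
    simp [State.putNat_nat, NatExp.eval, g1, min_eq_right hc.le]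
  · simp [NatExp.cost, RealExp.cost, Test.cost]
    linarith [Nat.cast_nonneg (α := ℝ) a]
  · simp [NatExp.cost, RealExp.cost, Test.cost]
    linarith [Nat.cast_nonneg (α := ℝ) a]
  · simp only [Test.Holds, NatExp.eval, g1, g3, not_lt] at hc
    rw [g3, min_eq_left hc]

/-- The computations that are done once. -/
noncomputable def setupProg (ω : ℝ) : Prog :=
  .seq nnzProg <| .seq dimProg <| .seq (sizeProg ω) <| .seq (lenProg ω) <| .seq flagProg batchProg

theorem runs_setupProg {ρ : Tape} {s : State} {ω : ℝ} (hω : 2 ≤ ω) {n d : ℕ} {A : ℕ → ℕ → ℝ}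
    (hn : s.nat 0 0 0 = n) (hd : s.nat 0 0 1 = d) (hA : s.real 0 = A) (hd1 : 1 ≤ d) (hdn : d ≤ n)
    (hsupp : ∀ i k, ¬ (i < n ∧ k < d) → A i k = 0) :
    Runs ρ (setupProg ω) s (2000 * n * d) (fun s' => ∃ c : Conf ω, c.n = n ∧ c.d = d ∧ c.A = A ∧
      Static c s' ∧ s'.real 1 = s.real 1) := by
  refine Runs.step (runs_nnzProg hn hd hA) ?_
  rintro s₁ ⟨e1, r1, f1⟩
  refine Runs.step (runs_dimProg e1.d_eq hd1).frame ?_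
  rintro s₂ ⟨⟨a, a1, a2, a3, a4, a5, a6⟩, f2⟩
  have e2 : Entries n d A n 0 s₂ := by
    refine e1.congr (fun b hb => f2.nat b ?_) (fun b hb => f2.real b ?_) <;>
      simp [dimProg, Prog.WritesNat, Prog.WritesReal] <;> omega
  refine Runs.step (runs_sizeProg e2.n_eq a2).frame ?_
  rintro s₃ ⟨h17, f3⟩
  refine Runs.step (runs_lenProg hω (hd1.trans hdn) h17).frame ?_
  rintro s₄ ⟨⟨τ, t3, t14, t4, t19, tl, tg⟩, f4⟩
  have n4 : ∀ b, (b < 3 ∨ (4 < b ∧ b < 14) ∨ b = 20) → s₄.nat b = s₂.nat b := by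
    intro b hb
    rw [f4.nat b (by simp [lenProg, Prog.WritesNat]; omega),
      f3.nat b (by simp [sizeProg, forP, Prog.WritesNat]; omega)]
  have r4 : ∀ b, b < 17 → s₄.real b = s₂.real b := by
    intro b hb
    rw [f4.real b (by simp [lenProg, Prog.WritesReal]; omega),
      f3.real b (by simp [sizeProg, forP, Prog.WritesReal]; omega)]
  refine Runs.step (runs_flagProg (S := 2 ^ τ * 2 ^ τ) (dh := 2 ^ a) (z := s₁.nat 9 0 0) (d := d)
    t14 (by rw [n4 1 (by simp), a1]) (by
      rw [n4 9 (by simp), f2.nat 9 (by simp [dimProg, Prog.WritesNat])])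
    (by rw [n4 0 (by simp), e2.d_eq]) t19).frame ?_
  rintro s₅ ⟨⟨b5, b7, b8⟩, f5⟩
  have n5 : ∀ b, b ≠ 5 → b ≠ 7 → b ≠ 8 → s₅.nat b = s₄.nat b := by
    intro b hb hb' hb''
    rw [f5.nat b (by simp [flagProg, Prog.WritesNat]; omega)]
  have r5 : ∀ b, s₅.real b = s₄.real b := fun b => f5.real b (by simp [flagProg, Prog.WritesReal])
  refine (runs_batchProg (s := s₅) (T := 2 ^ τ) (S := 2 ^ τ * 2 ^ τ) (a := a)
    (t := ((2 : ℝ) ^ τ) ^ ω) (by rw [n5 3 (by simp) (by simp) (by simp), t3])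
    (by rw [n5 14 (by simp) (by simp) (by simp), t14])
    (by rw [n5 1 (by simp) (by simp) (by simp), n4 1 (by simp), a1]) (by rw [r5, t19])
    (Real.one_le_rpow (one_le_pow₀ (by norm_num)) (by linarith))).frame.mono ?_ ?_
  · have h1 : (1 : ℝ) ≤ d := by exact_mod_cast hd1
    have h2 : (d : ℝ) ≤ n := by exact_mod_cast hdn
    have h3 : (a : ℝ) ≤ d := by exact_mod_cast a6
    have h4 : (n : ℝ) ≤ n * d := le_mul_of_one_le_right (by linarith) h1
    linarith
  rintro s₆ ⟨⟨j, j6, ju, jl⟩, f6⟩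
  have n6 : ∀ b, b ≠ 6 → s₆.nat b = s₅.nat b := by
    intro b hb
    rw [f6.nat b (by simp [batchProg, Prog.WritesNat]; omega)]
  have r6 : ∀ b, b < 17 → s₆.real b = s₂.real b := by
    intro b hb
    rw [f6.real b (by simp [batchProg, Prog.WritesReal]; omega), r5, r4 b hb]
  have nn : ∀ b, (b < 3 ∨ (8 < b ∧ b < 14) ∨ b = 20) → s₆.nat b = s₂.nat b := by
    intro b hb
    rw [n6 b (by omega), n5 b (by omega) (by omega) (by omega), n4 b (by omega)]
  have nz : s₆.nat 9 = s₁.nat 9 := by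
    rw [nn 9 (by simp), f2.nat 9 (by simp [dimProg, Prog.WritesNat])]
  refine ⟨⟨n, d, a, τ, j, s₁.nat 9 0 0, A, hd1, hdn, a4, a5, tl, tg, ju, jl, hsupp⟩, rfl, rfl, rfl,
    ⟨?_, ?_, ?_, ?_, ?_, ?_, ?_, ?_, ?_, ?_, ?_, ?_⟩, ?_⟩
  · rw [nn 1 (by simp), a1]
  · rw [nn 2 (by simp), a2]
  · rw [n6 3 (by simp), n5 3 (by simp) (by simp) (by simp), t3]; rfl
  · rw [n6 4 (by simp), n5 4 (by simp) (by simp) (by simp), t4]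
  · rw [n6 5 (by simp), b5]; rfl
  · rw [j6]; rfl
  · rw [n6 7 (by simp), b7]; classical exact if_congr Iff.rfl rfl rfl
  · rw [n6 8 (by simp), b8]; classical exact if_congr Iff.rfl rfl rfl
  · rw [nz]
  · rw [nn 20 (by simp)]; exact a3
  · exact e2.congr (fun b hb => nn b (by omega)) (fun b hb => r6 b (by omega))
  · refine r1.congr ?_ ?_
    · rw [nn 12 (by simp), f2.nat 12 (by simp [dimProg, Prog.WritesNat])]
    · rw [nn 13 (by simp), f2.nat 13 (by simp [dimProg, Prog.WritesNat])]
  · rw [r6 1 (by simp), f2.real 1 (by simp [dimProg, Prog.WritesReal]), f1]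

/-! ### Start of a block -/

theorem nb_ceil {M : ℕ} (hM : 1 ≤ M) (L k : ℕ) : k * M < L ↔ k < (L + M - 1) / M := by
  rw [Nat.lt_div_iff_mul_lt (by omega)]
  omega

theorem le_ceil_mul {M : ℕ} (hM : 1 ≤ M) (L : ℕ) : L ≤ (L + M - 1) / M * M := by
  by_contra h
  push Not at h
  exact lt_irrefl _ ((nb_ceil hM L _).1 h)

theorem ceil_mul_le {M : ℕ} (L : ℕ) : (L + M - 1) / M * M ≤ L + M :=
  (Nat.div_mul_le_self _ _).trans (by omega)

theorem sum_range_of_supp {m k : ℕ} (h : m ≤ k) {f : ℕ → ℝ} (hf : ∀ l, m ≤ l → f l = 0) :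
    ∑ l ∈ Finset.range k, f l = ∑ l ∈ Finset.range m, f l :=
  (Finset.sum_subset (Finset.range_mono h) fun l _ hl =>
    hf l (by simpa using hl)).symm

/-- The entry `(i, j)` of `Aᵀ diag(w) A`. -/
noncomputable def Conf.q {ω : ℝ} (c : Conf ω) (w : ℕ → ℝ) (i j : ℕ) : ℝ :=
  ∑ l ∈ Finset.range c.n, w l * c.A l i * c.A l j

/-- Extension of a `d × d` matrix by an identity block. -/
noncomputable def padId (d : ℕ) (f : ℕ → ℕ → ℝ) (i j : ℕ) : ℝ := f i j + if i = j ∧ d ≤ i then 1 else 0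

/-- The indicator of `i = j ∧ d ≤ i`. -/
abbrev padInd (i j : NatExp) : RealExp :=
  .ofNat (.sub (.sub (.lit 1) (.add (.sub i j) (.sub j i))) (.sub eD i))

/-- Truncated subtraction produces indicators without branching: (i − j) + (j − i) vanishes only for
i = j, and d − i only for d ≤ i. -/
theorem eval_padInd {s : State} {i j d : ℕ} {e f : NatExp} (he : e.eval s = i) (hf : f.eval s = j)
    (hd : s.nat 0 0 1 = d) :
    (padInd e f).eval s = if i = j ∧ d ≤ i then 1 else 0 := by
  simp only [RealExp.eval, NatExp.eval, he, hf, hd]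
  split_ifs with h
  · have : (1 - (i - j + (j - i)) - (d - i)) = 1 := by omega
    rw [this]; norm_num
  · have : (1 - (i - j + (j - i)) - (d - i)) = 0 := by omega
    rw [this]; norm_num

namespace Mul

variable (μ : Mul)

/-- Real array `15` becomes the inverse of the padded matrix `e`. -/
def padInvProg (e : RealExp) : Prog :=
  .seq (assign2 13 (.add (.lit 0) (V 80)) (.add (.lit 0) (V 81)) (V 1) (V 1)
    (.add e (padInd (V 80) (V 81)))) <|
  .seq (setV 38 (V 1)) <| .seq (setV 39 (V 2)) μ.invProg

theorem runs_padInvProg {ρ : Tape} {s : State} {c : Conf μ.ω} (hs : Static c s) {e : RealExp}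
    (f : ℕ → ℕ → ℝ) (he : e.cost ≤ 50)
    (hf : ∀ i < 2 ^ c.a, ∀ j < 2 ^ c.a, ∀ s₁, Agr 13 s s₁ → s₁.nat 80 0 0 = i → s₁.nat 81 0 0 = j →
      e.eval s₁ = f i j) (hdet : IsUnit (blk (padId c.d f) 0 0 (2 ^ c.a)).det) :
    Runs ρ (μ.padInvProg e) s (32 * μ.K * (c.a + 1) * ((2 : ℝ) ^ c.a) ^ μ.ω) (fun s' =>
      (∀ a < 80, a < 30 → s'.nat a = s.nat a) ∧
      (∀ a < 80, (a < 13 ∨ 16 < a) → s'.real a = s.real a) ∧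
      blk (s'.real 15) 0 0 (2 ^ c.a) = (blk (padId c.d f) 0 0 (2 ^ c.a))⁻¹) := by
  have hm : 1 ≤ 2 ^ c.a := Nat.one_le_two_pow
  refine Runs.step (runs_assign_blk 0 0 (2 ^ c.a) (padId c.d f) ?_ (by simp [NatExp.cost])
    (by simp [NatExp.cost]) (by simp [NatExp.cost]) ?_ hm ?_) ?_
  · intro s₁ h; simp [NatExp.eval, h.nat, hs.dh]
  · simp [NatExp.cost, RealExp.cost]; omega
  · intro i hi j hj s₁ h h1 h2 _
    have h3 := eval_padInd (s := s₁) (e := V 80) (f := V 81) (i := i) (j := j) (d := c.d) h1 h2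
      (by rw [h.nat 0 (by norm_num) (by norm_num), hs.entries.d_eq])
    have h4 := hf i hi j hj s₁ h h1 h2
    unfold padId
    rw [← h3, ← h4]; rfl
  rintro s₁ ⟨a1, p1, -⟩
  refine Runs.setNat_step <| Runs.setNat_step ?_
  have b1 : blk (s₁.real 13) 0 0 (2 ^ c.a) = blk (padId c.d f) 0 0 (2 ^ c.a) := by
    ext ⟨i, hi⟩ ⟨j, hj⟩
    have e : (blk (s₁.real 13) 0 0 (2 ^ c.a)) ⟨i, hi⟩ ⟨j, hj⟩ = s₁.real 13 (0 + i) (0 + j) := rfl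
    rw [e, p1 i hi j hj]; simp [blk]
  have n1 : ∀ a < 30, s₁.nat a = s.nat a := fun a ha => a1.nat a (by omega) (by omega)
  refine (μ.runs_invProg c.a ?_ ?_ ?_ ?_).mono ?_ ?_
  · simp [State.putNat_nat, NatExp.eval, n1, hs.dh]
  · simp [State.putNat_nat, NatExp.eval, n1, hs.a]
  · intro j hj
    simp [State.putNat_nat, n1, hs.pow j hj.le]
  · simp only [State.putNat_real]
    rw [b1]; exact hdet
  · have h1 := μ.sq_le (2 ^ c.a)
    have h2 := μ.K_ge
    push_cast at h1 ⊢
    have h3 : (1 : ℝ) ≤ (2 ^ c.a) ^ 2 := one_le_pow₀ (one_le_pow₀ (by norm_num))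
    set X := ((2 : ℝ) ^ c.a) ^ μ.ω
    have h4 : 3000 * X ≤ μ.K * X := mul_le_mul_of_nonneg_right h2 (by linarith)
    have h5 : 0 ≤ μ.K * X * c.a := by
      have : 0 ≤ μ.K * X := by linarith
      positivity
    simp [NatExp.cost]
    nlinarith
  · rintro s₂ ⟨g1, g2, g3⟩
    simp only [State.putNat_real] at g2 g3
    refine ⟨fun a ha ha' => ?_, fun a ha ha' => ?_, ?_⟩
    · rw [g1 a ha (by omega), State.putNat_nat_of_ne (by omega), State.putNat_nat_of_ne (by omega),
        n1 a ha']
    · rw [g2 a ha (by omega) (by omega) (by omega), a1.real a (by omega)]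
    · rw [g3, b1]

/-- Real array `6` becomes `Aᵀ diag(w) A`. -/
def gramProg : Prog :=
  .seq (μ.prod (V 1) eN (fun i l => .mul (.get 1 l (.lit 0)) (.get 0 l i)) (fun l j => .get 0 l j)) <|
  assign2 6 (.add (.lit 0) (V 80)) (.add (.lit 0) (V 81)) (V 1) (V 1) (.get 80 (V 80) (V 81))

end Mul

/-- The cost of a restart. -/
noncomputable def Conf.size {ω : ℝ} (c : Conf ω) : ℝ := c.n * ((2 : ℝ) ^ c.a) ^ (ω - 1)

namespace Conf

variable {ω : ℝ} (c : Conf ω)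

theorem dh_cast : ((2 ^ c.a : ℕ) : ℝ) = (2 : ℝ) ^ c.a := by push_cast; rfl

theorem n_pos : (1 : ℝ) ≤ c.n := by exact_mod_cast c.d_pos.trans c.d_le_n

theorem dh_pow (c : Conf ω) : ((2 : ℝ) ^ c.a) ^ ω = (2 : ℝ) ^ c.a * ((2 : ℝ) ^ c.a) ^ (ω - 1) := by
  rw [Real.rpow_sub_one (by positivity)]; field_simp

theorem dh_le : (2 : ℝ) ^ c.a ≤ 2 * c.n := by
  have : 2 ^ c.a ≤ 2 * c.n := c.le_d.trans (Nat.mul_le_mul_left _ c.d_le_n)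
  exact_mod_cast this

theorem pow_le_size : ((2 : ℝ) ^ c.a) ^ ω ≤ 2 * c.size := by
  rw [dh_pow, size, ← mul_assoc]
  exact mul_le_mul_of_nonneg_right c.dh_le (by positivity)

theorem n_le_size (hω : 2 ≤ ω) : (c.n : ℝ) ≤ c.size :=
  le_mul_of_one_le_right (by positivity)
    (Real.one_le_rpow (one_le_pow₀ (by norm_num)) (by linarith))

/-- ⌈n / D⌉ products of D × D matrices cost at most (n + D) D^(ω-1), and D ≤ 2d ≤ 2n. -/
theorem blocks_mul_le : (((c.n + 2 ^ c.a - 1) / 2 ^ c.a : ℕ) : ℝ) * ((2 : ℝ) ^ c.a) ^ ω ≤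
    3 * c.size := by
  have h1 := ceil_mul_le (M := 2 ^ c.a) c.n
  have h2 : (((c.n + 2 ^ c.a - 1) / 2 ^ c.a : ℕ) : ℝ) * (2 : ℝ) ^ c.a ≤ c.n + (2 : ℝ) ^ c.a := by
    exact_mod_cast h1
  rw [dh_pow, size, ← mul_assoc, ← mul_assoc]
  exact mul_le_mul_of_nonneg_right (by linarith [c.dh_le]) (by positivity)

end Conf

namespace Mul

variable (μ : Mul)

theorem runs_gramProg {ρ : Tape} {s : State} {c : Conf μ.ω} (hs : Static c s) (w : ℕ → ℝ)
    (hw : ∀ i < c.n, s.real 1 i 0 = w i) :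
    Runs ρ μ.gramProg s (6 * μ.K * c.size) (fun s' => (∀ b < 80, s'.nat b = s.nat b) ∧
      (∀ b < 80, b ≠ 6 → s'.real b = s.real b) ∧ ∀ i < 2 ^ c.a, ∀ j < 2 ^ c.a, s'.real 6 i j = c.q w i j) := by
  have hm : 1 ≤ 2 ^ c.a := Nat.one_le_two_pow
  refine Runs.step (μ.runs_prod (2 ^ c.a) c.n _ (fun i l => s.real 1 l 0 * c.A l i)
    (fun l j => c.A l j) hm (nb_ceil hm c.n) ?_ ?_ ?_ (by simp [NatExp.cost])
    (by simp [NatExp.cost]) (by simp [NatExp.cost, RealExp.cost])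
    (by simp [NatExp.cost, RealExp.cost])) ?_
  · intro s₁ l; simp [NatExp.eval, l.nat, hs.dh, hs.entries.n_eq]
  · intro s₁ l e₁ e₂; simp [RealExp.eval, NatExp.eval, l.real, hs.entries.mat]
  · intro s₁ l e₁ e₂; simp [RealExp.eval, l.real, hs.entries.mat]
  rintro s₁ ⟨l1, p1⟩
  refine (runs_assign_blk 0 0 (2 ^ c.a) (fun i j => s₁.real 80 i j) ?_ (by simp [NatExp.cost])
    (by simp [NatExp.cost]) (by simp [NatExp.cost]) (by simp [NatExp.cost, RealExp.cost]) hm ?_).mono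
    ?_ ?_
  · intro s₁ h; simp [NatExp.eval, h.nat, l1.nat, hs.dh]
  · intro i hi j hj s₂ g g1 g2 _; simp [NatExp.eval, RealExp.eval, g.real, g1, g2]
  · have h1 := μ.sq_le (2 ^ c.a)
    have h2 := μ.K_ge
    have h3 := c.pow_le_size
    have h4 := c.blocks_mul_le
    rw [c.dh_cast] at h1 ⊢
    have h6 : 0 ≤ c.size := by linarith [c.n_le_size μ.two_le, c.n_pos]
    nlinarith
  · rintro s₂ ⟨a2, p2, -⟩
    refine ⟨fun b hb => ?_, fun b hb h => ?_, fun i hi j hj => ?_⟩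
    · rw [a2.nat b (by omega) (by omega), l1.nat b hb]
    · rw [a2.real b h, l1.real b hb]
    · have := p2 i hi j hj
      rw [zero_add, zero_add, p1 i hi j hj] at this
      -- The last block of summands reaches beyond n, where the rows of A are zero.
      rw [this, sum_range_of_supp (le_ceil_mul hm c.n)]
      · refine Finset.sum_congr rfl fun l hl => ?_
        rw [hw l (Finset.mem_range.1 hl)]
      · intro l hl
        rw [c.supp l j (by omega), mul_zero]

/-- Real array `8` becomes the product of `A` with the array `11`. -/
def rowsProg : Prog :=
  .seq (setV 45 (.lit 0)) <| .loop (.natLt (V 45) eN) <|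
    .seq (μ.prod (V 1) (V 1) (fun i l => .get 0 (.add (V 45) i) l) (fun l j => .get 11 l j)) <|
    .seq (assign2 8 (.add (V 45) (V 80)) (.add (.lit 0) (V 81)) (V 1) (V 1)
      (.get 80 (V 80) (V 81))) <|
    setV 45 (.add (V 45) (V 1))

theorem runs_rowsProg {ρ : Tape} {s : State} {c : Conf μ.ω} (hs : Static c s) :
    Runs ρ μ.rowsProg s (10 * μ.K * c.size) (fun s' => (∀ a < 45, s'.nat a = s.nat a) ∧
      (∀ a < 80, a ≠ 8 → s'.real a = s.real a) ∧
      ∀ i < c.n, ∀ j < 2 ^ c.a, s'.real 8 i j =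
        ∑ l ∈ Finset.range (2 ^ c.a), c.A i l * s.real 11 l j) := by
  have hm : 1 ≤ 2 ^ c.a := Nat.one_le_two_pow
  have hX := μ.sq_le (2 ^ c.a)
  have hK := μ.K_ge
  rw [c.dh_cast] at hX
  have hX1 : (1 : ℝ) ≤ (2 ^ c.a) ^ 2 := one_le_pow₀ (one_le_pow₀ (by norm_num))
  refine Runs.setNat_step ?_
  refine (Runs.while_le (I := fun k s' => s'.nat 45 0 0 = k * 2 ^ c.a ∧
    (∀ a < 45, s'.nat a = s.nat a) ∧ (∀ a < 80, a ≠ 8 → s'.real a = s.real a) ∧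
    ∀ i < k * 2 ^ c.a, ∀ j < 2 ^ c.a, s'.real 8 i j =
        ∑ l ∈ Finset.range (2 ^ c.a), c.A i l * s.real 11 l j) ((c.n + 2 ^ c.a - 1) / 2 ^ c.a)
    (B := 2.5 * μ.K * ((2 : ℝ) ^ c.a) ^ μ.ω) (k := 0) (by positivity) ?_ ?_ (Nat.zero_le _)).mono ?_ ?_
  · rintro k s₁ ⟨h1, h2, h3, h4⟩ hb
    simp only [Test.Holds, NatExp.eval, h1, h2 0 (by norm_num), hs.entries.n_eq] at hb
    refine ⟨(nb_ceil hm _ _).1 hb, ?_⟩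
    refine Runs.step (μ.runs_prod (2 ^ c.a) (2 ^ c.a) 1 (fun i l => c.A (k * 2 ^ c.a + i) l)
      (fun l j => s.real 11 l j) hm (nb_one hm) ?_ ?_ ?_ (by simp [NatExp.cost])
      (by simp [NatExp.cost]) (by simp [NatExp.cost, RealExp.cost])
      (by simp [NatExp.cost, RealExp.cost])) ?_
    · intro s₂ l; simp [NatExp.eval, l.nat, h2, hs.dh]
    · intro s₂ l e₁ e₂; simp [RealExp.eval, NatExp.eval, l.real, l.nat, h1, h3, hs.entries.mat]
    · intro s₂ l e₁ e₂; simp [RealExp.eval, l.real, h3]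
    rintro s₂ ⟨l2, p2⟩
    refine Runs.step (runs_assign_blk (k * 2 ^ c.a) 0 (2 ^ c.a) (fun i j => s₂.real 80 i j) ?_
      (by simp [NatExp.cost]) (by simp [NatExp.cost]) (by simp [NatExp.cost])
      (by simp [NatExp.cost, RealExp.cost]) hm ?_) ?_
    · intro s₃ h; simp [NatExp.eval, h.nat, l2.nat, h1, h2, hs.dh]
    · intro i hi j hj s₃ g g1 g2 _; simp [NatExp.eval, RealExp.eval, g.real, g1, g2]
    rintro s₃ ⟨a3, p3, q3⟩
    have n3 : ∀ a < 45, s₃.nat a = s.nat a := fun a ha => by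
      rw [a3.nat a (by omega) (by omega), l2.nat a (by omega), h2 a ha]
    have e45 : s₃.nat 45 0 0 = k * 2 ^ c.a := by
      rw [a3.nat 45 (by omega) (by omega), l2.nat 45 (by omega), h1]
    refine Runs.setNat_last ⟨?_, ?_, ?_, ?_⟩ ?_
    · simp [State.putNat_nat, NatExp.eval, e45, n3, hs.dh]; ring
    · intro a ha
      rw [State.putNat_nat_of_ne (by omega), n3 a ha]
    · intro a ha h8
      rw [State.putNat_real, a3.real a h8, l2.real a ha, h3 a ha h8]
    · intro i hi j hj
      rw [State.putNat_real]
      by_cases hik : i < k * 2 ^ c.a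
      · rw [q3 i j (by omega), l2.real 8 (by norm_num), h4 i hik j hj]
      · obtain ⟨i', rfl⟩ := Nat.exists_eq_add_of_le (not_lt.1 hik)
        have hi' : i' < 2 ^ c.a := by rw [add_mul, one_mul] at hi; omega
        have := p3 i' hi' j hj
        rw [zero_add, p2 i' hi' j hj, one_mul] at this
        exact this
    · simp [NatExp.cost]
      nlinarith
  · simp [State.putNat_nat, NatExp.eval]
    intro a ha
    exact State.putNat_nat_of_ne (by omega)
  · have h3 := c.blocks_mul_le
    have h4 : (((c.n + 2 ^ c.a - 1) / 2 ^ c.a : ℕ) : ℝ) ≤ (((c.n + 2 ^ c.a - 1) / 2 ^ c.a : ℕ) : ℝ) *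
        ((2 : ℝ) ^ c.a) ^ μ.ω := le_mul_of_one_le_right (by positivity) (by linarith)
    have h6 : 1 ≤ c.size := by linarith [c.n_le_size μ.two_le, c.n_pos]
    simp [NatExp.cost, Test.cost, -Nat.cast_pow]
    generalize (((c.n + 2 ^ c.a - 1) / 2 ^ c.a : ℕ) : ℝ) = b at *
    nlinarith
  · rintro s' ⟨k, -, -, ⟨h1, h2, h3, h4⟩, hb⟩
    simp only [Test.Holds, NatExp.eval, h1, h2 0 (by norm_num), hs.entries.n_eq, not_lt] at hb
    exact ⟨h2, h3, fun i hi => h4 i (by omega)⟩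

/-- Start a new block. -/
def restartProg : Prog :=
  .seq (setV 15 (.lit 0)) <| .seq (setV 16 (.lit 0)) <| .seq (setV 19 (.lit 0)) <|
  .seq (forP 44 eN (.setNat 18 (V 44) (.lit 0) (.lit 0))) <|
  .seq (assign2 5 (V 80) (.lit 0) eN (.lit 1) (.get 1 (V 80) (.lit 0))) <|
  .seq μ.gramProg <|
  .branch (.natLt (.lit 0) (V 7))
    (.seq (μ.padInvProg (.get 6 (V 80) (V 81))) <|
     .seq (assign2 11 (.add (.lit 0) (V 80)) (.add (.lit 0) (V 81)) (V 1) (V 1)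
       (.get 15 (V 80) (V 81))) μ.rowsProg)
    .skip

end Mul

/-- The data that are fixed during a block with initial weights `w`. -/
structure Base {ω : ℝ} (c : Conf ω) (w : ℕ → ℝ) (s : State) : Prop where
  base : ∀ i < c.n, s.real 5 i 0 = w i
  gram : ∀ i < 2 ^ c.a, ∀ j < 2 ^ c.a, s.real 6 i j = c.q w i j
  inv : c.LowRank → blk (s.real 11) 0 0 (2 ^ c.a) = (blk (padId c.d (c.q w)) 0 0 (2 ^ c.a))⁻¹
  rows : c.LowRank → ∀ i < c.n, ∀ j < 2 ^ c.a, s.real 8 i j =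
    ∑ l ∈ Finset.range (2 ^ c.a), c.A i l * s.real 11 l j

theorem Base.congr {ω : ℝ} {c : Conf ω} {w : ℕ → ℝ} {s s' : State} (h : Base c w s)
    (hr : ∀ a, (a = 5 ∨ a = 6 ∨ a = 8 ∨ a = 11) → s'.real a = s.real a) : Base c w s' := by
  obtain ⟨h1, h2, h3, h4⟩ := h
  constructor
  · rw [hr 5 (by simp)]; exact h1
  · rw [hr 6 (by simp)]; exact h2
  · rw [hr 11 (by simp)]; exact h3
  · rw [hr 11 (by simp), hr 8 (by simp)]; exact h4

namespace Mul

variable (μ : Mul)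

/-- The Gram matrix and A V each take ⌈n / D⌉ products of size D, and `Conf.pow_le_size` puts the D
× D inversion under the same bound up to the logarithm. The list is emptied. Without the low rank
representation only the Gram matrix is needed. -/
theorem runs_restartProg {ρ : Tape} {s : State} {c : Conf μ.ω} (hs : Static c s) (w : ℕ → ℝ)
    (hw : ∀ i < c.n, s.real 1 i 0 = w i)
    (hdet : IsUnit (blk (padId c.d (c.q w)) 0 0 (2 ^ c.a)).det) :
    Runs ρ μ.restartProg s (100 * μ.K * (c.a + 1) * c.size) (fun s' => Static c s' ∧ Base c w s' ∧
      s'.real 1 = s.real 1 ∧ s'.nat 15 0 0 = 0 ∧ s'.nat 16 0 0 = 0 ∧ s'.nat 19 0 0 = 0 ∧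
      ∀ i < c.n, s'.nat 18 i 0 = 0) := by
  have hm : 1 ≤ 2 ^ c.a := Nat.one_le_two_pow
  have hX := μ.sq_le (2 ^ c.a)
  have hK := μ.K_ge
  have hS := c.pow_le_size
  rw [c.dh_cast] at hX
  have hn := c.n_le_size μ.two_le
  have hn1 := c.n_pos
  have hKS : 3000 * c.size ≤ μ.K * c.size := mul_le_mul_of_nonneg_right hK (by linarith)
  have hKSa : 0 ≤ μ.K * c.size * c.a := by
    have : 0 ≤ μ.K * c.size := by linarith
    positivity
  refine Runs.setNat_step <| Runs.setNat_step <| Runs.setNat_step <| Runs.step (Runs.forP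
    (N := c.n) (B := 10) (I := fun k s' => s'.nat 44 0 0 = k ∧ (∀ a, a < 14 ∨ a = 20 → s'.nat a = s.nat a) ∧
      s'.real = s.real ∧ s'.nat 15 0 0 = 0 ∧ s'.nat 16 0 0 = 0 ∧ s'.nat 19 0 0 = 0 ∧
      ∀ i < k, s'.nat 18 i 0 = 0) (by norm_num) ?_ ?_ ?_) ?_
  · refine ⟨by simp [State.putNat_nat], fun a ha => ?_, rfl, by simp [State.putNat_nat, NatExp.eval],
      by simp [State.putNat_nat, NatExp.eval], by simp [State.putNat_nat, NatExp.eval], by simp⟩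
    rw [State.putNat_nat_of_ne (by omega), State.putNat_nat_of_ne (by omega),
      State.putNat_nat_of_ne (by omega), State.putNat_nat_of_ne (by omega)]
  · rintro k s₁ ⟨h1, h2, _⟩
    simp [NatExp.eval, h1, h2, hs.entries.n_eq]
  · rintro k hk s₁ ⟨h1, h2, h3, h4, h5, h6, h7⟩
    refine Runs.setNat_last ⟨?_, ?_, fun a ha => ?_, ?_, ?_, ?_, ?_, fun i hi => ?_⟩ ?_
    · simp [State.putNat_nat, h1]
    · simp [State.putNat_nat]
    · rw [State.putNat_nat_of_ne (by omega), State.putNat_nat_of_ne (by omega), h2 a ha]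
    · exact h3
    · simp [State.putNat_nat, h4]
    · simp [State.putNat_nat, h5]
    · simp [State.putNat_nat, h6]
    · simp only [State.putNat_nat, NatExp.eval, h1]
      by_cases hik : i = k
      · simp [hik]
      · simp [hik, h7 i (by omega)]
    · simp [NatExp.cost]; norm_num
  rintro s₁ ⟨-, n1, r1, h15, h16, h19, h18⟩
  refine Runs.step (Runs.assign2 c.n 1 60 (fun i _ => i) (fun _ j => j) (fun i _ => s.real 1 i 0)
    ?_ ?_ ?_ ?_) ?_
  · intro s₂ h; simp [NatExp.eval, h.nat, n1, hs.entries.n_eq]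
  · simp [NatExp.cost, RealExp.cost]
  · rintro i _ j _ i' _ j' _ rfl _; rfl
  · intro i hi j hj s₂ g g1 g2 _
    obtain rfl : j = 0 := by omega
    simp [NatExp.eval, RealExp.eval, g.real, g1, r1]
  rintro s₂ ⟨a2, p2, -⟩
  have st2 : Static c s₂ := hs.congr
    (fun a ha => by rw [a2.nat a (by omega) (by omega), n1 a ha])
    (fun a ha => by rw [a2.real a (by omega), r1])
  refine Runs.step (μ.runs_gramProg st2 w
    (by intro i hi; rw [a2.real 1 (by norm_num), r1, hw i hi])) ?_
  rintro s₃ ⟨n3, r3, p3⟩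
  have st3 : Static c s₃ := st2.congr (fun a ha => n3 a (by omega))
    (fun a ha => r3 a (by omega) (by omega))
  have b3 : ∀ i < c.n, s₃.real 5 i 0 = w i := by
    intro i hi
    rw [r3 5 (by norm_num) (by norm_num), p2 i hi 0 (by norm_num), hw i hi]
  have e1 : s₃.real 1 = s.real 1 := by
    rw [r3 1 (by norm_num) (by norm_num), a2.real 1 (by norm_num), r1]
  have f3 : ∀ b, 14 < b → b < 20 → s₃.nat b = s₁.nat b := fun b hb hb' => by
    rw [n3 b (by omega), a2.nat b (by omega) (by omega)]
  refine Runs.branch_last (fun hb => ?_) (fun hb => ?_)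
  · refine Runs.step (μ.runs_padInvProg st3 (e := .get 6 (V 80) (V 81)) (c.q w)
      (by simp [RealExp.cost, NatExp.cost]) ?_ hdet) ?_
    · intro i hi j hj s₄ g g1 g2
      simp [RealExp.eval, NatExp.eval, g1, g2, g.real, p3 i hi j hj]
    rintro s₄ ⟨n4, r4, i4⟩
    have st4 : Static c s₄ := st3.congr (fun a ha => n4 a (by omega) (by omega))
      (fun a ha => r4 a (by omega) (by omega))
    refine Runs.step (runs_assign_blk 0 0 (2 ^ c.a) (fun i j => s₄.real 15 i j) ?_
      (by simp [NatExp.cost]) (by simp [NatExp.cost]) (by simp [NatExp.cost])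
      (by simp [NatExp.cost, RealExp.cost]) hm ?_) ?_
    · intro s₃ h; simp [NatExp.eval, h.nat, st4.dh]
    · intro i hi j hj s₃ g g1 g2 _; simp [NatExp.eval, RealExp.eval, g.real, g1, g2]
    rintro s₅ ⟨a5, p5, -⟩
    have st5 : Static c s₅ := st4.congr (fun a ha => a5.nat a (by omega) (by omega))
      (fun a ha => a5.real a (by omega))
    refine (μ.runs_rowsProg st5).mono ?_ ?_
    · rw [c.dh_cast]
      simp [NatExp.cost, Test.cost]
      have : μ.K * (c.a + 1) * ((2 : ℝ) ^ c.a) ^ μ.ω ≤ μ.K * (c.a + 1) * (2 * c.size) :=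
        mul_le_mul_of_nonneg_left hS (by positivity)
      nlinarith
    · rintro s₆ ⟨n6, r6, p6⟩
      have nn : ∀ b, 14 < b → b < 20 → s₆.nat b = s₁.nat b := fun b hb hb' => by
        rw [n6 b (by omega), a5.nat b (by omega) (by omega), n4 b (by omega) (by omega),
          f3 b hb hb']
      refine ⟨st5.congr (fun a ha => n6 a (by omega)) (fun a ha => r6 a (by omega) (by omega)),
        ⟨?_, ?_, ?_, ?_⟩, ?_, ?_, ?_, ?_, ?_⟩
      · intro i hi
        rw [r6 5 (by norm_num) (by norm_num), a5.real 5 (by norm_num), r4 5 (by norm_num) (by norm_num),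
          b3 i hi]
      · intro i hi j hj
        rw [r6 6 (by norm_num) (by norm_num), a5.real 6 (by norm_num), r4 6 (by norm_num) (by norm_num),
          p3 i hi j hj]
      · intro _
        rw [r6 11 (by norm_num) (by norm_num), ← i4]
        ext ⟨i, hi⟩ ⟨j, hj⟩
        have := p5 i hi j hj
        simpa [blk] using this
      · intro _ i hi j hj
        rw [p6 i hi j hj, r6 11 (by norm_num) (by norm_num)]
      · rw [r6 1 (by norm_num) (by norm_num), a5.real 1 (by norm_num), r4 1 (by norm_num) (by norm_num),
          e1]
      · rw [nn 15 (by norm_num) (by norm_num), h15]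
      · rw [nn 16 (by norm_num) (by norm_num), h16]
      · rw [nn 19 (by norm_num) (by norm_num), h19]
      · intro i hi
        rw [nn 18 (by norm_num) (by norm_num), h18 i hi]
  · have hnl : ¬ c.LowRank := by
      intro hl
      refine hb ?_
      simp [Test.Holds, NatExp.eval, st3.low, hl]
    refine (Runs.skip ⟨st3, ⟨b3, p3, fun h => absurd h hnl, fun h => absurd h hnl⟩, e1, ?_, ?_, ?_,
      ?_⟩).mono ?_ (fun _ h => h)
    · simp [NatExp.cost, Test.cost]
      nlinarith
    · rw [f3 15 (by norm_num) (by norm_num), h15]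
    · rw [f3 16 (by norm_num) (by norm_num), h16]
    · rw [f3 19 (by norm_num) (by norm_num), h19]
    · intro i hi
      rw [f3 18 (by norm_num) (by norm_num), h18 i hi]

end Mul

/-! ### The list of changed rows -/

/-- The weight `w` is not approximated by `b`. -/
def Bad (b w : ℝ) : Prop := ¬ (0.9 * b ≤ w ∧ w ≤ 1.1 * b)

/-- The rows in the list of changed rows: their number is in `16`, the rows in `17`, and the array
`18` marks them. -/
structure Listed (n : ℕ) (s : State) : Prop where
  lt : ∀ p < s.nat 16 0 0, s.nat 17 p 0 < n
  inj : ∀ p < s.nat 16 0 0, ∀ q < s.nat 16 0 0, s.nat 17 p 0 = s.nat 17 q 0 → p = q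
  mark : ∀ i < n, s.nat 18 i 0 = 0 ↔ ∀ p < s.nat 16 0 0, s.nat 17 p 0 ≠ i

theorem Listed.congr {n : ℕ} {s s' : State} (h : Listed n s) (h16 : s'.nat 16 = s.nat 16)
    (h17 : s'.nat 17 = s.nat 17) (h18 : s'.nat 18 = s.nat 18) : Listed n s' := by
  obtain ⟨h1, h2, h3⟩ := h
  constructor <;> simp only [h16, h17, h18] <;> assumption

/-- Append the row `V 41` to the list. -/
def appendProg : Prog :=
  .seq (.setNat 17 (V 16) (.lit 0) (V 41)) <| .seq (.setNat 18 (V 41) (.lit 0) (.lit 1)) <|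
  setV 16 (.add (V 16) (.lit 1))

/-- Append the rows whose weight is no longer approximated. -/
noncomputable def scanProg : Prog :=
  forP 40 (V 12) <| .seq (setV 41 (.get 13 (V 40) (.lit 0))) <|
  .branch (.natLt (.get 18 (V 41) (.lit 0)) (.lit 1))
    (.branch (.realLt (.get 1 (V 41) (.lit 0)) (.mul (.lit 0.9) (.get 5 (V 41) (.lit 0))))
      appendProg <|
      .branch (.realLt (.mul (.lit 1.1) (.get 5 (V 41) (.lit 0))) (.get 1 (V 41) (.lit 0)))
        appendProg .skip)
    .skip

/-- The list of `s'` extends the list of `s` by rows whose weight has changed. -/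
structure Extends (s s' : State) : Prop where
  nat : ∀ a < 80, a ≠ 16 → a ≠ 17 → a ≠ 18 → a ≠ 40 → a ≠ 41 → s'.nat a = s.nat a
  real : s'.real = s.real
  le : s.nat 16 0 0 ≤ s'.nat 16 0 0
  list : ∀ p < s.nat 16 0 0, s'.nat 17 p 0 = s.nat 17 p 0
  bad : ∀ p < s'.nat 16 0 0, s.nat 16 0 0 ≤ p →
    Bad (s.real 5 (s'.nat 17 p 0) 0) (s.real 1 (s'.nat 17 p 0) 0)

theorem Extends.put {s s' : State} (h : Extends s s') {a x y v : ℕ} (ha : a = 40 ∨ a = 41) :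
    Extends s (s'.putNat a x y v) := by
  have h16 : (s'.putNat a x y v).nat 16 = s'.nat 16 := State.putNat_nat_of_ne (by omega)
  have h17 : (s'.putNat a x y v).nat 17 = s'.nat 17 := State.putNat_nat_of_ne (by omega)
  obtain ⟨h1, h2, h3, h4, h5⟩ := h
  refine ⟨fun b hb g1 g2 g3 g4 g5 => ?_, h2, ?_, ?_, ?_⟩
  · rw [State.putNat_nat_of_ne (by omega), h1 b hb g1 g2 g3 g4 g5]
  · rw [h16]; exact h3
  · rw [h17]; exact h4
  · rw [h16, h17]; exact h5

theorem Listed.put {n : ℕ} {s : State} (h : Listed n s) {a x y v : ℕ} (ha : a = 40 ∨ a = 41) :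
    Listed n (s.putNat a x y v) :=
  h.congr (State.putNat_nat_of_ne (by omega)) (State.putNat_nat_of_ne (by omega))
    (State.putNat_nat_of_ne (by omega))

theorem runs_appendProg {ρ : Tape} {n i : ℕ} {s₀ s : State} (h : Extends s₀ s) (hl : Listed n s)
    (h41 : s.nat 41 0 0 = i) (hi : i < n) (hb : Bad (s₀.real 5 i 0) (s₀.real 1 i 0))
    (h18 : s.nat 18 i 0 = 0) :
    Runs ρ appendProg s 30 (fun s' => Extends s₀ s' ∧ Listed n s' ∧ s'.nat 40 = s.nat 40 ∧
      (∀ p < s.nat 16 0 0, s'.nat 17 p 0 = s.nat 17 p 0) ∧ s.nat 16 0 0 ≤ s'.nat 16 0 0 ∧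
      ∃ p < s'.nat 16 0 0, s'.nat 17 p 0 = i) := by
  have hnew := (hl.mark i hi).1 h18
  obtain ⟨h1, h2, h3, h4, h5⟩ := h
  obtain ⟨l1, l2, l3⟩ := hl
  refine Runs.setNat_step <| Runs.setNat_step <| Runs.setNat_last ?_ ?_
  · set s' := (((s.putNat 17 _ _ _).putNat 18 _ _ _).putNat 16 _ _ _) with hs'
    have e16 : s'.nat 16 0 0 = s.nat 16 0 0 + 1 := by
      simp [hs', State.putNat_nat, NatExp.eval]
    have e17 : ∀ p, s'.nat 17 p 0 = if p = s.nat 16 0 0 then i else s.nat 17 p 0 := by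
      intro p; simp [hs', State.putNat_nat, NatExp.eval, h41]
    have e18 : ∀ p, s'.nat 18 p 0 = if p = i then 1 else s.nat 18 p 0 := by
      intro p; simp [hs', State.putNat_nat, NatExp.eval, h41]
    have e17' : ∀ p < s.nat 16 0 0, s'.nat 17 p 0 = s.nat 17 p 0 := fun p hp => by
      rw [e17, if_neg hp.ne]
    have e17'' : s'.nat 17 (s.nat 16 0 0) 0 = i := by rw [e17, if_pos rfl]
    have en : ∀ b, b ≠ 16 → b ≠ 17 → b ≠ 18 → s'.nat b = s.nat b := fun b b1 b2 b3 => by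
      rw [hs', State.putNat_nat_of_ne b1, State.putNat_nat_of_ne b3, State.putNat_nat_of_ne b2]
    refine ⟨⟨fun b hb g1 g2 g3 g4 g5 => ?_, h2, by omega, fun p hp => ?_, fun p hp hp' => ?_⟩,
      ⟨fun p hp => ?_, fun p hp q hq => ?_, fun k hk => ?_⟩, en 40 (by simp) (by simp) (by simp),
      e17', by omega, s.nat 16 0 0, by omega, e17''⟩
    · rw [en b g1 g2 g3, h1 b hb g1 g2 g3 g4 g5]
    · rw [e17' p (by omega), h4 p hp]
    · rcases Nat.lt_succ_iff_lt_or_eq.1 (e16 ▸ hp) with g | rfl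
      · rw [e17' p g]; exact h5 p g hp'
      · rw [e17'']; exact hb
    · rcases Nat.lt_succ_iff_lt_or_eq.1 (e16 ▸ hp) with g | rfl
      · rw [e17' p g]; exact l1 p g
      · rw [e17'']; exact hi
    · rcases Nat.lt_succ_iff_lt_or_eq.1 (e16 ▸ hp) with g | rfl <;>
        rcases Nat.lt_succ_iff_lt_or_eq.1 (e16 ▸ hq) with g' | rfl
      · rw [e17' p g, e17' q g']; exact l2 p g q g'
      · rw [e17' p g, e17'']; exact fun h => absurd h (hnew p g)
      · rw [e17' q g', e17'']; exact fun h => absurd h.symm (hnew q g')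
      · exact fun _ => rfl
    · rw [e18]
      by_cases hki : k = i
      · rw [if_pos hki]
        refine iff_of_false (by norm_num) fun hc => ?_
        exact hc (s.nat 16 0 0) (by omega) (by rw [e17'', hki])
      · rw [if_neg hki, l3 k hk]
        constructor
        · intro hc p hp
          rcases Nat.lt_succ_iff_lt_or_eq.1 (e16 ▸ hp) with g | rfl
          · rw [e17' p g]; exact hc p g
          · rw [e17'']; exact fun h => hki h.symm
        · intro hc p hp
          rw [← e17' p hp]; exact hc p (by omega)
  · simp [NatExp.cost]; norm_num

/-- Zero rows of A do not occur in any Gram matrix and are skipped, so the cost is proportional to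
the number of nonzero rows. A listed row stays listed even if its weight returns to the window. -/
theorem runs_scanProg {ρ : Tape} {ω : ℝ} {c : Conf ω} {s : State} (hs : Static c s)
    (hl : Listed c.n s) :
    Runs ρ scanProg s (200 * s.nat 12 0 0 + 20) (fun s' => Extends s s' ∧ Listed c.n s' ∧
      ∀ i < c.n, (∃ j < c.d, c.A i j ≠ 0) → Bad (s.real 5 i 0) (s.real 1 i 0) →
        ∃ p < s'.nat 16 0 0, s'.nat 17 p 0 = i) := by
  refine (Runs.forP (N := s.nat 12 0 0) (B := 150) (I := fun k s' => s'.nat 40 0 0 = k ∧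
    Extends s s' ∧ Listed c.n s' ∧ ∀ p < k, Bad (s.real 5 (s.nat 13 p 0) 0) (s.real 1 (s.nat 13 p 0) 0) →
      ∃ q < s'.nat 16 0 0, s'.nat 17 q 0 = s.nat 13 p 0) (by norm_num) ?_ ?_ ?_).mono ?_ ?_
  · refine ⟨by simp [State.putNat_nat], Extends.put ⟨fun _ _ _ _ _ _ _ => rfl, rfl, le_rfl,
      fun _ _ => rfl, fun p hp hp' => by omega⟩ (by simp), hl.put (by simp), by simp⟩
  · rintro k s₁ ⟨h1, h2, _⟩
    exact ⟨h1, by simp [NatExp.eval, h2.nat 12]⟩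
  · rintro k hk s₁ ⟨h1, h2, h3, h4⟩
    refine Runs.setNat_step ?_
    have e41 : (NatExp.get 13 (V 40) (NatExp.lit 0)).eval s₁ = s.nat 13 k 0 := by
      simp [NatExp.eval, h1, h2.nat 13]
    have hi := hs.rows.lt k hk
    rw [e41]
    simp only [NatExp.eval]
    set i := s.nat 13 k 0 with hidef
    set s₂ := s₁.putNat 41 0 0 i with hs₂
    have x2 : Extends s s₂ := h2.put (by simp)
    have l2 : Listed c.n s₂ := h3.put (by simp)
    have e2 : s₂.nat 41 0 0 = i := by simp [hs₂, State.putNat_nat]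
    have e40 : s₂.nat 40 0 0 = k := by simp [hs₂, State.putNat_nat, h1]
    have old : ∀ p < k, Bad (s.real 5 (s.nat 13 p 0) 0) (s.real 1 (s.nat 13 p 0) 0) →
      ∃ q < s₂.nat 16 0 0, s₂.nat 17 q 0 = s.nat 13 p 0 := by
      simpa [hs₂, State.putNat_nat] using h4
    have skip : (Bad (s.real 5 i 0) (s.real 1 i 0) → ∃ q < s₂.nat 16 0 0, s₂.nat 17 q 0 = i) →
        Runs ρ .skip s₂ 1 (fun s' => s'.nat 40 0 0 = k ∧
          (s'.putNat 40 0 0 (k + 1)).nat 40 0 0 = k + 1 ∧ Extends s (s'.putNat 40 0 0 (k + 1)) ∧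
          Listed c.n (s'.putNat 40 0 0 (k + 1)) ∧
          ∀ p < k + 1, Bad (s.real 5 (s.nat 13 p 0) 0) (s.real 1 (s.nat 13 p 0) 0) →
            ∃ q < (s'.putNat 40 0 0 (k + 1)).nat 16 0 0,
              (s'.putNat 40 0 0 (k + 1)).nat 17 q 0 = s.nat 13 p 0) := by
      intro hc
      refine Runs.skip ⟨e40, by simp [State.putNat_nat], x2.put (by simp), l2.put (by simp), ?_⟩
      rw [State.putNat_nat_of_ne (by norm_num), State.putNat_nat_of_ne (by norm_num)]
      intro p hp
      rcases Nat.lt_succ_iff_lt_or_eq.1 hp with g | rfl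
      · exact old p g
      · exact hc
    have app : Bad (s.real 5 i 0) (s.real 1 i 0) → s₂.nat 18 i 0 = 0 →
        Runs ρ appendProg s₂ 30 (fun s' => s'.nat 40 0 0 = k ∧
          (s'.putNat 40 0 0 (k + 1)).nat 40 0 0 = k + 1 ∧ Extends s (s'.putNat 40 0 0 (k + 1)) ∧
          Listed c.n (s'.putNat 40 0 0 (k + 1)) ∧
          ∀ p < k + 1, Bad (s.real 5 (s.nat 13 p 0) 0) (s.real 1 (s.nat 13 p 0) 0) →
            ∃ q < (s'.putNat 40 0 0 (k + 1)).nat 16 0 0,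
              (s'.putNat 40 0 0 (k + 1)).nat 17 q 0 = s.nat 13 p 0) := by
      intro hb h18
      refine (runs_appendProg x2 l2 e2 hi hb h18).mono le_rfl ?_
      rintro s₃ ⟨x3, l3, f40, f17, f16, hex⟩
      refine ⟨by rw [f40, e40], by simp [State.putNat_nat], x3.put (by simp), l3.put (by simp), ?_⟩
      rw [State.putNat_nat_of_ne (by norm_num), State.putNat_nat_of_ne (by norm_num)]
      intro p hp hbp
      rcases Nat.lt_succ_iff_lt_or_eq.1 hp with g | rfl
      · obtain ⟨q, hq, hq'⟩ := old p g hbp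
        exact ⟨q, by omega, by rw [f17 q hq, hq']⟩
      · exact hex
    have e5 : s₂.real = s.real := x2.real
    refine Runs.branch_last (fun hm => ?_) (fun hm => ?_)
    · have h18 : s₂.nat 18 i 0 = 0 := by
        simpa [Test.Holds, NatExp.eval, e2] using hm
      refine Runs.branch_last (fun hc => (app ?_ h18).mono ?_ fun _ h => h) (fun hc =>
        Runs.branch_last (fun hc' => (app ?_ h18).mono ?_ fun _ h => h)
          (fun hc' => (skip ?_).mono ?_ fun _ h => h))
      · simp only [Test.Holds, RealExp.eval, NatExp.eval, e2, e5] at hc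
        exact fun h => absurd h.1 (not_le.2 hc)
      · simp [NatExp.cost, RealExp.cost, Test.cost]; norm_num
      · simp only [Test.Holds, RealExp.eval, NatExp.eval, e2, e5] at hc'
        exact fun h => absurd h.2 (not_le.2 hc')
      · simp [NatExp.cost, RealExp.cost, Test.cost]; norm_num
      · simp only [Test.Holds, RealExp.eval, NatExp.eval, e2, e5, not_lt] at hc hc'
        exact fun h => absurd ⟨hc, hc'⟩ h
      · simp [NatExp.cost, RealExp.cost, Test.cost]; norm_num
    · refine (skip fun _ => ?_).mono ?_ fun _ h => h
      · have h18 : ¬ s₂.nat 18 i 0 = 0 := by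
          simpa [Test.Holds, NatExp.eval, e2] using hm
        rw [l2.mark i hi] at h18
        push Not at h18
        exact h18
      · simp [NatExp.cost, Test.cost]; norm_num
  · simp [NatExp.cost]
    have : (0 : ℝ) ≤ s.nat 12 0 0 := Nat.cast_nonneg _
    nlinarith
  · rintro s' ⟨_, h1, h2, h3⟩
    refine ⟨h1, h2, fun i hi hne hb => ?_⟩
    obtain ⟨p, hp, rfl⟩ := hs.rows.mem i hi hne
    exact h3 p hp hb

/-! ### The products of the listed rows -/

/-- The entry of `A V Aᵀ` for the listed rows `p` and `q`, where `A V` is in the array `8`. -/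
noncomputable def Conf.g {ω : ℝ} (c : Conf ω) (s : State) (p q : ℕ) : ℝ :=
  ∑ l ∈ Finset.range (2 ^ c.a), s.real 8 (s.nat 17 p 0) l * c.A (s.nat 17 q 0) l

/-- V is the inverse of a symmetric matrix, hence A V Aᵀ is symmetric. This allows half of the
products of listed rows to be copied. -/
theorem Base.symm {ω : ℝ} {c : Conf ω} {w : ℕ → ℝ} {s : State} (h : Base c w s) (hl : c.LowRank)
    {i k : ℕ} (hi : i < c.n) (hk : k < c.n) :
    ∑ l ∈ Finset.range (2 ^ c.a), s.real 8 i l * c.A k l =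
      ∑ l ∈ Finset.range (2 ^ c.a), s.real 8 k l * c.A i l := by
  have hV : ∀ l < 2 ^ c.a, ∀ m < 2 ^ c.a, s.real 11 l m = s.real 11 m l := by
    have ht : (blk (s.real 11) 0 0 (2 ^ c.a)).transpose = blk (s.real 11) 0 0 (2 ^ c.a) := by
      rw [h.inv hl, Matrix.transpose_nonsing_inv]
      congr 1
      ext i j
      simp only [blk, padId, Conf.q, Matrix.transpose_apply, Matrix.of_apply]
      congr 1
      · exact Finset.sum_congr rfl fun _ _ => by ring
      · refine if_congr ?_ rfl rfl
        omega
    intro l hl m hm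
    have := congrFun (congrFun ht ⟨m, hm⟩) ⟨l, hl⟩
    simpa [blk] using this
  have e : ∀ i < c.n, ∀ k, ∑ l ∈ Finset.range (2 ^ c.a), s.real 8 i l * c.A k l =
      ∑ l ∈ Finset.range (2 ^ c.a), ∑ m ∈ Finset.range (2 ^ c.a),
        c.A i m * s.real 11 m l * c.A k l := by
    intro i hi k
    refine Finset.sum_congr rfl fun l hl' => ?_
    rw [h.rows hl i hi l (Finset.mem_range.1 hl'), Finset.sum_mul]
  rw [e i hi, e k hk, Finset.sum_comm]
  refine Finset.sum_congr rfl fun l hl => Finset.sum_congr rfl fun m hm => ?_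
  rw [hV l (Finset.mem_range.1 hl) m (Finset.mem_range.1 hm)]; ring

namespace Conf

variable {ω : ℝ} (c : Conf ω)

theorem T_pos : 1 ≤ c.T := Nat.one_le_two_pow

theorem θ_pos : 1 ≤ c.θ := by
  have := c.T_pos
  have h4 : 1 ≤ 4 ^ c.j := Nat.one_le_pow _ _ (by norm_num)
  exact le_min (Nat.mul_le_mul this h4) (Nat.mul_le_mul this this)

theorem θ_le : c.θ ≤ c.T * c.T := min_le_right _ _

/-- The cost of the treatment of a batch of changed rows. -/
noncomputable def batch : ℝ := (c.T : ℝ) ^ 2 * (2 : ℝ) ^ c.a * (c.θ : ℝ) ^ (ω - 2)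

/-- The amortized cost of a round. -/
noncomputable def round : ℝ := ((2 : ℝ) ^ c.τ) ^ ω * ((2 : ℝ) ^ c.τ) ^ ω

theorem θ_rpow (c : Conf ω) : (c.θ : ℝ) ^ ω = (c.θ : ℝ) ^ 2 * (c.θ : ℝ) ^ (ω - 2) := by
  have : (0 : ℝ) < c.θ := by exact_mod_cast c.θ_pos
  rw [Real.rpow_sub this, Real.rpow_two]; field_simp

theorem batch_ge (hω : 2 ≤ ω) : 1 ≤ c.batch := by
  have h1 : (1 : ℝ) ≤ c.T := by exact_mod_cast c.T_pos
  have h2 : (1 : ℝ) ≤ c.θ := by exact_mod_cast c.θ_pos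
  exact one_le_mul_of_one_le_of_one_le (one_le_mul_of_one_le_of_one_le (one_le_pow₀ h1)
    (one_le_pow₀ (by norm_num))) (Real.one_le_rpow h2 (by linarith))

end Conf

namespace Mul

variable (μ : Mul)

/-- Compute the products of the next batch of listed rows with the rows before. -/
def processProg : Prog :=
  .seq (setV 46 (.lit 0)) <| .loop (.natLt (V 46) (.add (V 19) (.lit 1))) <|
    .seq (μ.prod (V 6) (V 1) (fun i l => .get 8 (.get 17 (.add (V 46) i) (.lit 0)) l)
      (fun l j => .get 0 (.get 17 (.add (V 19) j) (.lit 0)) l)) <|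
    .seq (assign2 9 (.add (V 46) (V 80)) (.add (V 19) (V 81)) (V 6) (V 6)
      (.get 80 (V 80) (V 81))) <|
    .seq (assign2 9 (.add (V 19) (V 80)) (.add (V 46) (V 81)) (V 6) (V 6)
      (.get 80 (V 81) (V 80))) <|
    setV 46 (.add (V 46) (V 6))

/-- Register 19 counts the rows in completed batches, a multiple of θ. The next θ columns are
multiplied with the earlier rows in blocks of θ, up to and including the diagonal block, and the
result is mirrored. Positions beyond the end of the list produce unspecified entries, about which
nothing is claimed. -/
theorem runs_processProg {ρ : Tape} {s : State} {c : Conf μ.ω} {w : ℕ → ℝ} (hs : Static c s)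
    (hb : Base c w s) (hl : Listed c.n s) (hlow : c.LowRank) (hdvd : c.θ ∣ s.nat 19 0 0)
    (hpc : s.nat 19 0 0 ≤ s.nat 16 0 0) (hcnt : s.nat 16 0 0 ≤ c.T * c.T + c.T * c.T)
    (hG : ∀ p < s.nat 19 0 0, ∀ q < s.nat 19 0 0, s.real 9 p q = c.g s p q) :
    Runs ρ μ.processProg s (20 * μ.K * c.batch) (fun s' => (∀ a < 46, s'.nat a = s.nat a) ∧
      (∀ a < 80, a ≠ 9 → s'.real a = s.real a) ∧
      ∀ p < s.nat 16 0 0, ∀ q < s.nat 16 0 0, p < s.nat 19 0 0 + c.θ → q < s.nat 19 0 0 + c.θ →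
        s'.real 9 p q = c.g s p q) := by
  have hθ := c.θ_pos
  obtain ⟨N, hN⟩ := hdvd
  set P := s.nat 19 0 0 with hP
  set θ := c.θ with hθdef
  have hsym : ∀ p < s.nat 16 0 0, ∀ q < s.nat 16 0 0, c.g s p q = c.g s q p := fun p hp q hq =>
    hb.symm hlow (hl.lt p hp) (hl.lt q hq)
  have hX := μ.sq_le θ
  have hK := μ.K_ge
  have hθR : (1 : ℝ) ≤ θ := by exact_mod_cast hθ
  have hθdh : (θ : ℝ) ≤ 2 ^ c.a := by
    have : θ < 2 ^ c.a := c.θ_le.trans_lt hlow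
    exact_mod_cast this.le
  have hX1 : (1 : ℝ) ≤ (θ : ℝ) ^ 2 := one_le_pow₀ hθR
  set nb := (2 ^ c.a + θ - 1) / θ with hnb
  have hnbR : (nb : ℝ) * θ ≤ 2 ^ c.a + θ := by exact_mod_cast ceil_mul_le (M := θ) (2 ^ c.a)
  refine Runs.setNat_step ?_
  refine (Runs.while_le (I := fun k s' => s'.nat 46 0 0 = k * θ ∧
    (∀ a < 46, s'.nat a = s.nat a) ∧ (∀ a < 80, a ≠ 9 → s'.real a = s.real a) ∧
    ∀ p < s.nat 16 0 0, ∀ q < s.nat 16 0 0,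
      (p < P ∧ q < P) ∨ (p < k * θ ∧ P ≤ q ∧ q < P + θ) ∨ (q < k * θ ∧ P ≤ p ∧ p < P + θ) →
        s'.real 9 p q = c.g s p q) (N + 1)
    (B := μ.K * (nb + 2) * (θ : ℝ) ^ μ.ω) (k := 0) (by positivity) ?_ ?_ (Nat.zero_le _)).mono ?_ ?_
  · rintro k s₁ ⟨h1, h2, h3, h4⟩ hb
    simp only [Test.Holds, NatExp.eval, h1, h2 19 (by norm_num), ← hP] at hb
    refine ⟨?_, ?_⟩
    -- With P = θ N, the test k θ < P + 1 admits k = 0, …, N, so there are N + 1 blocks, the last on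
    -- the diagonal.
    · rw [hN] at hb
      by_contra hc
      push Not at hc
      have : θ * N + θ ≤ k * θ := by nlinarith
      omega
    refine Runs.step (μ.runs_prod θ (2 ^ c.a) nb (fun i l => s.real 8 (s.nat 17 (k * θ + i) 0) l)
      (fun l j => c.A (s.nat 17 (P + j) 0) l) hθ (nb_ceil hθ _) ?_ ?_ ?_ (by simp [NatExp.cost])
      (by simp [NatExp.cost]) (by simp [NatExp.cost, RealExp.cost])
      (by simp [NatExp.cost, RealExp.cost])) ?_
    · intro s₂ l; simp [NatExp.eval, l.nat, h2, hs.dh, hs.θ, hθdef]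
    · intro s₂ l e₁ e₂; simp [RealExp.eval, NatExp.eval, l.real, l.nat, h1, h2, h3]
    · intro s₂ l e₁ e₂; simp [RealExp.eval, NatExp.eval, l.real, l.nat, h2, h3, hs.entries.mat, hP]
    rintro s₂ ⟨l2, p2⟩
    have v2 : ∀ i < θ, ∀ j < θ, s₂.real 80 i j = c.g s (k * θ + i) (P + j) := by
      intro i hi j hj
      rw [p2 i hi j hj, Conf.g, sum_range_of_supp (c.d_le.trans (le_ceil_mul hθ _)),
        sum_range_of_supp c.d_le]
      · intro l hl'; rw [c.supp _ l (by omega), mul_zero]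
      · intro l hl'; rw [c.supp _ l (by omega), mul_zero]
    refine Runs.step (runs_assign_blk (k * θ) P θ (fun i j => s₂.real 80 i j) ?_
      (by simp [NatExp.cost]) (by simp [NatExp.cost]) (by simp [NatExp.cost])
      (by simp [NatExp.cost, RealExp.cost]) hθ ?_) ?_
    · intro s₃ h; simp [NatExp.eval, h.nat, l2.nat, h1, h2, hs.θ, hP, hθdef]
    · intro i hi j hj s₃ g g1 g2 _; simp [NatExp.eval, RealExp.eval, g.real, g1, g2]
    rintro s₃ ⟨a3, p3, q3⟩
    refine Runs.step (runs_assign_blk P (k * θ) θ (fun i j => s₂.real 80 j i) ?_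
      (by simp [NatExp.cost]) (by simp [NatExp.cost]) (by simp [NatExp.cost])
      (by simp [NatExp.cost, RealExp.cost]) hθ ?_) ?_
    · intro s₄ h; simp [NatExp.eval, h.nat, a3.nat, l2.nat, h1, h2, hs.θ, hP, hθdef]
    · intro i hi j hj s₄ g g1 g2 _; simp [NatExp.eval, RealExp.eval, g.real, a3.real, g1, g2]
    rintro s₄ ⟨a4, p4, q4⟩
    have n4 : ∀ a < 46, s₄.nat a = s.nat a := fun a ha => by
      rw [a4.nat a (by omega) (by omega), a3.nat a (by omega) (by omega), l2.nat a (by omega),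
        h2 a ha]
    have e46 : s₄.nat 46 0 0 = k * θ := by
      rw [a4.nat 46 (by omega) (by omega), a3.nat 46 (by omega) (by omega),
        l2.nat 46 (by omega), h1]
    refine Runs.setNat_last ⟨?_, ?_, ?_, ?_⟩ ?_
    · simp [State.putNat_nat, NatExp.eval, e46, n4, hs.θ, hθdef]; ring
    · intro a ha
      rw [State.putNat_nat_of_ne (by omega), n4 a ha]
    · intro a ha h9
      rw [State.putNat_real, a4.real a h9, a3.real a h9, l2.real a ha, h3 a ha h9]
    · intro p hp q hq hpq
      rw [State.putNat_real]
      rw [add_mul, one_mul] at hpq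
      by_cases c1 : (P ≤ p ∧ p < P + θ) ∧ k * θ ≤ q ∧ q < k * θ + θ
      · obtain ⟨p', rfl⟩ := Nat.exists_eq_add_of_le c1.1.1
        obtain ⟨q', rfl⟩ := Nat.exists_eq_add_of_le c1.2.1
        rw [p4 p' (by omega) q' (by omega), v2 q' (by omega) p' (by omega), hsym _ hq _ hp]
      · rw [q4 p q c1]
        by_cases c2 : (k * θ ≤ p ∧ p < k * θ + θ) ∧ P ≤ q ∧ q < P + θ
        · obtain ⟨p', rfl⟩ := Nat.exists_eq_add_of_le c2.1.1
          obtain ⟨q', rfl⟩ := Nat.exists_eq_add_of_le c2.2.1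
          rw [p3 p' (by omega) q' (by omega), v2 p' (by omega) q' (by omega)]
        · rw [q3 p q c2, l2.real 9 (by norm_num), h4 p hp q hq (by omega)]
    · simp [NatExp.cost]
      nlinarith
  · refine ⟨by simp [State.putNat_nat, NatExp.eval], fun a ha => State.putNat_nat_of_ne (by omega),
      fun _ _ _ => rfl, fun p hp q hq hpq => ?_⟩
    rcases hpq with h | h | h
    · exact hG p h.1 q h.2
    · omega
    · omega
  -- The list has at most 2T² rows and θ ≤ T², so (N + 1) θ ≤ 3T². Also θ < D, so the inner blocks
  -- cover O(D). The N + 1 products thus cost O(T² D θ^(ω-2)).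
  · have h1 : ((N : ℝ) + 1) * θ ≤ 3 * (c.T : ℝ) ^ 2 := by
      have h2 : θ * N ≤ c.T * c.T + c.T * c.T := by rw [← hN]; exact hpc.trans hcnt
      have h3 : (θ : ℝ) * N ≤ c.T * c.T + c.T * c.T := by exact_mod_cast h2
      have h4 : (θ : ℝ) ≤ c.T * c.T := by exact_mod_cast c.θ_le
      nlinarith
    have h2 : ((nb : ℝ) + 2 + 1) * θ ≤ 5 * 2 ^ c.a := by nlinarith
    have hY : (1 : ℝ) ≤ (θ : ℝ) ^ (μ.ω - 2) := Real.one_le_rpow hθR (by linarith [μ.two_le])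
    have hbatch := c.batch_ge μ.two_le
    have h3 : ((N : ℝ) + 1) * (μ.K * (nb + 2 + 1) * (θ : ℝ) ^ μ.ω) ≤ 15 * μ.K * c.batch := by
      rw [hθdef, c.θ_rpow, ← hθdef, Conf.batch, ← hθdef]
      have := mul_le_mul h1 h2 (by positivity) (by positivity)
      have := mul_le_mul_of_nonneg_right this (show 0 ≤ μ.K * (θ : ℝ) ^ (μ.ω - 2) by positivity)
      nlinarith
    have hN0 : (0 : ℝ) ≤ (N : ℝ) + 1 := by positivity
    have h4 : ((N : ℝ) + 1) * 10 ≤ ((N : ℝ) + 1) * (μ.K * (θ : ℝ) ^ μ.ω) :=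
      mul_le_mul_of_nonneg_left (by nlinarith) hN0
    simp [NatExp.cost, Test.cost]
    nlinarith
  · rintro s' ⟨k, -, -, ⟨h1, h2, h3, h4⟩, hb⟩
    simp only [Test.Holds, NatExp.eval, h1, h2 19 (by norm_num), not_lt, ← hP] at hb
    refine ⟨h2, h3, fun p hp q hq hp' hq' => h4 p hp q hq ?_⟩
    have : P + θ ≤ k * θ := by
      have h5 : N < k := by
        by_contra hc
        push Not at hc
        have : k * θ ≤ θ * N := by rw [mul_comm θ N]; exact Nat.mul_le_mul_right _ hc
        omega
      rw [hN]
      nlinarith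
    omega

/-- Treat all full batches. -/
def fullProg : Prog :=
  .loop (.natLt (.add (V 19) (V 6)) (.add (V 16) (.lit 1))) <|
    .seq μ.processProg (setV 19 (.add (V 19) (V 6)))

/-- P' is the end of the last batch that fits into the list. The cost is proportional to P' − P, so
a row pays for its full batch only once per block. At most θ − 1 rows remain. -/
theorem runs_fullProg {ρ : Tape} {s : State} {c : Conf μ.ω} {w : ℕ → ℝ} (hs : Static c s)
    (hb : Base c w s) (hl : Listed c.n s) (hlow : c.LowRank) (hdvd : c.θ ∣ s.nat 19 0 0)
    (hpc : s.nat 19 0 0 ≤ s.nat 16 0 0) (hcnt : s.nat 16 0 0 ≤ c.T * c.T + c.T * c.T)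
    (hG : ∀ p < s.nat 19 0 0, ∀ q < s.nat 19 0 0, s.real 9 p q = c.g s p q) :
    ∃ P', s.nat 19 0 0 ≤ P' ∧ P' ≤ s.nat 16 0 0 ∧ s.nat 16 0 0 < P' + c.θ ∧ c.θ ∣ P' ∧
    Runs ρ μ.fullProg s (21 * μ.K * c.batch / c.θ * (P' - s.nat 19 0 0) + 20) (fun s' =>
      (∀ a < 46, a ≠ 19 → s'.nat a = s.nat a) ∧ s'.nat 19 0 0 = P' ∧
      (∀ a < 80, a ≠ 9 → s'.real a = s.real a) ∧
      ∀ p < P', ∀ q < P', s'.real 9 p q = c.g s p q) := by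
  have hθ := c.θ_pos
  set P := s.nat 19 0 0 with hP
  set C := s.nat 16 0 0 with hC
  set θ := c.θ with hθdef
  set N := (C - P) / θ with hN
  have hNle : N * θ ≤ C - P := Nat.div_mul_le_self _ _
  have hNlt : C - P < N * θ + θ := by
    have := Nat.lt_div_mul_add (a := C - P) (b := θ) (by omega)
    exact this
  refine ⟨P + N * θ, by omega, by omega, by omega, (Nat.dvd_add_right hdvd).2 ⟨N, mul_comm _ _⟩, ?_⟩
  have hbatch := c.batch_ge μ.two_le
  have hK := μ.K_ge
  refine (Runs.while_le (I := fun k s' => s'.nat 19 0 0 = P + k * θ ∧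
    (∀ a < 46, a ≠ 19 → s'.nat a = s.nat a) ∧ (∀ a < 80, a ≠ 9 → s'.real a = s.real a) ∧
    ∀ p < P + k * θ, ∀ q < P + k * θ, s'.real 9 p q = c.g s p q) N
    (B := 20 * μ.K * c.batch + 20) (k := 0) (by positivity) ?_ ?_ (Nat.zero_le _)).mono ?_ ?_
  · rintro k s₁ ⟨h1, h2, h3, h4⟩ hc
    simp only [Test.Holds, NatExp.eval, h1, h2 16 (by norm_num) (by norm_num),
      h2 6 (by norm_num) (by norm_num), hs.θ, ← hC, ← hθdef] at hc
    have hg : ∀ p q, c.g s₁ p q = c.g s p q := by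
      intro p q
      simp only [Conf.g, h2 17 (by norm_num) (by norm_num), h3 8 (by norm_num) (by norm_num)]
    refine ⟨?_, ?_⟩
    · by_contra hcc
      push Not at hcc
      have : N * θ ≤ k * θ := Nat.mul_le_mul_right _ hcc
      omega
    refine Runs.step (μ.runs_processProg (hs.congr (fun a ha => h2 a (by omega) (by omega))
      (fun a ha => h3 a (by omega) (by omega))) (hb.congr (fun a ha => h3 a (by omega) (by omega)))
      (hl.congr (h2 16 (by norm_num) (by norm_num)) (h2 17 (by norm_num) (by norm_num))
        (h2 18 (by norm_num) (by norm_num))) hlow ?_ ?_ ?_ ?_) ?_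
    · rw [h1]; exact (Nat.dvd_add_right hdvd).2 ⟨k, mul_comm _ _⟩
    · rw [h1, h2 16 (by norm_num) (by norm_num)]; omega
    · rw [h2 16 (by norm_num) (by norm_num)]; exact hcnt
    · rw [h1]; intro p hp q hq
      rw [h4 p hp q hq, hg]
    rintro s₂ ⟨n2, r2, g2⟩
    rw [h1, h2 16 (by norm_num) (by norm_num), ← hθdef, ← hC] at g2
    refine Runs.setNat_last ⟨?_, fun a ha h19 => ?_, fun a ha h9 => ?_, fun p hp q hq => ?_⟩ ?_
    · simp only [State.putNat_nat, NatExp.eval, n2 19 (by norm_num), n2 6 (by norm_num), h1,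
        h2 6 (by norm_num) (by norm_num), hs.θ]
      simp only [and_self, if_true]
      ring
    · rw [State.putNat_nat_of_ne h19, n2 a ha, h2 a ha h19]
    · rw [State.putNat_real, r2 a ha h9, h3 a ha h9]
    · rw [State.putNat_real, g2 p ?_ q ?_ ?_ ?_, hg] <;> rw [add_mul, one_mul] at hp hq <;> omega
    · simp [NatExp.cost]; linarith
  · refine ⟨by simp [hP], fun _ _ _ => rfl, fun _ _ _ => rfl, ?_⟩
    rw [zero_mul, add_zero]; exact hG
  · simp [NatExp.cost, Test.cost]
    have hθ0 : (0 : ℝ) < θ := by exact_mod_cast hθ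
    have e : 21 * μ.K * c.batch / θ * ((N : ℝ) * θ) = 21 * μ.K * c.batch * N := by field_simp
    rw [e]
    have : (N : ℝ) * (20 * μ.K * c.batch + 20 + 13) ≤ N * (21 * μ.K * c.batch) :=
      mul_le_mul_of_nonneg_left (by nlinarith) (Nat.cast_nonneg _)
    linarith
  · rintro s' ⟨k, hk, -, ⟨h1, h2, h3, h4⟩, hc⟩
    simp only [Test.Holds, NatExp.eval, h1, h2 16 (by norm_num) (by norm_num),
      h2 6 (by norm_num) (by norm_num), hs.θ, ← hC, ← hθdef, not_lt] at hc
    obtain rfl : k = N := by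
      refine le_antisymm hk ?_
      by_contra hcc
      push Not at hcc
      have : (k + 1) * θ ≤ N * θ := Nat.mul_le_mul_right _ hcc
      rw [add_mul, one_mul] at this
      omega
    exact ⟨h2, h1, h3, h4⟩

end Mul

/-! ### Update of the inverse -/

/-- The indicator of `i = j`. -/
abbrev eqInd (i j : NatExp) : RealExp := .ofNat (.sub (.lit 1) (.add (.sub i j) (.sub j i)))

/-- The indicator of `i < n`. -/
abbrev ltInd (i n : NatExp) : RealExp := .ofNat (.sub (.lit 1) (.sub (.lit 1) (.sub n i)))

theorem eval_eqInd {s : State} {i j : ℕ} {e f : NatExp} (he : e.eval s = i) (hf : f.eval s = j) :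
    (eqInd e f).eval s = if i = j then 1 else 0 := by
  simp only [RealExp.eval, NatExp.eval, he, hf]
  split_ifs with h
  · rw [show 1 - (i - j + (j - i)) = 1 by omega]; norm_num
  · rw [show 1 - (i - j + (j - i)) = 0 by omega]; norm_num

theorem eval_ltInd {s : State} {i n : ℕ} {e f : NatExp} (he : e.eval s = i) (hf : f.eval s = n) :
    (ltInd e f).eval s = if i < n then 1 else 0 := by
  simp only [RealExp.eval, NatExp.eval, he, hf]
  split_ifs with h
  · rw [show 1 - (1 - (n - i)) = 1 by omega]; norm_num
  · rw [show 1 - (1 - (n - i)) = 0 by omega]; norm_num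

/-- The change of the weight of the `p`-th listed row. -/
abbrev deltaE (p : NatExp) : RealExp :=
  .sub (.get 1 (.get 17 p (.lit 0)) (.lit 0)) (.get 5 (.get 17 p (.lit 0)) (.lit 0))

/-- The change of the weight of the `p`-th listed row. -/
noncomputable def delta (s : State) (p : ℕ) : ℝ :=
  s.real 1 (s.nat 17 p 0) 0 - s.real 5 (s.nat 17 p 0) 0

/-- The matrix `1 + Δ G`, padded by an identity matrix. -/
noncomputable def capMat (m : ℕ) (δ : ℕ → ℝ) (g : ℕ → ℕ → ℝ) (p q : ℕ) : ℝ :=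
  (if p = q then 1 else 0) + if p < m ∧ q < m then δ p * g p q else 0

namespace Conf

variable {ω : ℝ} (c : Conf ω)

theorem alpha_eq : c.T * c.T + c.T * c.T = 2 ^ (2 * c.τ + 1) := by
  simp only [T]; ring

/-- T² and D are powers of two with T² < D, so 2T² ≤ D and the table of powers reaches far enough to
invert matrices of size 2T². -/
theorem level_le (h : c.LowRank) : 2 * c.τ + 1 ≤ c.a := by
  have h1 : 2 ^ (2 * c.τ) < 2 ^ c.a := by
    have : (2 : ℕ) ^ (2 * c.τ) = c.T * c.T := by simp only [T]; ring
    rw [this]; exact h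
  exact (Nat.pow_lt_pow_iff_right (by norm_num)).1 h1

theorem T_sq_rpow : ((c.T * c.T : ℕ) : ℝ) ^ ω = c.round := by
  rw [round, ← Real.mul_rpow (by positivity) (by positivity), T]
  push_cast; rfl

theorem alpha_rpow : ((2 : ℝ) ^ (2 * c.τ + 1)) ^ ω = 2 ^ ω * c.round := by
  rw [round, ← Real.mul_rpow (by positivity) (by positivity),
    ← Real.mul_rpow (by positivity) (by positivity)]
  congr 1; ring

theorem round_ge (hω : 2 ≤ ω) : 1 ≤ c.round := by
  have : 1 ≤ ((2 : ℝ) ^ c.τ) ^ ω := Real.one_le_rpow (one_le_pow₀ (by norm_num)) (by linarith)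
  exact one_le_mul_of_one_le_of_one_le this this

end Conf

namespace Mul

variable (μ : Mul)

/-- Compute the inverse of `1 + Δ G`. -/
def lowProg : Prog :=
  .seq μ.processProg <|
  .seq (assign2 13 (.add (.lit 0) (V 80)) (.add (.lit 0) (V 81)) (V 5) (V 5)
    (.add (eqInd (V 80) (V 81)) (.mul (.mul (ltInd (V 80) (V 16)) (ltInd (V 81) (V 16)))
      (.mul (deltaE (V 80)) (.get 9 (V 80) (V 81)))))) <|
  .seq (setV 38 (V 5)) <| .seq (setV 39 (V 4)) μ.invProg

/-- The incomplete batch is computed without advancing register 19, so its entries are recomputed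
once more rows have arrived. The matrix 1 + ΔG is padded by an identity block to the fixed size 2T²
= 2^(2τ+1), whose inversion costs O(T^(2ω)) up to a logarithm. -/
theorem runs_lowProg {ρ : Tape} {s : State} {c : Conf μ.ω} {w : ℕ → ℝ} (hs : Static c s)
    (hb : Base c w s) (hl : Listed c.n s) (hlow : c.LowRank) (hdvd : c.θ ∣ s.nat 19 0 0)
    (hpc : s.nat 19 0 0 ≤ s.nat 16 0 0) (hcnt : s.nat 16 0 0 ≤ c.T * c.T + c.T * c.T)
    (hlast : s.nat 16 0 0 < s.nat 19 0 0 + c.θ)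
    (hG : ∀ p < s.nat 19 0 0, ∀ q < s.nat 19 0 0, s.real 9 p q = c.g s p q)
    (hdet : IsUnit (blk (capMat (s.nat 16 0 0) (delta s) (c.g s)) 0 0 (2 ^ (2 * c.τ + 1))).det) :
    Runs ρ μ.lowProg s (20 * μ.K * c.batch + 32 * μ.K * 2 ^ μ.ω * (c.a + 1) * c.round) (fun s' =>
      (∀ a < 80, a < 30 → s'.nat a = s.nat a) ∧
      (∀ a < 80, a ≠ 9 → (a < 13 ∨ 16 < a) → s'.real a = s.real a) ∧
      (∀ p < s.nat 19 0 0, ∀ q < s.nat 19 0 0, s'.real 9 p q = c.g s p q) ∧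
      blk (s'.real 15) 0 0 (2 ^ (2 * c.τ + 1)) =
        (blk (capMat (s.nat 16 0 0) (delta s) (c.g s)) 0 0 (2 ^ (2 * c.τ + 1)))⁻¹) := by
  have hm : 1 ≤ 2 ^ (2 * c.τ + 1) := Nat.one_le_two_pow
  refine Runs.step (μ.runs_processProg hs hb hl hlow hdvd hpc hcnt hG) ?_
  rintro s₁ ⟨n1, r1, g1⟩
  refine Runs.step (runs_assign_blk 0 0 (2 ^ (2 * c.τ + 1))
    (capMat (s.nat 16 0 0) (delta s) (c.g s)) ?_ (by simp [NatExp.cost])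
    (by simp [NatExp.cost]) (by simp [NatExp.cost]) ?_ hm ?_) ?_
  · intro s₂ h; simp [NatExp.eval, h.nat, n1, hs.alpha, c.alpha_eq]
  · simp [NatExp.cost, RealExp.cost]
  · intro i hi j hj s₂ h h1 h2 _
    have h16 : (V 16).eval s₂ = s.nat 16 0 0 := by simp [NatExp.eval, h.nat, n1]
    have e1 := eval_eqInd (s := s₂) (e := V 80) (f := V 81) h1 h2
    have e2 := eval_ltInd (s := s₂) (e := V 80) (f := V 16) h1 h16
    have e3 := eval_ltInd (s := s₂) (e := V 81) (f := V 16) h2 h16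
    have e4 : (deltaE (V 80)).eval s₂ = delta s i := by
      simp [RealExp.eval, NatExp.eval, delta, h.nat, h.real, n1, r1, h1]
    have e5 : (RealExp.get 9 (V 80) (V 81)).eval s₂ = s₁.real 9 i j := by
      simp [RealExp.eval, NatExp.eval, h.real, h1, h2]
    have e6 : ∀ x y : RealExp, (RealExp.add x y).eval s₂ = x.eval s₂ + y.eval s₂ := fun _ _ => rfl
    have e7 : ∀ x y : RealExp, (RealExp.mul x y).eval s₂ = x.eval s₂ * y.eval s₂ := fun _ _ => rfl
    rw [e6, e7, e7, e7, e1, e2, e3, e4, e5, capMat]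
    by_cases c1 : i < s.nat 16 0 0 <;> by_cases c2 : j < s.nat 16 0 0 <;> simp only [c1, c2,
      if_true, if_false, and_self, and_false, false_and, mul_zero, zero_mul, one_mul, mul_one]
    rw [g1 i c1 j c2 (by omega) (by omega)]
  rintro s₂ ⟨a2, p2, -⟩
  refine Runs.setNat_step <| Runs.setNat_step ?_
  have b2 : blk (s₂.real 13) 0 0 (2 ^ (2 * c.τ + 1)) =
      blk (capMat (s.nat 16 0 0) (delta s) (c.g s)) 0 0 (2 ^ (2 * c.τ + 1)) := by
    ext ⟨i, hi⟩ ⟨j, hj⟩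
    have := p2 i hi j hj
    simpa [blk] using this
  have n2 : ∀ a < 30, s₂.nat a = s.nat a := fun a ha => by
    rw [a2.nat a (by omega) (by omega), n1 a (by omega)]
  refine (μ.runs_invProg (2 * c.τ + 1) ?_ ?_ ?_ ?_).mono ?_ ?_
  · simp [State.putNat_nat, NatExp.eval, n2, hs.alpha, c.alpha_eq]
  · simp [State.putNat_nat, NatExp.eval, n2, hs.level]
  · intro j hj
    simp [State.putNat_nat, n2, hs.pow j (by have := c.level_le hlow; omega)]
  · simp only [State.putNat_real]
    rw [b2]; exact hdet
  · have h1 := μ.sq_le (2 ^ (2 * c.τ + 1))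
    have h2 := μ.K_ge
    have e : ((2 ^ (2 * c.τ + 1) : ℕ) : ℝ) = (2 : ℝ) ^ (2 * c.τ + 1) := by push_cast; rfl
    rw [e] at h1 ⊢
    have h3 : (1 : ℝ) ≤ ((2 : ℝ) ^ (2 * c.τ + 1)) ^ 2 := one_le_pow₀ (one_le_pow₀ (by norm_num))
    have h4 : ((2 * c.τ + 1 : ℕ) : ℝ) ≤ c.a := by exact_mod_cast c.level_le hlow
    have e2 : 32 * μ.K * 2 ^ μ.ω * (c.a + 1) * c.round =
        32 * μ.K * (c.a + 1) * ((2 : ℝ) ^ (2 * c.τ + 1)) ^ μ.ω := by rw [c.alpha_rpow]; ring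
    rw [e2]
    set X := ((2 : ℝ) ^ (2 * c.τ + 1)) ^ μ.ω
    have h5 : μ.K * X * (((2 * c.τ + 1 : ℕ) : ℝ)) ≤ μ.K * X * c.a :=
      mul_le_mul_of_nonneg_left h4 (by nlinarith)
    have h6 : 0 ≤ μ.K * X * c.a := mul_nonneg (by nlinarith) (Nat.cast_nonneg _)
    simp only [NatExp.cost]
    push_cast at h5 ⊢
    nlinarith
  · rintro s₃ ⟨f1, f2, f3⟩
    simp only [State.putNat_real] at f2 f3
    refine ⟨fun a ha ha' => ?_, fun a ha h9 ha' => ?_, fun p hp q hq => ?_, ?_⟩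
    · rw [f1 a ha (by omega), State.putNat_nat_of_ne (by omega), State.putNat_nat_of_ne (by omega),
        n2 a ha']
    · rw [f2 a ha (by omega) (by omega) (by omega), a2.real a (by omega), r1 a ha h9]
    · rw [f2 9 (by norm_num) (by omega) (by omega) (by omega), a2.real 9 (by omega),
        g1 p (by omega) q (by omega) (by omega) (by omega)]
    · rw [f3, b2]

/-- Compute the inverse of `Aᵀ diag(u) A` for the current weights `u` of the listed rows. -/
def directProg : Prog :=
  .seq (μ.prod (V 1) (V 16) (fun i l => .mul (ltInd l (V 16)) (.mul (deltaE l)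
      (.get 0 (.get 17 l (.lit 0)) i)))
    (fun l j => .get 0 (.get 17 l (.lit 0)) j)) <|
  μ.padInvProg (.add (.get 6 (V 80) (V 81)) (.get 80 (V 80) (V 81)))

/-- Here D ≤ T² and the list has at most 2T² rows. The update takes at most 3T² / D products of size
D, and T² D^(ω-1) ≤ T^(2ω). The inversion obeys the same bound up to the logarithm. -/
theorem runs_directProg {ρ : Tape} {s : State} {c : Conf μ.ω} {w : ℕ → ℝ} (hs : Static c s)
    (hb : Base c w s) (hdir : ¬ c.LowRank) (hcnt : s.nat 16 0 0 ≤ c.T * c.T + c.T * c.T)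
    (hdet : IsUnit (blk (padId c.d fun i j => c.q w i j + ∑ p ∈ Finset.range (s.nat 16 0 0),
      delta s p * c.A (s.nat 17 p 0) i * c.A (s.nat 17 p 0) j) 0 0 (2 ^ c.a)).det) :
    Runs ρ μ.directProg s (40 * μ.K * (c.a + 1) * c.round) (fun s' =>
      (∀ a < 80, a < 30 → s'.nat a = s.nat a) ∧
      (∀ a < 80, (a < 13 ∨ 16 < a) → s'.real a = s.real a) ∧
      blk (s'.real 15) 0 0 (2 ^ c.a) =
        (blk (padId c.d fun i j => c.q w i j + ∑ p ∈ Finset.range (s.nat 16 0 0),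
          delta s p * c.A (s.nat 17 p 0) i * c.A (s.nat 17 p 0) j) 0 0 (2 ^ c.a))⁻¹) := by
  have hm : 1 ≤ 2 ^ c.a := Nat.one_le_two_pow
  set C := s.nat 16 0 0 with hC
  set nb := (C + 2 ^ c.a - 1) / 2 ^ c.a with hnb
  refine Runs.step (μ.runs_prod (2 ^ c.a) C nb
    (fun i l => (if l < C then 1 else 0) * (delta s l * c.A (s.nat 17 l 0) i))
    (fun l j => c.A (s.nat 17 l 0) j) hm (nb_ceil hm C) ?_ ?_ ?_ (by simp [NatExp.cost])
    (by simp [NatExp.cost]) (by simp [NatExp.cost, RealExp.cost])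
    (by simp [NatExp.cost, RealExp.cost])) ?_
  · intro s₁ l; simp [NatExp.eval, l.nat, hs.dh, hC]
  · intro s₁ l e₁ e₂
    have e7 : ∀ x y : RealExp, (RealExp.mul x y).eval s₁ = x.eval s₁ * y.eval s₁ := fun _ _ => rfl
    rw [e7, eval_ltInd (i := e₂.eval s₁) (n := C) rfl (by simp [NatExp.eval, l.nat, hC])]
    simp [RealExp.eval, NatExp.eval, delta, l.real, l.nat, hs.entries.mat]
  · intro s₁ l e₁ e₂; simp [RealExp.eval, NatExp.eval, l.real, l.nat, hs.entries.mat]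
  rintro s₁ ⟨l1, p1⟩
  refine (μ.runs_padInvProg (hs.congr (fun a ha => l1.nat a (by omega))
    (fun a ha => l1.real a (by omega))) _ (by simp [RealExp.cost, NatExp.cost]) ?_ hdet).mono ?_ ?_
  · intro i hi j hj s₂ h h1 h2
    simp only [RealExp.eval, NatExp.eval, h1, h2, h.real 6 (by norm_num), h.real 80 (by norm_num),
      p1 i hi j hj, l1.real 6 (by norm_num), hb.gram i hi j hj]
    -- The indicator in the first factor removes the positions beyond the end of the list that the
    -- rounded product visits.
    rw [sum_range_of_supp (le_ceil_mul hm C)]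
    · congr 1
      refine Finset.sum_congr rfl fun p hp => ?_
      rw [if_pos (Finset.mem_range.1 hp), one_mul]
    · intro l hl
      rw [if_neg (by omega)]; ring
  · have hd : 2 ^ c.a ≤ c.T * c.T := not_lt.1 hdir
    have h1 : ((2 : ℝ) ^ c.a) ^ μ.ω ≤ c.round := by
      rw [← c.T_sq_rpow]
      refine Real.rpow_le_rpow (by positivity) ?_ (by linarith [μ.two_le])
      exact_mod_cast hd
    have h2 : (nb : ℝ) * ((2 : ℝ) ^ c.a) ^ μ.ω ≤ 3 * c.round := by
      have h3 : (nb : ℝ) * (2 : ℝ) ^ c.a ≤ 3 * ((c.T * c.T : ℕ) : ℝ) := by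
        have : nb * 2 ^ c.a ≤ 3 * (c.T * c.T) := (ceil_mul_le C).trans (by omega)
        exact_mod_cast this
      have h4 : ((2 : ℝ) ^ c.a) ^ (μ.ω - 1) ≤ ((c.T * c.T : ℕ) : ℝ) ^ (μ.ω - 1) :=
        Real.rpow_le_rpow (by positivity) (by exact_mod_cast hd) (by linarith [μ.two_le])
      have hT : ((c.T * c.T : ℕ) : ℝ) ≠ 0 := by have := c.T_pos; positivity
      have h5 : ((c.T * c.T : ℕ) : ℝ) * ((c.T * c.T : ℕ) : ℝ) ^ (μ.ω - 1) = c.round := by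
        rw [← c.T_sq_rpow, Real.rpow_sub_one hT]; field_simp
      rw [c.dh_pow, ← mul_assoc, ← h5, ← mul_assoc]
      exact mul_le_mul h3 h4 (by positivity) (by positivity)
    have hK := μ.K_ge
    have h6 := c.round_ge μ.two_le
    have h7 : μ.K * (nb * ((2 : ℝ) ^ c.a) ^ μ.ω) ≤ μ.K * (3 * c.round) :=
      mul_le_mul_of_nonneg_left h2 (by linarith)
    have h8 : μ.K * (c.a + 1) * ((2 : ℝ) ^ c.a) ^ μ.ω ≤ μ.K * (c.a + 1) * c.round :=
      mul_le_mul_of_nonneg_left h1 (by positivity)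
    have h9 : μ.K * ((2 : ℝ) ^ c.a) ^ μ.ω ≤ μ.K * c.round :=
      mul_le_mul_of_nonneg_left h1 (by linarith)
    have h10 : 0 ≤ μ.K * c.a * c.round := by positivity
    rw [c.dh_cast]
    nlinarith
  · rintro s₂ ⟨f1, f2, f3⟩
    exact ⟨fun a ha ha' => by rw [f1 a ha ha', l1.nat a ha],
      fun a ha ha' => by rw [f2 a ha ha', l1.real a ha], f3⟩

end Mul

/-! ### Preconditioned gradient descent -/

theorem runs_scatter_row {ρ : Tape} {a : ℕ} {m₁ m₂ : NatExp} {e : RealExp} {s : State}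
    (N₁ N₂ w : ℕ) (f : ℕ → ℕ → ℝ) (hm : ∀ s₁, Agr a s s₁ → m₁.eval s₁ = N₁ ∧ m₂.eval s₁ = N₂)
    (hw : e.cost + m₁.cost + m₂.cost + 40 ≤ w)
    (hs : ∀ i < N₁, ∀ j < N₂, ∀ s₁, Agr a s s₁ → s₁.nat 80 0 0 = i → s₁.nat 81 0 0 = j →
      e.eval s₁ = f i j) :
    Runs ρ (scatter2 a (V 80) (.lit 0) m₁ m₂ e) s (N₁ * (N₂ * w + w) + w)
      (fun s' => Agr a s s' ∧ ∀ i < N₁, s'.real a i 0 = s.real a i 0 +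
        ∑ j ∈ Finset.range N₂, f i j) := by
  refine (Runs.scatter2 N₁ N₂ w (fun i _ => i) (fun _ _ => 0) f hm
    (by simp only [NatExp.cost]; omega) fun i hi j hj s₁ h h1 h2 =>
      ⟨show (V 80).eval s₁ = i from h1, rfl, hs i hi j hj s₁ h h1 h2⟩).mono le_rfl ?_
  rintro s' ⟨h1, h2⟩
  refine ⟨h1, fun i hi => ?_⟩
  rw [h2, Finset.sum_eq_single_of_mem i (Finset.mem_range.2 hi)]
  · simp
  · intro i' _ hne
    refine Finset.sum_eq_zero fun j _ => if_neg fun h => hne h.1.symm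

theorem runs_assign_row {ρ : Tape} {a : ℕ} {m : NatExp} {e : RealExp} {s : State}
    (N w : ℕ) (f : ℕ → ℝ) (hm : ∀ s₁, Agr a s s₁ → m.eval s₁ = N)
    (hw : e.cost + m.cost + 40 ≤ w)
    (hs : ∀ i < N, ∀ s₁, Agr a s s₁ → s₁.nat 80 0 0 = i → e.eval s₁ = f i) :
    Runs ρ (assign2 a (V 80) (.lit 0) m (.lit 1) e) s (N * (w + w) + w)
      (fun s' => Agr a s s' ∧ ∀ i < N, s'.real a i 0 = f i) := by
  refine (Runs.assign2 N 1 w (fun i _ => i) (fun _ _ => 0) (fun i _ => f i)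
    (fun s₁ h => ⟨hm s₁ h, rfl⟩) (by simp only [NatExp.cost]; omega) ?_
    fun i hi j hj s₁ h h1 h2 _ =>
      ⟨show (V 80).eval s₁ = i from h1, rfl, hs i hi s₁ h h1⟩).mono (by simp) ?_
  · rintro i _ j _ i' _ j' _ rfl _; rfl
  · rintro s' ⟨h1, h2, _⟩
    exact ⟨h1, fun i hi => h2 i hi 0 (by norm_num)⟩

/-- Real array `22` becomes the residual `b - M x`. -/
def residualProg : Prog :=
  .seq (assign2 22 (V 80) (.lit 0) eD (.lit 1) (.get 2 (V 80) (.lit 0))) <|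
  .seq (assign2 23 (.get 10 (V 80) (.lit 0)) (.lit 0) (V 9) (.lit 1) (.lit 0)) <|
  .seq (scatter2 23 (.get 10 (V 80) (.lit 0)) (.lit 0) (V 9) (.lit 1)
    (.mul (.get 4 (.get 11 (V 80) (.lit 0)) (.lit 0)) (.get 10 (V 80) (.lit 0)))) <|
  scatter2 22 (.get 11 (V 80) (.lit 0)) (.lit 0) (V 9) (.lit 1)
    (.mul (.mul (.sub (.lit 0) (.get 1 (.get 10 (V 80) (.lit 0)) (.lit 0)))
      (.get 23 (.get 10 (V 80) (.lit 0)) (.lit 0))) (.get 10 (V 80) (.lit 0)))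

theorem prefixSum_full (d : ℕ) (F : ℕ → ℕ → ℝ) (n : ℕ) :
    prefixSum d F n 0 = ∑ i ∈ Finset.range n, ∑ j ∈ Finset.range d, F i j := by
  simp [prefixSum]

/-- A x is accumulated in array 23 by one pass over the list of entries, and Aᵀ is applied by a
second pass. The cost is nnz(A) + d because only the cells of nonzero rows are cleared. -/
theorem runs_residualProg {ρ : Tape} {s : State} {ω : ℝ} {c : Conf ω} (hs : Static c s) :
    Runs ρ residualProg s (1000 * (c.z + c.d)) (fun s' =>
      (∀ b < 80, s'.nat b = s.nat b) ∧ (∀ b < 80, b ≠ 22 → b ≠ 23 → s'.real b = s.real b) ∧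
      ∀ j < c.d, s'.real 22 j 0 = s.real 2 j 0 - ∑ i ∈ Finset.range c.n,
        s.real 1 i 0 * (∑ l ∈ Finset.range c.d, c.A i l * s.real 4 l 0) * c.A i j) := by
  refine Runs.step (runs_assign_row c.d 50 (fun i => s.real 2 i 0) ?_
    (by simp [NatExp.cost, RealExp.cost]) ?_) ?_
  · intro s₁ h; simp [NatExp.eval, h.nat, hs.entries.d_eq]
  · intro i hi s₁ h h1; simp [RealExp.eval, NatExp.eval, h1, h.real]
  rintro s₁ ⟨a1, p1⟩
  refine Runs.step (Runs.assign2 c.z 1 50 (fun e _ => s.nat 10 e 0) (fun _ _ => 0) (fun _ _ => 0)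
    ?_ (by simp [NatExp.cost, RealExp.cost]) (fun _ _ _ _ _ _ _ _ _ _ => rfl) ?_) ?_
  · intro s₂ h; simp [NatExp.eval, h.nat, a1.nat, hs.z]
  · intro i hi j hj s₂ h h1 h2 _; simp [RealExp.eval, NatExp.eval, h1, h.nat, a1.nat]
  rintro s₂ ⟨a2, p2, -⟩
  refine Runs.step (Runs.scatter2 c.z 1 80 (fun e _ => s.nat 10 e 0) (fun _ _ => 0)
    (fun e _ => s.real 4 (s.nat 11 e 0) 0 * s.real 10 e 0)
    ?_ (by simp [NatExp.cost, RealExp.cost]) ?_) ?_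
  · intro s₃ h; simp [NatExp.eval, h.nat, a2.nat, a1.nat, hs.z]
  · intro i hi j hj s₃ h h1 h2
    simp [RealExp.eval, NatExp.eval, h1, h.nat, a2.nat, a1.nat, h.real, a2.real, a1.real]
  rintro s₃ ⟨a3, p3⟩
  -- `Entries` does not record that listed rows lie below n, so the other case is carried along. It
  -- does no harm, since values outside the index range do not enter the sum identity.
  have v3 : ∀ e < c.z, s₃.real 23 (s.nat 10 e 0) 0 =
      ∑ l ∈ Finset.range c.d, c.A (s.nat 10 e 0) l * s.real 4 l 0 ∨ c.n ≤ s.nat 10 e 0 := by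
    intro e he
    by_cases hr : c.n ≤ s.nat 10 e 0
    · exact Or.inr hr
    left
    have h1 := hs.entries.sum (fun i j => if s.nat 10 e 0 = i then s.real 4 j 0 else 0)
    rw [prefixSum_full, hs.z] at h1
    rw [p3, p2 e he 0 (by norm_num), zero_add]
    have h2 : ∀ x ∈ Finset.range c.z, (∑ j ∈ Finset.range 1, if s.nat 10 e 0 = s.nat 10 x 0 ∧ 0 = 0
        then s.real 4 (s.nat 11 x 0) 0 * s.real 10 x 0 else 0) =
        (if s.nat 10 e 0 = s.nat 10 x 0 then s.real 4 (s.nat 11 x 0) 0 else 0) * s.real 10 x 0 := by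
      intro x _
      simp
    rw [Finset.sum_congr rfl h2, h1,
      Finset.sum_eq_single_of_mem (s.nat 10 e 0) (Finset.mem_range.2 (by omega))]
    · refine Finset.sum_congr rfl fun l _ => ?_
      rw [if_pos rfl, mul_comm]
    · intro i _ hne
      refine Finset.sum_eq_zero fun j _ => ?_
      rw [if_neg (Ne.symm hne), zero_mul]
  refine (Runs.scatter2 c.z 1 80 (fun e _ => s.nat 11 e 0) (fun _ _ => 0)
    (fun e _ => (0 - s.real 1 (s.nat 10 e 0) 0) * s₃.real 23 (s.nat 10 e 0) 0 * s.real 10 e 0)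
    ?_ (by simp [NatExp.cost, RealExp.cost]) ?_).mono ?_ ?_
  · intro s₄ h; simp [NatExp.eval, h.nat, a3.nat, a2.nat, a1.nat, hs.z]
  · intro i hi j hj s₄ h h1 h2
    simp [RealExp.eval, NatExp.eval, h1, h.nat, a3.nat, a2.nat, a1.nat, h.real, a3.real, a2.real,
      a1.real]
  · have h1 : (1 : ℝ) ≤ c.d := by exact_mod_cast c.d_pos
    have h2 : (0 : ℝ) ≤ c.z := Nat.cast_nonneg _
    push_cast
    linarith
  · rintro s₄ ⟨a4, p4⟩
    refine ⟨fun b hb => ?_, fun b hb h22 h23 => ?_, fun j hj => ?_⟩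
    · rw [a4.nat b (by omega) (by omega), a3.nat b (by omega) (by omega),
        a2.nat b (by omega) (by omega), a1.nat b (by omega) (by omega)]
    · rw [a4.real b h22, a3.real b h23, a2.real b h23, a1.real b h22]
    · rw [p4, a3.real 22 (by norm_num), a2.real 22 (by norm_num), p1 j hj, sub_eq_add_neg]
      congr 1
      -- A total function that agrees with array 23 on every listed row, to which the sum identity
      -- can be applied.
      set t : ℕ → ℝ := fun i => if i < c.n then
        ∑ l ∈ Finset.range c.d, c.A i l * s.real 4 l 0 else s₃.real 23 i 0 with ht
      have h1 := hs.entries.sum (fun i k => if j = k then (0 - s.real 1 i 0) * t i else 0)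
      rw [prefixSum_full, hs.z] at h1
      have h2 : ∀ e ∈ Finset.range c.z, (∑ x ∈ Finset.range 1, if j = s.nat 11 e 0 ∧ 0 = 0
          then (0 - s.real 1 (s.nat 10 e 0) 0) * s₃.real 23 (s.nat 10 e 0) 0 * s.real 10 e 0 else 0) =
          (if j = s.nat 11 e 0 then (0 - s.real 1 (s.nat 10 e 0) 0) * t (s.nat 10 e 0) else 0) *
            s.real 10 e 0 := by
        intro e he
        have : t (s.nat 10 e 0) = s₃.real 23 (s.nat 10 e 0) 0 := by
          simp only [ht]
          split_ifs with hlt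
          · rcases v3 e (Finset.mem_range.1 he) with h | h
            · exact h.symm
            · omega
          · rfl
        rw [this]
        simp
      rw [Finset.sum_congr rfl h2, h1, ← Finset.sum_neg_distrib]
      refine Finset.sum_congr rfl fun i hi => ?_
      rw [Finset.sum_eq_single_of_mem j (Finset.mem_range.2 hj)]
      · simp only [ht, if_pos (Finset.mem_range.1 hi), if_true]
        ring
      · intro k _ hne
        rw [if_neg (Ne.symm hne), zero_mul]

open Classical in
/-- The preconditioner that is represented by the memory. -/
noncomputable def Conf.pre {ω : ℝ} (c : Conf ω) (s : State) (i j : ℕ) : ℝ :=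
  if c.LowRank then s.real 11 i j - ∑ p ∈ Finset.range (s.nat 16 0 0),
    s.real 8 (s.nat 17 p 0) i * ∑ q ∈ Finset.range (s.nat 16 0 0),
      s.real 15 p q * (delta s q * s.real 8 (s.nat 17 q 0) j)
  else s.real 15 i j

/-- Add to `x` the product of the preconditioner with the residual. -/
def applyProg : Prog :=
  .branch (.natLt (.lit 0) (V 7))
    (.seq (assign2 26 (V 80) (.lit 0) (V 16) (.lit 1) (.lit 0)) <|
     .seq (scatter2 26 (V 80) (.lit 0) (V 16) eD (.mul (.mul (deltaE (V 80))
       (.get 8 (.get 17 (V 80) (.lit 0)) (V 81))) (.get 22 (V 81) (.lit 0)))) <|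
     .seq (assign2 27 (V 80) (.lit 0) (V 16) (.lit 1) (.lit 0)) <|
     .seq (scatter2 27 (V 80) (.lit 0) (V 16) (V 16) (.mul (.get 15 (V 80) (V 81))
       (.get 26 (V 81) (.lit 0)))) <|
     .seq (scatter2 4 (V 80) (.lit 0) eD eD (.mul (.get 11 (V 80) (V 81)) (.get 22 (V 81) (.lit 0)))) <|
     scatter2 4 (V 80) (.lit 0) eD (V 16) (.mul (.sub (.lit 0)
       (.get 8 (.get 17 (V 81) (.lit 0)) (V 80))) (.get 27 (V 81) (.lit 0))))
    (scatter2 4 (V 80) (.lit 0) eD eD (.mul (.get 15 (V 80) (V 81)) (.get 22 (V 81) (.lit 0))))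

/-- The Woodbury expression is evaluated from the right by matrix–vector products only, with the
rows of U V read from array 8. With at most 4d listed rows each product costs O(d²). -/
theorem runs_applyProg {ρ : Tape} {s : State} {ω : ℝ} {c : Conf ω} (hs : Static c s)
    (hcnt : c.LowRank → s.nat 16 0 0 ≤ 4 * c.d) :
    Runs ρ applyProg s (10000 * (c.d * c.d)) (fun s' =>
      (∀ b < 80, s'.nat b = s.nat b) ∧
      (∀ b < 80, b ≠ 4 → b ≠ 26 → b ≠ 27 → s'.real b = s.real b) ∧
      ∀ i < c.d, s'.real 4 i 0 = s.real 4 i 0 +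
        ∑ j ∈ Finset.range c.d, c.pre s i j * s.real 22 j 0) := by
  have hd1 : (1 : ℝ) ≤ c.d := by exact_mod_cast c.d_pos
  have hdd : (c.d : ℝ) ≤ c.d * c.d := le_mul_of_one_le_left (by linarith) hd1
  refine Runs.branch_last (fun hb => ?_) (fun hb => ?_)
  · have hlow : c.LowRank := by
      by_contra hl
      simp [Test.Holds, NatExp.eval, hs.low, hl] at hb
    have hm := hcnt hlow
    set m := s.nat 16 0 0 with hmdef
    refine Runs.step (runs_assign_row m 50 (fun i => 0) ?_
      (by simp [NatExp.cost, RealExp.cost]) ?_) ?_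
    · intro s₁ h; simp [NatExp.eval, h.nat, hmdef]
    · intro i hi s₁ h h1; rfl
    rintro s₁ ⟨a1, p1⟩
    refine Runs.step (runs_scatter_row m c.d 100
      (fun p j => delta s p * s.real 8 (s.nat 17 p 0) j * s.real 22 j 0) ?_
      (by simp [NatExp.cost, RealExp.cost]) ?_) ?_
    · intro s₂ h; simp [NatExp.eval, h.nat, a1.nat, hmdef, hs.entries.d_eq]
    · intro i hi j hj s₂ h h1 h2
      simp [RealExp.eval, NatExp.eval, h1, h2, h.nat, a1.nat, h.real, a1.real, delta]
    rintro s₂ ⟨a2, p2⟩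
    refine Runs.step (runs_assign_row m 50 (fun i => 0) ?_
      (by simp [NatExp.cost, RealExp.cost]) ?_) ?_
    · intro s₃ h; simp [NatExp.eval, h.nat, a2.nat, a1.nat, hmdef]
    · intro i hi s₁ h h1; rfl
    rintro s₃ ⟨a3, p3⟩
    refine Runs.step (runs_scatter_row m m 100
      (fun p q => s.real 15 p q * s₂.real 26 q 0) ?_
      (by simp [NatExp.cost, RealExp.cost]) ?_) ?_
    · intro s₄ h; simp [NatExp.eval, h.nat, a3.nat, a2.nat, a1.nat, hmdef]
    · intro i hi j hj s₄ h h1 h2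
      simp [RealExp.eval, NatExp.eval, h1, h2, h.real, a3.real, a2.real, a1.real]
    rintro s₄ ⟨a4, p4⟩
    refine Runs.step (runs_scatter_row c.d c.d 100
      (fun i j => s.real 11 i j * s.real 22 j 0) ?_
      (by simp [NatExp.cost, RealExp.cost]) ?_) ?_
    · intro s₅ h; simp [NatExp.eval, h.nat, a4.nat, a3.nat, a2.nat, a1.nat, hs.entries.d_eq]
    · intro i hi j hj s₅ h h1 h2
      simp [RealExp.eval, NatExp.eval, h1, h2, h.real, a4.real, a3.real, a2.real, a1.real]
    rintro s₅ ⟨a5, p5⟩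
    refine (runs_scatter_row c.d m 100
      (fun i p => (0 - s.real 8 (s.nat 17 p 0) i) * s₄.real 27 p 0) ?_
      (by simp [NatExp.cost, RealExp.cost]) ?_).mono ?_ ?_
    · intro s₆ h
      simp [NatExp.eval, h.nat, a5.nat, a4.nat, a3.nat, a2.nat, a1.nat, hs.entries.d_eq, hmdef]
    · intro i hi j hj s₆ h h1 h2
      simp [RealExp.eval, NatExp.eval, h1, h2, h.real, h.nat, a5.real, a5.nat, a4.real, a4.nat,
        a3.real, a3.nat, a2.real, a2.nat, a1.real, a1.nat]
    · have hm' : (m : ℝ) ≤ 4 * c.d := by exact_mod_cast hm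
      have m0 : (0 : ℝ) ≤ m := Nat.cast_nonneg _
      have h1 : (m : ℝ) * c.d ≤ 4 * c.d * c.d := mul_le_mul_of_nonneg_right hm' (by linarith)
      have h2 : (m : ℝ) * m ≤ 4 * c.d * (4 * c.d) := mul_le_mul hm' hm' m0 (by linarith)
      simp [NatExp.cost, Test.cost]
      nlinarith
    · rintro s₆ ⟨a6, p6⟩
      refine ⟨fun b hb => ?_, fun b hb h4 h26 h27 => ?_, fun i hi => ?_⟩
      · rw [a6.nat b (by omega) (by omega), a5.nat b (by omega) (by omega),
          a4.nat b (by omega) (by omega), a3.nat b (by omega) (by omega),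
          a2.nat b (by omega) (by omega), a1.nat b (by omega) (by omega)]
      · rw [a6.real b h4, a5.real b h4, a4.real b h27, a3.real b h27, a2.real b h26, a1.real b h26]
      · rw [p6 i hi, p5 i hi, a4.real 4 (by norm_num), a3.real 4 (by norm_num),
          a2.real 4 (by norm_num), a1.real 4 (by norm_num), add_assoc]
        congr 1
        have e27 : ∀ p < m, s₄.real 27 p 0 = ∑ q ∈ Finset.range m, s.real 15 p q *
            ∑ j ∈ Finset.range c.d, delta s q * s.real 8 (s.nat 17 q 0) j * s.real 22 j 0 := by
          intro p hp
          rw [p4 p hp, p3 p hp, zero_add]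
          refine Finset.sum_congr rfl fun q hq => ?_
          rw [p2 q (Finset.mem_range.1 hq), p1 q (Finset.mem_range.1 hq), zero_add]
        have hS : ∑ p ∈ Finset.range m, (0 - s.real 8 (s.nat 17 p 0) i) * s₄.real 27 p 0 =
            -∑ p ∈ Finset.range m, s.real 8 (s.nat 17 p 0) i * ∑ q ∈ Finset.range m,
              s.real 15 p q * ∑ j ∈ Finset.range c.d,
                delta s q * s.real 8 (s.nat 17 q 0) j * s.real 22 j 0 := by
          rw [← Finset.sum_neg_distrib]
          refine Finset.sum_congr rfl fun p hp => ?_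
          rw [e27 p (Finset.mem_range.1 hp)]; ring
        rw [hS]
        simp only [Conf.pre, if_pos hlow, sub_mul, Finset.sum_sub_distrib, ← hmdef]
        rw [sub_eq_add_neg]
        congr 2
        simp only [Finset.sum_mul, Finset.mul_sum]
        symm
        rw [Finset.sum_comm]
        refine Finset.sum_congr rfl fun p _ => ?_
        rw [Finset.sum_comm]
        refine Finset.sum_congr rfl fun j _ => Finset.sum_congr rfl fun q _ => ?_
        ring
  · have hlow : ¬ c.LowRank := by
      intro hl
      exact hb (by simp [Test.Holds, NatExp.eval, hs.low, hl])
    refine (runs_scatter_row c.d c.d 100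
      (fun i j => s.real 15 i j * s.real 22 j 0) ?_
      (by simp [NatExp.cost, RealExp.cost]) ?_).mono ?_ ?_
    · intro s₁ h; simp [NatExp.eval, h.nat, hs.entries.d_eq]
    · intro i hi j hj s₁ h h1 h2
      simp [RealExp.eval, NatExp.eval, h1, h2, h.real]
    · simp [NatExp.cost, Test.cost]
      nlinarith
    · rintro s₁ ⟨a1, p1⟩
      refine ⟨fun b hb => a1.nat b (by omega) (by omega), fun b hb h4 _ _ => a1.real b h4,
        fun i hi => ?_⟩
      rw [p1 i hi]
      simp only [Conf.pre, if_neg hlow]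

/-- The iterates of preconditioned gradient descent. -/
noncomputable def iter {d : ℕ} (M K : Matrix (Fin d) (Fin d) ℝ) (b : Fin d → ℝ) : ℕ → Fin d → ℝ
  | 0 => 0
  | k + 1 => iter M K b k + K.mulVec (b - M.mulVec (iter M K b k))

/-- The matrix with the entries `f`. -/
def Conf.toMat {ω : ℝ} (c : Conf ω) (f : ℕ → ℕ → ℝ) : Matrix (Fin c.d) (Fin c.d) ℝ :=
  Matrix.of fun i j => f i j

/-- Preconditioned gradient descent with a number of steps that depends on the accuracy. -/
noncomputable def descentProg : Prog :=
  .seq (assign2 4 (V 80) (.lit 0) eD (.lit 1) (.lit 0)) <| .seq (setRV 25 (.lit 1)) <|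
  .loop (.realLt (RV 3) (RV 25)) <| .seq residualProg <| .seq applyProg <|
    setRV 25 (.mul (RV 25) (.lit (1 / 2)))

/-- Register 25 is halved in each step until it is at most ε. So the number of steps does not depend
on b, and all queries of the same accuracy apply the same linear operator. -/
theorem runs_descentProg {ρ : Tape} {s : State} {ω : ℝ} {c : Conf ω} (hs : Static c s)
    (hcnt : c.LowRank → s.nat 16 0 0 ≤ 4 * c.d) (w : ℕ → ℝ) (hw : ∀ i < c.n, s.real 1 i 0 = w i)
    (b : Fin c.d → ℝ) (hb : ∀ j : Fin c.d, s.real 2 j 0 = b j) (N : ℕ)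
    (hN : ∀ k, s.real 3 0 0 < (1 / 2) ^ k ↔ k < N) :
    Runs ρ descentProg s ((N + 1) * (20000 * (c.z + c.d * c.d))) (fun s' =>
      ∀ j : Fin c.d, s'.real 4 j 0 = iter (c.toMat (c.q w)) (c.toMat (c.pre s)) b N j) := by
  have hd1 : (1 : ℝ) ≤ c.d := by exact_mod_cast c.d_pos
  have hdd : (c.d : ℝ) ≤ c.d * c.d := le_mul_of_one_le_left (by linarith) hd1
  have hz : (0 : ℝ) ≤ c.z := Nat.cast_nonneg _
  refine Runs.step (runs_assign_row c.d 50 (fun i => 0) ?_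
    (by simp [NatExp.cost, RealExp.cost]) ?_) ?_
  · intro s₁ h; simp [NatExp.eval, h.nat, hs.entries.d_eq]
  · intro i hi s₁ h h1; rfl
  rintro s₁ ⟨a1, p1⟩
  refine Runs.setReal_step ?_
  refine (Runs.while_le (I := fun k s' => (∀ b < 80, s'.nat b = s.nat b) ∧
    (∀ b < 80, b ≠ 4 → b < 22 → s'.real b = s.real b) ∧
    s'.real 25 0 0 = (1 / 2) ^ k ∧
    ∀ j : Fin c.d, s'.real 4 j 0 = iter (c.toMat (c.q w)) (c.toMat (c.pre s)) b k j) N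
    (B := 15000 * (c.z + c.d * c.d)) (k := 0) (by positivity) ?_ ?_ (Nat.zero_le _)).mono ?_ ?_
  · rintro k s₂ ⟨h1, h2, h3, h4⟩ hc
    simp only [Test.Holds, RealExp.eval, NatExp.eval, h3,
      h2 3 (by norm_num) (by norm_num) (by norm_num)] at hc
    refine ⟨(hN k).1 hc, ?_⟩
    have st2 : Static c s₂ := hs.congr (fun a ha => h1 a (by omega))
      (fun a ha => h2 a (by omega) (by omega) (by omega))
    refine Runs.step (runs_residualProg st2) ?_
    rintro s₃ ⟨n3, r3, p3⟩
    have n3' : ∀ b < 80, s₃.nat b = s.nat b := fun b hb => by rw [n3 b hb, h1 b hb]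
    have r3' : ∀ b < 80, b ≠ 4 → b < 22 → s₃.real b = s.real b := fun b hb h4 h22 => by
      rw [r3 b hb (by omega) (by omega), h2 b hb h4 h22]
    have st3 : Static c s₃ := hs.congr (fun a ha => n3' a (by omega))
      (fun a ha => r3' a (by omega) (by omega) (by omega))
    refine Runs.step (runs_applyProg st3 (by rw [n3' 16 (by norm_num)]; exact hcnt)) ?_
    rintro s₄ ⟨n4, r4, p4⟩
    have hpre : c.pre s₃ = c.pre s := by
      funext i j
      have e : ∀ q, delta s₃ q = delta s q := fun q => by
        simp only [delta, n3' 17 (by norm_num), r3' 1 (by norm_num) (by norm_num) (by norm_num),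
          r3' 5 (by norm_num) (by norm_num) (by norm_num)]
      simp only [Conf.pre, e, n3' 16 (by norm_num), n3' 17 (by norm_num),
        r3' 8 (by norm_num) (by norm_num) (by norm_num),
        r3' 11 (by norm_num) (by norm_num) (by norm_num),
        r3' 15 (by norm_num) (by norm_num) (by norm_num)]
    refine Runs.setReal_last ⟨fun b hb => ?_, fun b hb h4 h22 => ?_, ?_, fun j => ?_⟩ ?_
    · rw [State.putReal_nat, n4 b hb, n3' b hb]
    · rw [State.putReal_real_of_ne (by omega), r4 b hb h4 (by omega) (by omega), r3' b hb h4 h22]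
    · have : s₄.real 25 0 0 = (1 / 2) ^ k := by
        rw [r4 25 (by norm_num) (by norm_num) (by norm_num) (by norm_num),
          r3 25 (by norm_num) (by norm_num) (by norm_num), h3]
      simp [State.putReal_real, RealExp.eval, NatExp.eval, this, pow_succ]
    · rw [State.putReal_real_of_ne (by norm_num), p4 j j.2, r3 4 (by norm_num) (by norm_num)
        (by norm_num), h4 j, hpre, iter, Pi.add_apply, Finset.sum_range]
      congr 1
      simp only [Matrix.mulVec, dotProduct, Conf.toMat, Matrix.of_apply]
      refine Finset.sum_congr rfl fun l _ => ?_
      congr 1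
      rw [p3 l l.2, h2 2 (by norm_num) (by norm_num) (by norm_num), hb l, Pi.sub_apply]
      congr 1
      have e : ∀ x : Fin c.d, c.q w l x * iter (c.toMat (c.q w)) (c.toMat (c.pre s)) b k x =
          ∑ i ∈ Finset.range c.n, w i * (c.A i x * s₂.real 4 x 0) * c.A i l := by
        intro x
        rw [h4 x, Conf.q, Finset.sum_mul]
        exact Finset.sum_congr rfl fun i _ => by ring
      show _ = ∑ x : Fin c.d, c.q w l x * iter (c.toMat (c.q w)) (c.toMat (c.pre s)) b k x
      rw [Finset.sum_congr rfl fun x _ => e x]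
      rw [Finset.sum_comm]
      refine Finset.sum_congr rfl fun i hi => ?_
      rw [h2 1 (by norm_num) (by norm_num) (by norm_num), hw i (Finset.mem_range.1 hi),
        Finset.sum_range, Finset.mul_sum, Finset.sum_mul]
    · simp [NatExp.cost, RealExp.cost]
      nlinarith
  · refine ⟨fun b hb => by rw [State.putReal_nat, a1.nat b (by omega) (by omega)],
      fun b hb h4 h22 => ?_, ?_, fun j => ?_⟩
    · rw [State.putReal_real_of_ne (by omega), a1.real b h4]
    · simp [State.putReal_real, RealExp.eval, NatExp.eval]
    · rw [State.putReal_real_of_ne (by norm_num), p1 j j.2]; rfl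
  · have hN0 : (0 : ℝ) ≤ N := Nat.cast_nonneg _
    have : (N : ℝ) * 1 ≤ N * (c.z + c.d * c.d) := mul_le_mul_of_nonneg_left (by linarith) hN0
    simp [NatExp.cost, RealExp.cost, Test.cost]
    nlinarith
  · rintro s' ⟨k, hk, -, ⟨h1, h2, h3, h4⟩, hc⟩
    simp only [Test.Holds, RealExp.eval, NatExp.eval, h3,
      h2 3 (by norm_num) (by norm_num) (by norm_num), hN k, not_lt] at hc
    obtain rfl := le_antisymm hk hc
    exact h4

/-! ### Spectral estimates -/

section Gram

variable {n d : ℕ} {A : Matrix (Fin n) (Fin d) ℝ}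

theorem gram_apply (A : Matrix (Fin n) (Fin d) ℝ) (w : Fin n → ℝ) (i j : Fin d) :
    gram A w i j = ∑ l, w l * A l i * A l j := by
  rw [gram, Matrix.mul_apply]
  refine Finset.sum_congr rfl fun l _ => ?_
  rw [Matrix.mul_diagonal, Matrix.transpose_apply]
  ring

theorem dotProduct_gram (A : Matrix (Fin n) (Fin d) ℝ) (w : Fin n → ℝ) (x : Fin d → ℝ) :
    x ⬝ᵥ (gram A w).mulVec x = ∑ i, w i * (A.mulVec x i) ^ 2 := by
  rw [gram, Matrix.mul_assoc, ← Matrix.mulVec_mulVec, Matrix.dotProduct_mulVec,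
    Matrix.vecMul_transpose, ← Matrix.mulVec_mulVec]
  simp only [dotProduct, Matrix.mulVec_diagonal]
  exact Finset.sum_congr rfl fun _ _ => by ring

/-- xᵀ Aᵀ diag(w) A x = ∑ wᵢ (A x)ᵢ², so Gram matrices are monotone in the weights, and zero rows
impose no condition. This matters because zero rows are never scanned. -/
theorem dotProduct_gram_le {u v : Fin n → ℝ} (h : ∀ i, A i ≠ 0 → u i ≤ v i) (x : Fin d → ℝ) :
    x ⬝ᵥ (gram A u).mulVec x ≤ x ⬝ᵥ (gram A v).mulVec x := by
  rw [dotProduct_gram, dotProduct_gram]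
  refine Finset.sum_le_sum fun i _ => ?_
  by_cases hA : A i = 0
  · have : A.mulVec x i = 0 := by simp [Matrix.mulVec, hA]
    simp [this]
  · exact mul_le_mul_of_nonneg_right (h i hA) (sq_nonneg _)

theorem smul_gram (A : Matrix (Fin n) (Fin d) ℝ) (t : ℝ) (w : Fin n → ℝ) :
    t • gram A w = gram A (fun i => t * w i) := by
  ext i j
  simp only [Matrix.smul_apply, gram_apply, smul_eq_mul, Finset.mul_sum]
  exact Finset.sum_congr rfl fun _ _ => by ring

theorem posDef_gram (hA : A.rank = d) {w : Fin n → ℝ} (hw : ∀ i, 0 < w i) : (gram A w).PosDef := by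
  have hinj : Function.Injective A.mulVec := by
    have h1 : Module.finrank ℝ (LinearMap.ker A.mulVecLin) = 0 := by
      have := LinearMap.finrank_range_add_finrank_ker A.mulVecLin
      rw [← Matrix.rank, hA] at this
      simpa using this
    have h2 : LinearMap.ker A.mulVecLin = ⊥ := Submodule.finrank_eq_zero.1 h1
    exact LinearMap.ker_eq_bot.1 h2
  have hdiag : (Matrix.diagonal w).PosDef := Matrix.PosDef.diagonal hw
  have := hdiag.conjTranspose_mul_mul_same hinj
  simpa [gram] using this

end Gram

/-! ### Approximate inverses and low rank updates -/

section Spec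

variable {d : ℕ} {P Q M : Matrix (Fin d) (Fin d) ℝ}

theorem dotProduct_symm (hP : P.transpose = P) (x y : Fin d → ℝ) :
    x ⬝ᵥ P.mulVec y = y ⬝ᵥ P.mulVec x := by
  rw [Matrix.dotProduct_mulVec, ← Matrix.mulVec_transpose, hP, dotProduct_comm]

theorem quad_add (hP : P.transpose = P) (x y : Fin d → ℝ) :
    (x + y) ⬝ᵥ P.mulVec (x + y) = x ⬝ᵥ P.mulVec x + 2 * (x ⬝ᵥ P.mulVec y) + y ⬝ᵥ P.mulVec y := by
  rw [Matrix.mulVec_add, add_dotProduct, dotProduct_add, dotProduct_add, dotProduct_symm hP y x]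
  ring

theorem quad_sub (hP : P.transpose = P) (x y : Fin d → ℝ) :
    (x - y) ⬝ᵥ P.mulVec (x - y) = x ⬝ᵥ P.mulVec x - 2 * (x ⬝ᵥ P.mulVec y) + y ⬝ᵥ P.mulVec y := by
  rw [Matrix.mulVec_sub, sub_dotProduct, dotProduct_sub, dotProduct_sub, dotProduct_symm hP y x]
  ring

theorem _root_.Matrix.PosDef.isUnit_det' (hP : P.PosDef) : IsUnit P.det :=
  (Matrix.isUnit_iff_isUnit_det _).1 hP.isUnit

theorem _root_.Matrix.PosDef.transpose_eq' (hP : P.PosDef) : P.transpose = P := by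
  simpa [Matrix.IsHermitian] using hP.isHermitian

theorem _root_.Matrix.PosDef.quad_nonneg (hP : P.PosDef) (x : Fin d → ℝ) : 0 ≤ x ⬝ᵥ P.mulVec x := by
  simpa using hP.posSemidef.dotProduct_mulVec_nonneg x

theorem mulVec_inv_mulVec (hP : IsUnit P.det) (x : Fin d → ℝ) : P.mulVec (P⁻¹.mulVec x) = x := by
  rw [Matrix.mulVec_mulVec, Matrix.mul_nonsing_inv _ hP, Matrix.one_mulVec]

/-- With y = Q⁻¹ x and z = P⁻¹ x, expand 0 ≤ (y − z)ᵀ P (y − z) and use yᵀ P y ≤ yᵀ Q y = yᵀ x. -/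
theorem inv_le_inv' (hP : P.PosDef) (hQ : Q.PosDef)
    (h : ∀ x : Fin d → ℝ, x ⬝ᵥ P.mulVec x ≤ x ⬝ᵥ Q.mulVec x) (x : Fin d → ℝ) :
    x ⬝ᵥ Q⁻¹.mulVec x ≤ x ⬝ᵥ P⁻¹.mulVec x := by
  set y := Q⁻¹.mulVec x with hy
  set z := P⁻¹.mulVec x with hz
  have e1 : Q.mulVec y = x := mulVec_inv_mulVec hQ.isUnit_det' x
  have e2 : P.mulVec z = x := mulVec_inv_mulVec hP.isUnit_det' x
  have h1 := h y
  have h2 := hP.quad_nonneg (y - z)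
  rw [quad_sub hP.transpose_eq', e2] at h2
  rw [e1] at h1
  rw [dotProduct_comm x y, dotProduct_comm x z]
  linarith

theorem specApprox_inv {κ : ℝ} (hP : P.PosDef) (hQ : Q.PosDef)
    (h1 : ∀ x : Fin d → ℝ, x ⬝ᵥ (Real.exp (-κ) • P).mulVec x ≤ x ⬝ᵥ Q.mulVec x)
    (h2 : ∀ x : Fin d → ℝ, x ⬝ᵥ Q.mulVec x ≤ x ⬝ᵥ (Real.exp κ • P).mulVec x) :
    SpecApprox κ P⁻¹ Q⁻¹ := by
  have e : ∀ t : ℝ, 0 < t → (t • P)⁻¹ = t⁻¹ • P⁻¹ := by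
    intro t ht
    apply Matrix.inv_eq_right_inv
    rw [Matrix.smul_mul, Matrix.mul_smul, smul_smul, mul_inv_cancel₀ ht.ne', one_smul,
      Matrix.mul_nonsing_inv _ hP.isUnit_det']
  have p1 := hP.smul (Real.exp_pos (-κ))
  have p2 := hP.smul (Real.exp_pos κ)
  have e5 : Real.exp κ * Real.exp (-κ) = 1 := by rw [← Real.exp_add]; simp
  constructor
  · intro x
    have := inv_le_inv' p1 hQ h1 x
    rw [e _ (Real.exp_pos (-κ)), ← Real.exp_neg, neg_neg, Matrix.smul_mulVec, dotProduct_smul,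
      smul_eq_mul] at this
    rw [Matrix.smul_mulVec, dotProduct_smul, smul_eq_mul]
    have h3 := mul_le_mul_of_nonneg_left this (Real.exp_pos (-κ)).le
    rwa [← mul_assoc, mul_comm (Real.exp (-κ)) (Real.exp κ), e5, one_mul] at h3
  · intro x
    have := inv_le_inv' hQ p2 h2 x
    rw [e _ (Real.exp_pos κ), ← Real.exp_neg, Matrix.smul_mulVec, dotProduct_smul,
      smul_eq_mul] at this
    rw [Matrix.smul_mulVec, dotProduct_smul, smul_eq_mul]
    have h3 := mul_le_mul_of_nonneg_left this (Real.exp_pos κ).le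
    rwa [← mul_assoc, e5, one_mul] at h3

/-- One step of gradient descent with a good preconditioner halves the squared error. -/
theorem contraction (hP : P.PosDef) (hM : M.PosDef)
    (h1 : ∀ x : Fin d → ℝ, 0.9 * (x ⬝ᵥ P.mulVec x) ≤ x ⬝ᵥ M.mulVec x)
    (h2 : ∀ x : Fin d → ℝ, x ⬝ᵥ M.mulVec x ≤ 1.1 * (x ⬝ᵥ P.mulVec x)) (y : Fin d → ℝ) :
    normSq M (y - P⁻¹.mulVec (M.mulVec y)) ≤ 1 / 2 * normSq M y := by
  unfold normSq
  set u := y - P⁻¹.mulVec (M.mulVec y) with hu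
  have sP := hP.transpose_eq'
  have sM := hM.transpose_eq'
  have e : P.mulVec u = P.mulVec y - M.mulVec y := by
    rw [hu, Matrix.mulVec_sub, mulVec_inv_mulVec hP.isUnit_det']
  have e1 : u ⬝ᵥ P.mulVec u = y ⬝ᵥ P.mulVec u - y ⬝ᵥ M.mulVec u := by
    have : u ⬝ᵥ P.mulVec u = u ⬝ᵥ (P.mulVec y - M.mulVec y) := by rw [← e]
    rw [this, dotProduct_sub, dotProduct_symm sP u y, dotProduct_symm sM u y]
  -- Put E = P − M, so that uᵀ P u = yᵀ E u and |xᵀ E x| ≤ 0.1 xᵀ P x for all x. Polarisation with y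
  -- + u and y − u gives 0.95 uᵀ P u ≤ 0.05 yᵀ P y. Passing from P to M costs the factors 1.1 and
  -- 1/0.9, which leaves less than 1/2.
  have g1 := h1 (y - u)
  have g2 := h2 (y + u)
  have g3 := h1 (y + u)
  have g4 := h2 (y - u)
  rw [quad_add sP, quad_add sM] at g2 g3
  rw [quad_sub sP, quad_sub sM] at g1 g4
  have g5 := h2 u
  have g6 := h1 y
  have g7 := hP.quad_nonneg y
  have g8 := hP.quad_nonneg u
  linarith

theorem iter_eq (M K : Matrix (Fin d) (Fin d) ℝ) (b : Fin d → ℝ) (k : ℕ) :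
    iter M K b k = (K * ∑ j ∈ Finset.range k, (1 - M * K) ^ j).mulVec b := by
  induction k with
  | zero => simp [iter]
  | succ k ih =>
    rw [iter, ih, geom_sum_succ, ← Matrix.mulVec_mulVec, ← Matrix.mulVec_mulVec]
    set S := ∑ j ∈ Finset.range k, (1 - M * K) ^ j
    rw [← Matrix.mulVec_add]
    congr 1
    rw [Matrix.add_mulVec, Matrix.one_mulVec, Matrix.sub_mul, Matrix.one_mul, Matrix.sub_mulVec,
      Matrix.mul_assoc, ← Matrix.mulVec_mulVec, ← Matrix.mulVec_mulVec]
    abel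

/-- `descentOperator` with parameter k sums k + 1 powers, hence the shift of the index. -/
theorem iter_eq_descent (M K : Matrix (Fin d) (Fin d) ℝ) (b : Fin d → ℝ) (k : ℕ) :
    iter M K b (k + 1) = (descentOperator M K 1 k).mulVec b := by
  rw [iter_eq, descentOperator, inv_one, one_smul, one_smul]

theorem normSq_iter (hP : P.PosDef) (hM : M.PosDef)
    (h1 : ∀ x : Fin d → ℝ, 0.9 * (x ⬝ᵥ P.mulVec x) ≤ x ⬝ᵥ M.mulVec x)
    (h2 : ∀ x : Fin d → ℝ, x ⬝ᵥ M.mulVec x ≤ 1.1 * (x ⬝ᵥ P.mulVec x)) (b : Fin d → ℝ) (k : ℕ) :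
    normSq M (iter M P⁻¹ b k - M⁻¹.mulVec b) ≤ (1 / 2) ^ k * normSq M (M⁻¹.mulVec b) := by
  induction k with
  | zero => simp [iter, normSq, Matrix.mulVec_neg]
  | succ k ih =>
    have e : iter M P⁻¹ b (k + 1) - M⁻¹.mulVec b = (iter M P⁻¹ b k - M⁻¹.mulVec b) -
        P⁻¹.mulVec (M.mulVec (iter M P⁻¹ b k - M⁻¹.mulVec b)) := by
      rw [iter, Matrix.mulVec_sub M, mulVec_inv_mulVec hM.isUnit_det', Matrix.mulVec_sub,
        Matrix.mulVec_sub]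
      abel
    rw [e, pow_succ]
    refine (contraction hP hM h1 h2 _).trans ?_
    linarith

/-- The inverse of a matrix after a low rank update. -/
theorem low_rank_inv {m : ℕ} {V : Matrix (Fin d) (Fin d) ℝ} {U : Matrix (Fin m) (Fin d) ℝ}
    {δ : Matrix (Fin m) (Fin m) ℝ} (hQ : IsUnit Q.det)
    (hQU : IsUnit (Q + U.transpose * δ * U).det) (hV : V = Q⁻¹) :
    IsUnit (1 + δ * (U * V * U.transpose)).det ∧
    (Q + U.transpose * δ * U)⁻¹ = V - V * U.transpose * ((1 + δ * (U * V * U.transpose))⁻¹ *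
      (δ * (U * V))) := by
  have hQV : Q * V = 1 := by rw [hV, Matrix.mul_nonsing_inv _ hQ]
  have hVQ : V * Q = 1 := by rw [hV, Matrix.nonsing_inv_mul _ hQ]
  -- Sylvester's identity: det(1 + δ U V Uᵀ) = det(1 + V Uᵀ δ U) = det(V (Q + Uᵀ δ U)).
  have hB : IsUnit (1 + δ * (U * V * U.transpose)).det := by
    have e : 1 + δ * (U * V * U.transpose) = 1 + (δ * U) * (V * U.transpose) := by
      simp only [Matrix.mul_assoc]
    have e2 : 1 + (V * U.transpose) * (δ * U) = V * (Q + U.transpose * δ * U) := by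
      rw [Matrix.mul_add, hVQ]; simp only [Matrix.mul_assoc]
    rw [e, Matrix.det_one_add_mul_comm, e2, Matrix.det_mul]
    refine IsUnit.mul ?_ hQU
    rw [hV, Matrix.det_nonsing_inv]
    exact hQ.ringInverse
  refine ⟨hB, Matrix.inv_eq_right_inv ?_⟩
  set B := 1 + δ * (U * V * U.transpose) with hBdef
  set X := B⁻¹ * (δ * (U * V)) with hX
  have hBX : B * X = δ * (U * V) := by
    rw [hX, ← Matrix.mul_assoc, Matrix.mul_nonsing_inv _ hB, Matrix.one_mul]
  -- B X = δ U V with B written out. Together with Q V = 1 this makes all correction terms cancel.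
  have h1 : δ * (U * (V * (U.transpose * X))) = δ * (U * V) - X := by
    rw [← hBX, hBdef, Matrix.add_mul, Matrix.one_mul]
    simp only [Matrix.mul_assoc]
    abel
  have h2 : Q * (V * (U.transpose * X)) = U.transpose * X := by
    rw [← Matrix.mul_assoc, hQV, Matrix.one_mul]
  simp only [Matrix.mul_sub, Matrix.add_mul, Matrix.mul_assoc, hQV, h2, h1]
  abel

end Spec

/-- The inverse of a matrix that is extended by an identity block. -/
theorem blk_inv_of_pad {d m : ℕ} (hdm : d ≤ m) {r : ℕ → ℕ → ℝ} {F : Matrix (Fin d) (Fin d) ℝ}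
    (hF : ∀ i j : Fin d, r i j = F i j)
    (hr : ∀ i < m, ∀ j < m, ¬ (i < d ∧ j < d) → r i j = if i = j then 1 else 0)
    (hdet : IsUnit F.det) :
    IsUnit (blk r 0 0 m).det ∧ ∀ i j : Fin d,
      (blk r 0 0 m)⁻¹ ⟨i, i.2.trans_le hdm⟩ ⟨j, j.2.trans_le hdm⟩ = F⁻¹ i j := by
  obtain ⟨e, rfl⟩ := Nat.exists_eq_add_of_le hdm
  have hb : blk r 0 0 (d + e) = (Matrix.fromBlocks F 0 0 (1 : Matrix (Fin e) (Fin e) ℝ)).submatrix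
      finSumFinEquiv.symm finSumFinEquiv.symm := by
    ext i j
    obtain ⟨i, rfl⟩ := finSumFinEquiv.surjective i
    obtain ⟨j, rfl⟩ := finSumFinEquiv.surjective j
    rcases i with i | i <;> rcases j with j | j
    · simp [blk, hF]
    · have h := hr i (by omega) (d + j) (by omega) (by omega)
      simp [blk, h]; omega
    · have h := hr (d + i) (by omega) j (by omega) (by omega)
      simp [blk, h]; omega
    · have h := hr (d + i) (by omega) (d + j) (by omega) (by omega)
      simp [blk, h, Matrix.one_apply, Fin.ext_iff]
  have hi : (Matrix.fromBlocks F 0 0 (1 : Matrix (Fin e) (Fin e) ℝ))⁻¹ =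
      Matrix.fromBlocks F⁻¹ 0 0 1 := by
    apply Matrix.inv_eq_right_inv
    rw [Matrix.fromBlocks_multiply]
    simp [Matrix.mul_nonsing_inv _ hdet]
  constructor
  · rw [hb, Matrix.det_submatrix_equiv_self, Matrix.det_fromBlocks_zero₁₂]
    simpa using hdet
  · intro i j
    rw [hb, Matrix.inv_submatrix_equiv, hi, Matrix.submatrix_apply]
    have h1 : finSumFinEquiv.symm (⟨i, i.2.trans_le hdm⟩ : Fin (d + e)) = Sum.inl i := by
      rw [Equiv.symm_apply_eq]; rfl
    have h2 : finSumFinEquiv.symm (⟨j, j.2.trans_le hdm⟩ : Fin (d + e)) = Sum.inl j := by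
      rw [Equiv.symm_apply_eq]; rfl
    rw [h1, h2, Matrix.fromBlocks_apply₁₁]

/-! ### The number of changed rows -/

/-- Above the window log(w/b) ≥ 1 − 1/1.1 > 0.09, and below it log(w/b) ≤ w/b − 1 < −0.1. -/
theorem abs_log_of_bad {b w : ℝ} (hb : 0 < b) (hw : 0 < w) (h : Bad b w) :
    0.09 ≤ |Real.log w - Real.log b| := by
  rw [← Real.log_div hw.ne' hb.ne']
  have hq : 0 < w / b := by positivity
  by_cases h1 : 0.9 * b ≤ w
  · have h2 : 1.1 < w / b := by
      rw [lt_div_iff₀ hb]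
      by_contra hc
      exact h ⟨h1, by linarith⟩
    have h3 := Real.one_sub_inv_le_log_of_pos hq
    have h4 : (w / b)⁻¹ ≤ (1.1 : ℝ)⁻¹ := inv_anti₀ (by norm_num) h2.le
    refine le_trans ?_ (le_abs_self _)
    have h5 : (1.1 : ℝ)⁻¹ ≤ 0.91 := by norm_num
    linarith
  · have h2 : w / b < 0.9 := by
      rw [div_lt_iff₀ hb]
      push Not at h1
      exact h1
    have h3 := Real.log_le_sub_one_of_pos hq
    refine le_trans ?_ (neg_le_abs _)
    norm_num at h2 ⊢
    linarith

/-- A row of S moves by at least 0.09 in logarithm in fewer than T steps, so by Cauchy–Schwarz its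
squared movement is at least 0.0081 / T. All rows together have squared movement at most 0.01 T.
Hence S has at most (0.01 / 0.0081) T² ≤ 2T² elements. -/
theorem card_changed_le {n : ℕ} {D : ℕ → Fin n → ℝ} {k₀ T r : ℕ}
    (hpos : ∀ k ≤ r, ∀ i, 0 < D k i)
    (hstep : ∀ k < r, ‖WithLp.toLp 2 (fun i => Real.log (D (k + 1) i) - Real.log (D k i))‖ ≤ 0.1)
    (S : Finset (Fin n)) (hS : ∀ i ∈ S, ∃ k ≤ r, k₀ < k ∧ k < k₀ + T ∧ Bad (D k₀ i) (D k i)) :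
    S.card ≤ T * T + T * T := by
  have h1 : ∀ k < r, ∑ i, (Real.log (D (k + 1) i) - Real.log (D k i)) ^ 2 ≤ 0.01 := by
    intro k hk
    have h := hstep k hk
    rw [EuclideanSpace.norm_eq, Real.sqrt_le_left (by norm_num)] at h
    simp only [Real.norm_eq_abs, sq_abs] at h
    norm_num at h ⊢
    exact h
  -- The step bound holds only before round r, so the time window is cut off there.
  set R := (Finset.range T).filter (fun t => k₀ + t < r) with hR
  have hRT : (R.card : ℝ) ≤ T := by
    have := Finset.card_filter_le (Finset.range T) (fun t => k₀ + t < r)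
    rw [Finset.card_range] at this
    exact_mod_cast this
  have h2 : ∀ i ∈ S, 0.0081 ≤ (T : ℝ) * ∑ t ∈ R,
      (Real.log (D (k₀ + t + 1) i) - Real.log (D (k₀ + t) i)) ^ 2 := by
    intro i hi
    obtain ⟨k, hkr, hk0, hkT, hbad⟩ := hS i hi
    obtain ⟨t, rfl⟩ := Nat.exists_eq_add_of_le hk0.le
    have hb := abs_log_of_bad (hpos k₀ (by omega) i) (hpos _ hkr i) hbad
    have e : Real.log (D (k₀ + t) i) - Real.log (D k₀ i) =
        ∑ x ∈ Finset.range t, (Real.log (D (k₀ + x + 1) i) - Real.log (D (k₀ + x) i)) := by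
      have := Finset.sum_range_sub (fun x => Real.log (D (k₀ + x) i)) t
      simp only [add_zero, ← add_assoc] at this
      exact this.symm
    have hsub : Finset.range t ⊆ R := by
      intro x hx
      have := Finset.mem_range.1 hx
      rw [hR, Finset.mem_filter, Finset.mem_range]
      omega
    have h3 : (0.09 : ℝ) ≤ ∑ x ∈ R, |Real.log (D (k₀ + x + 1) i) - Real.log (D (k₀ + x) i)| := by
      refine hb.trans ?_
      rw [e]
      exact (Finset.abs_sum_le_sum_abs _ _).trans
        (Finset.sum_le_sum_of_subset_of_nonneg hsub fun _ _ _ => abs_nonneg _)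
    have h4 := sq_sum_le_card_mul_sum_sq (s := R)
      (f := fun x => |Real.log (D (k₀ + x + 1) i) - Real.log (D (k₀ + x) i)|)
    simp only [sq_abs] at h4
    have h5 : (0.0081 : ℝ) ≤ (∑ x ∈ R, |Real.log (D (k₀ + x + 1) i) - Real.log (D (k₀ + x) i)|) ^ 2 := by
      have := pow_le_pow_left₀ (by norm_num) h3 2
      norm_num at this ⊢
      exact this
    refine h5.trans (h4.trans (mul_le_mul_of_nonneg_right hRT ?_))
    exact Finset.sum_nonneg fun _ _ => sq_nonneg _
  have h3 : (S.card : ℝ) * 0.0081 ≤ T * (T * 0.01) := by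
    calc (S.card : ℝ) * 0.0081 = ∑ i ∈ S, (0.0081 : ℝ) := by simp
      _ ≤ ∑ i ∈ S, (T : ℝ) * ∑ t ∈ R,
          (Real.log (D (k₀ + t + 1) i) - Real.log (D (k₀ + t) i)) ^ 2 := Finset.sum_le_sum h2
      _ ≤ ∑ i, (T : ℝ) * ∑ t ∈ R,
          (Real.log (D (k₀ + t + 1) i) - Real.log (D (k₀ + t) i)) ^ 2 :=
        Finset.sum_le_univ_sum_of_nonneg fun i =>
          mul_nonneg (Nat.cast_nonneg _) (Finset.sum_nonneg fun _ _ => sq_nonneg _)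
      _ = T * ∑ t ∈ R, ∑ i, (Real.log (D (k₀ + t + 1) i) - Real.log (D (k₀ + t) i)) ^ 2 := by
        rw [← Finset.mul_sum, Finset.sum_comm]
      _ ≤ T * ∑ t ∈ R, (0.01 : ℝ) := by
        refine mul_le_mul_of_nonneg_left (Finset.sum_le_sum fun t ht => h1 _ ?_) (Nat.cast_nonneg _)
        exact (Finset.mem_filter.1 ht).2
      _ ≤ T * (T * 0.01) := by
        refine mul_le_mul_of_nonneg_left ?_ (Nat.cast_nonneg _)
        rw [Finset.sum_const, nsmul_eq_mul]
        exact mul_le_mul_of_nonneg_right hRT (by norm_num)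
  have h4 : (S.card : ℝ) ≤ T * T + T * T := by
    norm_num at h3
    nlinarith [sq_nonneg (T : ℝ)]
  exact_mod_cast h4

/-! ### The matrices that are represented by the memory -/

open Classical in
/-- The weights of the represented matrix. -/
noncomputable def current (s : State) (i : ℕ) : ℝ :=
  if s.nat 18 i 0 = 0 then s.real 5 i 0 else s.real 1 i 0

namespace Conf

variable {ω : ℝ} (c : Conf ω)

/-- The input matrix. -/
def mat : Matrix (Fin c.n) (Fin c.d) ℝ := Matrix.of fun i j => c.A i j

theorem mat_apply (i : Fin c.n) (j : Fin c.d) : c.mat i j = c.A i j := rfl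

theorem toMat_apply (f : ℕ → ℕ → ℝ) (i j : Fin c.d) : c.toMat f i j = f i j := rfl

theorem toMat_q (w : ℕ → ℝ) : c.toMat (c.q w) = gram c.mat (fun i => w i) := by
  ext i j
  rw [toMat_apply, gram_apply, q, Finset.sum_range]
  rfl

theorem q_of_not_lt (w : ℕ → ℝ) {i j : ℕ} (h : ¬ (i < c.d ∧ j < c.d)) : c.q w i j = 0 := by
  refine Finset.sum_eq_zero fun l _ => ?_
  by_cases hi : i < c.d
  · rw [c.supp l j (fun hc => h ⟨hi, hc.2⟩), mul_zero]
  · rw [c.supp l i (fun hc => hi hc.2), mul_zero, zero_mul]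

theorem posDef_q (hr : c.mat.rank = c.d) {w : ℕ → ℝ} (hw : ∀ i < c.n, 0 < w i) :
    (c.toMat (c.q w)).PosDef := by
  rw [toMat_q]
  exact posDef_gram hr fun i => hw i i.2

theorem padId_inv (hr : c.mat.rank = c.d) {w : ℕ → ℝ} (hw : ∀ i < c.n, 0 < w i) :
    IsUnit (blk (padId c.d (c.q w)) 0 0 (2 ^ c.a)).det ∧ ∀ i j : Fin c.d,
      (blk (padId c.d (c.q w)) 0 0 (2 ^ c.a))⁻¹ ⟨i, i.2.trans_le c.d_le⟩ ⟨j, j.2.trans_le c.d_le⟩ =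
        (c.toMat (c.q w))⁻¹ i j := by
  refine blk_inv_of_pad c.d_le (F := c.toMat (c.q w)) ?_ ?_ (c.posDef_q hr hw).isUnit_det'
  · intro i j
    have := i.2
    simp [padId, toMat_apply]
  · intro i _ j _ hij
    rw [padId, c.q_of_not_lt w hij, zero_add]
    refine if_congr ?_ rfl rfl
    omega

theorem sum_listed {s : State} (hl : Listed c.n s) (f : ℕ → ℝ)
    (hf : ∀ i < c.n, s.nat 18 i 0 = 0 → f i = 0) :
    ∑ l ∈ Finset.range c.n, f l = ∑ p ∈ Finset.range (s.nat 16 0 0), f (s.nat 17 p 0) := by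
  have hinj : Set.InjOn (fun p => s.nat 17 p 0) (Finset.range (s.nat 16 0 0) : Set ℕ) := by
    intro p hp q hq h
    exact hl.inj p (by simpa using hp) q (by simpa using hq) h
  rw [← Finset.sum_image hinj]
  symm
  refine Finset.sum_subset ?_ ?_
  · intro i hi
    obtain ⟨p, hp, rfl⟩ := Finset.mem_image.1 hi
    exact Finset.mem_range.2 (hl.lt p (Finset.mem_range.1 hp))
  · intro i hi hni
    refine hf i (Finset.mem_range.1 hi) ((hl.mark i (Finset.mem_range.1 hi)).2 fun p hp h => hni ?_)
    exact Finset.mem_image.2 ⟨p, Finset.mem_range.2 hp, h⟩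

/-- Only listed rows carry a weight other than the initial one, so the represented matrix is an
update of rank at most the length of the list. -/
theorem q_cur {s : State} {w : ℕ → ℝ} (hb : Base c w s) (hl : Listed c.n s) (i j : ℕ) :
    c.q (current s) i j = c.q w i j + ∑ p ∈ Finset.range (s.nat 16 0 0),
      delta s p * c.A (s.nat 17 p 0) i * c.A (s.nat 17 p 0) j := by
  have h1 := c.sum_listed hl (fun l => (current s l - s.real 5 l 0) * c.A l i * c.A l j)
    (fun i _ h => by simp [current, h])
  have h2 : ∀ p ∈ Finset.range (s.nat 16 0 0), (current s (s.nat 17 p 0) - s.real 5 (s.nat 17 p 0) 0) *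
      c.A (s.nat 17 p 0) i * c.A (s.nat 17 p 0) j =
      delta s p * c.A (s.nat 17 p 0) i * c.A (s.nat 17 p 0) j := by
    intro p hp
    have hp := Finset.mem_range.1 hp
    have : s.nat 18 (s.nat 17 p 0) 0 ≠ 0 := fun h =>
      (hl.mark _ (hl.lt p hp)).1 h p hp rfl
    rw [current, if_neg this, delta]
  rw [← Finset.sum_congr rfl h2, ← h1, q, q, ← Finset.sum_add_distrib]
  refine Finset.sum_congr rfl fun l hl' => ?_
  rw [hb.base l (Finset.mem_range.1 hl')]; ring

theorem cur_pos {s : State} {w : ℕ → ℝ} (hb : Base c w s) (hw : ∀ i < c.n, 0 < w i)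
    (h1 : ∀ i < c.n, 0 < s.real 1 i 0) {i : ℕ} (hi : i < c.n) : 0 < current s i := by
  unfold current
  split_ifs
  · rw [hb.base i hi]; exact hw i hi
  · exact h1 i hi

/-- The preconditioner is the inverse of the represented matrix. -/
def Ready (s : State) : Prop := c.toMat (c.pre s) = (c.toMat (c.q (current s)))⁻¹

theorem ready_of_direct {s : State} (hr : c.mat.rank = c.d) (hdir : ¬ c.LowRank)
    (hc : ∀ i < c.n, 0 < current s i)
    (h : blk (s.real 15) 0 0 (2 ^ c.a) = (blk (padId c.d (c.q (current s))) 0 0 (2 ^ c.a))⁻¹) :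
    c.Ready s := by
  ext i j
  rw [toMat_apply, pre, if_neg hdir, ← (c.padId_inv hr hc).2 i j, ← h]
  simp [blk]

/-- The listed rows of the matrix. -/
def listMat (s : State) : Matrix (Fin (s.nat 16 0 0)) (Fin c.d) ℝ :=
  Matrix.of fun p j => c.A (s.nat 17 p 0) j

theorem toMat_q_cur {s : State} {w : ℕ → ℝ} (hb : Base c w s) (hl : Listed c.n s) :
    c.toMat (c.q (current s)) = c.toMat (c.q w) + (c.listMat s).transpose *
      Matrix.diagonal (fun p : Fin (s.nat 16 0 0) => delta s p) * c.listMat s := by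
  ext i j
  rw [toMat_apply, c.q_cur hb hl, Matrix.add_apply, toMat_apply, Matrix.mul_apply, Finset.sum_range]
  congr 1
  refine Finset.sum_congr rfl fun p _ => ?_
  rw [Matrix.mul_diagonal, Matrix.transpose_apply, listMat, Matrix.of_apply, Matrix.of_apply]
  ring

theorem real_eleven {s : State} {w : ℕ → ℝ} (hr : c.mat.rank = c.d) (hb : Base c w s)
    (hlow : c.LowRank) (hw : ∀ i < c.n, 0 < w i) (i j : Fin c.d) :
    s.real 11 i j = (c.toMat (c.q w))⁻¹ i j := by
  rw [← (c.padId_inv hr hw).2 i j, ← hb.inv hlow]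
  simp [blk]

theorem sum_supp (i : ℕ) (f : ℕ → ℝ) :
    ∑ l ∈ Finset.range (2 ^ c.a), c.A i l * f l = ∑ l : Fin c.d, c.A i l * f l := by
  rw [sum_range_of_supp c.d_le, Finset.sum_range]
  intro l hl
  rw [c.supp i l (by omega), zero_mul]

theorem real_eight {s : State} {w : ℕ → ℝ} (hr : c.mat.rank = c.d) (hb : Base c w s)
    (hl : Listed c.n s) (hlow : c.LowRank) (hw : ∀ i < c.n, 0 < w i) (p : Fin (s.nat 16 0 0))
    (j : Fin c.d) : s.real 8 (s.nat 17 p 0) j = (c.listMat s * (c.toMat (c.q w))⁻¹) p j := by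
  rw [hb.rows hlow _ (hl.lt p p.2) j (j.2.trans_le c.d_le), c.sum_supp _ (fun l => s.real 11 l j),
    Matrix.mul_apply]
  refine Finset.sum_congr rfl fun l _ => ?_
  rw [c.real_eleven hr hb hlow hw]; rfl

theorem g_eq {s : State} {w : ℕ → ℝ} (hr : c.mat.rank = c.d) (hb : Base c w s)
    (hl : Listed c.n s) (hlow : c.LowRank) (hw : ∀ i < c.n, 0 < w i) (p q : Fin (s.nat 16 0 0)) :
    c.g s p q = (c.listMat s * (c.toMat (c.q w))⁻¹ * (c.listMat s).transpose) p q := by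
  have e : c.g s p q = ∑ l ∈ Finset.range (2 ^ c.a),
      c.A (s.nat 17 q 0) l * s.real 8 (s.nat 17 p 0) l :=
    Finset.sum_congr rfl fun _ _ => mul_comm _ _
  rw [e, c.sum_supp _ (fun l => s.real 8 (s.nat 17 p 0) l), Matrix.mul_apply]
  refine Finset.sum_congr rfl fun l _ => ?_
  rw [c.real_eight hr hb hl hlow hw, mul_comm]; rfl

/-- Identity padding does not disturb the leading block of the inverse. The small matrix is
invertible because both the initial and the updated Gram matrix are. -/
theorem capMat_inv {s : State} {w : ℕ → ℝ} (hr : c.mat.rank = c.d) (hb : Base c w s)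
    (hl : Listed c.n s) (hlow : c.LowRank) (hw : ∀ i < c.n, 0 < w i)
    (hc : ∀ i < c.n, 0 < current s i) (hcnt : s.nat 16 0 0 ≤ 2 ^ (2 * c.τ + 1)) :
    IsUnit (blk (capMat (s.nat 16 0 0) (delta s) (c.g s)) 0 0 (2 ^ (2 * c.τ + 1))).det ∧
    ∀ p q : Fin (s.nat 16 0 0),
      (blk (capMat (s.nat 16 0 0) (delta s) (c.g s)) 0 0 (2 ^ (2 * c.τ + 1)))⁻¹
        ⟨p, p.2.trans_le hcnt⟩ ⟨q, q.2.trans_le hcnt⟩ =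
      (1 + Matrix.diagonal (fun p : Fin (s.nat 16 0 0) => delta s p) *
        (c.listMat s * (c.toMat (c.q w))⁻¹ * (c.listMat s).transpose) :
          Matrix (Fin (s.nat 16 0 0)) (Fin (s.nat 16 0 0)) ℝ)⁻¹ p q := by
  refine blk_inv_of_pad hcnt ?_ ?_ (low_rank_inv (c.posDef_q hr hw).isUnit_det' ?_ rfl).1
  · intro p q
    have hpq : (p : ℕ) < s.nat 16 0 0 ∧ (q : ℕ) < s.nat 16 0 0 := ⟨p.2, q.2⟩
    rw [capMat, if_pos hpq, Matrix.add_apply, Matrix.diagonal_mul,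
      ← c.g_eq hr hb hl hlow hw, Matrix.one_apply]
    simp [Fin.ext_iff]
  · intro i _ j _ hij
    rw [capMat, if_neg hij, add_zero]
  · rw [← c.toMat_q_cur hb hl]
    exact (c.posDef_q hr hc).isUnit_det'

/-- Woodbury's formula. Since V is symmetric, V Uᵀ = (U V)ᵀ, so array 8 supplies both outer factors.
-/
theorem ready_of_low {s : State} {w : ℕ → ℝ} (hr : c.mat.rank = c.d) (hb : Base c w s)
    (hl : Listed c.n s) (hlow : c.LowRank) (hw : ∀ i < c.n, 0 < w i)
    (hc : ∀ i < c.n, 0 < current s i) (hcnt : s.nat 16 0 0 ≤ 2 ^ (2 * c.τ + 1))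
    (h : blk (s.real 15) 0 0 (2 ^ (2 * c.τ + 1)) =
      (blk (capMat (s.nat 16 0 0) (delta s) (c.g s)) 0 0 (2 ^ (2 * c.τ + 1)))⁻¹) :
    c.Ready s := by
  have hV := (c.posDef_q hr hw).inv.transpose_eq'
  set V := (c.toMat (c.q w))⁻¹ with hVdef
  set U := c.listMat s with hU
  set δ := Matrix.diagonal (fun p : Fin (s.nat 16 0 0) => delta s p) with hδ
  have h2 := (low_rank_inv (Q := c.toMat (c.q w)) (U := U) (δ := δ)
    (c.posDef_q hr hw).isUnit_det' (by rw [← c.toMat_q_cur hb hl]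
                                       exact (c.posDef_q hr hc).isUnit_det') hVdef).2
  unfold Ready
  rw [c.toMat_q_cur hb hl, h2]
  ext i j
  rw [toMat_apply, pre, if_pos hlow, Matrix.sub_apply, c.real_eleven hr hb hlow hw, Matrix.mul_apply,
    Finset.sum_range]
  congr 1
  refine Finset.sum_congr rfl fun p _ => ?_
  congr 1
  · rw [c.real_eight hr hb hl hlow hw, ← Matrix.transpose_apply (U * V), Matrix.transpose_mul, hV]
  · rw [Matrix.mul_apply, Finset.sum_range]
    refine Finset.sum_congr rfl fun q _ => ?_
    have e8 : s.real 8 (s.nat 17 q 0) j = (U * V) q j := c.real_eight hr hb hl hlow hw q j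
    rw [e8, Matrix.diagonal_mul,
      ← (c.capMat_inv hr hb hl hlow hw hc hcnt).2 p q, ← h]
    simp [blk]

end Conf

/-- All rows of the matrix whose weight has changed are listed. -/
def Conf.Scanned {ω : ℝ} (c : Conf ω) (s : State) : Prop :=
  ∀ i < c.n, (∃ j < c.d, c.A i j ≠ 0) → Bad (s.real 5 i 0) (s.real 1 i 0) →
    ∃ p < s.nat 16 0 0, s.nat 17 p 0 = i

theorem aprWeights_approx {n : ℕ} {D : ℕ → Fin n → ℝ} (k : ℕ) {i : Fin n} (hD : 0 < D k i) :
    0.9 * aprWeights D k i ≤ D k i ∧ D k i ≤ 1.1 * aprWeights D k i := by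
  cases k with
  | zero => simp only [aprWeights]; constructor <;> linarith
  | succ k =>
    simp only [aprWeights]
    split_ifs with h
    · exact h
    · constructor <;> linarith

/-- Both u and v have w in their 10% window, so their quotient lies between 9/11 and 11/9, inside
[e⁻¹, e]. This is why κ = 1 suffices. -/
theorem ratio_bounds {u v w : ℝ} (hw : 0 < w) (h1 : 0.9 * u ≤ w ∧ w ≤ 1.1 * u)
    (h2 : 0.9 * v ≤ w ∧ w ≤ 1.1 * v) : Real.exp (-1) * u ≤ v ∧ v ≤ Real.exp 1 * u := by
  have e1 := Real.exp_one_gt_d9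
  have e2 : Real.exp (-1) ≤ 0.5 := by
    rw [Real.exp_neg, inv_le_comm₀ (Real.exp_pos 1) (by norm_num)]
    norm_num at e1 ⊢
    linarith
  obtain ⟨a1, a2⟩ := h1
  obtain ⟨b1, b2⟩ := h2
  norm_num at a1 a2 b1 b2 e1 e2
  constructor <;> nlinarith

/-! ### Estimates of the parameters -/

namespace Conf

variable {ω : ℝ} (c : Conf ω)

theorem one_le_t : (1 : ℝ) ≤ 2 ^ c.τ := one_le_pow₀ (by norm_num)

theorem one_le_u : (1 : ℝ) ≤ 2 ^ c.j := one_le_pow₀ (by norm_num)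

theorem round_eq : c.round = ((2 : ℝ) ^ c.τ) ^ (2 * ω) := by
  rw [round, ← Real.rpow_add (by positivity)]; ring_nf

theorem T_cast : (c.T : ℝ) = 2 ^ c.τ := by simp [T]

theorem θ_cast : (c.θ : ℝ) = min (2 ^ c.τ * (2 ^ c.j) ^ 2) (2 ^ c.τ * 2 ^ c.τ) := by
  rw [θ, Nat.cast_min]
  push_cast
  rw [T_cast, show (4 : ℝ) = 2 ^ 2 by norm_num, ← pow_mul, ← pow_mul, mul_comm 2 c.j]

/-- D^ω ≤ 2 n D^(ω-1) ≤ 2 (2T)^(2ω+1) by the choice of T. After taking ω-th roots the constant is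
2^((2ω+2)/ω) ≤ 2³. -/
theorem dh_le_rpow (hω : 2 ≤ ω) : (2 : ℝ) ^ c.a ≤ 8 * ((2 : ℝ) ^ c.τ) ^ ((2 * ω + 1) / ω) := by
  have h1 := c.pow_le_size
  have h2 := c.T_ge
  rw [← size] at h2
  have h0 : (0 : ℝ) < ω := by linarith
  have h3 : ((2 : ℝ) ^ c.a) ^ ω ≤ 2 ^ (2 * ω + 2) * ((2 : ℝ) ^ c.τ) ^ (2 * ω + 1) := by
    have : (2 : ℝ) ^ (2 * ω + 2) = 2 * 2 ^ (2 * ω + 1) := by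
      rw [show 2 * ω + 2 = 1 + (2 * ω + 1) by ring, Real.rpow_add (by norm_num), Real.rpow_one]
    rw [this]; linarith
  have h4 := Real.rpow_le_rpow (by positivity) h3 (inv_nonneg.2 h0.le)
  rw [Real.rpow_rpow_inv (by positivity) h0.ne', Real.mul_rpow (by positivity) (by positivity),
    ← Real.rpow_mul (by positivity), ← Real.rpow_mul (by positivity)] at h4
  refine h4.trans (mul_le_mul_of_nonneg_right ?_ (by positivity))
  have h5 : (2 * ω + 2) * ω⁻¹ ≤ 3 := by
    rw [← div_eq_mul_inv, div_le_iff₀ h0]; linarith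
  calc (2 : ℝ) ^ ((2 * ω + 2) * ω⁻¹) ≤ 2 ^ (3 : ℝ) := Real.rpow_le_rpow_of_exponent_le (by norm_num) h5
    _ = 8 := by norm_num

theorem dh_le_cube (hω : 2 ≤ ω) : (2 : ℝ) ^ c.a ≤ 8 * ((2 : ℝ) ^ c.τ) ^ (3 : ℝ) := by
  refine (c.dh_le_rpow hω).trans (mul_le_mul_of_nonneg_left ?_ (by norm_num))
  refine Real.rpow_le_rpow_of_exponent_le c.one_le_t ?_
  rw [div_le_iff₀ (by linarith)]; linarith

/-- For ω ≥ 5/2 one has (2ω+1)/ω ≤ ω, so D ≤ 8 T^ω. Minimality of `j` then gives 2^j T^ω < 2D ≤ 16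
T^ω. The constant 256 in the time bounds is 16². -/
theorem u_le_sixteen (hω : 5 / 2 ≤ ω) : (2 : ℝ) ^ c.j ≤ 16 := by
  rcases c.u_le with h | h
  · rw [h]; norm_num
  · have h1 : (2 : ℝ) ^ c.a ≤ 8 * ((2 : ℝ) ^ c.τ) ^ ω := by
      refine (c.dh_le_rpow (by linarith)).trans (mul_le_mul_of_nonneg_left ?_ (by norm_num))
      refine Real.rpow_le_rpow_of_exponent_le c.one_le_t ?_
      rw [div_le_iff₀ (by linarith)]; nlinarith
    have h2 : 0 < ((2 : ℝ) ^ c.τ) ^ ω := by positivity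
    by_contra hc
    push Not at hc
    nlinarith

theorem one_le_const (hω : 2 ≤ ω) : (1 : ℝ) ≤ 256 ^ ω := Real.one_le_rpow (by norm_num) (by linarith)

/-- With u = 2^j and θ ≤ T u², a batch costs at most T^ω D u^(2ω-4). If ω ≤ 5/2, the last factor is
at most u, and either u = 1, where T^ω D ≤ T^(2ω) + D², or u T^ω < 2D. If ω > 5/2, u is bounded. -/
theorem batch_le (hω : 2 ≤ ω) : c.batch ≤ 2 * 256 ^ ω * (c.round + ((2 : ℝ) ^ c.a) ^ 2) := by
  have ht := c.one_le_t
  have hu := c.one_le_u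
  set t := (2 : ℝ) ^ c.τ with htd
  set u := (2 : ℝ) ^ c.j with hud
  set D := (2 : ℝ) ^ c.a with hD
  have hD0 : 0 < D := by positivity
  have ht0 : 0 < t := by positivity
  have hθ : (c.θ : ℝ) ≤ t * u ^ 2 := by rw [θ_cast]; exact min_le_left _ _
  have h1 : (c.θ : ℝ) ^ (ω - 2) ≤ t ^ (ω - 2) * (u ^ 2) ^ (ω - 2) := by
    rw [← Real.mul_rpow ht0.le (by positivity)]
    exact Real.rpow_le_rpow (by positivity) hθ (by linarith)
  have h2 : t ^ 2 * t ^ (ω - 2) = t ^ ω := by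
    rw [← Real.rpow_natCast t 2, ← Real.rpow_add ht0]; congr 1; push_cast; ring
  have h3 : c.batch ≤ t ^ ω * D * (u ^ 2) ^ (ω - 2) := by
    rw [batch, T_cast, ← h2]
    have : t ^ 2 * D * (c.θ : ℝ) ^ (ω - 2) ≤ t ^ 2 * D * (t ^ (ω - 2) * (u ^ 2) ^ (ω - 2)) :=
      mul_le_mul_of_nonneg_left h1 (by positivity)
    linarith
  have hX : 0 < t ^ ω := by positivity
  have hr : c.round = t ^ ω * t ^ ω := rfl
  rw [hr]
  have hc := one_le_const hω
  set X := t ^ ω with hXd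
  have hS : 0 ≤ X * X + D ^ 2 := by positivity
  have hXD : X * D ≤ X * X + D ^ 2 := by nlinarith [sq_nonneg (X - D)]
  rcases le_or_gt ω (5 / 2) with h | h
  · have h4 : (u ^ 2) ^ (ω - 2) ≤ u := by
      rw [← Real.rpow_natCast u 2, ← Real.rpow_mul (by positivity)]
      calc u ^ (((2 : ℕ) : ℝ) * (ω - 2)) ≤ u ^ (1 : ℝ) :=
            Real.rpow_le_rpow_of_exponent_le hu (by push_cast; linarith)
        _ = u := Real.rpow_one u
    have h5 : X * D * (u ^ 2) ^ (ω - 2) ≤ X * D * u := mul_le_mul_of_nonneg_left h4 (by positivity)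
    have h6 : X * D * u ≤ 2 * (X * X + D ^ 2) := by
      rcases c.u_le with h0 | h0
      · have : u = 1 := by rw [hud, h0, pow_zero]
        rw [this]; linarith
      · have : u * X * D ≤ 2 * D * D := mul_le_mul_of_nonneg_right h0.le hD0.le
        nlinarith
    have h7 : 1 * (X * X + D ^ 2) ≤ 256 ^ ω * (X * X + D ^ 2) := mul_le_mul_of_nonneg_right hc hS
    linarith
  · have hu16 := c.u_le_sixteen h.le
    have h4 : (u ^ 2) ^ (ω - 2) ≤ 256 ^ ω := by
      calc (u ^ 2) ^ (ω - 2) ≤ 256 ^ (ω - 2) :=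
            Real.rpow_le_rpow (by positivity) (by nlinarith) (by linarith)
        _ ≤ 256 ^ ω := Real.rpow_le_rpow_of_exponent_le (by norm_num) (by linarith)
    have h5 : X * D * (u ^ 2) ^ (ω - 2) ≤ (X * X + D ^ 2) * 256 ^ ω :=
      mul_le_mul hXD h4 (by positivity) hS
    have : 0 ≤ 256 ^ ω * (X * X + D ^ 2) := by positivity
    linarith

/-- The left side is T⁴ D θ^(ω-3). If θ = T u² with u = 2^j, then D ≤ u T^ω gives u^(2ω-5) T^(2ω+1),
where either the exponent of u is nonpositive or u ≤ 16. If θ = T², then D ≤ 8 T³ suffices. -/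
theorem batches_le (hω : 2 ≤ ω) : (c.T : ℝ) * c.T * (c.batch / c.θ) ≤
    256 ^ ω * ((2 : ℝ) ^ c.τ) ^ (2 * ω + 1) := by
  have ht := c.one_le_t
  have hu := c.one_le_u
  have hθ0 : (0 : ℝ) < c.θ := by exact_mod_cast c.θ_pos
  have hu_ge := c.u_ge
  have h16 := c.u_le_sixteen
  have hD3 := c.dh_le_cube hω
  have hθc := c.θ_cast
  rw [batch, T_cast]
  set t := (2 : ℝ) ^ c.τ with htd
  set u := (2 : ℝ) ^ c.j with hud
  set D := (2 : ℝ) ^ c.a with hD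
  have hD0 : 0 < D := by positivity
  have ht0 : 0 < t := by positivity
  have hu0 : 0 < u := by positivity
  have e1 : t * t * (t ^ 2 * D * (c.θ : ℝ) ^ (ω - 2) / c.θ) = t ^ (4 : ℝ) * D * (c.θ : ℝ) ^ (ω - 3) := by
    have h1 : (c.θ : ℝ) ^ (ω - 3) = (c.θ : ℝ) ^ (ω - 2) / c.θ := by
      rw [← Real.rpow_sub_one hθ0.ne']; congr 1; ring
    have h2 : t ^ (4 : ℝ) = t * t * t ^ 2 := by
      rw [show (4 : ℝ) = ((4 : ℕ) : ℝ) by norm_num, Real.rpow_natCast]; ring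
    rw [h1, h2]; ring
  rw [e1]
  rcases min_choice (t * u ^ 2) (t * t) with h | h
  · rw [h] at hθc
    have h1 : (c.θ : ℝ) ^ (ω - 3) = t ^ (ω - 3) * u ^ (2 * (ω - 3)) := by
      rw [hθc, Real.mul_rpow ht0.le (by positivity), ← Real.rpow_natCast u 2,
        ← Real.rpow_mul hu0.le]; norm_num
    have h2 : t ^ (4 : ℝ) * (u * t ^ ω) * (t ^ (ω - 3) * u ^ (2 * (ω - 3))) =
        u ^ (2 * ω - 5) * t ^ (2 * ω + 1) := by
      have a1 : t ^ (4 : ℝ) * t ^ ω * t ^ (ω - 3) = t ^ (2 * ω + 1) := by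
        rw [← Real.rpow_add ht0, ← Real.rpow_add ht0]; congr 1; ring
      have a2 : u * u ^ (2 * (ω - 3)) = u ^ (2 * ω - 5) := by
        nth_rewrite 1 [← Real.rpow_one u]
        rw [← Real.rpow_add hu0]; congr 1; ring
      rw [← a1, ← a2]; ring
    have h3 : u ^ (2 * ω - 5) ≤ 256 ^ ω := by
      rcases le_or_gt ω (5 / 2) with h | h
      · exact (Real.rpow_le_one_of_one_le_of_nonpos hu (by linarith)).trans (one_le_const hω)
      · calc u ^ (2 * ω - 5) ≤ 16 ^ (2 * ω - 5) :=
              Real.rpow_le_rpow hu0.le (h16 h.le) (by linarith)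
          _ ≤ 16 ^ (2 * ω) := Real.rpow_le_rpow_of_exponent_le (by norm_num) (by linarith)
          _ = 256 ^ ω := by rw [Real.rpow_mul (by norm_num)]; norm_num
    calc t ^ (4 : ℝ) * D * (c.θ : ℝ) ^ (ω - 3)
        ≤ t ^ (4 : ℝ) * (u * t ^ ω) * (t ^ (ω - 3) * u ^ (2 * (ω - 3))) := by
          rw [h1]
          exact mul_le_mul_of_nonneg_right (mul_le_mul_of_nonneg_left hu_ge (by positivity))
            (by positivity)
      _ = u ^ (2 * ω - 5) * t ^ (2 * ω + 1) := h2
      _ ≤ _ := mul_le_mul_of_nonneg_right h3 (by positivity)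
  · rw [h] at hθc
    have h1 : t ^ (4 : ℝ) * (8 * t ^ (3 : ℝ)) * (c.θ : ℝ) ^ (ω - 3) = 8 * t ^ (2 * ω + 1) := by
      have a1 : t ^ (4 : ℝ) * t ^ (3 : ℝ) * (t ^ (ω - 3) * t ^ (ω - 3)) = t ^ (2 * ω + 1) := by
        rw [← Real.rpow_add ht0, ← Real.rpow_add ht0, ← Real.rpow_add ht0]; congr 1; ring
      rw [hθc, Real.mul_rpow ht0.le ht0.le, ← a1]; ring
    have h8 : (8 : ℝ) ≤ 256 ^ ω := by
      calc (8 : ℝ) ≤ 256 ^ (1 : ℝ) := by norm_num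
        _ ≤ 256 ^ ω := Real.rpow_le_rpow_of_exponent_le (by norm_num) (by linarith)
    calc t ^ (4 : ℝ) * D * (c.θ : ℝ) ^ (ω - 3)
        ≤ t ^ (4 : ℝ) * (8 * t ^ (3 : ℝ)) * (c.θ : ℝ) ^ (ω - 3) :=
          mul_le_mul_of_nonneg_right (mul_le_mul_of_nonneg_left hD3 (by positivity)) (by positivity)
      _ = 8 * t ^ (2 * ω + 1) := h1
      _ ≤ _ := mul_le_mul_of_nonneg_right h8 (by positivity)

/-- From T² ≤ D, the choice of T gives n T^(2ω-2) = O(T^(2ω+1)), so n = O(T³), and 3 ≤ 2ω. In the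
low rank case a round can therefore afford to scan all rows. -/
theorem n_le_round (hω : 2 ≤ ω) (hl : c.LowRank) : (c.n : ℝ) ≤ 2 ^ (2 * ω + 1) * c.round := by
  have h1 := c.T_ge
  have ht := c.one_le_t
  have hl' : ((2 : ℝ) ^ c.τ) * (2 : ℝ) ^ c.τ ≤ (2 : ℝ) ^ c.a := by
    have : c.T * c.T ≤ 2 ^ c.a := le_of_lt hl
    rw [T] at this
    exact_mod_cast this
  rw [round_eq]
  set t := (2 : ℝ) ^ c.τ with htd
  have ht0 : 0 < t := by positivity
  have h2 : t ^ (2 * ω - 2) ≤ ((2 : ℝ) ^ c.a) ^ (ω - 1) := by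
    have : t ^ (2 * ω - 2) = (t * t) ^ (ω - 1) := by
      rw [Real.mul_rpow ht0.le ht0.le, ← Real.rpow_add ht0]; congr 1; ring
    rw [this]
    exact Real.rpow_le_rpow (by positivity) hl' (by linarith)
  have h3 : t ^ (2 * ω + 1) = t ^ (3 : ℝ) * t ^ (2 * ω - 2) := by
    rw [← Real.rpow_add ht0]; congr 1; ring
  have h4 : (c.n : ℝ) * t ^ (2 * ω - 2) ≤ 2 ^ (2 * ω + 1) * t ^ (3 : ℝ) * t ^ (2 * ω - 2) := by
    have := mul_le_mul_of_nonneg_left h2 (Nat.cast_nonneg c.n : (0 : ℝ) ≤ c.n)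
    rw [h3] at h1
    linarith
  have h5 := le_of_mul_le_mul_right h4 (by positivity)
  refine h5.trans (mul_le_mul_of_nonneg_left ?_ (by positivity))
  exact Real.rpow_le_rpow_of_exponent_le ht (by linarith)

theorem size_le_block : c.size ≤ 2 ^ (2 * ω + 1) * (c.T * c.round) := by
  have h := c.T_ge
  have e : (c.T : ℝ) * c.round = ((2 : ℝ) ^ c.τ) ^ (2 * ω + 1) := by
    rw [round_eq, T_cast, Real.rpow_add_one (by positivity)]; ring
  rw [e, size]; linarith

theorem block_le_size : (c.T : ℝ) * c.round ≤ c.size := by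
  have e : (c.T : ℝ) * c.round = ((2 : ℝ) ^ c.τ) ^ (2 * ω + 1) := by
    rw [round_eq, T_cast, Real.rpow_add_one (by positivity)]; ring
  rw [e]; exact c.T_le

theorem size_le (hω : 2 ≤ ω) : c.size ≤ 2 ^ ω * (c.n * (c.d : ℝ) ^ (ω - 1)) := by
  have h1 : (2 : ℝ) ^ c.a ≤ 2 * c.d := by exact_mod_cast c.le_d
  have h2 : ((2 : ℝ) ^ c.a) ^ (ω - 1) ≤ 2 ^ ω * (c.d : ℝ) ^ (ω - 1) := by
    calc ((2 : ℝ) ^ c.a) ^ (ω - 1) ≤ (2 * (c.d : ℝ)) ^ (ω - 1) :=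
          Real.rpow_le_rpow (by positivity) h1 (by linarith)
      _ = 2 ^ (ω - 1) * (c.d : ℝ) ^ (ω - 1) := Real.mul_rpow (by norm_num) (by positivity)
      _ ≤ _ := mul_le_mul_of_nonneg_right
        (Real.rpow_le_rpow_of_exponent_le (by norm_num) (by linarith)) (by positivity)
  have := mul_le_mul_of_nonneg_left h2 (Nat.cast_nonneg c.n : (0 : ℝ) ≤ c.n)
  rw [size]; linarith

/-- T^(2ω) is the power of T^(2ω+1) with exponent 2ω/(2ω+1). This exponent is at most 1, so the
constant 2^ω does not grow. -/
theorem round_le (hω : 2 ≤ ω) : c.round ≤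
    2 ^ ω * ((c.n : ℝ) * (c.d : ℝ) ^ (ω - 1)) ^ (2 * ω / (2 * ω + 1)) := by
  have h1 : ((2 : ℝ) ^ c.τ) ^ (2 * ω + 1) ≤ 2 ^ ω * (c.n * (c.d : ℝ) ^ (ω - 1)) :=
    c.T_le.trans (c.size_le hω)
  have h0 : (0 : ℝ) < 2 * ω + 1 := by linarith
  have he : 0 ≤ 2 * ω / (2 * ω + 1) := by positivity
  have he1 : 2 * ω / (2 * ω + 1) ≤ 1 := by rw [div_le_one h0]; linarith
  have h2 := Real.rpow_le_rpow (by positivity) h1 he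
  rw [← Real.rpow_mul (by positivity), Real.mul_rpow (by positivity) (by positivity),
    mul_div_cancel₀ _ h0.ne', ← round_eq] at h2
  refine h2.trans (mul_le_mul_of_nonneg_right ?_ (by positivity))
  calc ((2 : ℝ) ^ ω) ^ (2 * ω / (2 * ω + 1)) ≤ ((2 : ℝ) ^ ω) ^ (1 : ℝ) :=
        Real.rpow_le_rpow_of_exponent_le (Real.one_le_rpow (by norm_num) (by linarith)) he1
    _ = 2 ^ ω := Real.rpow_one _

theorem a_le_log : (c.a : ℝ) + 1 ≤ 3 * (1 + Real.log c.n) := by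
  have h1 : Real.log ((2 : ℝ) ^ c.a) ≤ Real.log (2 * c.n) := Real.log_le_log (by positivity) c.dh_le
  have hn := c.n_pos
  rw [Real.log_pow, Real.log_mul (by norm_num) (by positivity)] at h1
  have h2 := Real.log_two_gt_d9
  have h3 := Real.log_nonneg hn
  have h4 : (c.a : ℝ) ≤ 1 + 2 * Real.log c.n := by
    by_contra hc
    push Not at hc
    nlinarith
  linarith

theorem dh_sq_le : ((2 : ℝ) ^ c.a) ^ 2 ≤ 4 * (c.d * c.d) := by
  have h1 : (2 : ℝ) ^ c.a ≤ 2 * c.d := by exact_mod_cast c.le_d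
  have h0 : (0 : ℝ) ≤ (2 : ℝ) ^ c.a := by positivity
  nlinarith

end Conf

/-! ### Maintenance of the inverse inside a block -/

/-- The memory inside a block that was started with the weights `w`; all listed rows satisfy `H`. -/
structure Inv {ω : ℝ} (c : Conf ω) (w : ℕ → ℝ) (H : ℕ → Prop) (s : State) : Prop where
  st : Static c s
  base : Base c w s
  listed : Listed c.n s
  hist : ∀ p < s.nat 16 0 0, H (s.nat 17 p 0)
  dvd : c.θ ∣ s.nat 19 0 0
  le : s.nat 19 0 0 ≤ s.nat 16 0 0
  prod : ∀ p < s.nat 19 0 0, ∀ q < s.nat 19 0 0, s.real 9 p q = c.g s p q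

/-- At most `2 T ^ 2` rows satisfy `H`. -/
def Few {ω : ℝ} (c : Conf ω) (H : ℕ → Prop) : Prop :=
  ∀ S : Finset ℕ, (∀ i ∈ S, i < c.n ∧ H i) → S.card ≤ c.T * c.T + c.T * c.T

section

variable {ω : ℝ} {c : Conf ω} {w : ℕ → ℝ} {H : ℕ → Prop} {s s' : State}

theorem Conf.g_congr (h17 : s'.nat 17 = s.nat 17) (h8 : s'.real 8 = s.real 8) : c.g s' = c.g s := by
  funext p q
  simp only [Conf.g, h17, h8]

theorem delta_congr (h17 : s'.nat 17 = s.nat 17) (h1 : s'.real 1 = s.real 1)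
    (h5 : s'.real 5 = s.real 5) : delta s' = delta s := by
  funext p
  simp only [delta, h17, h1, h5]

theorem current_congr (h18 : s'.nat 18 = s.nat 18) (h1 : s'.real 1 = s.real 1)
    (h5 : s'.real 5 = s.real 5) : current s' = current s := by
  funext p
  simp only [current, h18, h1, h5]

theorem Conf.Scanned.congr (h : c.Scanned s) (h16 : s'.nat 16 = s.nat 16)
    (h17 : s'.nat 17 = s.nat 17) (h1 : s'.real 1 = s.real 1) (h5 : s'.real 5 = s.real 5) :
    c.Scanned s' := by
  unfold Conf.Scanned at h ⊢
  rwa [h16, h17, h1, h5]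

theorem Conf.Ready.congr (h : c.Ready s) (hn : ∀ a < 30, s'.nat a = s.nat a)
    (hr : ∀ a, a ≠ 2 → a ≠ 3 → s'.real a = s.real a) : c.Ready s' := by
  have e1 : c.pre s' = c.pre s := by
    funext i j
    simp only [Conf.pre, hn 16 (by norm_num), hn 17 (by norm_num), hr 11 (by norm_num) (by norm_num),
      hr 8 (by norm_num) (by norm_num), hr 15 (by norm_num) (by norm_num),
      delta_congr (hn 17 (by norm_num)) (hr 1 (by norm_num) (by norm_num))
        (hr 5 (by norm_num) (by norm_num))]
  unfold Conf.Ready at h ⊢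
  rwa [e1, current_congr (hn 18 (by norm_num)) (hr 1 (by norm_num) (by norm_num))
        (hr 5 (by norm_num) (by norm_num))]

theorem Inv.congr (h : Inv c w H s) (hn : ∀ a < 30, a ≠ 15 → s'.nat a = s.nat a)
    (hr : ∀ a < 13, a = 0 ∨ 4 < a → a ≠ 9 → s'.real a = s.real a)
    (hG : ∀ p < s.nat 19 0 0, ∀ q < s.nat 19 0 0, s'.real 9 p q = c.g s p q) : Inv c w H s' := by
  obtain ⟨h1, h2, h3, h4, h5, h6, h7⟩ := h
  refine ⟨h1.congr (fun a ha => hn a (by omega) (by omega))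
    (fun a ha => hr a (by omega) (by omega) (by omega)),
    h2.congr fun a ha => hr a (by omega) (by omega) (by omega),
    h3.congr (hn 16 (by norm_num) (by norm_num)) (hn 17 (by norm_num) (by norm_num))
      (hn 18 (by norm_num) (by norm_num)), ?_, ?_, ?_, ?_⟩
  · rw [hn 16 (by norm_num) (by norm_num), hn 17 (by norm_num) (by norm_num)]; exact h4
  · rw [hn 19 (by norm_num) (by norm_num)]; exact h5
  · rw [hn 19 (by norm_num) (by norm_num), hn 16 (by norm_num) (by norm_num)]; exact h6
  · rw [hn 19 (by norm_num) (by norm_num), Conf.g_congr (hn 17 (by norm_num) (by norm_num))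
      (hr 8 (by norm_num) (by norm_num) (by norm_num))]
    exact hG

theorem Inv.congr' (h : Inv c w H s) (hn : ∀ a < 30, a ≠ 15 → s'.nat a = s.nat a)
    (hr : ∀ a < 13, a = 0 ∨ 4 < a → s'.real a = s.real a) : Inv c w H s' :=
  h.congr hn (fun a ha ha' _ => hr a ha ha') fun p hp q hq => by
    rw [hr 9 (by norm_num) (by norm_num)]; exact h.prod p hp q hq

theorem Inv.mono (h : Inv c w H s) {H' : ℕ → Prop} (hH : ∀ i, H i → H' i) : Inv c w H' s := by
  obtain ⟨h1, h2, h3, h4, h5, h6, h7⟩ := h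
  exact ⟨h1, h2, h3, fun p hp => hH _ (h4 p hp), h5, h6, h7⟩

theorem Inv.card (h : Inv c w H s) (hf : Few c H) : s.nat 16 0 0 ≤ c.T * c.T + c.T * c.T := by
  have := hf ((Finset.range (s.nat 16 0 0)).image fun p => s.nat 17 p 0) ?_
  · rwa [Finset.card_image_of_injOn, Finset.card_range] at this
    intro p hp q hq e
    exact h.listed.inj p (by simpa using hp) q (by simpa using hq) e
  · intro i hi
    obtain ⟨p, hp, rfl⟩ := Finset.mem_image.1 hi
    exact ⟨h.listed.lt p (Finset.mem_range.1 hp), h.hist p (Finset.mem_range.1 hp)⟩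

theorem Inv.card_le_dim (h : Inv c w H s) (hf : Few c H) (hl : c.LowRank) :
    s.nat 16 0 0 ≤ 4 * c.d := by
  have h1 := h.card hf
  have h2 : c.T * c.T < 2 ^ c.a := hl
  have h3 := c.le_d
  omega

open Classical in
/-- The weights that are represented after the next scan. -/
noncomputable def fresh (s : State) (i : ℕ) : ℝ :=
  if s.nat 18 i 0 = 0 ∧ ¬ Bad (s.real 5 i 0) (s.real 1 i 0) then s.real 5 i 0 else s.real 1 i 0

theorem fresh_congr (h18 : s'.nat 18 = s.nat 18) (h1 : s'.real 1 = s.real 1)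
    (h5 : s'.real 5 = s.real 5) : fresh s' = fresh s := by
  funext p
  rw [fresh, fresh, h18, h1, h5]

/-- After a complete scan, a nonzero row is listed exactly if it was listed before or has left the
window. So the weights of the preconditioner are determined by the memory before the scan, even if
the scan itself is postponed to the queries. -/
theorem Conf.Scanned.current_eq (h : c.Scanned s') (hl : Listed c.n s')
    (h1 : s'.real 1 = s.real 1) (h5 : s'.real 5 = s.real 5) {i : ℕ} (hi : i < c.n)
    (hA : ∃ j < c.d, c.A i j ≠ 0) (ha : s.nat 18 i 0 ≠ 0 → s'.nat 18 i 0 ≠ 0)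
    (hb : s'.nat 18 i 0 ≠ 0 → s.nat 18 i 0 ≠ 0 ∨ Bad (s.real 5 i 0) (s.real 1 i 0)) :
    current s' i = fresh s i := by
  classical
  unfold current fresh
  rw [h1, h5]
  refine if_congr ⟨fun h0 => ⟨?_, fun hbad => ?_⟩, fun h0 => ?_⟩ rfl rfl
  · by_contra hc
    exact ha hc h0
  · obtain ⟨p, hp, hpi⟩ := h i hi hA (by rw [h1, h5]; exact hbad)
    exact (hl.mark i hi).1 h0 p hp hpi
  · by_contra hc
    exact (hb hc).elim (fun h => h h0.1) h0.2

theorem runs_scan {ρ : Tape} (h : Inv c w H s) (hH : ∀ i < c.n, Bad (w i) (s.real 1 i 0) → H i) :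
    Runs ρ scanProg s (200 * s.nat 12 0 0 + 20) (fun s' => Inv c w H s' ∧ c.Scanned s' ∧
      (∀ i < c.n, (∃ j < c.d, c.A i j ≠ 0) → current s' i = fresh s i) ∧
      s'.real = s.real ∧ s'.nat 15 = s.nat 15 ∧ s'.nat 19 = s.nat 19) := by
  refine (runs_scanProg h.st h.listed).mono le_rfl ?_
  rintro s₁ ⟨e, l, hb⟩
  have n19 := e.nat 19 (by norm_num) (by norm_num) (by norm_num) (by norm_num) (by norm_num)
    (by norm_num)
  have sc : c.Scanned s₁ := by
    intro i hi hA
    rw [e.real]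
    exact hb i hi hA
  refine ⟨⟨h.st.congr (fun a ha => e.nat a (by omega) (by omega) (by omega) (by omega) (by omega)
    (by omega)) (fun a _ => by rw [e.real]), h.base.congr fun a _ => by rw [e.real], l, ?_, ?_, ?_,
    ?_⟩, sc, ?_, e.real, e.nat 15 (by norm_num) (by norm_num) (by norm_num) (by norm_num) (by norm_num)
    (by norm_num), n19⟩
  · intro p hp
    rcases lt_or_ge p (s.nat 16 0 0) with hp' | hp'
    · rw [e.list p hp']; exact h.hist p hp'
    · have := e.bad p hp hp'
      have hlt := l.lt p hp
      rw [h.base.base _ hlt] at this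
      exact hH _ hlt this
  · rw [n19]; exact h.dvd
  · rw [n19]; exact h.le.trans e.le
  · rw [n19, e.real]
    intro p hp q hq
    have := h.le
    rw [h.prod p hp q hq, Conf.g, Conf.g, e.real, e.list p (by omega), e.list q (by omega)]
  · intro i hi hA
    refine sc.current_eq l (by rw [e.real]) (by rw [e.real]) hi hA (fun h0 h0' => h0 ?_) fun h0 => ?_
    · refine (h.listed.mark i hi).2 fun p hp => ?_
      rw [← e.list p hp]
      exact (l.mark i hi).1 h0' p (hp.trans_le e.le)
    · obtain ⟨p, hp, hpi⟩ : ∃ p < s₁.nat 16 0 0, s₁.nat 17 p 0 = i := by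
        by_contra hc
        push Not at hc
        exact h0 ((l.mark i hi).2 hc)
      rcases lt_or_ge p (s.nat 16 0 0) with hp' | hp'
      · left
        intro h00
        exact (h.listed.mark i hi).1 h00 p hp' (by rw [← e.list p hp', hpi])
      · right
        rw [← hpi]; exact e.bad p hp hp'

end

/-- The state between two rounds. -/
structure Maintained {ω : ℝ} (c : Conf ω) (w : ℕ → ℝ) (H : ℕ → Prop) (s : State) : Prop where
  inv : Inv c w H s
  low : c.LowRank → c.Scanned s ∧ s.nat 16 0 0 < s.nat 19 0 0 + c.θ
  ready : ¬ c.Lazy → c.Scanned s ∧ c.Ready s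

/-! ### Immediate and postponed updates -/

namespace Mul

variable (μ : Mul)

/-- Update the list of changed rows and the data that depend on it. -/
noncomputable def maintainProg : Prog :=
  .branch (.natLt (.lit 0) (V 7))
    (.seq scanProg <| .seq μ.fullProg <| .branch (.natLt (.lit 0) (V 8)) .skip μ.lowProg)
    (.branch (.natLt (.lit 0) (V 8)) .skip <| .seq scanProg μ.directProg)

/-- Complete the postponed computations. -/
noncomputable def finishProg : Prog :=
  .branch (.natLt (.lit 0) (V 8))
    (.branch (.natLt (.lit 0) (V 7)) μ.lowProg <| .seq scanProg μ.directProg)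
    .skip

/-- The constant of the running time. -/
noncomputable def B : ℝ := 300 * μ.K * 256 ^ μ.ω

variable {μ} {c : Conf μ.ω} {w : ℕ → ℝ} {H : ℕ → Prop} {s : State} {ρ : Tape}

theorem K_le_B : 300 * μ.K ≤ μ.B := by
  have := Conf.one_le_const μ.two_le
  unfold B
  exact le_mul_of_one_le_right (by linarith [μ.K_ge]) this

theorem runs_low (h : Inv c w H s) (hf : Few c H) (hr : c.mat.rank = c.d) (hl : c.LowRank)
    (hw : ∀ i < c.n, 0 < w i) (h1 : ∀ i < c.n, 0 < s.real 1 i 0)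
    (hlast : s.nat 16 0 0 < s.nat 19 0 0 + c.θ) :
    Runs ρ μ.lowProg s (20 * μ.K * c.batch + 32 * μ.K * 2 ^ μ.ω * (c.a + 1) * c.round) (fun s' =>
      Inv c w H s' ∧ c.Ready s' ∧ (∀ a < 30, s'.nat a = s.nat a) ∧
      ∀ a < 13, a ≠ 9 → s'.real a = s.real a) := by
  have hcnt := h.card hf
  have hc : ∀ i < c.n, 0 < current s i := fun i hi => c.cur_pos h.base hw h1 hi
  refine (μ.runs_lowProg h.st h.base h.listed hl h.dvd h.le hcnt hlast h.prod
    (c.capMat_inv hr h.base h.listed hl hw hc (by rw [← c.alpha_eq]; exact hcnt)).1).mono le_rfl ?_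
  rintro s₁ ⟨n1, r1, g1, b1⟩
  have n1' : ∀ a < 30, s₁.nat a = s.nat a := fun a ha => n1 a (by omega) ha
  have r1' : ∀ a < 13, a ≠ 9 → s₁.real a = s.real a := fun a ha ha' =>
    r1 a (by omega) ha' (Or.inl ha)
  have h' : Inv c w H s₁ := h.congr (fun a ha _ => n1' a ha) (fun a ha _ ha' => r1' a ha ha') g1
  refine ⟨h', c.ready_of_low hr h'.base h'.listed hl hw ?_ ?_ ?_, n1', r1'⟩
  · rw [current_congr (n1' 18 (by norm_num)) (r1' 1 (by norm_num) (by norm_num))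
      (r1' 5 (by norm_num) (by norm_num))]
    exact hc
  · rw [← c.alpha_eq]; exact h'.card hf
  · rw [b1, Conf.g_congr (n1' 17 (by norm_num)) (r1' 8 (by norm_num) (by norm_num)),
      delta_congr (n1' 17 (by norm_num)) (r1' 1 (by norm_num) (by norm_num))
      (r1' 5 (by norm_num) (by norm_num)), n1' 16 (by norm_num)]

theorem runs_direct (h : Inv c w H s) (hf : Few c H) (hr : c.mat.rank = c.d) (hl : ¬ c.LowRank)
    (hw : ∀ i < c.n, 0 < w i) (h1 : ∀ i < c.n, 0 < s.real 1 i 0) :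
    Runs ρ μ.directProg s (40 * μ.K * (c.a + 1) * c.round) (fun s' =>
      Inv c w H s' ∧ c.Ready s' ∧ (∀ a < 30, s'.nat a = s.nat a) ∧
      ∀ a < 13, s'.real a = s.real a) := by
  have hcnt := h.card hf
  have hc : ∀ i < c.n, 0 < current s i := fun i hi => c.cur_pos h.base hw h1 hi
  have e : (fun i j => c.q w i j + ∑ p ∈ Finset.range (s.nat 16 0 0),
      delta s p * c.A (s.nat 17 p 0) i * c.A (s.nat 17 p 0) j) = c.q (current s) := by
    funext i j
    exact (c.q_cur h.base h.listed i j).symm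
  have hd := μ.runs_directProg (ρ := ρ) h.st h.base hl hcnt
    (by rw [e]; exact (c.padId_inv hr hc).1)
  rw [e] at hd
  refine hd.mono le_rfl ?_
  rintro s₁ ⟨n1, r1, b1⟩
  have n1' : ∀ a < 30, s₁.nat a = s.nat a := fun a ha => n1 a (by omega) ha
  have r1' : ∀ a < 13, s₁.real a = s.real a := fun a ha => r1 a (by omega) (Or.inl ha)
  have ec := current_congr (n1' 18 (by norm_num)) (r1' 1 (by norm_num)) (r1' 5 (by norm_num))
  refine ⟨h.congr' (fun a ha _ => n1' a ha) (fun a ha _ => r1' a ha),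
    c.ready_of_direct hr hl ?_ ?_, n1', r1'⟩
  · rw [ec]; exact hc
  · rw [b1, ec]

theorem runs_scan_direct (h : Inv c w H s) (hf : Few c H) (hr : c.mat.rank = c.d)
    (hl : ¬ c.LowRank) (hH : ∀ i < c.n, Bad (w i) (s.real 1 i 0) → H i)
    (hw : ∀ i < c.n, 0 < w i) (h1 : ∀ i < c.n, 0 < s.real 1 i 0) :
    Runs ρ (.seq scanProg μ.directProg) s (200 * c.z + 20 + 40 * μ.K * (c.a + 1) * c.round)
      (fun s' => Inv c w H s' ∧ c.Scanned s' ∧ c.Ready s' ∧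
        (∀ i < c.n, (∃ j < c.d, c.A i j ≠ 0) → current s' i = fresh s i) ∧ s'.nat 15 = s.nat 15 ∧
        s'.nat 19 = s.nat 19 ∧ ∀ a < 13, s'.real a = s.real a) := by
  refine Runs.seq ((runs_scan h hH).mono ?_ fun _ h => h) ?_
  · have : (s.nat 12 0 0 : ℝ) ≤ c.z := by exact_mod_cast h.st.rows.le_z
    linarith
  rintro s₁ ⟨i1, sc1, fr1, r1, n15, n19⟩
  refine (runs_direct i1 hf hr hl hw (by rw [r1]; exact h1)).mono le_rfl ?_
  rintro s₂ ⟨i2, rd2, n2, r2⟩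
  exact ⟨i2, sc1.congr (n2 16 (by norm_num)) (n2 17 (by norm_num)) (r2 1 (by norm_num))
    (r2 5 (by norm_num)), rd2, fun i hi hA => by
      rw [current_congr (n2 18 (by norm_num)) (r2 1 (by norm_num)) (r2 5 (by norm_num)), fr1 i hi hA],
    by rw [n2 15 (by norm_num), n15], by rw [n2 19 (by norm_num), n19],
    fun a ha => by rw [r2 a ha, r1]⟩

/-- In the low rank case the scan and the full batches are done in every round, so that at most one
incomplete batch is ever postponed. The small inversion and that batch are done here only if nnz(A)
+ d² ≤ T^(2ω). The term with P' is the amortized part. -/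
theorem runs_maintainProg (h : Inv c w H s) (hf : Few c H) (hr : c.mat.rank = c.d)
    (hH : ∀ i < c.n, Bad (w i) (s.real 1 i 0) → H i)
    (hw : ∀ i < c.n, 0 < w i) (h1 : ∀ i < c.n, 0 < s.real 1 i 0) :
    ∃ P', s.nat 19 0 0 ≤ P' ∧ P' ≤ c.T * c.T + c.T * c.T ∧ Runs ρ μ.maintainProg s
      (μ.B * (c.a + 1) * c.round + 21 * μ.K * c.batch / c.θ * (P' - s.nat 19 0 0)) (fun s' =>
        Maintained c w H s' ∧ s'.nat 19 0 0 = P' ∧ s'.nat 15 0 0 = s.nat 15 0 0 ∧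
        s'.real 1 = s.real 1) := by
  have hK := μ.K_ge
  have hC := Conf.one_le_const μ.two_le
  have hR := c.round_ge μ.two_le
  have ha : (1 : ℝ) ≤ c.a + 1 := by linarith [(Nat.cast_nonneg c.a : (0 : ℝ) ≤ c.a)]
  have hKC : μ.K ≤ μ.K * 256 ^ μ.ω := le_mul_of_one_le_right (by linarith) hC
  have hRa : c.round ≤ (c.a + 1) * c.round := le_mul_of_one_le_left (by linarith) ha
  set Y := (c.a + 1) * c.round with hY
  have hKY : μ.K * Y ≤ μ.K * 256 ^ μ.ω * Y := mul_le_mul_of_nonneg_right hKC (by linarith)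
  have hY1 : 256 ^ μ.ω * c.round ≤ 256 ^ μ.ω * Y := mul_le_mul_of_nonneg_left hRa (by linarith)
  have hY2 : 3000 * (256 ^ μ.ω * Y) ≤ μ.K * (256 ^ μ.ω * Y) :=
    mul_le_mul_of_nonneg_right hK (mul_nonneg (by linarith) (by linarith))
  have hY3 : 1 * Y ≤ 256 ^ μ.ω * Y := mul_le_mul_of_nonneg_right hC (by linarith)
  have hBY : μ.B * (c.a + 1) * c.round = 300 * (μ.K * (256 ^ μ.ω * Y)) := by
    unfold B; rw [hY]; ring
  by_cases hl : c.LowRank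
  -- The witness P' depends on the list after the scan, so the scan is executed before P' is chosen.
  · obtain ⟨s₁, t₁, ex1, le1, i1, sc1, -, r1, n15, n19⟩ := runs_scan (ρ := ρ) h hH
    obtain ⟨P', p1, p2, p3, p4, hfull⟩ := μ.runs_fullProg (ρ := ρ) i1.st i1.base i1.listed hl i1.dvd
      i1.le (i1.card hf) i1.prod
    rw [n19] at p1 hfull
    refine ⟨P', p1, p2.trans (i1.card hf), ?_⟩
    have hnr : (s.nat 12 0 0 : ℝ) ≤ 2 * 256 ^ μ.ω * c.round := by
      have e1 : (s.nat 12 0 0 : ℝ) ≤ c.n := by exact_mod_cast h.st.rows.le_i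
      refine e1.trans ((c.n_le_round μ.two_le hl).trans (mul_le_mul_of_nonneg_right ?_ (by linarith)))
      rw [Real.rpow_add_one (by norm_num), Real.rpow_mul (by norm_num), mul_comm]
      refine mul_le_mul_of_nonneg_left ?_ (by norm_num)
      exact Real.rpow_le_rpow (by positivity) (by norm_num) (by linarith [μ.two_le])
    refine Runs.branch_last (fun _ => ?_) (fun hb => ?_)
    swap
    · exact absurd (by simp [Test.Holds, NatExp.eval, h.st.low, hl]) hb
    refine Runs.step (Q' := fun s' => s₁ = s') ⟨s₁, t₁, ex1, le1, rfl⟩ ?_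
    rintro _ rfl
    refine Runs.step hfull ?_
    rintro s₂ ⟨n2, n219, r2, g2⟩
    have n2' : ∀ a < 30, a ≠ 19 → s₂.nat a = s₁.nat a := fun a ha => n2 a (by omega)
    have i2 : Inv c w H s₂ := by
      refine ⟨i1.st.congr (fun a ha => n2' a (by omega) (by omega))
        (fun a ha => r2 a (by omega) (by omega)),
        i1.base.congr fun a ha => r2 a (by omega) (by omega),
        i1.listed.congr (n2' 16 (by norm_num) (by norm_num)) (n2' 17 (by norm_num) (by norm_num))
          (n2' 18 (by norm_num) (by norm_num)), ?_, ?_, ?_, ?_⟩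
      · rw [n2' 16 (by norm_num) (by norm_num), n2' 17 (by norm_num) (by norm_num)]; exact i1.hist
      · rw [n219]; exact p4
      · rw [n219, n2' 16 (by norm_num) (by norm_num)]; exact p2
      · rw [n219, Conf.g_congr (n2' 17 (by norm_num) (by norm_num)) (r2 8 (by norm_num) (by norm_num))]
        exact g2
    have sc2 : c.Scanned s₂ := sc1.congr (n2' 16 (by norm_num) (by norm_num))
      (n2' 17 (by norm_num) (by norm_num)) (r2 1 (by norm_num) (by norm_num))
      (r2 5 (by norm_num) (by norm_num))
    have hlast : s₂.nat 16 0 0 < s₂.nat 19 0 0 + c.θ := by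
      rw [n2' 16 (by norm_num) (by norm_num), n219]; exact p3
    have e1 : s₂.real 1 = s.real 1 := by rw [r2 1 (by norm_num) (by norm_num), r1]
    have e15 : s₂.nat 15 = s.nat 15 := by rw [n2' 15 (by norm_num) (by norm_num), n15]
    refine Runs.branch_last (fun hb => ?_) (fun hb => ?_)
    · have hlz : c.Lazy := by
        by_contra hc
        simp [Test.Holds, NatExp.eval, i2.st.lazy, hc] at hb
      refine (Runs.skip ⟨⟨i2, fun _ => ⟨sc2, hlast⟩, fun hc => absurd hlz hc⟩, n219, by rw [e15],
        e1⟩).mono ?_ fun _ h => h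
      simp only [Test.cost, NatExp.cost, hBY]
      push_cast
      linarith
    · have hlz : ¬ c.Lazy := by
        intro hc
        exact hb (by simp [Test.Holds, NatExp.eval, i2.st.lazy, hc])
      refine (runs_low i2 hf hr hl hw (by rw [e1]; exact h1) hlast).mono ?_ ?_
      -- Since the update is not postponed, D² ≤ 4d² ≤ 4 T^(2ω), and a batch fits into the budget of
      -- a round.
      · have hz : (c.z : ℝ) + c.d * c.d ≤ c.round := not_lt.1 hlz
        have hz0 : (0 : ℝ) ≤ c.z := Nat.cast_nonneg _
        have b1 := c.batch_le μ.two_le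
        have b2 := c.dh_sq_le
        have b3 : c.batch ≤ 2 * 256 ^ μ.ω * (5 * c.round) :=
          b1.trans (mul_le_mul_of_nonneg_left (by linarith) (by linarith))
        have b4 : μ.K * c.batch ≤ μ.K * (10 * (256 ^ μ.ω * Y)) :=
          mul_le_mul_of_nonneg_left (by linarith) (by linarith)
        have b5 : (2 : ℝ) ^ μ.ω ≤ 256 ^ μ.ω :=
          Real.rpow_le_rpow (by norm_num) (by norm_num) (by linarith [μ.two_le])
        have b6 : 32 * μ.K * 2 ^ μ.ω * (c.a + 1) * c.round ≤ 32 * (μ.K * (256 ^ μ.ω * Y)) := by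
          have : (2 : ℝ) ^ μ.ω * (μ.K * Y) ≤ 256 ^ μ.ω * (μ.K * Y) :=
            mul_le_mul_of_nonneg_right b5 (mul_nonneg (by linarith) (by linarith))
          rw [hY] at this ⊢
          linarith
        simp only [Test.cost, NatExp.cost, hBY]
        push_cast
        linarith
      · rintro s₃ ⟨i3, rd3, n3, r3⟩
        have sc3 := sc2.congr (n3 16 (by norm_num)) (n3 17 (by norm_num)) (r3 1 (by norm_num)
          (by norm_num)) (r3 5 (by norm_num) (by norm_num))
        refine ⟨⟨i3, fun _ => ⟨sc3, ?_⟩, fun _ => ⟨sc3, rd3⟩⟩, ?_, ?_, ?_⟩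
        · rw [n3 16 (by norm_num), n3 19 (by norm_num)]; exact hlast
        · rw [n3 19 (by norm_num), n219]
        · rw [n3 15 (by norm_num), e15]
        · rw [r3 1 (by norm_num) (by norm_num), e1]
  · refine ⟨s.nat 19 0 0, le_rfl, h.le.trans (h.card hf), ?_⟩
    rw [sub_self, mul_zero, add_zero]
    refine Runs.branch_last (fun hb => ?_) (fun _ => ?_)
    · exact absurd hb (by simp [Test.Holds, NatExp.eval, h.st.low, hl])
    refine Runs.branch_last (fun hb => ?_) (fun hb => ?_)
    · have hlz : c.Lazy := by
        by_contra hc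
        simp [Test.Holds, NatExp.eval, h.st.lazy, hc] at hb
      refine (Runs.skip ⟨⟨h, fun hc => absurd hc hl, fun hc => absurd hlz hc⟩, rfl, rfl,
        rfl⟩).mono ?_ fun _ h => h
      simp only [Test.cost, NatExp.cost, hBY]
      push_cast
      linarith
    · have hlz : ¬ c.Lazy := by
        intro hc
        exact hb (by simp [Test.Holds, NatExp.eval, h.st.lazy, hc])
      refine (runs_scan_direct h hf hr hl hH hw h1).mono ?_ ?_
      · have hz : (c.z : ℝ) + c.d * c.d ≤ c.round := not_lt.1 hlz
        have hd0 : (0 : ℝ) ≤ c.d * c.d := by positivity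
        have : 40 * μ.K * (c.a + 1) * c.round = 40 * (μ.K * Y) := by rw [hY]; ring
        rw [this]
        simp only [Test.cost, NatExp.cost, hBY]
        push_cast
        linarith
      · rintro s₁ ⟨i1, sc1, rd1, -, n15, n19, r1⟩
        exact ⟨⟨i1, fun hc => absurd hc hl, fun _ => ⟨sc1, rd1⟩⟩, by rw [n19], by rw [n15],
          r1 1 (by norm_num)⟩

/-- Postponement means T^(2ω) < nnz(A) + d², so the inversion and the last batch, of cost O(T^(2ω) +
D²), are within the budget of a query up to a logarithm. The work is repeated for every query,
because rounds continue from the memory before the query. -/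
theorem runs_finishProg (h : Maintained c w H s) (hf : Few c H) (hr : c.mat.rank = c.d)
    (hH : ∀ i < c.n, Bad (w i) (s.real 1 i 0) → H i)
    (hw : ∀ i < c.n, 0 < w i) (h1 : ∀ i < c.n, 0 < s.real 1 i 0) :
    Runs ρ μ.finishProg s (μ.B * (c.a + 1) * (c.z + c.d * c.d)) (fun s' =>
        Inv c w H s' ∧ c.Scanned s' ∧ c.Ready s' ∧
        (∀ i < c.n, (∃ j < c.d, c.A i j ≠ 0) → current s' i = fresh s i) ∧ ∀ a < 4, s'.real a = s.real a) := by
  have hK := μ.K_ge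
  have hC := Conf.one_le_const μ.two_le
  have hR := c.round_ge μ.two_le
  have ha : (1 : ℝ) ≤ c.a + 1 := by linarith [(Nat.cast_nonneg c.a : (0 : ℝ) ≤ c.a)]
  have hKC : μ.K ≤ μ.K * 256 ^ μ.ω := le_mul_of_one_le_right (by linarith) hC
  have hd1 : (1 : ℝ) ≤ c.d := by exact_mod_cast c.d_pos
  have hdd : (1 : ℝ) ≤ c.d * c.d := by nlinarith
  have hz0 : (0 : ℝ) ≤ c.z := Nat.cast_nonneg _
  set m := (c.z : ℝ) + c.d * c.d with hm
  have hma : m ≤ (c.a + 1) * m := le_mul_of_one_le_left (by linarith) ha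
  set Y := (c.a + 1) * m with hY
  have hKY : μ.K * Y ≤ μ.K * 256 ^ μ.ω * Y := mul_le_mul_of_nonneg_right hKC (by linarith)
  have hY1 : 256 ^ μ.ω * m ≤ 256 ^ μ.ω * Y := mul_le_mul_of_nonneg_left hma (by linarith)
  have hY2 : 3000 * (256 ^ μ.ω * Y) ≤ μ.K * (256 ^ μ.ω * Y) :=
    mul_le_mul_of_nonneg_right hK (mul_nonneg (by linarith) (by linarith))
  have hY3 : 1 * Y ≤ 256 ^ μ.ω * Y := mul_le_mul_of_nonneg_right hC (by linarith)
  have hBY : μ.B * (c.a + 1) * m = 300 * (μ.K * (256 ^ μ.ω * Y)) := by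
    unfold B; rw [hY]; ring
  rw [hBY]
  refine Runs.branch_last (fun hb => ?_) (fun hb => ?_)
  · have hlz : c.Lazy := by
      by_contra hc
      simp [Test.Holds, NatExp.eval, h.inv.st.lazy, hc] at hb
    have hz : c.round ≤ m := hlz.le
    have hzY : (c.a + 1) * c.round ≤ Y := mul_le_mul_of_nonneg_left hz (by linarith)
    refine Runs.branch_last (fun hb => ?_) (fun hb => ?_)
    · have hl : c.LowRank := by
        by_contra hc
        simp [Test.Holds, NatExp.eval, h.inv.st.low, hc] at hb
      obtain ⟨sc, hlast⟩ := h.low hl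
      refine (runs_low h.inv hf hr hl hw h1 hlast).mono ?_ ?_
      · have b1 := c.batch_le μ.two_le
        have b2 := c.dh_sq_le
        have b3 : c.batch ≤ 2 * 256 ^ μ.ω * (5 * m) :=
          b1.trans (mul_le_mul_of_nonneg_left (by linarith) (by linarith))
        have b4 : μ.K * c.batch ≤ μ.K * (10 * (256 ^ μ.ω * Y)) :=
          mul_le_mul_of_nonneg_left (by linarith) (by linarith)
        have b5 : (2 : ℝ) ^ μ.ω ≤ 256 ^ μ.ω :=
          Real.rpow_le_rpow (by norm_num) (by norm_num) (by linarith [μ.two_le])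
        have b6 : 32 * μ.K * 2 ^ μ.ω * (c.a + 1) * c.round ≤ 32 * (μ.K * (256 ^ μ.ω * Y)) := by
          have g1 : (2 : ℝ) ^ μ.ω * (μ.K * Y) ≤ 256 ^ μ.ω * (μ.K * Y) :=
            mul_le_mul_of_nonneg_right b5 (mul_nonneg (by linarith) (by linarith))
          have g2 : μ.K * 2 ^ μ.ω * ((c.a + 1) * c.round) ≤ μ.K * 2 ^ μ.ω * Y :=
            mul_le_mul_of_nonneg_left hzY (by have := μ.K_ge; positivity)
          linarith
        simp only [Test.cost, NatExp.cost]
        push_cast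
        linarith
      · rintro s₁ ⟨i1, rd1, n1, r1⟩
        exact ⟨i1, sc.congr (n1 16 (by norm_num)) (n1 17 (by norm_num)) (r1 1 (by norm_num)
          (by norm_num)) (r1 5 (by norm_num) (by norm_num)), rd1,
          fun i hi hA => by
            rw [current_congr (n1 18 (by norm_num)) (r1 1 (by norm_num) (by norm_num))
              (r1 5 (by norm_num) (by norm_num))]
            exact sc.current_eq h.inv.listed rfl rfl hi hA id Or.inl,
          fun a ha => r1 a (by omega) (by omega)⟩
    · have hl : ¬ c.LowRank := by
        intro hc
        exact hb (by simp [Test.Holds, NatExp.eval, h.inv.st.low, hc])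
      refine (runs_scan_direct h.inv hf hr hl hH hw h1).mono ?_ ?_
      · have : 40 * μ.K * (c.a + 1) * c.round = 40 * (μ.K * ((c.a + 1) * c.round)) := by ring
        have g2 : μ.K * ((c.a + 1) * c.round) ≤ μ.K * Y :=
            mul_le_mul_of_nonneg_left hzY (by linarith)
        rw [this]
        simp only [Test.cost, NatExp.cost]
        push_cast
        linarith
      · rintro s₁ ⟨i1, sc1, rd1, fr1, n15, n19, r1⟩
        exact ⟨i1, sc1, rd1, fr1, fun a ha => r1 a (by omega)⟩
  · have hlz : ¬ c.Lazy := by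
      intro hc
      exact hb (by simp [Test.Holds, NatExp.eval, h.inv.st.lazy, hc])
    obtain ⟨sc, rd⟩ := h.ready hlz
    refine (Runs.skip ⟨h.inv, sc, rd, fun i hi hA =>
      sc.current_eq h.inv.listed rfl rfl hi hA id Or.inl, fun a _ => rfl⟩).mono ?_ fun _ h => h
    simp only [Test.cost, NatExp.cost]
    push_cast
    linarith

end Mul

/-! ### Solver queries -/

theorem State.putVec_real_of_ne {s : State} {a b m : ℕ} {v : Fin m → ℝ} (h : b ≠ a) :
    (s.putVec a v).real b = s.real b := by
  funext i j
  simp [State.putVec, h]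

theorem State.putVec_real {s : State} {a m i : ℕ} {v : Fin m → ℝ} (h : i < m) :
    (s.putVec a v).real a i 0 = v ⟨i, h⟩ := by
  simp [State.putVec, h]

theorem ext1_apply {n i : ℕ} (w : Fin n → ℝ) (h : i < n) : ext1 w i = w ⟨i, h⟩ := by
  simp [ext1, h]

/-- N is the least exponent with 2^(-N) ≤ ε. From (N − 1) log 2 < log(1/ε) and log 2 ≤ log(1/ε) one
gets N < (2 / log 2) log(1/ε) ≤ 3 log(1/ε). -/
theorem exists_steps {ε : ℝ} (h0 : 0 < ε) (h1 : ε ≤ 1 / 2) :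
    ∃ N : ℕ, 0 < N ∧ (∀ k, ε < (1 / 2) ^ k ↔ k < N) ∧ (N : ℝ) ≤ 3 * Real.log (1 / ε) := by
  have hex : ∃ k : ℕ, ((1 : ℝ) / 2) ^ k ≤ ε := by
    obtain ⟨k, hk⟩ := exists_pow_lt_of_lt_one h0 (by norm_num : (1 : ℝ) / 2 < 1)
    exact ⟨k, hk.le⟩
  classical
  set N := Nat.find hex with hN
  have hspec := Nat.find_spec hex
  have hiff : ∀ k, ε < (1 / 2) ^ k ↔ k < N := by
    intro k
    constructor
    · intro hk
      by_contra hc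
      push Not at hc
      have : ((1 : ℝ) / 2) ^ k ≤ (1 / 2) ^ N :=
        pow_le_pow_of_le_one (by norm_num) (by norm_num) hc
      linarith
    · intro hk
      exact not_le.1 (Nat.find_min hex hk)
  have hpos : 0 < N := (hiff 0).1 (by rw [pow_zero]; linarith)
  refine ⟨N, hpos, hiff, ?_⟩
  have h2 := (hiff (N - 1)).2 (by omega)
  have h3 := Real.log_lt_log h0 h2
  have h4 := Real.log_le_log h0 h1
  have h5 := Real.log_two_gt_d9
  rw [one_div, Real.log_pow, Real.log_inv, Nat.cast_sub hpos] at h3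
  rw [one_div, Real.log_inv] at h4
  rw [one_div, Real.log_inv]
  have h6 : (1 : ℝ) ≤ N := by exact_mod_cast hpos
  push_cast at h3
  by_contra hc
  push Not at hc
  nlinarith

theorem gram_congr {n d : ℕ} {A : Matrix (Fin n) (Fin d) ℝ} {u v : Fin n → ℝ}
    (h : ∀ i, A i ≠ 0 → u i = v i) : gram A u = gram A v := by
  ext i j
  rw [gram_apply, gram_apply]
  refine Finset.sum_congr rfl fun l _ => ?_
  by_cases hA : A l = 0
  · simp [hA]
  · rw [h l hA]

theorem mul_dotProduct_gram {n d : ℕ} (A : Matrix (Fin n) (Fin d) ℝ) (t : ℝ) (w : Fin n → ℝ)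
    (x : Fin d → ℝ) :
    t * (x ⬝ᵥ (gram A w).mulVec x) = x ⬝ᵥ (gram A fun i => t * w i).mulVec x := by
  rw [← smul_gram, Matrix.smul_mulVec, dotProduct_smul, smul_eq_mul]

theorem fresh_approx {s : State} {i : ℕ} (h : 0 < s.real 1 i 0) :
    0.9 * fresh s i ≤ s.real 1 i 0 ∧ s.real 1 i 0 ≤ 1.1 * fresh s i := by
  unfold fresh
  split_ifs with h0
  · exact not_not.1 h0.2
  · constructor <;> linarith

/-- Some row weight of round `k'` between the rounds `k₀` and `k` is not approximated by the one of
round `k₀`. -/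
def Hist {n : ℕ} (D : ℕ → Fin n → ℝ) (k₀ k i : ℕ) : Prop :=
  ∃ k' ≤ k, k₀ < k' ∧ Bad (ext1 (D k₀) i) (ext1 (D k') i)

theorem few_hist {ω : ℝ} {c : Conf ω} {D : ℕ → Fin c.n → ℝ} {k₀ k r : ℕ}
    (hpos : ∀ k ≤ r, ∀ i, 0 < D k i)
    (hstep : ∀ k < r, ‖WithLp.toLp 2 (fun i => Real.log (D (k + 1) i) - Real.log (D k i))‖ ≤ 0.1)
    (hk : k ≤ r) (hT : k < k₀ + c.T) : Few c (Hist D k₀ k) := by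
  intro S hS
  rw [← Finset.card_attachFin S fun i hi => (hS i hi).1]
  refine card_changed_le hpos hstep (k₀ := k₀) _ fun i hi => ?_
  obtain ⟨hlt, k', h1, h2, h3⟩ := hS i (Finset.mem_attachFin _ |>.1 hi)
  rw [ext1_apply _ hlt, ext1_apply _ hlt] at h3
  exact ⟨k', h1.trans hk, h2, by omega, h3⟩

/-- The state of the memory after round `k`. -/
def Good {ω : ℝ} (c : Conf ω) (D : ℕ → Fin c.n → ℝ) (k : ℕ) (s : State) : Prop :=
  (∃ k₀ ≤ k, s.nat 15 0 0 = k - k₀ ∧ k < k₀ + c.T ∧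
    Maintained c (ext1 (D k₀)) (Hist D k₀ k) s) ∧ ∀ i : Fin c.n, s.real 1 i 0 = D k i

/-- The preconditioner after a round. -/
noncomputable def Conf.prec {ω : ℝ} (c : Conf ω) (s : State) : Matrix (Fin c.d) (Fin c.d) ℝ :=
  (gram c.mat fun i => fresh s i)⁻¹

namespace Mul

variable {μ : Mul} {c : Conf μ.ω} {D : ℕ → Fin c.n → ℝ} {s : State} {ρ : Tape} {r k : ℕ}

/-- The answer to a query. -/
noncomputable def solveProg (μ : Mul) : Prog := .seq μ.finishProg descentProg

theorem runs_solveProg (hg : Good c D k s) (hr : c.mat.rank = c.d)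
    (hpos : ∀ k ≤ r, ∀ i, 0 < D k i)
    (hstep : ∀ k < r, ‖WithLp.toLp 2 (fun i => Real.log (D (k + 1) i) - Real.log (D k i))‖ ≤ 0.1)
    (hk : k ≤ r) (b : Fin c.d → ℝ) {ε : ℝ} {N : ℕ} (hN : ∀ k, ε < (1 / 2) ^ k ↔ k < N) :
    Runs ρ μ.solveProg ((s.putVec 2 b).putReal 3 0 0 ε)
      (μ.B * (c.a + 1) * (c.z + c.d * c.d) + (N + 1) * (20000 * (c.z + c.d * c.d))) (fun s' =>
        ∀ j : Fin c.d, s'.real 4 j 0 = iter (gram c.mat (D k)) (c.prec s) b N j) := by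
  obtain ⟨⟨k₀, hk₀, -, hT, hm⟩, h1⟩ := hg
  set s₁ := (s.putVec 2 b).putReal 3 0 0 ε with hs₁
  have n1 : s₁.nat = s.nat := rfl
  have r1 : ∀ a, a ≠ 2 → a ≠ 3 → s₁.real a = s.real a := fun a h2 h3 => by
    rw [hs₁, State.putReal_real_of_ne h3, State.putVec_real_of_ne h2]
  have hw : ∀ i < c.n, 0 < ext1 (D k₀) i := fun i hi => by
    rw [ext1_apply _ hi]; exact hpos k₀ (hk₀.trans hk) _
  have h1' : ∀ i < c.n, s₁.real 1 i 0 = ext1 (D k) i := fun i hi => by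
    rw [r1 1 (by norm_num) (by norm_num), ext1_apply _ hi]; exact h1 ⟨i, hi⟩
  have h1pos : ∀ i < c.n, 0 < s₁.real 1 i 0 := fun i hi => by
    rw [h1' i hi, ext1_apply _ hi]; exact hpos k hk _
  have hf := few_hist hpos hstep hk hT
  have hH : ∀ i < c.n, Bad (ext1 (D k₀) i) (s₁.real 1 i 0) → Hist D k₀ k i := by
    intro i hi hbad
    rw [h1' i hi] at hbad
    -- At the start of the block the weight equals its reference value and cannot have left the
    -- window, so k₀ < k.
    refine ⟨k, le_rfl, lt_of_le_of_ne hk₀ ?_, hbad⟩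
    rintro rfl
    have := hw i hi
    exact hbad ⟨by linarith, by linarith⟩
  -- Writing a query changes only the real arrays 2 and 3, on which the data structure does not
  -- depend.
  have hm1 : Maintained c (ext1 (D k₀)) (Hist D k₀ k) s₁ := by
    refine ⟨hm.inv.congr' (fun a _ _ => by rw [n1]) fun a ha ha' => r1 a (by omega) (by omega),
      fun hl => ⟨(hm.low hl).1.congr (by rw [n1]) (by rw [n1]) (r1 1 (by norm_num) (by norm_num))
        (r1 5 (by norm_num) (by norm_num)), (hm.low hl).2⟩,
      fun hl => ⟨(hm.ready hl).1.congr (by rw [n1]) (by rw [n1]) (r1 1 (by norm_num) (by norm_num))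
        (r1 5 (by norm_num) (by norm_num)), (hm.ready hl).2.congr (fun a _ => by rw [n1]) r1⟩⟩
  refine Runs.seq (runs_finishProg hm1 hf hr hH hw h1pos) ?_
  rintro s₂ ⟨i2, -, rd2, fr2, r2⟩
  have e2 : ∀ j : Fin c.d, s₂.real 2 j 0 = b j := fun j => by
    rw [r2 2 (by norm_num), hs₁, State.putReal_real_of_ne (by norm_num), State.putVec_real j.2]
  have e3 : s₂.real 3 0 0 = ε := by
    rw [r2 3 (by norm_num), hs₁, State.putReal_real]; simp
  refine (runs_descentProg i2.st (i2.card_le_dim hf) (ext1 (D k))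
    (fun i hi => by rw [r2 1 (by norm_num), h1' i hi]) b e2 N (by rw [e3]; exact hN)).mono le_rfl ?_
  intro s₃ h3 j
  have eM : c.toMat (c.q (ext1 (D k))) = gram c.mat (D k) := by
    rw [Conf.toMat_q]
    congr 1
    funext i
    exact ext1_apply _ i.2
  have eP : c.toMat (c.pre s₂) = c.prec s := by
    have hrd : c.toMat (c.pre s₂) = (c.toMat (c.q (current s₂)))⁻¹ := rd2
    rw [hrd, Conf.toMat_q, Conf.prec]
    congr 1
    refine gram_congr fun i hi => ?_
    obtain ⟨l, hl⟩ := Function.ne_iff.1 hi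
    rw [fr2 i i.2 ⟨l, l.2, hl⟩, fresh_congr (by rw [n1]) (r1 1 (by norm_num) (by norm_num))
      (r1 5 (by norm_num) (by norm_num))]
  rw [h3 j, eM, eP]

end Mul

/-! ### Quality of the preconditioner -/

section

variable {ω : ℝ} {c : Conf ω} {D : ℕ → Fin c.n → ℝ} {s : State} {k : ℕ}

theorem Good.fresh_pos (hg : Good c D k s) (hpos : ∀ i, 0 < D k i) (i : Fin c.n) :
    0 < fresh s i := by
  have h1 := hg.2 i
  have := (fresh_approx (s := s) (i := i) (by rw [h1]; exact hpos i)).2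
  rw [h1] at this
  have := hpos i
  by_contra hc
  push Not at hc
  linarith

theorem Good.isSymm_prec (hg : Good c D k s) (hr : c.mat.rank = c.d) (hpos : ∀ i, 0 < D k i) :
    (c.prec s).IsSymm :=
  (posDef_gram hr (hg.fresh_pos hpos)).inv.transpose_eq'

theorem Good.specApprox_prec (hg : Good c D k s) (hr : c.mat.rank = c.d) (hpos : ∀ i, 0 < D k i) :
    SpecApprox 1 (c.prec s) (gram c.mat (aprWeights D k))⁻¹ := by
  have hb : ∀ i : Fin c.n, Real.exp (-1) * fresh s i ≤ aprWeights D k i ∧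
      aprWeights D k i ≤ Real.exp 1 * fresh s i := by
    intro i
    have h := fresh_approx (s := s) (i := i) (by rw [hg.2 i]; exact hpos i)
    rw [hg.2 i] at h
    exact ratio_bounds (hpos i) h (aprWeights_approx k (hpos i))
  have hP := posDef_gram hr (hg.fresh_pos hpos)
  have hQ : (gram c.mat (aprWeights D k)).PosDef := posDef_gram hr fun i =>
    lt_of_lt_of_le (mul_pos (Real.exp_pos _) (hg.fresh_pos hpos i)) (hb i).1
  refine specApprox_inv hP hQ ?_ ?_
  · intro x
    rw [smul_gram]
    exact dotProduct_gram_le (fun i _ => (hb i).1) x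
  · intro x
    rw [smul_gram]
    exact dotProduct_gram_le (fun i _ => (hb i).2) x

theorem Good.normSq_iter (hg : Good c D k s) (hr : c.mat.rank = c.d) (hpos : ∀ i, 0 < D k i)
    (b : Fin c.d → ℝ) (N : ℕ) :
    normSq (gram c.mat (D k)) (iter (gram c.mat (D k)) (c.prec s) b N -
      (gram c.mat (D k))⁻¹.mulVec b) ≤
      (1 / 2) ^ N * normSq (gram c.mat (D k)) ((gram c.mat (D k))⁻¹.mulVec b) := by
  have hb : ∀ i : Fin c.n, 0.9 * fresh s i ≤ D k i ∧ D k i ≤ 1.1 * fresh s i := by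
    intro i
    have h := fresh_approx (s := s) (i := i) (by rw [hg.2 i]; exact hpos i)
    rwa [hg.2 i] at h
  refine InverseMaintenance.normSq_iter (posDef_gram hr (hg.fresh_pos hpos))
    (posDef_gram hr hpos) ?_ ?_ b N
  · intro x
    rw [mul_dotProduct_gram]
    exact dotProduct_gram_le (fun i _ => (hb i).1) x
  · intro x
    rw [mul_dotProduct_gram]
    exact dotProduct_gram_le (fun i _ => (hb i).2) x

end

/-! ### Rounds -/

namespace Mul

variable {μ : Mul} {c : Conf μ.ω} {D : ℕ → Fin c.n → ℝ} {s : State} {ρ : Tape} {r k : ℕ}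

/-- Start a new block. -/
noncomputable def blockProg (μ : Mul) : Prog := .seq μ.restartProg μ.maintainProg

/-- The computations of a round. -/
noncomputable def roundProg (μ : Mul) : Prog :=
  .branch (.natLt (.add (V 15) (.lit 1)) (V 3))
    (.seq (setV 15 (.add (V 15) (.lit 1))) μ.maintainProg) μ.blockProg

/-- The cost of a restart. -/
noncomputable def restartCost (μ : Mul) (c : Conf μ.ω) : ℝ := 100 * μ.K * (c.a + 1) * c.size

/-- The cost of a round without the treatment of full batches. -/
noncomputable def roundCost (μ : Mul) (c : Conf μ.ω) : ℝ := μ.B * (c.a + 1) * c.round + 20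

/-- The cost of the treatment of full batches per row. -/
noncomputable def rowCost (μ : Mul) (c : Conf μ.ω) : ℝ := 21 * μ.K * c.batch / c.θ

theorem rowCost_nonneg : 0 ≤ μ.rowCost c := by
  have h1 := μ.K_ge
  have h2 := c.batch_ge μ.two_le
  unfold rowCost; positivity

/-- The slack of 20 on the left pays for the test in `roundProg`. The restart resets register 19, so
all rows in completed batches count as new. -/
theorem exec_blockProg (hs : Static c s) (hr : c.mat.rank = c.d)
    (hpos : ∀ k ≤ r, ∀ i, 0 < D k i)
    (hstep : ∀ k < r, ‖WithLp.toLp 2 (fun i => Real.log (D (k + 1) i) - Real.log (D k i))‖ ≤ 0.1)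
    (hk : k ≤ r) (h1 : ∀ i : Fin c.n, s.real 1 i 0 = D k i) :
    ∃ s' t, Exec ρ μ.blockProg s s' t ∧ Good c D k s' ∧ s'.nat 15 0 0 = 0 ∧
      s'.nat 19 0 0 ≤ c.T * c.T + c.T * c.T ∧
      (t : ℝ) + 20 ≤ μ.restartCost c + μ.roundCost c + μ.rowCost c * s'.nat 19 0 0 := by
  have hw : ∀ i < c.n, 0 < ext1 (D k) i := fun i hi => by
    rw [ext1_apply _ hi]; exact hpos k hk _
  have h1' : ∀ i < c.n, s.real 1 i 0 = ext1 (D k) i := fun i hi => by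
    rw [ext1_apply _ hi]; exact h1 ⟨i, hi⟩
  obtain ⟨s₁, t₁, ex₁, le₁, st, ba, r1, n15, n16, n19, n18⟩ :=
    μ.runs_restartProg (ρ := ρ) hs _ h1' (c.padId_inv hr hw).1
  have inv : Inv c (ext1 (D k)) (Hist D k k) s₁ := by
    refine ⟨st, ba, ⟨?_, ?_, ?_⟩, ?_, ?_, ?_, ?_⟩
    · rw [n16]; intro p hp; omega
    · rw [n16]; intro p hp; omega
    · rw [n16]; intro i hi
      exact iff_of_true (n18 i hi) fun p hp => by omega
    · rw [n16]; intro p hp; omega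
    · rw [n19]; exact dvd_zero _
    · rw [n19]; exact Nat.zero_le _
    · rw [n19]; intro p hp; omega
  have hT : k < k + c.T := by have := c.T_pos; omega
  have h1'' : ∀ i < c.n, s₁.real 1 i 0 = ext1 (D k) i := fun i hi => by rw [r1, h1' i hi]
  obtain ⟨P', -, hP', s₂, t₂, ex₂, le₂, m, n19', n15', r1'⟩ := runs_maintainProg (ρ := ρ) inv
    (few_hist hpos hstep hk hT) hr
    (fun i hi hb => by
      rw [h1'' i hi] at hb
      have := hw i hi
      exact absurd ⟨by linarith, by linarith⟩ hb)
    hw (fun i hi => by rw [h1'' i hi]; exact hw i hi)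
  refine ⟨s₂, t₁ + t₂, .seq ex₁ ex₂, ⟨⟨k, le_rfl, ?_, hT, m⟩, fun i => ?_⟩, ?_, ?_, ?_⟩
  · rw [n15', n15, Nat.sub_self]
  · rw [r1', r1, h1]
  · rw [n15', n15]
  · rw [n19']; exact hP'
  · rw [n19', restartCost, roundCost, rowCost]
    rw [n19] at le₂
    push_cast at le₂ ⊢
    linarith

/-- The potential of the amortized analysis. -/
noncomputable def potential (μ : Mul) (c : Conf μ.ω) (k : ℕ) (s : State) : ℝ :=
  μ.roundCost c * (k + 1) + (μ.restartCost c + 2 * (c.T * c.T) * μ.rowCost c) *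
    ((k - s.nat 15 0 0) / c.T) + μ.rowCost c * s.nat 19 0 0

/-- Inside a block the middle term of the potential is constant, and the growth of register 19 pays
for the full batches. At a restart the start of the block advances by T, so the quotient grows by
one. This releases the cost of the restart together with the charge of 2T² rows, which compensates
for the reset of register 19. -/
theorem exec_roundProg (hg : Good c D k s) (hr : c.mat.rank = c.d)
    (hpos : ∀ k ≤ r, ∀ i, 0 < D k i)
    (hstep : ∀ k < r, ‖WithLp.toLp 2 (fun i => Real.log (D (k + 1) i) - Real.log (D k i))‖ ≤ 0.1)
    (hk : k < r) :
    ∃ s' t, Exec ρ μ.roundProg (s.putVec 1 (D (k + 1))) s' t ∧ Good c D (k + 1) s' ∧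
      (t : ℝ) + μ.potential c k s ≤ μ.potential c (k + 1) s' := by
  obtain ⟨⟨k₀, hk₀, h15, hT, hm⟩, h1⟩ := hg
  set s₁ := s.putVec 1 (D (k + 1)) with hs₁
  have n1 : s₁.nat = s.nat := rfl
  have r1 : ∀ a, a ≠ 1 → s₁.real a = s.real a := fun a h => State.putVec_real_of_ne h
  have h1' : ∀ i : Fin c.n, s₁.real 1 i 0 = D (k + 1) i := fun i => State.putVec_real i.2
  have hTpos := c.T_pos
  have hTr : (0 : ℝ) < c.T := by exact_mod_cast hTpos
  have inv1 : Inv c (ext1 (D k₀)) (Hist D k₀ k) s₁ :=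
    hm.inv.congr' (fun a _ _ => by rw [n1]) fun a ha ha' => r1 a (by omega)
  have e15 : s₁.nat 15 0 0 = k - k₀ := by rw [n1, h15]
  have hP : s.nat 19 0 0 ≤ c.T * c.T + c.T * c.T :=
    hm.inv.le.trans (hm.inv.card (few_hist hpos hstep hk.le hT))
  have hcost : (Test.natLt (.add (V 15) (.lit 1)) (V 3)).cost = 9 := by simp [Test.cost, NatExp.cost]
  by_cases hb : (Test.natLt (.add (V 15) (.lit 1)) (V 3)).Holds s₁
  · have hlt : k - k₀ + 1 < c.T := by
      simpa [Test.Holds, NatExp.eval, e15, inv1.st.T] using hb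
    set s₂ := s₁.putNat 15 0 0 (k - k₀ + 1) with hs₂
    have ex₂ : Exec ρ (setV 15 (.add (V 15) (.lit 1))) s₁ s₂ 8 := by
      have := Exec.setNat (ρ := ρ) s₁ 15 (.lit 0) (.lit 0) (.add (V 15) (.lit 1))
      simpa [NatExp.eval, NatExp.cost, e15, hs₂] using this
    have n2 : ∀ a, a ≠ 15 → s₂.nat a = s.nat a := fun a ha => State.putNat_nat_of_ne ha
    have h2' : ∀ i < c.n, s₂.real 1 i 0 = ext1 (D (k + 1)) i := fun i hi => by
      rw [ext1_apply _ hi]; exact h1' ⟨i, hi⟩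
    have hT' : k + 1 < k₀ + c.T := by omega
    have hw : ∀ i < c.n, 0 < ext1 (D k₀) i := fun i hi => by
      rw [ext1_apply _ hi]; exact hpos k₀ (by omega) _
    have inv2 : Inv c (ext1 (D k₀)) (Hist D k₀ (k + 1)) s₂ :=
      (inv1.congr' (fun a _ ha => n2 a ha) fun a _ _ => rfl).mono fun i ⟨k', a1, a2, a3⟩ =>
        ⟨k', by omega, a2, a3⟩
    obtain ⟨P', hPP, hP', s₃, t₃, ex₃, le₃, m, n19', n15', r1'⟩ := runs_maintainProg (ρ := ρ) inv2
      (few_hist hpos hstep hk hT') hr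
      (fun i hi hb => by
        rw [h2' i hi] at hb
        exact ⟨k + 1, le_rfl, by omega, hb⟩)
      hw (fun i hi => by rw [h2' i hi, ext1_apply _ hi]; exact hpos _ hk _)
    have e15' : s₃.nat 15 0 0 = k + 1 - k₀ := by
      rw [n15', hs₂]; simp [State.putNat_nat]; omega
    refine ⟨s₃, _, Exec.branch_true hb (.seq ex₂ ex₃), ⟨⟨k₀, by omega, e15', hT', m⟩, fun i => ?_⟩,
      ?_⟩
    · rw [r1', h2' i i.2, ext1_apply _ i.2]
    · rw [potential, potential, n19', e15', h15, hcost]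
      rw [n2 19 (by norm_num)] at le₃
      rw [Nat.cast_sub hk₀, Nat.cast_sub (by omega : k₀ ≤ k + 1)]
      push_cast at le₃ ⊢
      rw [rowCost, roundCost] at *
      have e : (k : ℝ) - (k - k₀) = k + 1 - (k + 1 - k₀) := by ring
      rw [e]
      linarith
  · have hge : c.T ≤ k - k₀ + 1 := by
      simpa [Test.Holds, NatExp.eval, e15, inv1.st.T] using hb
    obtain ⟨s₂, t₂, ex₂, g₂, n15, n19, le₂⟩ := exec_blockProg (ρ := ρ) inv1.st hr hpos hstep
      (k := k + 1) hk h1'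
    refine ⟨s₂, _, Exec.branch_false hb ex₂, g₂, ?_⟩
    rw [potential, potential, n15, hcost, h15]
    have hE := rowCost_nonneg (c := c)
    have hP' : (s.nat 19 0 0 : ℝ) ≤ 2 * (c.T * c.T) := by
      have : (s.nat 19 0 0 : ℝ) ≤ c.T * c.T + c.T * c.T := by exact_mod_cast hP
      linarith
    have hPE := mul_le_mul_of_nonneg_left hP' hE
    have ek : (k : ℝ) + 1 - (k - k₀ : ℕ) - c.T + c.T = k + 1 - (k - k₀ : ℕ) := by ring
    -- A block lasts exactly T rounds: the failed test gives one inequality, the invariant k < k₀ +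
    -- T the other.
    have hkT : k - k₀ + 1 = c.T := by omega
    have e : ((k + 1 : ℕ) - ((0 : ℕ) : ℝ)) / c.T = ((k : ℝ) - (k - k₀ : ℕ)) / c.T + 1 := by
      have : (c.T : ℝ) = (k - k₀ : ℕ) + 1 := by exact_mod_cast hkT.symm
      rw [div_add_one hTr.ne']
      congr 1
      push_cast
      linarith
    rw [e]
    push_cast
    nlinarith

/-- The implementation. -/
noncomputable def maintainer (μ : Mul) : Maintainer where
  init := .seq (setupProg μ.ω) μ.blockProg
  round := μ.roundProg
  solve := μ.solveProg

theorem exists_rounds (hg : Good c D 0 s) (hr : c.mat.rank = c.d)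
    (hpos : ∀ k ≤ r, ∀ i, 0 < D k i)
    (hstep : ∀ k < r, ‖WithLp.toLp 2 (fun i => Real.log (D (k + 1) i) - Real.log (D k i))‖ ≤ 0.1)
    (t₀ : ℕ) : ∃ (σ : ℕ → State) (t : ℕ → ℕ), σ 0 = s ∧ t 0 = t₀ ∧
      (∀ k < r, Exec ρ μ.roundProg ((σ k).putVec 1 (D (k + 1))) (σ (k + 1)) (t (k + 1))) ∧
      ∀ k ≤ r, Good c D k (σ k) ∧ ∑ l ∈ Finset.range (k + 1), (t l : ℝ) + μ.potential c 0 s ≤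
        t₀ + μ.potential c k (σ k) := by
  -- The step is made total by an arbitrary default, so that the sequence of memories can be defined
  -- by recursion before its properties are known.
  have hex : ∀ k s, ∃ p : State × ℕ, k < r → Good c D k s →
      Exec ρ μ.roundProg (s.putVec 1 (D (k + 1))) p.1 p.2 ∧ Good c D (k + 1) p.1 ∧
      (p.2 : ℝ) + μ.potential c k s ≤ μ.potential c (k + 1) p.1 := by
    intro k s
    by_cases h : k < r ∧ Good c D k s
    · obtain ⟨s', t, h'⟩ := exec_roundProg (ρ := ρ) h.2 hr hpos hstep h.1
      exact ⟨(s', t), fun _ _ => h'⟩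
    · exact ⟨(s, 0), fun a b => absurd ⟨a, b⟩ h⟩
  choose next hnext using hex
  set σ : ℕ → State := fun k => Nat.rec s (fun k s => (next k s).1) k with hσ
  set t : ℕ → ℕ := fun k => Nat.casesOn k t₀ fun k => (next k (σ k)).2 with ht
  have main : ∀ k ≤ r, Good c D k (σ k) ∧ ∑ l ∈ Finset.range (k + 1), (t l : ℝ) +
      μ.potential c 0 s ≤ t₀ + μ.potential c k (σ k) := by
    intro k
    induction k with
    | zero =>
      intro _
      refine ⟨hg, ?_⟩
      simp [ht, hσ]
    | succ k ih =>
      intro hk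
      obtain ⟨h1, h2⟩ := ih (by omega)
      obtain ⟨-, h4, h5⟩ := hnext k (σ k) (by omega) h1
      refine ⟨h4, ?_⟩
      rw [Finset.sum_range_succ]
      have e1 : t (k + 1) = (next k (σ k)).2 := rfl
      have e2 : σ (k + 1) = (next k (σ k)).1 := rfl
      rw [e1, e2]
      linarith
  exact ⟨σ, t, rfl, rfl, fun k hk => (hnext k (σ k) hk (main k hk.le).1).1, main⟩

end Mul

/-! ### The running time -/

theorem nnz_eq {n d : ℕ} (A : Matrix (Fin n) (Fin d) ℝ) :
    (nnz A : ℝ) = ∑ i, ∑ j, if A i j = 0 then 0 else 1 := by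
  classical
  rw [nnz, Set.ncard_eq_toFinset_card', ← Fintype.sum_prod_type',
    Finset.card_eq_sum_ones, Nat.cast_sum, ← Finset.sum_filter_add_sum_filter_not Finset.univ
      (fun e : Fin n × Fin d => A e.1 e.2 ≠ 0)]
  have h2 : ∑ e ∈ Finset.univ.filter (fun e : Fin n × Fin d => ¬ A e.1 e.2 ≠ 0),
      (if A e.1 e.2 = 0 then (0 : ℝ) else 1) = 0 :=
    Finset.sum_eq_zero fun e he => if_pos (not_not.1 (Finset.mem_filter.1 he).2)
  rw [h2, add_zero]
  refine Finset.sum_congr ?_ fun e he => ?_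
  · ext e; simp
  · rw [if_neg]
    · simp
    · simpa using he

theorem Static.nnz_mat {ω : ℝ} {c : Conf ω} {s : State} (h : Static c s) :
    (c.z : ℝ) = nnz c.mat := by
  have := h.entries.card
  rw [h.z, prefixSum_full, Finset.sum_range] at this
  rw [this, nnz_eq]
  refine Finset.sum_congr rfl fun i _ => ?_
  rw [Finset.sum_range]
  refine Finset.sum_congr rfl fun j _ => ?_
  rw [Conf.mat_apply]

/-- Positive vectors have full support. Hence s ≥ n, and the first term of the time bound covers
setup and first restart. -/
theorem le_nnzVec {n : ℕ} {v : Fin n → ℝ} (h : ∀ i, 0 < v i) : n ≤ nnzVec v := by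
  have : {i : Fin n | v i ≠ 0} = Set.univ := Set.eq_univ_of_forall fun i => (h i).ne'
  rw [nnzVec, this, Set.ncard_univ, Nat.card_eq_fintype_card, Fintype.card_fin]

namespace Mul

variable {μ : Mul} {c : Conf μ.ω}

/-- The setup, the first restart and the batches of the unfinished block are compared with n
d^(ω-1). Everything else amounts to O(T^(2ω)) per round, up to the logarithm that bounds a + 1. -/
theorem total_le (μ : Mul) (c : Conf μ.ω) {r : ℕ} (hr : 0 < r) :
    2000 * c.n * c.d + μ.restartCost c + (μ.roundCost c * (r + 1) +
      (μ.restartCost c + 2 * (c.T * c.T) * μ.rowCost c) * (r / c.T) +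
      μ.rowCost c * (2 * (c.T * c.T))) ≤
    24 * 2 ^ μ.ω * μ.B * (1 + Real.log c.n) * (c.n * (c.d : ℝ) ^ (μ.ω - 1) +
      r * ((c.n : ℝ) * (c.d : ℝ) ^ (μ.ω - 1)) ^ (2 * μ.ω / (2 * μ.ω + 1))) := by
  have hω := μ.two_le
  have hK := μ.K_ge
  have hC := Conf.one_le_const hω
  have hKB := K_le_B (μ := μ)
  have hBdef : μ.B = 300 * (μ.K * 256 ^ μ.ω) := by unfold B; ring
  have hR := c.round_ge hω
  have ha : (1 : ℝ) ≤ c.a + 1 := by linarith [(Nat.cast_nonneg c.a : (0 : ℝ) ≤ c.a)]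
  have hal := c.a_le_log
  have hT : (1 : ℝ) ≤ c.T := by exact_mod_cast c.T_pos
  have hr1 : (1 : ℝ) ≤ r := by exact_mod_cast hr
  have hn1 := c.n_pos
  have hd1 : (1 : ℝ) ≤ c.d := by exact_mod_cast c.d_pos
  have hX0 : (c.d : ℝ) ≤ (c.d : ℝ) ^ (μ.ω - 1) := by
    calc (c.d : ℝ) = (c.d : ℝ) ^ (1 : ℝ) := (Real.rpow_one _).symm
      _ ≤ _ := Real.rpow_le_rpow_of_exponent_le hd1 (by linarith)
  have hX1 : (c.n : ℝ) * c.d ≤ c.n * (c.d : ℝ) ^ (μ.ω - 1) :=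
    mul_le_mul_of_nonneg_left hX0 (by linarith)
  have hnd : 1 ≤ (c.n : ℝ) * c.d := one_le_mul_of_one_le_of_one_le hn1 hd1
  have hsX := c.size_le hω
  have hrX := c.round_le hω
  set X := (c.n : ℝ) * (c.d : ℝ) ^ (μ.ω - 1) with hX
  set Xe := X ^ (2 * μ.ω / (2 * μ.ω + 1)) with hXe
  have hXe0 : 0 ≤ Xe := by positivity
  set W := (c.T : ℝ) * c.round with hW
  have hW0 : 0 < W := by positivity
  have hWs : W ≤ c.size := c.block_le_size
  have hBa : 0 ≤ μ.B * (c.a + 1) := mul_nonneg (by linarith) (by linarith)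
  have e1 : c.T * c.T * μ.rowCost c ≤ 21 * (μ.K * 256 ^ μ.ω) * W := by
    have h := c.batches_le hω
    have e : ((2 : ℝ) ^ c.τ) ^ (2 * μ.ω + 1) = W := by
      rw [hW, c.round_eq, c.T_cast, Real.rpow_add_one (by positivity)]; ring
    rw [e] at h
    have := mul_le_mul_of_nonneg_left h (by linarith : 0 ≤ 21 * μ.K)
    calc c.T * c.T * μ.rowCost c = 21 * μ.K * (c.T * c.T * (c.batch / c.θ)) := by
          rw [rowCost]; ring
      _ ≤ 21 * μ.K * (256 ^ μ.ω * W) := this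
      _ = _ := by ring
  have e1' : 2 * (c.T * c.T) * μ.rowCost c ≤ μ.B * (c.a + 1) * W := by
    have h1 : μ.B * W ≤ μ.B * (c.a + 1) * W :=
      mul_le_mul_of_nonneg_right (le_mul_of_one_le_right (by linarith) ha) hW0.le
    have h2 : 0 ≤ μ.K * 256 ^ μ.ω * W := by positivity
    rw [hBdef] at h1 ⊢
    linarith
  -- Later restarts are measured by W = T · T^(2ω), to be divided by T. The first one has no block
  -- before it to be charged to and is bounded by the size in `e3`.
  have e2 : μ.restartCost c ≤ μ.B * (c.a + 1) * W := by
    have h1 := c.size_le_block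
    have h2 : (2 : ℝ) ^ (2 * μ.ω + 1) ≤ 3 * 256 ^ μ.ω := by
      rw [Real.rpow_add_one (by norm_num), Real.rpow_mul (by norm_num)]
      have : ((2 : ℝ) ^ (2 : ℝ)) ^ μ.ω ≤ 256 ^ μ.ω :=
        Real.rpow_le_rpow (by positivity) (by norm_num) (by linarith)
      linarith
    have h3 : c.size ≤ 3 * 256 ^ μ.ω * W := h1.trans (mul_le_mul_of_nonneg_right h2 hW0.le)
    have h4 := mul_le_mul_of_nonneg_left h3 (by positivity : 0 ≤ 100 * μ.K * ((c.a : ℝ) + 1))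
    rw [restartCost, hBdef]
    linarith
  have e3 : μ.restartCost c ≤ μ.B * (c.a + 1) * c.size := by
    rw [restartCost]
    refine mul_le_mul_of_nonneg_right (mul_le_mul_of_nonneg_right ?_ (by linarith)) (by linarith)
    linarith
  have e4 : μ.roundCost c ≤ 2 * (μ.B * (c.a + 1) * c.round) := by
    have h1 : 1 ≤ (c.a + 1) * c.round := one_le_mul_of_one_le_of_one_le ha hR
    have h2 : μ.B * 1 ≤ μ.B * ((c.a + 1) * c.round) := mul_le_mul_of_nonneg_left h1 (by linarith)
    rw [roundCost]
    linarith
  have hF0 : 0 ≤ μ.roundCost c := by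
    rw [roundCost]
    have : 0 ≤ μ.B * (c.a + 1) * c.round := mul_nonneg hBa (by linarith)
    linarith
  have e5 : (μ.restartCost c + 2 * (c.T * c.T) * μ.rowCost c) * (r / c.T) ≤
      2 * (μ.B * (c.a + 1) * c.round) * r := by
    have h1 : (μ.restartCost c + 2 * (c.T * c.T) * μ.rowCost c) * (r / c.T) ≤
        (2 * (μ.B * (c.a + 1) * W)) * (r / c.T) :=
      mul_le_mul_of_nonneg_right (by linarith) (by positivity)
    have h2 : (2 * (μ.B * (c.a + 1) * W)) * (r / c.T) = 2 * (μ.B * (c.a + 1) * c.round) * r := by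
      rw [hW]; field_simp
    rwa [h2] at h1
  have e6 : μ.roundCost c * (r + 1) ≤ 4 * (μ.B * (c.a + 1) * c.round) * r := by
    calc μ.roundCost c * (r + 1) ≤ μ.roundCost c * (2 * r) :=
          mul_le_mul_of_nonneg_left (by linarith) hF0
      _ ≤ 2 * (μ.B * (c.a + 1) * c.round) * (2 * r) :=
          mul_le_mul_of_nonneg_right e4 (by linarith)
      _ = _ := by ring
  have e7 : 2000 * c.n * c.d ≤ μ.B * (c.a + 1) * X := by
    have h1 : 2000 * (c.n * c.d) ≤ μ.B * X := mul_le_mul (by linarith) hX1 (by linarith) (by linarith)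
    have h2 : μ.B * X ≤ μ.B * (c.a + 1) * X :=
      mul_le_mul_of_nonneg_right (le_mul_of_one_le_right (by linarith) ha) (by linarith)
    linarith
  have e8 : μ.rowCost c * (2 * (c.T * c.T)) ≤ μ.B * (c.a + 1) * c.size := by
    have := mul_le_mul_of_nonneg_left hWs hBa
    linarith
  have f1 := mul_le_mul_of_nonneg_left hsX hBa
  have f2 : μ.B * (c.a + 1) * c.round * r ≤ μ.B * (c.a + 1) * (2 ^ μ.ω * Xe) * r :=
    mul_le_mul_of_nonneg_right (mul_le_mul_of_nonneg_left hrX hBa) (by linarith)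
  have h2ω : (1 : ℝ) ≤ 2 ^ μ.ω := Real.one_le_rpow (by norm_num) (by linarith)
  have f3 : μ.B * (c.a + 1) * X ≤ 2 ^ μ.ω * (μ.B * (c.a + 1) * X) :=
    le_mul_of_one_le_left (mul_nonneg hBa (by linarith)) h2ω
  have hrXe : 0 ≤ r * Xe := by positivity
  have f4 : 8 * 2 ^ μ.ω * (μ.B * (c.a + 1)) * (X + r * Xe) ≤
      24 * 2 ^ μ.ω * μ.B * (1 + Real.log c.n) * (X + r * Xe) := by
    refine mul_le_mul_of_nonneg_right ?_ (by linarith)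
    have h := mul_le_mul_of_nonneg_left hal (by positivity : 0 ≤ 8 * (2 : ℝ) ^ μ.ω)
    have := mul_le_mul_of_nonneg_left h (by linarith : 0 ≤ μ.B)
    linarith
  refine le_trans ?_ f4
  have g1 : 0 ≤ 2 ^ μ.ω * (μ.B * (c.a + 1) * X) :=
    mul_nonneg (by linarith) (mul_nonneg hBa (by linarith))
  have g2 : 0 ≤ 2 ^ μ.ω * (μ.B * (c.a + 1)) * (r * Xe) :=
    mul_nonneg (mul_nonneg (by linarith) hBa) hrXe
  linarith

theorem query_le (μ : Mul) (c : Conf μ.ω) {N : ℕ} {x : ℝ} (hx : 1 / 2 ≤ x) (hN : (N : ℝ) ≤ 3 * x) :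
    μ.B * (c.a + 1) * (c.z + c.d * c.d) + (N + 1) * (20000 * (c.z + c.d * c.d)) ≤
      24 * 2 ^ μ.ω * μ.B * (1 + Real.log c.n) * (c.z + (c.d : ℝ) ^ 2) * x := by
  have hK := μ.K_ge
  have hKB := K_le_B (μ := μ)
  have hal := c.a_le_log
  have hl := Real.log_nonneg c.n_pos
  set l := 1 + Real.log c.n with hldef
  have hl1 : 1 ≤ l := by linarith
  have hm0 : (0 : ℝ) ≤ c.z + c.d * c.d := by positivity
  have h2ω : (1 : ℝ) ≤ 2 ^ μ.ω := Real.one_le_rpow (by norm_num) (by linarith [μ.two_le])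
  rw [pow_two]
  set m := (c.z : ℝ) + c.d * c.d
  have hlx : l ≤ l * (2 * x) := le_mul_of_one_le_right (by linarith) (by linarith)
  have hx1 : x ≤ l * x := le_mul_of_one_le_left (by linarith) hl1
  have hB0 : 0 ≤ μ.B := by linarith
  have h1 : μ.B * (c.a + 1) ≤ μ.B * (3 * (l * (2 * x))) :=
    mul_le_mul_of_nonneg_left (by linarith) hB0
  have h2 : ((N : ℝ) + 1) * 20000 ≤ μ.B * (l * x) := by
    have : 100000 * (l * x) ≤ μ.B * (l * x) :=
      mul_le_mul_of_nonneg_right (by linarith) (by positivity)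
    linarith
  have h3 : μ.B * (c.a + 1) + (N + 1) * 20000 ≤ 7 * (μ.B * (l * x)) := by linarith
  have h4 := mul_le_mul_of_nonneg_right h3 hm0
  have hY : 0 ≤ μ.B * (l * x) * m := by positivity
  have h5 : 7 * (μ.B * (l * x)) * m ≤ 24 * 2 ^ μ.ω * (μ.B * (l * x) * m) := by nlinarith
  linarith

theorem runs_of_input (μ : Mul) {n d r : ℕ} {A : Matrix (Fin n) (Fin d) ℝ} {D : ℕ → Fin n → ℝ}
    (hin : IsInput r A D)
    (hstep : ∀ k < r, ‖WithLp.toLp 2 (fun i => Real.log (D (k + 1) i) - Real.log (D k i))‖ ≤ 0.1)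
    (ρ : Tape) : ∃ (σ : ℕ → State) (t : ℕ → ℕ), μ.maintainer.IsRun r A D ρ σ t ∧
      (∑ k ∈ Finset.range (r + 1), (t k : ℝ)) ≤ 24 * 2 ^ μ.ω * μ.B * (1 + Real.log n) *
        (n * (d : ℝ) ^ (μ.ω - 1) + r * ((n : ℝ) * (d : ℝ) ^ (μ.ω - 1)) ^ (2 * μ.ω / (2 * μ.ω + 1))) ∧
      ∀ k ≤ r, ∃ K : Matrix (Fin d) (Fin d) ℝ, K.IsSymm ∧
        SpecApprox 1 K (gram A (aprWeights D k))⁻¹ ∧ ∀ ε : ℝ, 0 < ε → ε ≤ 1 / 2 → ∃ z : ℕ,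
          ∀ b : Fin d → ℝ, normSq (gram A (D k)) ((descentOperator (gram A (D k)) K 1 z).mulVec b -
              (gram A (D k))⁻¹.mulVec b) ≤
            ε * normSq (gram A (D k)) ((gram A (D k))⁻¹.mulVec b) ∧
          ∃ τ : ℕ, μ.maintainer.Answers ρ (σ k) b ε
              ((descentOperator (gram A (D k)) K 1 z).mulVec b) τ ∧
            (τ : ℝ) ≤ 24 * 2 ^ μ.ω * μ.B * (1 + Real.log n) * ((nnz A : ℝ) + (d : ℝ) ^ 2) *
              Real.log (1 / ε) := by
  have hdn : d ≤ n := by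
    have := A.rank_le_height
    rwa [hin.full_rank] at this
  have h0 : (startState r A (D 0)).real 0 = ext2 A := by
    rw [startState, State.putVec_real_of_ne (by norm_num)]
    funext i j
    simp [ext2]
  obtain ⟨s₁, t₁, ex₁, le₁, c, hn, hd, hA, st, r1⟩ := runs_setupProg (ρ := ρ)
    (s := startState r A (D 0)) μ.two_le (n := n) (d := d) (A := ext2 A)
    (by simp [startState, State.putVec]) (by simp [startState, State.putVec]) h0 hin.d_pos hdn
    (fun i k h => by simp [ext2, h])
  subst hn
  subst hd
  obtain rfl : c.mat = A := by
    ext i j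
    rw [c.mat_apply, hA]
    simp [ext2]
  have hrk := hin.full_rank
  have hpos := hin.weights_pos
  have h1 : ∀ i : Fin c.n, s₁.real 1 i 0 = D 0 i := fun i => by
    rw [r1, startState, State.putVec_real i.2]
  obtain ⟨s₂, t₂, ex₂, g₂, n15, -, le₂⟩ := exec_blockProg (ρ := ρ) st hrk hpos hstep
    (Nat.zero_le r) h1
  obtain ⟨σ, t, hσ, ht, hex, hall⟩ := exists_rounds (ρ := ρ) g₂ hrk hpos hstep (t₁ + t₂)
  refine ⟨σ, t, ⟨?_, hex⟩, ?_, fun k hk => ?_⟩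
  · rw [hσ, ht]
    exact .seq ex₁ ex₂
  · obtain ⟨g, hsum⟩ := hall r le_rfl
    refine le_trans ?_ (total_le μ c hin.r_pos)
    -- The last block need not be finished, so the charge of its rows appears once more on its own.
    have h19 : ((σ r).nat 19 0 0 : ℝ) ≤ 2 * (c.T * c.T) := by
      obtain ⟨k₀, hk₀, -, hT, hm⟩ := g.1
      have : (σ r).nat 19 0 0 ≤ c.T * c.T + c.T * c.T :=
        hm.inv.le.trans (hm.inv.card (few_hist hpos hstep le_rfl hT))
      have : ((σ r).nat 19 0 0 : ℝ) ≤ c.T * c.T + c.T * c.T := by exact_mod_cast this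
      linarith
    have hE := rowCost_nonneg (c := c)
    have hTr : (0 : ℝ) < c.T := by exact_mod_cast c.T_pos
    have p0 : μ.potential c 0 s₂ = μ.roundCost c + μ.rowCost c * s₂.nat 19 0 0 := by
      rw [potential, n15]; simp
    have hR0 : 0 ≤ μ.restartCost c + 2 * (c.T * c.T) * μ.rowCost c := by
      have h1 := c.n_le_size μ.two_le
      have h2 := c.n_pos
      have h3 := μ.K_ge
      have : 0 ≤ μ.restartCost c := by
        unfold restartCost
        exact mul_nonneg (by positivity) (by linarith)
      positivity
    have pr : μ.potential c r (σ r) ≤ μ.roundCost c * (r + 1) +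
        (μ.restartCost c + 2 * (c.T * c.T) * μ.rowCost c) * (r / c.T) +
        μ.rowCost c * (2 * (c.T * c.T)) := by
      rw [potential]
      have q1 : ((r : ℝ) - (σ r).nat 15 0 0) / c.T ≤ r / c.T :=
        div_le_div_of_nonneg_right (by linarith [(Nat.cast_nonneg ((σ r).nat 15 0 0) :
          (0 : ℝ) ≤ _)]) hTr.le
      have q2 := mul_le_mul_of_nonneg_left q1 hR0
      have q3 := mul_le_mul_of_nonneg_left h19 hE
      linarith
    push_cast at hsum
    linarith
  · obtain ⟨g, -⟩ := hall k hk
    refine ⟨c.prec (σ k), g.isSymm_prec hrk (hpos k hk), g.specApprox_prec hrk (hpos k hk),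
      fun ε hε hε' => ?_⟩
    obtain ⟨N, hN0, hN, hNle⟩ := exists_steps hε hε'
    -- `descentOperator` with parameter z makes z + 1 steps, which is why N > 0 is needed.
    obtain ⟨z, rfl⟩ : ∃ z, N = z + 1 := ⟨N - 1, by omega⟩
    refine ⟨z, fun b => ⟨?_, ?_⟩⟩
    · rw [← iter_eq_descent]
      refine (g.normSq_iter hrk (hpos k hk) b (z + 1)).trans (mul_le_mul_of_nonneg_right ?_ ?_)
      · exact not_lt.1 fun h => lt_irrefl _ ((hN (z + 1)).1 h)
      · exact (posDef_gram hrk (hpos k hk)).quad_nonneg _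
    · obtain ⟨s', τ, ex, le, hx⟩ := runs_solveProg (ρ := ρ) g hrk hpos hstep hk b hN
      refine ⟨τ, ⟨s', ex, fun j => ?_⟩, ?_⟩
      · rw [hx j, iter_eq_descent]
      · rw [← st.nnz_mat]
        have hlog : 1 / 2 ≤ Real.log (1 / ε) := by
          have h4 := Real.log_le_log hε hε'
          have h5 := Real.log_two_gt_d9
          rw [one_div, Real.log_inv] at h4
          rw [one_div ε, Real.log_inv]
          linarith
        exact le.trans (query_le μ c hlog hNle)

end Mul

end InverseMaintenance

/-! ### Assembly of the theorem -/

open InverseMaintenance in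
theorem theorem3p2 (ω : ℝ) (hω : IsMatMulExponent ω) (p : Polynomial ℝ) (c : ℝ) :
    ∃ (𝒜 : Maintainer) (κ L C : ℝ) (q : ℕ), 0 < L ∧
      ∀ (n d r : ℕ) (A : Matrix (Fin n) (Fin d) ℝ) (D : ℕ → Fin n → ℝ),
        IsInput r A D → L2Stable r A D (p.eval (n : ℝ)) →
        ∃ (σ : Tape → ℕ → State) (t : Tape → ℕ → ℕ),
          (∀ ρ : Tape,
            𝒜.IsRun r A D ρ (σ ρ) (t ρ) ∧
            (∑ k ∈ Finset.range (r + 1), (t ρ k : ℝ)) ≤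
              C * (1 + Real.log n) ^ q *
                (((max ((Finset.Icc 1 r).sup fun k => nnzVec (D k)) d : ℕ) : ℝ)
                    * (d : ℝ) ^ (ω - 1)
                  + r * ((n : ℝ) * (d : ℝ) ^ (ω - 1)) ^ (2 * ω / (2 * ω + 1))) ∧
            ∀ k ≤ r, ∀ (b : Fin d → ℝ) (ε : ℝ), 0 < ε → ε ≤ 1 / 2 →
              ∃ (x : Fin d → ℝ) (τ : ℕ), 𝒜.Answers ρ (σ ρ k) b ε x τ ∧
                (τ : ℝ) ≤ C * (1 + Real.log n) ^ q *
                  ((nnz A : ℝ) + (d : ℝ) ^ 2) * Real.log (1 / ε)) ∧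
          tapeMeasure {ρ : Tape | ¬ ∀ k ≤ r, ∃ K : Matrix (Fin d) (Fin d) ℝ,
              K.IsSymm ∧ SpecApprox κ K (gram A (aprWeights D k))⁻¹ ∧
              IsSolverFrom (gram A (D k)) K L
                (fun b ε x => ∃ τ : ℕ, 𝒜.Answers ρ (σ ρ k) b ε x τ)}
            ≤ ENNReal.ofReal ((n : ℝ) ^ (-c)) := by
  obtain ⟨μ, rfl⟩ := hω.exists_mul
  refine ⟨μ.maintainer, 1, 1, 24 * 2 ^ μ.ω * μ.B, 1, one_pos, fun n d r A D hin hst => ?_⟩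
  choose σ t hrun htime hsolve using fun ρ => μ.runs_of_input hin hst.step ρ
  refine ⟨σ, t, fun ρ => ⟨hrun ρ, (htime ρ).trans ?_, fun k hk b ε h0 h1 => ?_⟩, ?_⟩
  · rw [pow_one]
    -- Round 1 exists and its vector has n nonzero entries.
    have hn : n ≤ max ((Finset.Icc 1 r).sup fun k => nnzVec (D k)) d :=
      ((le_nnzVec (hin.weights_pos 1 hin.r_pos)).trans
        (Finset.le_sup (f := fun k => nnzVec (D k)) (Finset.mem_Icc.2 ⟨le_rfl, hin.r_pos⟩))).trans
        (le_max_left _ _)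
    have hn' : (n : ℝ) ≤ ((max ((Finset.Icc 1 r).sup fun k => nnzVec (D k)) d : ℕ) : ℝ) := by
      exact_mod_cast hn
    have hl : 0 ≤ Real.log n := Real.log_natCast_nonneg n
    have hB : 0 ≤ μ.B := by have := Mul.K_le_B (μ := μ); linarith [μ.K_ge]
    refine mul_le_mul_of_nonneg_left ?_ (by positivity)
    exact add_le_add_left (mul_le_mul_of_nonneg_right hn' (by positivity)) _
  · obtain ⟨K, -, -, hK⟩ := hsolve ρ k hk
    obtain ⟨z, hz⟩ := hK ε h0 h1
    obtain ⟨τ, ha, hτ⟩ := (hz b).2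
    exact ⟨_, τ, ha, by rw [pow_one]; exact hτ⟩
  -- The guarantee holds on every tape, so the exceptional set is empty.
  · refine le_of_eq_of_le ?_ zero_le
    convert measure_empty (μ := tapeMeasure)
    refine Set.eq_empty_of_forall_notMem fun ρ hρ => hρ fun k hk => ?_
    obtain ⟨K, hK1, hK2, hK⟩ := hsolve ρ k hk
    refine ⟨K, hK1, hK2, fun ε h0 h1 => ?_⟩
    obtain ⟨z, hz⟩ := hK ε h0 h1
    refine ⟨z, fun b x ⟨τ, s', ex, hx⟩ => ?_⟩
    -- Any answer comes from the unique execution of the solver, so it is the one that has been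
    -- analysed.
    obtain ⟨τ', ⟨s'', ex', hx'⟩, -⟩ := (hz b).2
    obtain ⟨rfl, rfl⟩ := ex.deterministic ex'
    obtain rfl : x = _ := funext fun j => (hx j).symm.trans (hx' j)
    exact ⟨rfl, (hz b).1⟩
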